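/- Let $p$ be an odd prime, let $\mathbb{C}_p$ be the completed algebraic closure of $\mathbb{Q}_p$, normed by $|\cdot|$, and let $\pi\in\mathbb{C}_p$ satisfy $\pi^{p-1}=-p$. For coordinates $u$, some of which may be invertible, let $\mathcal{O}^\dagger$ be the space of overconvergent series $\sum_I a_Iu^I$ (negative exponents are allowed only for invertible coordinates), i.e. $|a_I|\le C r^{|I|}$ for all $I$, for some $C$ and some $r<1$. For an algebraic function $f$, let $H^k_{dR}(e^f)$ ($k\in\mathbb{Z}$) be the cohomology of the complex of differential forms with coefficients in $\mathcal{O}^\dagger$ with differential $\omega\mapsto d\omega+df\wedge\omega$. Let $Y=\mathbb{A}^n\times(\mathbb{A}^\times)^m$ with coordinates $z_i,w_j$, where the $w_j$ are invertible, and let $H^i(Y)=H^i_{dR}(e^0)$. For a hypersurface $X=\{P=0\}$ in $Y$, with $P\in\mathbb{C}_p[z_i,w_j^{\pm1}]$, let $H^i(X)$ be its Dwork cohomology with the usual degree: $H^i(X)=H^{i+2}_{dR}(e^{\pi Pt})$ on $Y\times\mathbb{A}^1$, $t$ being the coordinate of $\mathbb{A}^1$. Let $\overline{H^i(X)}=H^{i+2}_{dR}(e^{\pi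 Pt})$ on $Y\times\mathbb{A}^\times$, that is, with $t$ made invertible. The Frobenius map $Fr$ on $H^\bullet(X)$ is $p^{-1}$ times the map induced by $$g\,du_S\mapsto e^{\pi(P(z^p,w^p)t^p-P(z,w)t)}\,g(u^p)\,d(u^p)_S,\qquad u=(z,w,t),$$ whenever the exponential series is overconvergent. Let $P\ne0$ define a smooth hypersurface $X=\{P=0\}$ in $Y$ over $\mathbb{C}_p$, the equation being scaled so that all coefficients of $P$ have absolute value at most $1$. Let $\tilde X=\{xy+P=0\}\subset\mathbb{A}^{n+2}\times(\mathbb{A}^\times)^m$. Then: (1) There is a long exact sequence $$\cdots\to H^i(Y)\to H^i(X)\xrightarrow{a}\overline{H^i(X)}\to H^{i+1}(Y)\to H^{i+1}(X)\to\cdots$$ in which $a$ is induced by the inclusion of forms; thus $\overline{H^\bullet(X)}$ is an extension of $H^\bullet(Y)[1]$ by $H^\bullet(X)$ in the sense of this sequence. (2) The map of forms $\omega\mapsto d(tx)\wedge dy\wedge\omega$ induces a map $\alpha:H^{\bullet}(X)[-2]\to H^\bullet(\tilde X)$, and there is an isomorphism of graded vector spaces $$H^\bullet(\tilde X)\cong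 H^\bullet(Y)\oplus\overline{H^\bullet(X)}[-2]$$ under which $\alpha$ becomes $(0,a)$. (3) If moreover every coefficient $c$ of $P$ satisfies $|c^p-c|<1$, then the exponential series above is overconvergent for $P$ and for $xy+P$, the Frobenius maps on $H^\bullet(X)$ and $H^\bullet(\tilde X)$ are well defined, and $$Fr\circ\alpha=p\,\alpha\circ Fr.$$ -/

import Mathlib

noncomputable section

/-- Exponent vectors `I : σ → ℤ` of monomials that are regular on the product of affine lines and
punctured lines with coordinates `σ`, where `inv` is the set of invertible coordinates. -/
def IsRegularExp {σ : Type} (inv : Set σ) (I : σ → ℤ) : Prop :=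
  ∀ j, j ∉ inv → 0 ≤ I j

/-- Laurent polynomials over `ℂ_[p]` in all the coordinates `σ`. -/
abbrev LPoly (p : ℕ) [Fact p.Prime] (σ : Type) : Type :=
  AddMonoidAlgebra ℂ_[p] (σ → ℤ)

/-- The ring of algebraic functions: polynomials in the coordinates of `σ` and in the inverses of
the coordinates that lie in `inv`. -/
def algFun (p : ℕ) [Fact p.Prime] {σ : Type} (inv : Set σ) : Subalgebra ℂ_[p] (LPoly p σ) where
  carrier := {f | ∀ I, f.coeff I ≠ 0 → IsRegularExp inv I}
  mul_mem' := by
    classical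
    intro f g hf hg I hI
    by_contra hcon
    apply hI
    rw [AddMonoidAlgebra.coeff_mul]
    refine Finset.sum_eq_zero fun J hJ => Finset.sum_eq_zero fun K hK => ?_
    dsimp only
    rw [if_neg]
    rintro rfl
    refine hcon fun j hj => ?_
    exact add_nonneg (hf J (Finsupp.mem_support_iff.1 hJ) j hj)
      (hg K (Finsupp.mem_support_iff.1 hK) j hj)
  add_mem' := by
    intro f g hf hg I hI
    by_cases h : f.coeff I = 0
    · refine hg I fun h' => hI ?_
      rw [AddMonoidAlgebra.coeff_add, Finsupp.add_apply, h, h', add_zero]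
    · exact hf I h
  algebraMap_mem' := by
    intro r I hI j hj
    by_cases h : (0 : σ → ℤ) = I
    · rw [← h]; simp
    · exact absurd (by simp [AddMonoidAlgebra.coe_algebraMap, h]) hI

/-- The coordinate function `z_j`. -/
def coordFun (p : ℕ) [Fact p.Prime] {σ : Type} [DecidableEq σ] (j : σ) : LPoly p σ :=
  AddMonoidAlgebra.single (Pi.single j 1) 1

/-- The partial derivative of a Laurent polynomial. -/
def LPoly.pderiv {p : ℕ} [Fact p.Prime] {σ : Type} [DecidableEq σ] (j : σ) (f : LPoly p σ) :
    LPoly p σ :=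
  f.coeff.sum fun I c => AddMonoidAlgebra.single (I - Pi.single j 1) ((I j : ℂ_[p]) * c)

/-- Extend a Laurent polynomial along an injection `e` of coordinates. -/
def LPoly.extend {p : ℕ} [Fact p.Prime] {σ τ : Type} (e : σ → τ) (f : LPoly p σ) : LPoly p τ :=
  AddMonoidAlgebra.mapDomain (fun I => Function.extend e I 0) f

/-- Substitute `z_j ^ p` for every coordinate `z_j`. -/
def LPoly.powP {p : ℕ} [Fact p.Prime] {σ : Type} (f : LPoly p σ) : LPoly p σ :=
  AddMonoidAlgebra.mapDomain (fun I j => (p : ℤ) * I j) f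

/-! ### Overconvergent functions and the `D`-module structure twisted by `e ^ f` -/

/-- Formal families of coefficients `∑ a_I z^I`, `I : σ → ℤ`. -/
abbrev Series (p : ℕ) [Fact p.Prime] (σ : Type) : Type := (σ → ℤ) → ℂ_[p]

/-- The overconvergent functions `∑ a_I z^I`: only regular exponents occur, and
`‖a_I‖ ≤ C r ^ |I|` for some `r < 1`, that is, `ord_p a_I ≥ c |I| + d` for some `c > 0`. -/
def overconv (p : ℕ) [Fact p.Prime] {σ : Type} [Fintype σ] (inv : Set σ) :
    Submodule ℂ_[p] (Series p σ) where
  carrier := {a | (∀ I, ¬ IsRegularExp inv I → a I = 0) ∧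
    ∃ C r : ℝ, 0 < r ∧ r < 1 ∧ ∀ I, ‖a I‖ ≤ C * r ^ (∑ j, (I j).natAbs)}
  zero_mem' := ⟨fun _ _ => rfl, 0, 1 / 2, by norm_num, by norm_num, fun I => by simp⟩
  add_mem' := by
    rintro a b ⟨ha, C, r, hr0, hr1, h⟩ ⟨hb, C', r', hr0', hr1', h'⟩
    refine ⟨fun I hI => by rw [Pi.add_apply, ha I hI, hb I hI, add_zero], |C| + |C'|, max r r',
      lt_max_of_lt_left hr0, max_lt hr1 hr1', fun I => ?_⟩
    have e1 : C * r ^ (∑ j, (I j).natAbs) ≤ |C| * max r r' ^ (∑ j, (I j).natAbs) :=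
      mul_le_mul (le_abs_self C) (pow_le_pow_left₀ hr0.le (le_max_left _ _) _)
        (pow_nonneg hr0.le _) (abs_nonneg C)
    have e2 : C' * r' ^ (∑ j, (I j).natAbs) ≤ |C'| * max r r' ^ (∑ j, (I j).natAbs) :=
      mul_le_mul (le_abs_self C') (pow_le_pow_left₀ hr0'.le (le_max_right _ _) _)
        (pow_nonneg hr0'.le _) (abs_nonneg C')
    calc ‖a I + b I‖ ≤ ‖a I‖ + ‖b I‖ := norm_add_le _ _
      _ ≤ _ := by rw [add_mul]; exact add_le_add ((h I).trans e1) ((h' I).trans e2)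
  smul_mem' := by
    rintro c a ⟨ha, C, r, hr0, hr1, h⟩
    refine ⟨fun I hI => by rw [Pi.smul_apply, ha I hI, smul_zero], ‖c‖ * C, r, hr0, hr1,
      fun I => ?_⟩
    rw [Pi.smul_apply, norm_smul, mul_assoc]
    exact mul_le_mul_of_nonneg_left (h I) (norm_nonneg c)

/-- Multiplication by a Laurent polynomial. -/
def polyMul {p : ℕ} [Fact p.Prime] {σ : Type} (f : LPoly p σ) : Series p σ →ₗ[ℂ_[p]] Series p σ :=
  f.coeff.sum fun J c => c • LinearMap.funLeft ℂ_[p] ℂ_[p] (fun I => I - J)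

/-- The partial derivative `∂_j` of a series. -/
def seriesDeriv {p : ℕ} [Fact p.Prime] {σ : Type} [DecidableEq σ] (j : σ) :
    Series p σ →ₗ[ℂ_[p]] Series p σ where
  toFun a := fun I => ((I j : ℂ_[p]) + 1) * a (I + Pi.single j 1)
  map_add' a b := by ext I; simp [mul_add]
  map_smul' c a := by ext I; simp [mul_left_comm]

/-- The action of `∂_j` on the `D`-module `e ^ f`, that is, `∂_j + (∂_j f)`. -/
def twistedDeriv {p : ℕ} [Fact p.Prime] {σ : Type} [DecidableEq σ] (f : LPoly p σ) (j : σ) :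
    Series p σ →ₗ[ℂ_[p]] Series p σ :=
  seriesDeriv j + polyMul (f.pderiv j)

/-! ### The de Rham complex -/

/-- Differential forms: `ω S` is the coefficient of `dz_S`, the product of the `dz_j`, `j ∈ S`, in
increasing order. -/
abbrev Forms (p : ℕ) [Fact p.Prime] (σ : Type) : Type := Finset σ → Series p σ

/-- Multiplication of forms by `dz_j` on the left. -/
def wedge (p : ℕ) [Fact p.Prime] {σ : Type} [LinearOrder σ] (j : σ) :
    Forms p σ →ₗ[ℂ_[p]] Forms p σ where
  toFun ω := fun S =>
    if j ∈ S then (-1 : ℂ_[p]) ^ (S.filter (· < j)).card • ω (S.erase j) else 0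
  map_add' ω η := by
    ext S I
    by_cases h : j ∈ S <;> simp [h, mul_add]
  map_smul' c ω := by
    ext S I
    by_cases h : j ∈ S <;> simp [h, mul_left_comm]

/-- The de Rham differential `∑ dz_j (∂_j + (∂_j f))` of the `D`-module `e ^ f`. -/
def deRhamD {p : ℕ} [Fact p.Prime] {σ : Type} [Fintype σ] [LinearOrder σ] (f : LPoly p σ) :
    Forms p σ →ₗ[ℂ_[p]] Forms p σ :=
  ∑ j, wedge p j ∘ₗ (twistedDeriv f j).compLeft (Finset σ)

/-- Overconvergent forms of degree `k`. -/
def formsOfDeg (p : ℕ) [Fact p.Prime] {σ : Type} [Fintype σ] (inv : Set σ) (k : ℤ) :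
    Submodule ℂ_[p] (Forms p σ) where
  carrier := {ω | ∀ S, ω S ∈ overconv p inv ∧ ((S.card : ℤ) ≠ k → ω S = 0)}
  zero_mem' := fun _ => ⟨Submodule.zero_mem _, fun _ => rfl⟩
  add_mem' := fun hω hη S => ⟨Submodule.add_mem _ (hω S).1 (hη S).1, fun h => by
    rw [Pi.add_apply, (hω S).2 h, (hη S).2 h, add_zero]⟩
  smul_mem' := fun c ω hω S => ⟨Submodule.smul_mem _ c (hω S).1, fun h => by
    rw [Pi.smul_apply, (hω S).2 h, smul_zero]⟩

/-- Closed overconvergent forms of degree `k`. -/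
def closedForms {p : ℕ} [Fact p.Prime] {σ : Type} [Fintype σ] [LinearOrder σ] (inv : Set σ)
    (f : LPoly p σ) (k : ℤ) : Submodule ℂ_[p] (Forms p σ) :=
  formsOfDeg p inv k ⊓ LinearMap.ker (deRhamD f)

/-- Differentials of overconvergent forms of degree `k - 1`. -/
def exactForms {p : ℕ} [Fact p.Prime] {σ : Type} [Fintype σ] [LinearOrder σ] (inv : Set σ)
    (f : LPoly p σ) (k : ℤ) : Submodule ℂ_[p] (Forms p σ) :=
  (formsOfDeg p inv (k - 1)).map (deRhamD f)

/-- The de Rham cohomology in degree `k` of the overconvergent `D`-module `e ^ f`. -/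
abbrev DeRham {p : ℕ} [Fact p.Prime] {σ : Type} [Fintype σ] [LinearOrder σ] (inv : Set σ)
    (f : LPoly p σ) (k : ℤ) : Type :=
  closedForms inv f k ⧸ (exactForms inv f k).submoduleOf (closedForms inv f k)

/-- `Φ` is the map on cohomology induced by the map of forms `F`: it sends the class of every
closed form `ω` to the class of `F ω` (which is again closed, overconvergent, and of the right
degree). -/
def Induces {p : ℕ} [Fact p.Prime] {σ τ : Type} [Fintype σ] [LinearOrder σ] [Fintype τ]
    [LinearOrder τ] {inv : Set σ} {f : LPoly p σ} {k : ℤ} {inv' : Set τ} {g : LPoly p τ} {l : ℤ}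
    (F : Forms p σ → Forms p τ) (Φ : DeRham inv f k →ₗ[ℂ_[p]] DeRham inv' g l) : Prop :=
  ∀ ω : closedForms inv f k, ∃ h : F ω ∈ closedForms inv' g l,
    Φ (Submodule.Quotient.mk ω) = Submodule.Quotient.mk ⟨F ω, h⟩

/-! ### The spaces `Y`, and hypersurfaces in them -/

/-- The coordinates `z_1, …, z_n, w_1, …, w_m` of `𝔸ⁿ × (𝔸ˣ)ᵐ`. -/
abbrev Coord (n m : ℕ) : Type := Fin n ⊕ₗ Fin m

/-- The invertible coordinates `w_1, …, w_m`. -/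
def torusCoord (n m : ℕ) : Set (Coord n m) := {j | (ofLex j).isRight = true}

/-- The cohomology `H^i(Y)` of `Y = 𝔸ⁿ × (𝔸ˣ)ᵐ`. -/
abbrev HY (p : ℕ) [Fact p.Prime] (n m : ℕ) (i : ℤ) : Type :=
  DeRham (torusCoord n m) (0 : LPoly p (Coord n m)) i

/-- The coordinates of `Y` together with one more coordinate `t = ⊤`. -/
abbrev CoordT (n m : ℕ) : Type := WithTop (Coord n m)

/-- The invertible coordinates of `Y × 𝔸¹`. -/
def torusCoordT (n m : ℕ) : Set (CoordT n m) := WithTop.some '' torusCoord n m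

/-- The function `P t`. -/
def timesT {p : ℕ} [Fact p.Prime] {n m : ℕ} (P : LPoly p (Coord n m)) : LPoly p (CoordT n m) :=
  coordFun p ⊤ * P.extend WithTop.some

/-- The cohomology `H^i(X)` of the hypersurface `X = {P = 0}` in `𝔸ⁿ × (𝔸ˣ)ᵐ`: its Dwork
cohomology, i.e. the de Rham cohomology of the overconvergent `D`-module `e ^ (ϖ P t)` on
`Y × 𝔸¹`, taken in degree `i + 2`. -/
abbrev HX {p : ℕ} [Fact p.Prime] {n m : ℕ} (ϖ : ℂ_[p]) (P : LPoly p (Coord n m)) (i : ℤ) : Type :=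
  DeRham (torusCoordT n m) (ϖ • timesT P) (i + 2)

/-- The de Rham cohomology of the overconvergent `D`-module `e ^ (ϖ P t)` on `Y × 𝔸ˣ`, where `t`
is invertible, in degree `i + 2`. -/
abbrev HXbar {p : ℕ} [Fact p.Prime] {n m : ℕ} (ϖ : ℂ_[p]) (P : LPoly p (Coord n m)) (i : ℤ) :
    Type :=
  DeRham (insert ⊤ (torusCoordT n m)) (ϖ • timesT P) (i + 2)

/-! ### Frobenius -/

/-- The formal exponential `∑ G ^ k / k!`; it is used for `G` divisible by one of the coordinates,
and then every coefficient is a finite sum. -/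
def expSeries {p : ℕ} [Fact p.Prime] {σ : Type} (G : LPoly p σ) : Series p σ :=
  fun I => ∑' k : ℕ, ((k.factorial : ℂ_[p]))⁻¹ * (G ^ k).coeff I

/-- The product of two series; for overconvergent ones all the sums converge. -/
def seriesMul {p : ℕ} [Fact p.Prime] {σ : Type} (a b : Series p σ) : Series p σ :=
  fun I => ∑' J, a J * b (I - J)

open scoped Classical in
/-- `g(z) ↦ g(z ^ p)`. -/
def seriesPowP {p : ℕ} [Fact p.Prime] {σ : Type} (g : Series p σ) : Series p σ :=
  fun I => if ∀ j, (p : ℤ) ∣ I j then g (fun j => I j / p) else 0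

/-- The series `exp (ϖ (P(z ^ p) t ^ p - P(z) t))`. -/
def dworkSeries {p : ℕ} [Fact p.Prime] {n m : ℕ} (ϖ : ℂ_[p]) (P : LPoly p (Coord n m)) :
    Series p (CoordT n m) :=
  expSeries (ϖ • ((timesT P).powP - timesT P))

/-- Dwork's Frobenius on forms,
`g dz_S ↦ exp (ϖ (P(z ^ p) t ^ p - P(z) t)) g(z ^ p) d(z ^ p)_S`, where
`d(z ^ p)_S = p ^ |S| (∏ j ∈ S, z_j ^ (p - 1)) dz_S`. -/
def dworkFrob {p : ℕ} [Fact p.Prime] {n m : ℕ} (ϖ : ℂ_[p]) (P : LPoly p (Coord n m))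
    (ω : Forms p (CoordT n m)) : Forms p (CoordT n m) :=
  fun S => (p : ℂ_[p]) ^ S.card • seriesMul (dworkSeries ϖ P)
    (polyMul (∏ j ∈ S, coordFun p j ^ (p - 1)) (seriesPowP (ω S)))

/-- `Φ` is the Frobenius map on `H^i(X)`, in the usual normalization: Dwork's Frobenius is
`p` times the usual one. -/
def IsFrobenius {p : ℕ} [Fact p.Prime] {n m : ℕ} {ϖ : ℂ_[p]} {P : LPoly p (Coord n m)} {i : ℤ}
    (Φ : HX ϖ P i →ₗ[ℂ_[p]] HX ϖ P i) : Prop :=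
  Induces (dworkFrob ϖ P) ((p : ℂ_[p]) • Φ)

/-! ### The hypersurface `x y + P = 0` -/

/-- The coordinates `z_i, w_j` of `𝔸ⁿ × (𝔸ˣ)ᵐ` among those of `𝔸ⁿ⁺² × (𝔸ˣ)ᵐ`. -/
def coordEmb (n m : ℕ) (j : Coord n m) : Coord (n + 2) m :=
  toLex (Sum.map (Fin.castAdd 2) id (ofLex j))

/-- The coordinate `x` of `𝔸ⁿ⁺² × (𝔸ˣ)ᵐ`. -/
def coordX (n m : ℕ) : Coord (n + 2) m := toLex (Sum.inl ⟨n, by omega⟩)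

/-- The coordinate `y` of `𝔸ⁿ⁺² × (𝔸ˣ)ᵐ`. -/
def coordY (n m : ℕ) : Coord (n + 2) m := toLex (Sum.inl ⟨n + 1, by omega⟩)

/-- The function `x y + P` on `𝔸ⁿ⁺² × (𝔸ˣ)ᵐ`. -/
def suspend {p : ℕ} [Fact p.Prime] {n m : ℕ} (P : LPoly p (Coord n m)) :
    LPoly p (Coord (n + 2) m) :=
  coordFun p (coordX n m) * coordFun p (coordY n m) + P.extend (coordEmb n m)

open scoped Classical in
/-- Pull-back of forms in the coordinates `z, w, t` to forms in the coordinates `z, x, y, w, t`. -/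
def pullForm {p : ℕ} [Fact p.Prime] {n m : ℕ} (ω : Forms p (CoordT n m)) :
    Forms p (CoordT (n + 2) m) :=
  fun S I =>
    if ∀ j, j ∉ Set.range (WithTop.map (coordEmb n m)) → j ∉ S ∧ I j = 0 then
      ω (Finset.univ.filter fun j => WithTop.map (coordEmb n m) j ∈ S)
        (I ∘ WithTop.map (coordEmb n m))
    else 0

/-- The map of forms `ω ↦ d(t x) dy ω = t dx dy ω + x dt dy ω`. -/
def alphaForm {p : ℕ} [Fact p.Prime] {n m : ℕ} (ω : Forms p (CoordT n m)) :
    Forms p (CoordT (n + 2) m) :=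
  (polyMul (coordFun p ⊤)).compLeft (Finset (CoordT (n + 2) m))
      (wedge p (coordX n m : CoordT (n + 2) m)
        (wedge p (coordY n m : CoordT (n + 2) m) (pullForm ω))) +
    (polyMul (coordFun p (coordX n m : CoordT (n + 2) m))).compLeft (Finset (CoordT (n + 2) m))
      (wedge p ⊤ (wedge p (coordY n m : CoordT (n + 2) m) (pullForm ω)))

end

/-!
Everything is computed on the level of overconvergent forms, viewed as Koszul complexes of the
commuting operators `T_j = ∂_j + ∂_j f`. Two elimination lemmas reduce exactness to linear algebra
with one or two of these operators: a closed form is exact if `T_j` is injective and the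
coefficients of its `dz_j` part lie in the image of `T_j` (`exact_of_contract_mem_range`), or if
`T_i, T_j` is a regular sequence and the coefficients of its `dz_i dz_j` part lie in the sum of the
images (`exact_of_contract_contract_mem_range`). The operators that occur have the form `U + N`,
where `U` is inverted explicitly up to an error, and the geometric series in `N` converges to an
overconvergent series because `|ϖ ^ k|` and `|k!|` agree up to a factor of polynomial growth
(`exists_projector_of_perturbation`).

*The long exact sequence.* Modulo series regular along `t = 0`, the operator `∂_t + ϖ P` is
injective, and the terms in `t⁻¹` form a complement of its image: `∂_t` is inverted by integration,
and `ϖ P` is the perturbation (`exists_projector_polar`). Hence a residue map identifies the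
cohomology of the quotient of the complex with `t` invertible by the regular one with that of `Y`,
shifted by one, and the exact sequence follows (`exists_gysin_sequence`).

*The suspension.* The function of `x y + P` is `F = ϖ P t + ϖ t x y`. If `t` is invertible, then
`∂_x + ϖ t y` and `∂_y + ϖ t x` form a regular sequence with quotient `t` times the series in the
old coordinates, so that `ω ↦ d(t x) dy ω` is bijective on cohomology (`suspendForm_bijective`). If
`ξ` has poles along `t = 0` and `D ξ` has none, multiplying `dy ξ` by `(1 - exp (-ϖ t x y)) / (ϖ y)`
gives a formal primitive of `d(t x) dy ξ` up to a regular error. Its polar part is overconvergent,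
so `d(t x) dy ξ` is regular up to exact forms (`exists_suspendForm_sub_mem`). Therefore the long
exact sequence of the suspension breaks up into short exact sequences, which split compatibly with
`α`, and the cohomology of `Y × 𝔸²` is that of `Y` (`exists_suspension_iso`).

*Frobenius.* The splitting function `λ(s) = exp (ϖ (s ^ p - s))` is overconvergent by comparison
with the Artin–Hasse exponential (`exists_norm_dworkCoeff_le`). As `P(z ^ p) ≡ P(z) ^ p` modulo the
maximal ideal, `exp (ϖ (P(z ^ p) t ^ p - P(z) t))` is the product of `λ(P t)` and an exponential
with small exponent (`expSeries_powPHom_sub_mem_overconv`). For the suspension the exponential is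
multiplied by `λ(t x y)` (`expSeries_suspend`). With `s = t x y`, Frobenius of `d(t x) dy ω` is thus
`p ^ 2 s ^ (p - 1) λ(s) d(t x) dy Fr ω`, and `p ^ 2 s ^ (p - 1) λ(s) - p` is the image of
`p / ϖ * (λ(s) - 1)` under `∂_s + ϖ`. This gives an explicit form whose differential is the
difference of the two sides of the commutation relation (`exists_frobForms_suspendForm_sub`).
-/

open Finset

set_option linter.unusedSectionVars false

/-! ### Norms of factorials and absorption of polynomial growth -/

section Analysis

variable {p : ℕ} [Fact p.Prime]

theorem norm_natCast_padicComplex (n : ℕ) : ‖(n : ℂ_[p])‖ = ‖(n : ℚ_[p])‖ := by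
  have h := PadicComplex.norm_extends' p (n : ℚ_[p])
  rw [← h]
  congr 1
  simp

theorem norm_natCast_eq_pow {n : ℕ} (hn : n ≠ 0) :
    ‖(n : ℂ_[p])‖ = ((p : ℝ) ^ padicValNat p n)⁻¹ := by
  rw [norm_natCast_padicComplex, Padic.norm_eq_zpow_neg_valuation (by exact_mod_cast hn),
    Padic.valuation_natCast, zpow_neg, zpow_natCast]

theorem norm_natCast_le_one (n : ℕ) : ‖(n : ℂ_[p])‖ ≤ 1 := by
  rw [norm_natCast_padicComplex]
  simpa using Padic.norm_int_le_one (p := p) (n : ℤ)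

theorem norm_intCast_le_one (n : ℤ) : ‖(n : ℂ_[p])‖ ≤ 1 := by
  obtain ⟨k, rfl | rfl⟩ := n.eq_nat_or_neg
  · simpa using norm_natCast_le_one (p := p) k
  · simpa using norm_natCast_le_one (p := p) k

theorem norm_inv_natCast_le (n : ℕ) : ‖((n : ℂ_[p]))⁻¹‖ ≤ n := by
  rcases eq_or_ne n 0 with rfl | hn
  · simp
  rw [norm_inv, norm_natCast_eq_pow hn, inv_inv]
  exact_mod_cast Nat.le_of_dvd (Nat.pos_of_ne_zero hn) pow_padicValNat_dvd

theorem norm_inv_intCast_le (n : ℤ) : ‖((n : ℂ_[p]))⁻¹‖ ≤ n.natAbs := by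
  obtain ⟨k, rfl | rfl⟩ := n.eq_nat_or_neg
  · simpa using norm_inv_natCast_le (p := p) k
  · simpa [inv_neg] using norm_inv_natCast_le (p := p) k

variable {ϖ : ℂ_[p]} (hϖ : ϖ ^ (p - 1) = -(p : ℂ_[p]))

include hϖ in
theorem norm_pi_pow : ‖ϖ‖ ^ (p - 1) = (p : ℝ)⁻¹ := by
  rw [← norm_pow, hϖ, norm_neg, norm_natCast_padicComplex, Padic.norm_p]

include hϖ in
theorem pi_ne_zero : ϖ ≠ 0 := by
  rintro rfl
  have h := norm_pi_pow hϖ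
  have hp := (Fact.out : p.Prime).two_le
  rw [norm_zero, zero_pow (by omega)] at h
  have : (0 : ℝ) < (p : ℝ)⁻¹ := by positivity
  linarith

include hϖ in
theorem norm_pi_lt_one : ‖ϖ‖ < 1 := by
  have hp := (Fact.out : p.Prime).two_le
  by_contra hcon
  have h1 : 1 ≤ ‖ϖ‖ ^ (p - 1) := one_le_pow₀ (not_lt.1 hcon)
  rw [norm_pi_pow hϖ] at h1
  have h2 : (p : ℝ)⁻¹ < 1 := inv_lt_one_of_one_lt₀ (by exact_mod_cast hp)
  linarith

include hϖ in
/-- Legendre's formula: up to the root `p - 1`, the norm of `n! / ϖ ^ n` is `p` to the digit sum. -/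
theorem norm_factorial_div_pi_pow (n : ℕ) :
    ‖(n.factorial : ℂ_[p]) / ϖ ^ n‖ ^ (p - 1) = (p : ℝ) ^ (p.digits n).sum := by
  have hp0 : (p : ℝ) ≠ 0 := by exact_mod_cast (Fact.out : p.Prime).ne_zero
  rw [norm_div, norm_pow, norm_natCast_eq_pow n.factorial_ne_zero, div_pow, ← pow_mul, mul_comm n,
    pow_mul, norm_pi_pow hϖ, inv_pow, ← pow_mul, mul_comm _ (p - 1),
    sub_one_mul_padicValNat_factorial, inv_pow, div_inv_eq_mul]
  have h := Nat.digit_sum_le p n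
  rw [inv_mul_eq_div, div_eq_iff (pow_ne_zero _ hp0), ← pow_add, Nat.add_sub_cancel' h]

include hϖ in
theorem norm_pi_pow_div_factorial_le (n : ℕ) : ‖ϖ ^ n / (n.factorial : ℂ_[p])‖ ≤ 1 := by
  have hp := (Fact.out : p.Prime).two_le
  have h := norm_factorial_div_pi_pow hϖ n
  have h1 : 1 ≤ ‖(n.factorial : ℂ_[p]) / ϖ ^ n‖ := by
    by_contra hcon
    have := pow_lt_one₀ (norm_nonneg _) (not_le.1 hcon) (n := p - 1) (by omega)
    rw [h] at this
    exact absurd this (not_lt.2 (one_le_pow₀ (by exact_mod_cast (by omega : 1 ≤ p))))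
  rw [← inv_div, norm_inv]
  exact inv_le_one_of_one_le₀ h1

include hϖ in
theorem norm_factorial_div_pi_pow_le (n : ℕ) :
    ‖(n.factorial : ℂ_[p]) / ϖ ^ n‖ ≤ p * (n + 1) := by
  have hp := (Fact.out : p.Prime).two_le
  have h := norm_factorial_div_pi_pow hϖ n
  have hlen : (p.digits n).sum ≤ (p.digits n).length * (p - 1) := by
    rw [← smul_eq_mul]
    refine List.sum_le_card_nsmul _ _ fun d hd => ?_
    have := Nat.digits_lt_base (by omega : 1 < p) hd
    omega
  have h1 : ‖(n.factorial : ℂ_[p]) / ϖ ^ n‖ ≤ (p : ℝ) ^ (p.digits n).length := by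
    refine le_of_pow_le_pow_left₀ (n := p - 1) (by omega) (by positivity) ?_
    rw [h, ← pow_mul]
    exact pow_le_pow_right₀ (by exact_mod_cast (by omega : 1 ≤ p)) hlen
  refine h1.trans ?_
  rcases eq_or_ne n 0 with rfl | hn
  · simp; omega
  · have h2 := Nat.base_pow_length_digits_le p n (by omega) hn
    calc ((p : ℝ)) ^ (p.digits n).length ≤ p * n := by exact_mod_cast h2
      _ ≤ p * (n + 1) := by gcongr; linarith

/-- A linear factor, and a bounded contraction of the exponent, can be absorbed in a geometric
rate of decay. -/
theorem exists_geometric_bound {r : ℝ} (hr0 : 0 < r) (hr1 : r < 1) (K : ℝ) (M : ℕ) :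
    ∃ C s : ℝ, 0 ≤ C ∧ 0 < s ∧ s < 1 ∧
      ∀ N q : ℕ, N ≤ M * (q + 1) → K * (N + 1) * r ^ q ≤ C * s ^ N := by
  set u : ℝ := r ^ ((M + 1 : ℝ)⁻¹) with hu
  have hu0 : 0 < u := Real.rpow_pos_of_pos hr0 _
  have hu1 : u < 1 := Real.rpow_lt_one hr0.le hr1 (by positivity)
  have hur : u ^ (M + 1) = r := by
    rw [hu, ← Real.rpow_natCast, ← Real.rpow_mul hr0.le]
    push_cast
    rw [inv_mul_cancel₀ (by positivity), Real.rpow_one]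
  obtain ⟨s, hus, hs1⟩ := exists_between hu1
  have hs0 := hu0.trans hus
  set ε := s / u - 1 with hε
  have hε0 : 0 < ε := by rw [hε, sub_pos, one_lt_div hu0]; exact hus
  refine ⟨|K| * (1 + ε⁻¹) * (u ^ (M + 1))⁻¹, s, by positivity, hs0, hs1, fun N q hN => ?_⟩
  have h1 : ((N : ℝ) + 1) * u ^ N ≤ (1 + ε⁻¹) * s ^ N := by
    have hb : 1 + N * ε ≤ (1 + ε) ^ N := one_add_mul_le_pow (by linarith) N
    have hsu : s = (1 + ε) * u := by rw [hε]; field_simp; ring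
    rw [hsu, mul_pow, ← mul_assoc]
    refine mul_le_mul_of_nonneg_right ?_ (by positivity)
    calc (N : ℝ) + 1 ≤ (1 + ε⁻¹) * (1 + N * ε) := by
          have : ε⁻¹ * ε = 1 := inv_mul_cancel₀ hε0.ne'
          have h3 : 0 < ε⁻¹ := by positivity
          have h4 : 0 ≤ (N : ℝ) * ε := by positivity
          nlinarith
      _ ≤ _ := by gcongr
  have h2 : r ^ q ≤ (u ^ (M + 1))⁻¹ * u ^ N := by
    rw [inv_mul_eq_div, le_div_iff₀ (by positivity), ← hur, ← pow_mul, ← pow_add]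
    exact pow_le_pow_of_le_one hu0.le hu1.le (by nlinarith)
  calc K * (N + 1) * r ^ q ≤ |K| * (N + 1) * ((u ^ (M + 1))⁻¹ * u ^ N) := by
        gcongr; exact le_abs_self K
    _ = |K| * (u ^ (M + 1))⁻¹ * (((N : ℝ) + 1) * u ^ N) := by ring
    _ ≤ |K| * (u ^ (M + 1))⁻¹ * ((1 + ε⁻¹) * s ^ N) := by gcongr
    _ = _ := by ring

end Analysis

/-! ### Overconvergent series -/

section Overconvergent

variable {p : ℕ} [Fact p.Prime] {σ τ : Type} [Fintype σ] [Fintype τ]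

/-- The size `|I|` of an exponent vector. -/
def expSize (I : σ → ℤ) : ℕ := ∑ j, (I j).natAbs

theorem expSize_add_le (I J : σ → ℤ) : expSize (I + J) ≤ expSize I + expSize J := by
  rw [expSize, expSize, expSize, ← Finset.sum_add_distrib]
  exact Finset.sum_le_sum fun j _ => Int.natAbs_add_le _ _

theorem expSize_neg (I : σ → ℤ) : expSize (-I) = expSize I := by simp [expSize]

theorem expSize_sub_le (I J : σ → ℤ) : expSize (I - J) ≤ expSize I + expSize J := by
  rw [sub_eq_add_neg, ← expSize_neg J]; exact expSize_add_le _ _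

theorem expSize_le_sub_add (I J : σ → ℤ) : expSize I ≤ expSize (I - J) + expSize J := by
  simpa using expSize_add_le (I - J) J

theorem natAbs_le_expSize (I : σ → ℤ) (j : σ) : (I j).natAbs ≤ expSize I :=
  Finset.single_le_sum (f := fun j => (I j).natAbs) (fun _ _ => Nat.zero_le _) (Finset.mem_univ j)

@[simp] theorem expSize_single [DecidableEq σ] (j : σ) (k : ℤ) :
    expSize (Pi.single j k) = k.natAbs := by
  rw [expSize, Finset.sum_eq_single j]
  · simp
  · intro b _ hb; simp [hb]
  · simp

theorem finite_expSize_le (N : ℕ) : {I : σ → ℤ | expSize I ≤ N}.Finite := by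
  refine (Set.Finite.pi' (t := fun _ : σ => Set.Icc (-(N : ℤ)) N)
    fun _ => Set.finite_Icc _ _).subset fun I hI j => ?_
  have := (natAbs_le_expSize I j).trans hI
  simp only [Set.mem_Icc]
  omega

theorem mem_overconv {inv : Set σ} {a : Series p σ} :
    a ∈ overconv p inv ↔ (∀ I, ¬ IsRegularExp inv I → a I = 0) ∧
      ∃ C r : ℝ, 0 ≤ C ∧ 0 < r ∧ r < 1 ∧ ∀ I, ‖a I‖ ≤ C * r ^ expSize I := by
  refine and_congr_right fun _ => ⟨?_, ?_⟩
  · rintro ⟨C, r, h0, h1, h⟩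
    exact ⟨|C|, r, abs_nonneg _, h0, h1, fun I => (h I).trans
      (mul_le_mul_of_nonneg_right (le_abs_self C) (by positivity))⟩
  · rintro ⟨C, r, -, h0, h1, h⟩
    exact ⟨C, r, h0, h1, h⟩

theorem overconv_mono {inv inv' : Set σ} (h : inv ⊆ inv') : overconv p inv ≤ overconv p inv' := by
  rintro a ⟨h1, h2⟩
  exact ⟨fun I hI => h1 I fun h' => hI fun j hj => h' j fun hj' => hj (h hj'), h2⟩

/-- Overconvergence is inherited along a map of exponents that does not contract sizes by more
than a bounded factor, up to coefficients of linear growth. -/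
theorem overconv_of_le {inv : Set σ} {inv' : Set τ} {b : Series p σ} (hb : b ∈ overconv p inv)
    {a : Series p τ} (hreg : ∀ I, ¬ IsRegularExp inv' I → a I = 0) (K : ℝ) (M : ℕ)
    (h : ∀ I, a I ≠ 0 → ∃ J, expSize I ≤ M * (expSize J + 1) ∧
      ‖a I‖ ≤ K * (expSize I + 1) * ‖b J‖) : a ∈ overconv p inv' := by
  obtain ⟨-, C, r, hC, hr0, hr1, hbd⟩ := mem_overconv.1 hb
  obtain ⟨D, s, hD, hs0, hs1, hs⟩ := exists_geometric_bound hr0 hr1 (|K| * C) M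
  refine mem_overconv.2 ⟨hreg, D, s, hD, hs0, hs1, fun I => ?_⟩
  by_cases hI : a I = 0
  · rw [hI, norm_zero]; positivity
  obtain ⟨J, hJ, hle⟩ := h I hI
  calc ‖a I‖ ≤ K * (expSize I + 1) * ‖b J‖ := hle
    _ ≤ |K| * (expSize I + 1) * (C * r ^ expSize J) := by
        gcongr
        · exact le_abs_self K
        · exact hbd J
    _ = |K| * C * (expSize I + 1) * r ^ expSize J := by ring
    _ ≤ _ := hs _ _ hJ

theorem summable_of_geometric_bound {f : (σ → ℤ) → ℂ_[p]} {C r : ℝ} (hr0 : 0 < r) (hr1 : r < 1)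
    (h : ∀ I, ‖f I‖ ≤ C * r ^ expSize I) : Summable f := by
  refine NonarchimedeanAddGroup.summable_of_tendsto_cofinite_zero ?_
  rw [tendsto_zero_iff_norm_tendsto_zero]
  have h1 : Filter.Tendsto (fun I : σ → ℤ => expSize I) Filter.cofinite Filter.atTop := by
    rw [Filter.tendsto_atTop]
    intro N
    rw [Filter.eventually_cofinite]
    exact (finite_expSize_le N).subset fun I hI => (not_le.1 hI).le
  have h2 : Filter.Tendsto (fun I : σ → ℤ => C * r ^ expSize I) Filter.cofinite (nhds 0) := by
    have := ((tendsto_pow_atTop_nhds_zero_of_lt_one hr0.le hr1).comp h1).const_mul C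
    simpa using this
  exact squeeze_zero (fun _ => norm_nonneg _) h h2

theorem summable_nat_of_geometric_bound {f : ℕ → ℂ_[p]} {C r : ℝ} (hr0 : 0 < r) (hr1 : r < 1)
    (h : ∀ n, ‖f n‖ ≤ C * r ^ n) : Summable f :=
  Summable.of_norm_bounded ((summable_geometric_of_lt_one hr0.le hr1).mul_left C) h

end Overconvergent

/-! ### Exterior and interior multiplication -/

noncomputable section Exterior

variable {p : ℕ} [Fact p.Prime] {σ : Type} [LinearOrder σ]

/-- The sign of moving `dz_j` past the factors of `dz_S` that precede it. -/
def wedgeSign (p : ℕ) [Fact p.Prime] (j : σ) (S : Finset σ) : ℂ_[p] :=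
  (-1) ^ (S.filter (· < j)).card

theorem wedgeSign_mul_self (j : σ) (S : Finset σ) : wedgeSign p j S * wedgeSign p j S = 1 := by
  rw [wedgeSign, ← mul_pow]; simp

theorem wedgeSign_ne_zero (j : σ) (S : Finset σ) : wedgeSign p j S ≠ 0 := by
  intro h; simpa [h] using wedgeSign_mul_self (p := p) j S

theorem wedgeSign_insert {j k : σ} {S : Finset σ} (hk : k ∉ S) :
    wedgeSign p j (insert k S) = if k < j then -wedgeSign p j S else wedgeSign p j S := by
  unfold wedgeSign
  rw [Finset.filter_insert]
  split_ifs with h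
  · rw [Finset.card_insert_of_notMem (by simp [hk]), pow_succ]; simp
  · rfl

theorem wedgeSign_erase {j k : σ} {S : Finset σ} (hk : k ∈ S) :
    wedgeSign p j (S.erase k) = if k < j then -wedgeSign p j S else wedgeSign p j S := by
  conv_rhs => rw [← Finset.insert_erase hk]
  rw [wedgeSign_insert (Finset.notMem_erase k S)]
  split_ifs <;> simp

theorem wedge_apply (j : σ) (ω : Forms p σ) (S : Finset σ) :
    wedge p j ω S = if j ∈ S then wedgeSign p j S • ω (S.erase j) else 0 := rfl

/-- Interior multiplication by the vector field `∂_j`, the contraction that is adjoint to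
multiplication by `dz_j`. -/
def contract (p : ℕ) [Fact p.Prime] {σ : Type} [LinearOrder σ] (j : σ) :
    Forms p σ →ₗ[ℂ_[p]] Forms p σ where
  toFun ω := fun S => if j ∈ S then 0 else wedgeSign p j S • ω (insert j S)
  map_add' ω η := by
    ext S I
    by_cases h : j ∈ S <;> simp [h, mul_add]
  map_smul' c ω := by
    ext S I
    by_cases h : j ∈ S <;> simp [h, mul_left_comm]

theorem contract_apply (j : σ) (ω : Forms p σ) (S : Finset σ) :
    contract p j ω S = if j ∈ S then 0 else wedgeSign p j S • ω (insert j S) := rfl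

theorem wedge_self (j : σ) (ω : Forms p σ) : wedge p j (wedge p j ω) = 0 := by
  funext S
  by_cases hj : j ∈ S <;> simp [wedge_apply, hj]

theorem wedge_anticomm (j k : σ) (ω : Forms p σ) :
    wedge p j (wedge p k ω) = -wedge p k (wedge p j ω) := by
  rcases eq_or_ne j k with rfl | hjk
  · simp [wedge_self]
  funext S
  simp only [wedge_apply, Pi.neg_apply]
  by_cases hj : j ∈ S <;> by_cases hk : k ∈ S <;>
    simp only [hj, hk, Finset.mem_erase, hjk, hjk.symm, ne_eq, not_false_eq_true, and_self,
      if_true, if_false, smul_zero, neg_zero, and_false]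
  rw [wedgeSign_erase hj, wedgeSign_erase hk, Finset.erase_right_comm, smul_smul, smul_smul,
    ← neg_smul]
  congr 1
  rcases lt_or_gt_of_ne hjk with h | h
  · rw [if_pos h, if_neg h.not_gt]; ring
  · rw [if_neg h.not_gt, if_pos h]; ring

theorem contract_self (j : σ) (ω : Forms p σ) : contract p j (contract p j ω) = 0 := by
  funext S
  by_cases hj : j ∈ S <;> simp [contract_apply, hj]

theorem contract_anticomm (j k : σ) (ω : Forms p σ) :
    contract p j (contract p k ω) = -contract p k (contract p j ω) := by
  rcases eq_or_ne j k with rfl | hjk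
  · simp [contract_self]
  funext S
  simp only [contract_apply, Pi.neg_apply]
  by_cases hj : j ∈ S <;> by_cases hk : k ∈ S <;>
    simp only [hj, hk, Finset.mem_insert, hjk, hjk.symm, or_true, or_false, if_true, if_false,
      smul_zero, neg_zero]
  rw [wedgeSign_insert hj, wedgeSign_insert hk, Finset.insert_comm, smul_smul, smul_smul,
    ← neg_smul]
  congr 1
  rcases lt_or_gt_of_ne hjk with h | h
  · rw [if_pos h, if_neg h.not_gt]; ring
  · rw [if_neg h.not_gt, if_pos h]; ring

theorem contract_wedge_self (j : σ) (ω : Forms p σ) :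
    contract p j (wedge p j ω) = ω - wedge p j (contract p j ω) := by
  funext S
  simp only [contract_apply, wedge_apply, Pi.sub_apply]
  by_cases hj : j ∈ S
  · simp only [hj, if_true, Finset.notMem_erase, if_false, Finset.insert_erase, smul_smul]
    rw [wedgeSign_erase hj, if_neg (lt_irrefl j), wedgeSign_mul_self, one_smul, sub_self]
  · simp only [hj, if_false, Finset.mem_insert_self, if_true, smul_smul]
    rw [wedgeSign_insert hj, if_neg (lt_irrefl j), wedgeSign_mul_self, one_smul, sub_zero,
      Finset.erase_insert hj]

theorem contract_wedge_of_ne {j k : σ} (hjk : j ≠ k) (ω : Forms p σ) :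
    contract p j (wedge p k ω) = -wedge p k (contract p j ω) := by
  funext S
  simp only [contract_apply, wedge_apply, Pi.neg_apply]
  by_cases hj : j ∈ S <;> by_cases hk : k ∈ S <;>
    simp only [hj, hk, Finset.mem_insert, Finset.mem_erase, hjk, hjk.symm, ne_eq,
      not_false_eq_true, and_self, or_true, or_false, if_true, if_false,
      smul_zero, neg_zero, and_false]
  rw [wedgeSign_insert hj, wedgeSign_erase hk, Finset.erase_insert_of_ne hjk, smul_smul, smul_smul,
    ← neg_smul]
  congr 1
  rcases lt_or_gt_of_ne hjk with h | h
  · rw [if_pos h, if_neg h.not_gt]; ring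
  · rw [if_neg h.not_gt, if_pos h]; ring

variable {τ : Type}

/-- The action of an operator on the coefficients of forms. -/
abbrev coeffwise (T : Series p σ →ₗ[ℂ_[p]] Series p τ) :
    (Finset σ → Series p σ) →ₗ[ℂ_[p]] (Finset σ → Series p τ) := T.compLeft (Finset σ)

theorem coeffwise_wedge (T : Series p σ →ₗ[ℂ_[p]] Series p σ) (j : σ) (ω : Forms p σ) :
    coeffwise T (wedge p j ω) = wedge p j (coeffwise T ω) := by
  funext S
  simp only [LinearMap.compLeft_apply, Function.comp_apply, wedge_apply]
  split_ifs <;> simp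

theorem coeffwise_contract (T : Series p σ →ₗ[ℂ_[p]] Series p σ) (j : σ) (ω : Forms p σ) :
    coeffwise T (contract p j ω) = contract p j (coeffwise T ω) := by
  funext S
  simp only [LinearMap.compLeft_apply, Function.comp_apply, contract_apply]
  split_ifs <;> simp

/-- Forms of degree `k` with coefficients in a space `A` of series. -/
def formsIn (A : Submodule ℂ_[p] (Series p σ)) (k : ℤ) : Submodule ℂ_[p] (Forms p σ) where
  carrier := {ω | ∀ S, ω S ∈ A ∧ ((S.card : ℤ) ≠ k → ω S = 0)}
  zero_mem' := fun _ => ⟨Submodule.zero_mem _, fun _ => rfl⟩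
  add_mem' := fun hω hη S => ⟨Submodule.add_mem _ (hω S).1 (hη S).1, fun h => by
    rw [Pi.add_apply, (hω S).2 h, (hη S).2 h, add_zero]⟩
  smul_mem' := fun c ω hω S => ⟨Submodule.smul_mem _ c (hω S).1, fun h => by
    rw [Pi.smul_apply, (hω S).2 h, smul_zero]⟩

variable {A : Submodule ℂ_[p] (Series p σ)} {k : ℤ}

theorem wedge_mem_formsIn {l : ℤ} (hl : l = k + 1) (j : σ) {ω : Forms p σ} (hω : ω ∈ formsIn A k) :
    wedge p j ω ∈ formsIn A l := by
  subst hl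
  intro S
  rw [wedge_apply]
  split_ifs with hj
  · refine ⟨A.smul_mem _ (hω _).1, fun h => ?_⟩
    rw [(hω _).2, smul_zero]
    have := Finset.card_erase_add_one hj
    omega
  · exact ⟨A.zero_mem, fun _ => rfl⟩

theorem contract_mem_formsIn {l : ℤ} (hl : k = l + 1) (j : σ) {ω : Forms p σ}
    (hω : ω ∈ formsIn A k) : contract p j ω ∈ formsIn A l := by
  subst hl
  intro S
  rw [contract_apply]
  split_ifs with hj
  · exact ⟨A.zero_mem, fun _ => rfl⟩
  · refine ⟨A.smul_mem _ (hω _).1, fun h => ?_⟩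
    rw [(hω _).2, smul_zero]
    have := Finset.card_insert_of_notMem hj
    omega

omit [LinearOrder σ] in
theorem coeffwise_mem_formsIn {A' : Submodule ℂ_[p] (Series p σ)}
    {T : Series p σ →ₗ[ℂ_[p]] Series p σ} (hT : ∀ a ∈ A, T a ∈ A') {ω : Forms p σ}
    (hω : ω ∈ formsIn A k) : coeffwise T ω ∈ formsIn A' k := fun S =>
  ⟨hT _ (hω S).1, fun h => by simp [(hω S).2 h]⟩

end Exterior

/-! ### Koszul complexes of commuting operators -/

noncomputable section Koszul

variable {p : ℕ} [Fact p.Prime] {σ : Type} [LinearOrder σ] [Fintype σ]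

/-- The differential `∑ dz_j T_j` on forms that is defined by a family of operators. -/
def koszulD (T : σ → Series p σ →ₗ[ℂ_[p]] Series p σ) : Forms p σ →ₗ[ℂ_[p]] Forms p σ :=
  ∑ j, wedge p j ∘ₗ coeffwise (T j)

theorem deRhamD_eq_koszulD (f : LPoly p σ) : deRhamD f = koszulD (twistedDeriv f) := rfl

variable {T : σ → Series p σ →ₗ[ℂ_[p]] Series p σ}

theorem koszulD_apply (ω : Forms p σ) :
    koszulD T ω = ∑ j, wedge p j (coeffwise (T j) ω) := by
  simp [koszulD, LinearMap.sum_apply]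

theorem koszulD_mem_formsIn {A A' : Submodule ℂ_[p] (Series p σ)} (hT : ∀ j, ∀ a ∈ A, T j a ∈ A')
    {k l : ℤ} (hl : l = k + 1) {ω : Forms p σ} (hω : ω ∈ formsIn A k) :
    koszulD T ω ∈ formsIn A' l := by
  rw [koszulD_apply]
  exact Submodule.sum_mem _ fun j _ =>
    wedge_mem_formsIn hl j (coeffwise_mem_formsIn (hT j) hω)

theorem koszulD_wedge (j : σ) (ω : Forms p σ) :
    koszulD T (wedge p j ω) = -wedge p j (koszulD T ω) := by
  rw [koszulD_apply, koszulD_apply, map_sum, ← Finset.sum_neg_distrib]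
  refine Finset.sum_congr rfl fun k _ => ?_
  rw [coeffwise_wedge, wedge_anticomm]

/-- Cartan's formula: the contraction is a homotopy from `T_j` to zero. -/
theorem contract_koszulD (j : σ) (ω : Forms p σ) :
    contract p j (koszulD T ω) = coeffwise (T j) ω - koszulD T (contract p j ω) := by
  rw [koszulD_apply, koszulD_apply, map_sum, eq_sub_iff_add_eq, ← Finset.sum_add_distrib,
    Finset.sum_eq_single j]
  · rw [contract_wedge_self, coeffwise_contract, sub_add_cancel]
  · intro k _ hk
    rw [contract_wedge_of_ne hk.symm, coeffwise_contract, neg_add_cancel]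
  · simp

theorem koszulD_koszulD {ω : Forms p σ}
    (hcomm : ∀ i j S, T i (T j (ω S)) = T j (T i (ω S))) : koszulD T (koszulD T ω) = 0 := by
  have h2 : koszulD T (koszulD T ω)
      = ∑ i, ∑ j, wedge p i (wedge p j (coeffwise (T i) (coeffwise (T j) ω))) := by
    rw [koszulD_apply]
    refine Finset.sum_congr rfl fun i _ => ?_
    rw [koszulD_apply, map_sum, map_sum]
    refine Finset.sum_congr rfl fun j _ => ?_
    rw [coeffwise_wedge]
  have h3 : koszulD T (koszulD T ω) = -koszulD T (koszulD T ω) := by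
    conv_rhs => rw [h2, Finset.sum_comm]
    rw [h2, ← Finset.sum_neg_distrib]
    refine Finset.sum_congr rfl fun i _ => ?_
    rw [← Finset.sum_neg_distrib]
    refine Finset.sum_congr rfl fun j _ => ?_
    rw [wedge_anticomm]
    congr 3
    funext S
    exact hcomm i j S
  funext S I
  have h4 := congrFun (congrFun h3 S) I
  simp only [Pi.neg_apply] at h4
  simpa [self_eq_neg] using h4

omit [Fintype σ] in
theorem contract_eq_zero_iff {j : σ} {ω : Forms p σ} :
    contract p j ω = 0 ↔ ∀ S, j ∈ S → ω S = 0 := by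
  constructor
  · intro h S hj
    have := congrFun h (S.erase j)
    rw [contract_apply, if_neg (Finset.notMem_erase j S), Finset.insert_erase hj] at this
    simpa [wedgeSign_ne_zero] using this
  · intro h
    funext S
    rw [contract_apply]
    split_ifs
    · rfl
    · rw [h _ (Finset.mem_insert_self j S), smul_zero]; rfl

omit [Fintype σ] in
/-- A form whose coefficients all lie in the image of an operator lifts, and the lift inherits
degree and missing factors `dz_j`. -/
theorem exists_formsIn_lift {A : Submodule ℂ_[p] (Series p σ)} {k : ℤ} {ω : Forms p σ}
    (hk : ∀ S : Finset σ, (S.card : ℤ) ≠ k → ω S = 0) {P : Series p σ → Series p σ → Prop}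
    (h : ∀ S, ω S ≠ 0 → ∃ a ∈ A, P a (ω S)) (h0 : P 0 0) :
    ∃ θ ∈ formsIn A k, (∀ S, P (θ S) (ω S)) ∧
      ∀ j, contract p j ω = 0 → contract p j θ = 0 := by
  classical
  choose f hfA hfP using h
  refine ⟨fun S => if hS : ω S = 0 then 0 else f S hS, fun S => ?_, fun S => ?_, fun j hj => ?_⟩
  · by_cases hS : ω S = 0
    · simp [hS]
    · simp only [hS, dif_neg, not_false_eq_true]
      exact ⟨hfA S hS, fun hc => absurd (hk S hc) hS⟩
  · by_cases hS : ω S = 0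
    · simpa [hS] using h0
    · simpa only [hS, dif_neg, not_false_eq_true] using hfP S hS
  · rw [contract_eq_zero_iff] at hj ⊢
    intro S hS
    simp [hj S hS]

variable {A : Submodule ℂ_[p] (Series p σ)} (hTA : ∀ j, ∀ a ∈ A, T j a ∈ A)
  (hcomm : ∀ i j, ∀ a ∈ A, T i (T j a) = T j (T i a))

include hTA hcomm in
/-- Elimination of one variable: if `T_j` is injective, then a closed form is exact as soon as the
coefficients of its `dz_j` part are in the image of `T_j`. -/
theorem exact_of_contract_mem_range {j : σ} (hinj : ∀ a ∈ A, T j a = 0 → a = 0) {k : ℤ}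
    {ω : Forms p σ} (hω : ω ∈ formsIn A k) (hclosed : koszulD T ω = 0)
    (hrange : ∀ S, ∃ a ∈ A, T j a = contract p j ω S) :
    ∃ θ ∈ formsIn A (k - 1), koszulD T θ = ω := by
  have hι : contract p j ω ∈ formsIn A (k - 1) := contract_mem_formsIn (by ring) j hω
  obtain ⟨θ, hθ, hθP, hθc⟩ := exists_formsIn_lift (P := fun a b => T j a = b)
    (fun S => (hι S).2) (fun S _ => hrange S) (map_zero _)
  have hθ0 := hθc j (contract_self j ω)
  refine ⟨θ, hθ, ?_⟩
  have hDθ : koszulD T θ ∈ formsIn A k := koszulD_mem_formsIn hTA (by ring) hθ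
  have hc : contract p j (ω - koszulD T θ) = 0 := by
    rw [map_sub, contract_koszulD, hθ0, map_zero, sub_zero, sub_eq_zero]
    funext S
    exact (hθP S).symm
  have hD : koszulD T (ω - koszulD T θ) = 0 := by
    rw [map_sub, hclosed, koszulD_koszulD fun i j S => hcomm i j _ (hθ S).1, sub_zero]
  have hT := contract_koszulD (T := T) j (ω - koszulD T θ)
  rw [hD, hc, map_zero, map_zero, sub_zero] at hT
  have h0 : ω - koszulD T θ = 0 := by
    funext S
    exact hinj _ (A.sub_mem (hω S).1 (hDθ S).1) (congrFun hT.symm S)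
  exact (sub_eq_zero.1 h0).symm

include hTA hcomm in
/-- Elimination of two variables: if `T_i, T_j` is a regular sequence, then a closed form is exact
as soon as the coefficients of its `dz_i dz_j` part are in the sum of the images. -/
theorem exact_of_contract_contract_mem_range {i j : σ} (hij : i ≠ j)
    (hinj : ∀ a ∈ A, T i a = 0 → a = 0)
    (hreg : ∀ a ∈ A, ∀ b ∈ A, T j a = T i b → ∃ c ∈ A, T i c = a) {k : ℤ}
    {ω : Forms p σ} (hω : ω ∈ formsIn A k) (hclosed : koszulD T ω = 0)
    (hrange : ∀ S, ∃ a ∈ A, ∃ b ∈ A, T i a + T j b = contract p j (contract p i ω) S) :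
    ∃ θ ∈ formsIn A (k - 1), koszulD T θ = ω := by
  set φ := contract p j (contract p i ω) with hφ
  have hφA : φ ∈ formsIn A (k - 2) :=
    contract_mem_formsIn (by ring) j (contract_mem_formsIn (k := k) (l := k - 1) (by ring) i hω)
  have hφi : contract p i φ = 0 := by
    rw [hφ, contract_anticomm, contract_self, map_zero, neg_zero]
  have hφj : contract p j φ = 0 := contract_self _ _
  -- The `dz_i dz_j` part is `T_i a + T_j b`; it is also that of the differential of `θ₁`.
  obtain ⟨a, ha, haP, hac⟩ := exists_formsIn_lift (A := A)
    (P := fun a c => ∃ b ∈ A, T i a + T j b = c)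
    (fun S => (hφA S).2) (fun S _ => hrange S) ⟨0, A.zero_mem, by simp⟩
  have hai := hac i hφi
  have haj := hac j hφj
  obtain ⟨b, hb, hbP, hbc⟩ := exists_formsIn_lift (A := A) (P := fun b c => T j b = c)
    (ω := φ - coeffwise (T i) a) (k := k - 2)
    (fun S hS => by simp [(hφA S).2 hS, (ha S).2 hS])
    (fun S _ => by
      obtain ⟨b, hb, h⟩ := haP S
      exact ⟨b, hb, by simp [← h]⟩) (map_zero _)
  have hbi := hbc i (by rw [map_sub, hφi, ← coeffwise_contract, hai]; simp)
  have hbj := hbc j (by rw [map_sub, hφj, ← coeffwise_contract, haj]; simp)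
  have hφeq : coeffwise (T i) a + coeffwise (T j) b = φ := by
    funext S
    have := hbP S
    simp only [Pi.sub_apply] at this
    simp [this]
  set θ₁ := wedge p j a - wedge p i b with hθ₁
  have hθ₁A : θ₁ ∈ formsIn A (k - 1) :=
    Submodule.sub_mem _ (wedge_mem_formsIn (by ring) j ha) (wedge_mem_formsIn (by ring) i hb)
  set ω₁ := ω - koszulD T θ₁ with hω₁
  have hω₁A : ω₁ ∈ formsIn A k :=
    Submodule.sub_mem _ hω (koszulD_mem_formsIn hTA (by ring) hθ₁A)
  have hω₁D : koszulD T ω₁ = 0 := by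
    rw [hω₁, map_sub, hclosed, koszulD_koszulD fun i j S => hcomm i j _ (hθ₁A S).1, sub_zero]
  have hcc : contract p j (contract p i ω₁) = 0 := by
    rw [hω₁, map_sub, map_sub, ← hφ, ← hφeq, hθ₁, map_sub, map_sub, map_sub, koszulD_wedge,
      koszulD_wedge, map_neg, map_neg, map_neg, map_neg, contract_wedge_of_ne hij,
      contract_koszulD, hai, map_zero, sub_zero, map_neg, contract_wedge_self,
      ← coeffwise_contract, haj, map_zero, map_zero, sub_zero,
      contract_wedge_self, map_sub, contract_koszulD i, contract_koszulD j, hbj, hbi]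
    simp only [map_zero, sub_zero]
    rw [contract_wedge_of_ne hij.symm, ← coeffwise_contract, hbj]
    simp
  -- The remaining `dz_i` part `μ` satisfies `T_j μ ∈ T_i A`, hence lies in `T_i A` by regularity.
  set μ := contract p i ω₁ with hμ
  have hμA : μ ∈ formsIn A (k - 1) := contract_mem_formsIn (by ring) i hω₁A
  have hνA : contract p j ω₁ ∈ formsIn A (k - 1) := contract_mem_formsIn (by ring) j hω₁A
  have hrel : coeffwise (T j) μ = coeffwise (T i) (contract p j ω₁) := by
    have h1 := contract_koszulD (T := T) i ω₁
    rw [hω₁D, map_zero, eq_comm, sub_eq_zero] at h1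
    have h2 := congrArg (contract p j) h1
    rw [contract_koszulD, hcc, map_zero, sub_zero, ← coeffwise_contract] at h2
    exact h2.symm
  obtain ⟨c, hc, hcP, hcc'⟩ := exists_formsIn_lift (A := A) (P := fun c m => T i c = m)
    (fun S => (hμA S).2) (fun S _ => hreg _ (hμA S).1 _ (hνA S).1 (congrFun hrel S)) (map_zero _)
  have hci := hcc' i (contract_self _ _)
  set ω₂ := ω₁ - koszulD T c with hω₂
  have hω₂A : ω₂ ∈ formsIn A k :=
    Submodule.sub_mem _ hω₁A (koszulD_mem_formsIn hTA (by ring) hc)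
  have hω₂D : koszulD T ω₂ = 0 := by
    rw [hω₂, map_sub, hω₁D, koszulD_koszulD fun i j S => hcomm i j _ (hc S).1, sub_zero]
  have hω₂c : contract p i ω₂ = 0 := by
    rw [hω₂, map_sub, contract_koszulD, hci, map_zero, sub_zero, sub_eq_zero]
    funext S
    exact (hcP S).symm
  -- A closed form without `dz_i` part is killed by `T_i`, hence zero.
  have hT := contract_koszulD (T := T) i ω₂
  rw [hω₂D, hω₂c, map_zero, map_zero, sub_zero] at hT
  have h0 : ω₂ = 0 := by
    funext S
    exact hinj _ (hω₂A S).1 (congrFun hT.symm S)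
  refine ⟨θ₁ + c, Submodule.add_mem _ hθ₁A hc, ?_⟩
  rw [hω₂, hω₁, sub_sub, sub_eq_zero] at h0
  rw [map_add, ← h0]

end Koszul

/-! ### Laurent polynomials acting on series -/

noncomputable section PolyMul

variable {p : ℕ} [Fact p.Prime] {σ : Type}

theorem polyMul_apply (f : LPoly p σ) (a : Series p σ) (I : σ → ℤ) :
    polyMul f a I = f.coeff.sum fun J c => c * a (I - J) := by
  simp [polyMul, Finsupp.sum, LinearMap.sum_apply, LinearMap.funLeft_apply]

@[simp] theorem polyMul_zero : polyMul (0 : LPoly p σ) = 0 := by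
  simp [polyMul]

theorem polyMul_add (f g : LPoly p σ) : polyMul (f + g) = polyMul f + polyMul g := by
  classical
  rw [polyMul, AddMonoidAlgebra.coeff_add, Finsupp.sum_add_index'] <;> simp [polyMul, add_smul]

theorem polyMul_single (J : σ → ℤ) (c : ℂ_[p]) (a : Series p σ) (I : σ → ℤ) :
    polyMul (AddMonoidAlgebra.single J c) a I = c * a (I - J) := by
  rw [polyMul_apply, AddMonoidAlgebra.coeff_single, Finsupp.sum_single_index (by simp)]

theorem polyMul_smul (c : ℂ_[p]) (f : LPoly p σ) : polyMul (c • f) = c • polyMul f := by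
  induction f using AddMonoidAlgebra.induction_linear with
  | zero => simp
  | add f g hf hg => rw [smul_add, polyMul_add, hf, hg, polyMul_add, smul_add]
  | single J d =>
    ext a I
    simp [polyMul_single, mul_assoc]

theorem polyMul_neg (f : LPoly p σ) : polyMul (-f) = -polyMul f := by
  exact eq_neg_of_add_eq_zero_left (by rw [← polyMul_add, neg_add_cancel, polyMul_zero])

theorem polyMul_sub (f g : LPoly p σ) : polyMul (f - g) = polyMul f - polyMul g := by
  rw [sub_eq_add_neg, polyMul_add, polyMul_neg, sub_eq_add_neg]

@[simp] theorem polyMul_one (a : Series p σ) : polyMul (1 : LPoly p σ) a = a := by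
  funext I
  rw [AddMonoidAlgebra.one_def, polyMul_single]; simp

theorem polyMul_mul (f g : LPoly p σ) (a : Series p σ) :
    polyMul (f * g) a = polyMul f (polyMul g a) := by
  induction f using AddMonoidAlgebra.induction_linear with
  | zero => simp
  | add f f' hf hf' => rw [add_mul, polyMul_add, polyMul_add, LinearMap.add_apply, hf, hf']; rfl
  | single J c =>
    induction g using AddMonoidAlgebra.induction_linear with
    | zero => simp
    | add g g' hg hg' =>
      rw [mul_add, polyMul_add, polyMul_add, LinearMap.add_apply, hg, hg', LinearMap.add_apply,
        map_add]
    | single K d =>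
      funext I
      simp only [AddMonoidAlgebra.single_mul_single, polyMul_single, mul_assoc, sub_sub]

theorem polyMul_comm (f g : LPoly p σ) (a : Series p σ) :
    polyMul f (polyMul g a) = polyMul g (polyMul f a) := by
  rw [← polyMul_mul, mul_comm, polyMul_mul]

/-- A Laurent polynomial acts on the coefficients of Laurent polynomials by multiplication. -/
theorem polyMul_coeff (f g : LPoly p σ) (I : σ → ℤ) :
    polyMul f (fun J => g.coeff J) I = (f * g).coeff I := by
  induction f using AddMonoidAlgebra.induction_linear with
  | zero => simp
  | add f f' hf hf' =>
    rw [add_mul, polyMul_add, LinearMap.add_apply, Pi.add_apply, hf, hf']; simp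
  | single J c => rw [polyMul_single, AddMonoidAlgebra.coeff_single_mul_apply]; congr 2; abel

theorem exists_norm_polyMul_le (f : LPoly p σ) (a : Series p σ) (I : σ → ℤ)
    (h : polyMul f a I ≠ 0) :
    ∃ J, f.coeff J ≠ 0 ∧ a (I - J) ≠ 0 ∧ ‖polyMul f a I‖ ≤ ‖f.coeff J‖ * ‖a (I - J)‖ := by
  rw [polyMul_apply] at h ⊢
  obtain ⟨J, hJ, hle⟩ := IsUltrametricDist.exists_norm_finsetSum_le f.coeff.support
    fun J => f.coeff J * a (I - J)
  have h0 : f.coeff J * a (I - J) ≠ 0 := by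
    intro h0
    rw [h0, norm_zero] at hle
    exact h (norm_le_zero_iff.1 hle)
  exact ⟨J, left_ne_zero_of_mul h0, right_ne_zero_of_mul h0,
    hle.trans_eq (norm_mul _ _)⟩

theorem continuous_polyMul (f : LPoly p σ) : Continuous (polyMul f : Series p σ → Series p σ) := by
  refine continuous_pi fun I => ?_
  simp only [polyMul_apply, Finsupp.sum]
  fun_prop

variable [DecidableEq σ]

theorem seriesDeriv_apply (j : σ) (a : Series p σ) (I : σ → ℤ) :
    seriesDeriv j a I = ((I j : ℂ_[p]) + 1) * a (I + Pi.single j 1) := rfl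

theorem continuous_seriesDeriv (j : σ) :
    Continuous (seriesDeriv j : Series p σ → Series p σ) := by
  refine continuous_pi fun I => ?_
  simp only [seriesDeriv_apply]
  fun_prop

@[simp] theorem pderiv_single (j : σ) (I : σ → ℤ) (c : ℂ_[p]) :
    LPoly.pderiv j (AddMonoidAlgebra.single I c : LPoly p σ)
      = AddMonoidAlgebra.single (I - Pi.single j 1) ((I j : ℂ_[p]) * c) := by
  rw [LPoly.pderiv, AddMonoidAlgebra.coeff_single, Finsupp.sum_single_index (by simp)]

@[simp] theorem pderiv_zero (j : σ) : LPoly.pderiv j (0 : LPoly p σ) = 0 := by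
  simp [LPoly.pderiv]

theorem pderiv_add (j : σ) (f g : LPoly p σ) :
    LPoly.pderiv j (f + g) = LPoly.pderiv j f + LPoly.pderiv j g := by
  rw [LPoly.pderiv, AddMonoidAlgebra.coeff_add, Finsupp.sum_add_index'] <;>
    simp [LPoly.pderiv, mul_add]

theorem pderiv_smul (j : σ) (c : ℂ_[p]) (f : LPoly p σ) :
    LPoly.pderiv j (c • f) = c • LPoly.pderiv j f := by
  induction f using AddMonoidAlgebra.induction_linear with
  | zero => simp
  | add f g hf hg => rw [smul_add, pderiv_add, hf, hg, pderiv_add, smul_add]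
  | single J d => simp [mul_left_comm]

theorem pderiv_sub (j : σ) (f g : LPoly p σ) :
    LPoly.pderiv j (f - g) = LPoly.pderiv j f - LPoly.pderiv j g := by
  rw [sub_eq_add_neg, pderiv_add, ← neg_one_smul ℂ_[p] g, pderiv_smul, neg_one_smul,
    sub_eq_add_neg]

theorem pderiv_mul (j : σ) (f g : LPoly p σ) :
    LPoly.pderiv j (f * g) = LPoly.pderiv j f * g + f * LPoly.pderiv j g := by
  induction f using AddMonoidAlgebra.induction_linear with
  | zero => simp
  | add f f' hf hf' => rw [add_mul, pderiv_add, hf, hf', pderiv_add, add_mul, add_mul]; abel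
  | single J c =>
    induction g using AddMonoidAlgebra.induction_linear with
    | zero => simp
    | add g g' hg hg' => rw [mul_add, pderiv_add, hg, hg', pderiv_add, mul_add, mul_add]; abel
    | single K d =>
      simp only [AddMonoidAlgebra.single_mul_single, pderiv_single]
      rw [show J - Pi.single j 1 + K = J + K - Pi.single j 1 by abel,
        show J + (K - Pi.single j 1) = J + K - Pi.single j 1 by abel,
        ← AddMonoidAlgebra.single_add]
      congr 1
      simp only [Pi.add_apply]
      push_cast
      ring

theorem pderiv_pow (j : σ) (f : LPoly p σ) (k : ℕ) :
    LPoly.pderiv j (f ^ (k + 1)) = ((k : ℂ_[p]) + 1) • (f ^ k * LPoly.pderiv j f) := by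
  induction k with
  | zero => simp
  | succ k ih =>
    rw [pow_succ, pderiv_mul, ih, smul_mul_assoc, mul_right_comm, ← pow_succ]
    push_cast
    rw [add_smul ((k : ℂ_[p]) + 1) 1, one_smul]

theorem pderiv_comm (i j : σ) (f : LPoly p σ) :
    LPoly.pderiv i (LPoly.pderiv j f) = LPoly.pderiv j (LPoly.pderiv i f) := by
  induction f using AddMonoidAlgebra.induction_linear with
  | zero => simp
  | add f g hf hg => simp only [pderiv_add, hf, hg]
  | single J c =>
    rcases eq_or_ne i j with rfl | hij
    · rfl
    simp only [pderiv_single]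
    rw [sub_right_comm]
    congr 1
    simp only [Pi.sub_apply, Pi.single_eq_of_ne hij, Pi.single_eq_of_ne hij.symm, sub_zero]
    ring

theorem coeff_pderiv (j : σ) (f : LPoly p σ) (I : σ → ℤ) :
    (LPoly.pderiv j f).coeff I = ((I j : ℂ_[p]) + 1) * f.coeff (I + Pi.single j 1) := by
  classical
  induction f using AddMonoidAlgebra.induction_linear with
  | zero => simp
  | add f g hf hg => simp only [pderiv_add, AddMonoidAlgebra.coeff_add, Finsupp.add_apply, hf, hg,
      mul_add]
  | single J c =>
    simp only [pderiv_single, AddMonoidAlgebra.coeff_single, Finsupp.single_apply]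
    by_cases h : J = I + Pi.single j 1
    · subst h
      simp
    · rw [if_neg h, if_neg (fun h' => h (by rw [← h']; simp)), mul_zero]

theorem seriesDeriv_comm (i j : σ) (a : Series p σ) :
    seriesDeriv i (seriesDeriv j a) = seriesDeriv j (seriesDeriv i a) := by
  rcases eq_or_ne i j with rfl | hij
  · rfl
  funext I
  simp only [seriesDeriv_apply, Pi.add_apply, Pi.single_eq_of_ne hij, Pi.single_eq_of_ne hij.symm,
    add_zero, add_right_comm I]
  ring

theorem seriesDeriv_polyMul (j : σ) (f : LPoly p σ) (a : Series p σ) :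
    seriesDeriv j (polyMul f a) = polyMul (LPoly.pderiv j f) a + polyMul f (seriesDeriv j a) := by
  induction f using AddMonoidAlgebra.induction_linear with
  | zero => simp
  | add f g hf hg =>
    simp only [pderiv_add, polyMul_add, LinearMap.add_apply, map_add, hf, hg]; abel
  | single J c =>
    funext I
    simp only [pderiv_single, polyMul_single, seriesDeriv_apply, Pi.add_apply, Pi.sub_apply]
    rw [show I - (J - Pi.single j 1) = I + Pi.single j 1 - J by abel,
      show I - J + Pi.single j 1 = I + Pi.single j 1 - J by abel]
    push_cast
    ring

theorem twistedDeriv_apply (f : LPoly p σ) (j : σ) (a : Series p σ) :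
    twistedDeriv f j a = seriesDeriv j a + polyMul (LPoly.pderiv j f) a := rfl

theorem twistedDeriv_polyMul (f g : LPoly p σ) (j : σ) (a : Series p σ) :
    twistedDeriv f j (polyMul g a) = polyMul (LPoly.pderiv j g) a +
      polyMul g (twistedDeriv f j a) := by
  rw [twistedDeriv_apply, twistedDeriv_apply, seriesDeriv_polyMul, polyMul_comm, map_add, add_assoc]

/-- The partial derivatives of the `D`-module `e ^ f` commute. -/
theorem twistedDeriv_comm (f : LPoly p σ) (i j : σ) (a : Series p σ) :
    twistedDeriv f i (twistedDeriv f j a) = twistedDeriv f j (twistedDeriv f i a) := by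
  simp only [twistedDeriv_apply, map_add, seriesDeriv_polyMul, seriesDeriv_comm i j,
    pderiv_comm i j, polyMul_comm (LPoly.pderiv i f)]
  abel

variable [Fintype σ] {inv : Set σ}

omit [Fintype σ] in
theorem pderiv_mem_algFun (j : σ) {f : LPoly p σ} (hf : f ∈ algFun p inv) :
    LPoly.pderiv j f ∈ algFun p inv := by
  intro I hI i hi
  rw [coeff_pderiv] at hI
  have h1 := hf _ (right_ne_zero_of_mul hI) i hi
  rcases eq_or_ne i j with rfl | hij
  · have h2 := left_ne_zero_of_mul hI
    simp only [Pi.add_apply, Pi.single_eq_same] at h1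
    have h3 : I i ≠ -1 := fun h => h2 (by rw [h]; simp)
    omega
  · simpa [Pi.single_eq_of_ne hij] using h1

omit [DecidableEq σ] in
theorem polyMul_mem_overconv {f : LPoly p σ} (hf : f ∈ algFun p inv) {a : Series p σ}
    (ha : a ∈ overconv p inv) : polyMul f a ∈ overconv p inv := by
  obtain ⟨M, hM⟩ : ∃ M : ℕ, ∀ J, f.coeff J ≠ 0 → expSize J ≤ M :=
    ⟨f.coeff.support.sup expSize, fun J hJ => Finset.le_sup (Finsupp.mem_support_iff.2 hJ)⟩
  obtain ⟨K, hK⟩ : ∃ K : ℝ, ∀ J, f.coeff J ≠ 0 → ‖f.coeff J‖ ≤ K :=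
    ⟨∑ J ∈ f.coeff.support, ‖f.coeff J‖, fun J hJ =>
      Finset.single_le_sum (f := fun J => ‖f.coeff J‖) (fun _ _ => norm_nonneg _)
        (Finsupp.mem_support_iff.2 hJ)⟩
  refine overconv_of_le ha (fun I hI => ?_) |K| (M + 1) fun I hI => ?_
  · by_contra hne
    obtain ⟨J, hJ, haJ, -⟩ := exists_norm_polyMul_le f a I hne
    refine hI fun j hj => ?_
    by_contra hlt
    refine haJ (ha.1 _ fun h => hlt ?_)
    have h1 := h j hj
    have h2 := hf J hJ j hj
    simp only [Pi.sub_apply] at h1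
    omega
  · obtain ⟨J, hJ, haJ, hle⟩ := exists_norm_polyMul_le f a I hI
    refine ⟨I - J, ?_, hle.trans ?_⟩
    · have h1 := expSize_le_sub_add I J
      have h2 := hM J hJ
      nlinarith
    · gcongr
      calc ‖f.coeff J‖ ≤ K := hK J hJ
        _ ≤ |K| := le_abs_self K
        _ ≤ |K| * (expSize I + 1) := le_mul_of_one_le_right (abs_nonneg _) (by simp)

theorem seriesDeriv_mem_overconv (j : σ) {a : Series p σ} (ha : a ∈ overconv p inv) :
    seriesDeriv j a ∈ overconv p inv := by
  refine overconv_of_le ha (fun I hI => ?_) 1 1 fun I _ => ⟨I + Pi.single j 1, ?_, ?_⟩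
  · rw [seriesDeriv_apply]
    by_cases hI' : IsRegularExp inv (I + Pi.single j 1)
    · rw [show I j = -1 from ?_]
      · simp
      · by_contra hne
        refine hI fun i hi => ?_
        have h1 := hI' i hi
        rcases eq_or_ne i j with rfl | hij
        · simp only [Pi.add_apply, Pi.single_eq_same] at h1
          omega
        · simpa [Pi.single_eq_of_ne hij] using h1
    · rw [ha.1 _ hI', mul_zero]
  · have := expSize_sub_le (I + Pi.single j 1) (Pi.single j 1)
    simpa using this
  · rw [seriesDeriv_apply, norm_mul, one_mul]
    gcongr
    have h1 : ‖((I j : ℂ_[p]) + 1)‖ ≤ 1 := by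
      have := norm_intCast_le_one (p := p) (I j + 1)
      push_cast at this
      exact this
    refine h1.trans ?_
    simp

theorem twistedDeriv_mem_overconv {f : LPoly p σ} (hf : f ∈ algFun p inv) (j : σ)
    {a : Series p σ} (ha : a ∈ overconv p inv) : twistedDeriv f j a ∈ overconv p inv :=
  Submodule.add_mem _ (seriesDeriv_mem_overconv j ha)
    (polyMul_mem_overconv (pderiv_mem_algFun j hf) ha)

end PolyMul

/-! ### Maps induced on cohomology -/

section Induced

variable {p : ℕ} [Fact p.Prime] {σ τ : Type} [Fintype σ] [LinearOrder σ] [Fintype τ]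
  [LinearOrder τ]

theorem deRhamD_deRhamD (f : LPoly p σ) (ω : Forms p σ) : deRhamD f (deRhamD f ω) = 0 :=
  koszulD_koszulD fun i j S => twistedDeriv_comm f i j (ω S)

variable {inv : Set σ} {f : LPoly p σ} {k : ℤ} {inv' : Set τ} {g : LPoly p τ} {l : ℤ}

theorem deRhamD_mem_formsOfDeg (hf : f ∈ algFun p inv) (hl : l = k + 1) {ω : Forms p σ}
    (hω : ω ∈ formsOfDeg p inv k) : deRhamD f ω ∈ formsOfDeg p inv l :=
  koszulD_mem_formsIn (A := overconv p inv) (A' := overconv p inv)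
    (fun j _ => twistedDeriv_mem_overconv hf j) hl hω

theorem mk_eq_mk_iff {ω η : closedForms inv f k} :
    (Submodule.Quotient.mk ω : DeRham inv f k) = Submodule.Quotient.mk η ↔
      ∃ θ ∈ formsOfDeg p inv (k - 1), deRhamD f θ = (ω : Forms p σ) - η := by
  rw [Submodule.Quotient.eq, Submodule.submoduleOf, Submodule.mem_comap]
  rfl

theorem mk_eq_zero_iff {ω : closedForms inv f k} :
    (Submodule.Quotient.mk ω : DeRham inv f k) = 0 ↔
      ∃ θ ∈ formsOfDeg p inv (k - 1), deRhamD f θ = ω := by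
  rw [Submodule.Quotient.mk_eq_zero, Submodule.submoduleOf, Submodule.mem_comap]
  rfl

/-- A map of forms that is linear on overconvergent forms and preserves closed and exact forms
induces a linear map on cohomology. -/
theorem exists_induces (F : Forms p σ → Forms p τ)
    (hadd : ∀ ω ∈ formsOfDeg p inv k, ∀ η ∈ formsOfDeg p inv k, F (ω + η) = F ω + F η)
    (hsmul : ∀ (c : ℂ_[p]), ∀ ω ∈ formsOfDeg p inv k, F (c • ω) = c • F ω)
    (hclosed : ∀ ω ∈ closedForms inv f k, F ω ∈ closedForms inv' g l)
    (hexact : ∀ θ ∈ formsOfDeg p inv (k - 1), deRhamD f θ ∈ formsOfDeg p inv k →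
      ∃ η ∈ formsOfDeg p inv' (l - 1), deRhamD g η = F (deRhamD f θ)) :
    ∃ Φ : DeRham inv f k →ₗ[ℂ_[p]] DeRham inv' g l, Induces F Φ := by
  let F₀ : closedForms inv f k →ₗ[ℂ_[p]] closedForms inv' g l :=
    { toFun := fun ω => ⟨F ω, hclosed ω ω.2⟩
      map_add' := fun ω η => Subtype.ext (hadd _ ω.2.1 _ η.2.1)
      map_smul' := fun c ω => Subtype.ext (hsmul c _ ω.2.1) }
  refine ⟨Submodule.mapQ _ _ F₀ ?_, fun ω => ⟨hclosed ω ω.2, ?_⟩⟩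
  · rintro ω ⟨θ, hθ, hω⟩
    have hω' : deRhamD f θ = ω := hω
    rw [Submodule.mem_comap, Submodule.submoduleOf, Submodule.mem_comap]
    obtain ⟨η, hη, h⟩ := hexact θ hθ (hω' ▸ ω.2.1)
    exact ⟨η, hη, h.trans (by rw [hω']; rfl)⟩
  · rw [Submodule.mapQ_apply]
    rfl

end Induced

/-! ### Pull-back and restriction of forms along an inclusion of coordinates -/

noncomputable section Pull

variable {p : ℕ} [Fact p.Prime] {σ τ : Type} [Fintype σ] [LinearOrder σ] [LinearOrder τ]

theorem forall_finset_of_image {e : σ → τ} {P : Finset τ → Prop}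
    (h1 : ∀ S : Finset σ, P (S.image e)) (h2 : ∀ S k, k ∈ S → k ∉ Set.range e → P S)
    (S : Finset τ) : P S := by
  by_cases h : ∀ k ∈ S, k ∈ Set.range e
  · obtain ⟨S', -, rfl⟩ := Finset.subset_set_image_iff (s := Set.univ) (f := e) (t := S) |>.1
      (fun k hk => by simpa using h k hk)
    exact h1 S'
  · push Not at h
    obtain ⟨k, hk, hk'⟩ := h
    exact h2 S k hk hk'

theorem wedgeSign_image {e : σ → τ} (he : StrictMono e) (j : σ) (S : Finset σ) :
    wedgeSign p (e j) (S.image e) = wedgeSign p j S := by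
  rw [wedgeSign, wedgeSign, Finset.filter_image, Finset.card_image_of_injective _ he.injective]
  simp [he.lt_iff_lt]

open scoped Classical in
/-- The form with coefficients `G a` in place of the coefficients `a` of a form in fewer
coordinates, where `e` includes the coordinates. -/
def pullWith (e : σ → τ) (G : Series p σ →ₗ[ℂ_[p]] Series p τ) :
    Forms p σ →ₗ[ℂ_[p]] Forms p τ where
  toFun ω := fun S => if ∀ k ∈ S, k ∈ Set.range e then G (ω (univ.filter fun j => e j ∈ S)) else 0
  map_add' ω η := by
    funext S
    simp only [Pi.add_apply]
    split_ifs <;> simp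
  map_smul' c ω := by
    funext S
    simp only [Pi.smul_apply]
    split_ifs <;> simp

/-- The components of a form along `e`, with an operator `R` applied to the coefficients. -/
def restrWith (e : σ → τ) (R : Series p τ →ₗ[ℂ_[p]] Series p σ) :
    Forms p τ →ₗ[ℂ_[p]] Forms p σ where
  toFun Ω := fun S => R (Ω (S.image e))
  map_add' Ω Ω' := by funext S; simp
  map_smul' c Ω := by funext S; simp

variable {e : σ → τ} {G : Series p σ →ₗ[ℂ_[p]] Series p τ} {R : Series p τ →ₗ[ℂ_[p]] Series p σ}

open scoped Classical in
theorem pullWith_apply (ω : Forms p σ) (S : Finset τ) :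
    pullWith e G ω S
      = if ∀ k ∈ S, k ∈ Set.range e then G (ω (univ.filter fun j => e j ∈ S)) else 0 :=
  rfl

theorem pullWith_image (he : StrictMono e) (ω : Forms p σ) (S : Finset σ) :
    pullWith e G ω (S.image e) = G (ω S) := by
  have h : ∀ k ∈ S.image e, k ∈ Set.range e := by
    intro k hk
    obtain ⟨j, -, rfl⟩ := Finset.mem_image.1 hk
    exact ⟨j, rfl⟩
  have h2 : (univ.filter fun j => e j ∈ S.image e) = S := by
    ext j; simp [he.injective.eq_iff]
  rw [pullWith_apply, if_pos h, h2]

theorem pullWith_of_notMem_range (ω : Forms p σ) {S : Finset τ} {k : τ}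
    (hk : k ∈ S) (hk' : k ∉ Set.range e) : pullWith e G ω S = 0 := by
  rw [pullWith_apply, if_neg fun h => hk' (h k hk)]

theorem restrWith_apply (Ω : Forms p τ) (S : Finset σ) :
    restrWith e R Ω S = R (Ω (S.image e)) := rfl

theorem coeffwise_pullWith (T : Series p τ →ₗ[ℂ_[p]] Series p τ) (ω : Forms p σ) :
    coeffwise T (pullWith e G ω) = pullWith e (T ∘ₗ G) ω := by
  funext S
  rw [LinearMap.compLeft_apply, Function.comp_apply, pullWith_apply, pullWith_apply]
  split_ifs <;> simp

theorem pullWith_zero (ω : Forms p σ) :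
    pullWith e (0 : Series p σ →ₗ[ℂ_[p]] Series p τ) ω = 0 := by
  funext S
  rw [pullWith_apply]
  split_ifs <;> simp

theorem pullWith_wedge (he : StrictMono e) (j : σ) (ω : Forms p σ) :
    pullWith e G (wedge p j ω) = wedge p (e j) (pullWith e G ω) := by
  funext S
  induction S using forall_finset_of_image (e := e) with
  | h1 S =>
    rw [pullWith_image he, wedge_apply, wedge_apply, wedgeSign_image he]
    simp only [Finset.mem_image, he.injective.eq_iff, exists_eq_right]
    split_ifs
    · rw [map_smul, ← Finset.image_erase he.injective, pullWith_image he]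
    · simp
  | h2 S k hk hk' =>
    rw [pullWith_of_notMem_range _ hk hk', wedge_apply]
    split_ifs
    · rw [pullWith_of_notMem_range _ (Finset.mem_erase.2 ⟨fun h => hk' ⟨j, h.symm⟩, hk⟩) hk',
        smul_zero]
    · rfl

theorem contract_pullWith {k : τ} (hk : k ∉ Set.range e) (ω : Forms p σ) :
    contract p k (pullWith e G ω) = 0 :=
  contract_eq_zero_iff.2 fun _ hS => pullWith_of_notMem_range ω hS hk

theorem restrWith_wedge (he : StrictMono e) (j : σ) (Ω : Forms p τ) :
    restrWith e R (wedge p (e j) Ω) = wedge p j (restrWith e R Ω) := by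
  funext S
  rw [restrWith_apply, wedge_apply, wedge_apply, wedgeSign_image he]
  simp only [Finset.mem_image, he.injective.eq_iff, exists_eq_right]
  split_ifs
  · rw [map_smul, ← Finset.image_erase he.injective]; rfl
  · simp

theorem restrWith_wedge_of_notMem {k : τ} (hk : k ∉ Set.range e) (Ω : Forms p τ) :
    restrWith e R (wedge p k Ω) = 0 := by
  funext S
  rw [restrWith_apply, wedge_apply, if_neg, map_zero]
  · rfl
  · intro h
    obtain ⟨j, -, rfl⟩ := Finset.mem_image.1 h
    exact hk ⟨j, rfl⟩

theorem restrWith_pullWith (he : StrictMono e) (ω : Forms p σ) :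
    restrWith e R (pullWith e G ω) = coeffwise (R ∘ₗ G) ω := by
  funext S
  rw [restrWith_apply, pullWith_image he]; rfl

variable {A : Submodule ℂ_[p] (Series p σ)} {B : Submodule ℂ_[p] (Series p τ)} {k : ℤ}

theorem pullWith_mem_formsIn (he : StrictMono e) (hG : ∀ a ∈ A, G a ∈ B) {ω : Forms p σ}
    (hω : ω ∈ formsIn A k) : pullWith e G ω ∈ formsIn B k := by
  intro S
  induction S using forall_finset_of_image (e := e) with
  | h1 S =>
    rw [pullWith_image he, Finset.card_image_of_injective _ he.injective]
    exact ⟨hG _ (hω S).1, fun h => by rw [(hω S).2 h, map_zero]⟩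
  | h2 S k hk hk' =>
    rw [pullWith_of_notMem_range _ hk hk']
    exact ⟨B.zero_mem, fun _ => rfl⟩

theorem restrWith_mem_formsIn (he : StrictMono e) (hR : ∀ b ∈ B, R b ∈ A) {Ω : Forms p τ}
    (hΩ : Ω ∈ formsIn B k) : restrWith e R Ω ∈ formsIn A k := by
  intro S
  have h := hΩ (S.image e)
  rw [Finset.card_image_of_injective _ he.injective] at h
  exact ⟨hR _ h.1, fun hk => by rw [restrWith_apply, h.2 hk, map_zero]⟩

theorem formsIn_ext_pull {Ω Ω' : Forms p τ} (h1 : ∀ S : Finset σ, Ω (S.image e) = Ω' (S.image e))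
    (h2 : ∀ k, k ∉ Set.range e → contract p k Ω = contract p k Ω') : Ω = Ω' := by
  funext S
  induction S using forall_finset_of_image (e := e) with
  | h1 S => exact h1 S
  | h2 S k hk hk' =>
    have := (contract_eq_zero_iff (j := k) (ω := Ω - Ω')).1
      (by rw [map_sub, h2 k hk', sub_self]) S hk
    exact sub_eq_zero.1 this

end Pull

noncomputable section PullSeries

variable {p : ℕ} [Fact p.Prime] {σ τ : Type}

open scoped Classical in
/-- A series as a series in more coordinates. -/
def pullSeries (p : ℕ) [Fact p.Prime] {σ τ : Type} (e : σ → τ) :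
    Series p σ →ₗ[ℂ_[p]] Series p τ where
  toFun a := fun I => if ∀ k, k ∉ Set.range e → I k = 0 then a (I ∘ e) else 0
  map_add' a b := by
    funext I
    simp only [Pi.add_apply]
    split_ifs <;> simp
  map_smul' c a := by
    funext I
    simp only [Pi.smul_apply]
    split_ifs <;> simp

/-- The restriction of a series to the locus where the additional coordinates vanish. -/
def restrSeries (p : ℕ) [Fact p.Prime] {σ τ : Type} (e : σ → τ) :
    Series p τ →ₗ[ℂ_[p]] Series p σ where
  toFun a := fun I => a (Function.extend e I 0)
  map_add' _ _ := rfl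
  map_smul' _ _ := rfl

variable {e : σ → τ}

theorem pullSeries_apply_of_forall (a : Series p σ) {I : τ → ℤ}
    (h : ∀ k, k ∉ Set.range e → I k = 0) : pullSeries p e a I = a (I ∘ e) := if_pos h

theorem pullSeries_apply_of_ne (a : Series p σ) {I : τ → ℤ} {k : τ} (hk : k ∉ Set.range e)
    (h : I k ≠ 0) : pullSeries p e a I = 0 := if_neg fun h' => h (h' k hk)

theorem restrSeries_apply (a : Series p τ) (I : σ → ℤ) :
    restrSeries p e a I = a (Function.extend e I 0) := rfl

theorem extend_comp_of_forall (he : e.Injective) {I : τ → ℤ}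
    (h : ∀ k, k ∉ Set.range e → I k = 0) : Function.extend e (I ∘ e) 0 = I := by
  funext k
  by_cases hk : k ∈ Set.range e
  · obtain ⟨j, rfl⟩ := hk
    rw [he.extend_apply]; rfl
  · rw [Function.extend_apply' _ _ _ (by simpa using hk), h k hk]; rfl

theorem extend_eq_zero {I : σ → ℤ} {k : τ} (hk : k ∉ Set.range e) :
    Function.extend e I 0 k = 0 := by
  rw [Function.extend_apply' _ _ _ (by simpa using hk)]; rfl

theorem extend_add (he : e.Injective) (I J : σ → ℤ) :
    Function.extend e (I + J) 0 = Function.extend e I 0 + Function.extend e J 0 := by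
  funext k
  by_cases hk : k ∈ Set.range e
  · obtain ⟨j, rfl⟩ := hk
    simp [he.extend_apply]
  · simp [extend_eq_zero hk]

theorem extend_sub (he : e.Injective) (I J : σ → ℤ) :
    Function.extend e (I - J) 0 = Function.extend e I 0 - Function.extend e J 0 := by
  rw [eq_sub_iff_add_eq, ← extend_add he, sub_add_cancel]

theorem extend_single [DecidableEq σ] [DecidableEq τ] (he : e.Injective) (j : σ) (c : ℤ) :
    Function.extend e (Pi.single j c) 0 = Pi.single (e j) c := by
  funext k
  by_cases hk : k ∈ Set.range e
  · obtain ⟨i, rfl⟩ := hk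
    rw [he.extend_apply]
    rcases eq_or_ne i j with rfl | h
    · simp
    · rw [Pi.single_eq_of_ne h, Pi.single_eq_of_ne (he.ne h)]
  · rw [extend_eq_zero hk, Pi.single_eq_of_ne]
    rintro rfl
    exact hk ⟨j, rfl⟩

theorem expSize_extend [Fintype σ] [Fintype τ] (he : e.Injective) (I : σ → ℤ) :
    expSize (Function.extend e I 0) = expSize I := by
  classical
  have h1 : expSize (Function.extend e I 0)
      = ∑ k ∈ univ.image e, (Function.extend e I 0 k).natAbs := by
    refine (Finset.sum_subset (Finset.subset_univ _) fun k _ hk => ?_).symm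
    rw [extend_eq_zero (by simpa using hk), Int.natAbs_zero]
  rw [h1, Finset.sum_image fun _ _ _ _ h => he h]
  simp only [he.extend_apply]
  rfl

theorem restrSeries_pullSeries (he : e.Injective) (a : Series p σ) :
    restrSeries p e (pullSeries p e a) = a := by
  funext I
  rw [restrSeries_apply, pullSeries_apply_of_forall _ fun k hk => extend_eq_zero hk]
  congr 1
  funext j
  exact he.extend_apply _ _ _

theorem pullSeries_mem_overconv [Fintype σ] [Fintype τ] (he : e.Injective) {inv : Set σ}
    {inv' : Set τ} (hinv : ∀ j, j ∈ inv → e j ∈ inv') {a : Series p σ} (ha : a ∈ overconv p inv) :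
    pullSeries p e a ∈ overconv p inv' := by
  refine overconv_of_le ha (fun I hI => ?_) 1 1 fun I hI => ⟨I ∘ e, ?_, ?_⟩
  · by_cases h : ∀ k, k ∉ Set.range e → I k = 0
    · rw [pullSeries_apply_of_forall _ h]
      refine ha.1 _ fun hr => hI fun k hk => ?_
      by_cases hk' : k ∈ Set.range e
      · obtain ⟨j, rfl⟩ := hk'
        exact hr j fun hj => hk (hinv j hj)
      · rw [h k hk']
    · exact if_neg h
  · have h : ∀ k, k ∉ Set.range e → I k = 0 := by
      by_contra h
      exact hI (if_neg h)
    have := expSize_extend he (I ∘ e)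
    rw [extend_comp_of_forall he h] at this
    omega
  · have h : ∀ k, k ∉ Set.range e → I k = 0 := by
      by_contra h
      exact hI (if_neg h)
    rw [pullSeries_apply_of_forall _ h, one_mul]
    exact le_mul_of_one_le_left (norm_nonneg _) (by simp)

theorem restrSeries_mem_overconv [Fintype σ] [Fintype τ] (he : e.Injective) {inv : Set σ}
    {inv' : Set τ} (hinv : ∀ j, e j ∈ inv' → j ∈ inv) {a : Series p τ} (ha : a ∈ overconv p inv') :
    restrSeries p e a ∈ overconv p inv := by
  refine overconv_of_le ha (fun I hI => ha.1 _ fun h => hI fun j hj => ?_) 1 1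
    fun I _ => ⟨Function.extend e I 0, ?_, ?_⟩
  · have := h (e j) fun h' => hj (hinv j h')
    rwa [he.extend_apply] at this
  · rw [expSize_extend he]; omega
  · rw [one_mul]
    exact le_mul_of_one_le_left (norm_nonneg _) (by simp)

/-- Extension of Laurent polynomials to more coordinates, as a homomorphism of algebras. -/
def extendHom (p : ℕ) [Fact p.Prime] {σ τ : Type} {e : σ → τ} (he : e.Injective) :
    LPoly p σ →ₐ[ℂ_[p]] LPoly p τ :=
  AddMonoidAlgebra.mapDomainAlgHom ℂ_[p] ℂ_[p]
    { toFun := fun I => Function.extend e I 0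
      map_zero' := by
        funext k
        by_cases hk : k ∈ Set.range e
        · obtain ⟨j, rfl⟩ := hk
          rw [he.extend_apply]; rfl
        · exact extend_eq_zero hk
      map_add' := extend_add he }

theorem extendHom_apply (he : e.Injective) (f : LPoly p σ) : extendHom p he f = f.extend e := rfl

@[simp] theorem extendHom_single (he : e.Injective) (I : σ → ℤ) (c : ℂ_[p]) :
    extendHom p he (AddMonoidAlgebra.single I c)
      = AddMonoidAlgebra.single (Function.extend e I 0) c := by
  rw [extendHom_apply, LPoly.extend, AddMonoidAlgebra.mapDomain_single]

theorem coeff_extendHom (he : e.Injective) (f : LPoly p σ) (I : τ → ℤ) :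
    (extendHom p he f).coeff I = pullSeries p e (fun J => f.coeff J) I := by
  classical
  induction f using AddMonoidAlgebra.induction_linear with
  | zero => rw [map_zero]; exact (congrFun (map_zero (pullSeries p e)) I).symm
  | add f g hf hg =>
    rw [map_add, AddMonoidAlgebra.coeff_add, Finsupp.add_apply, hf, hg]
    exact (congrFun (map_add (pullSeries p e) _ _) I).symm
  | single J c =>
    rw [extendHom_single, AddMonoidAlgebra.coeff_single, Finsupp.single_apply]
    by_cases h : ∀ k, k ∉ Set.range e → I k = 0
    · rw [pullSeries_apply_of_forall _ h, AddMonoidAlgebra.coeff_single, Finsupp.single_apply]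
      refine if_congr ⟨?_, ?_⟩ rfl rfl
      · rintro rfl
        funext j
        exact (he.extend_apply _ _ _).symm
      · rintro rfl
        exact extend_comp_of_forall he h
    · rw [if_neg]
      · exact (if_neg h).symm
      · rintro rfl
        exact h fun k hk => extend_eq_zero hk

theorem extendHom_mem_algFun (he : e.Injective) {inv : Set σ} {inv' : Set τ}
    (hinv : ∀ j, j ∈ inv → e j ∈ inv') {f : LPoly p σ} (hf : f ∈ algFun p inv) :
    extendHom p he f ∈ algFun p inv' := by
  intro I hI k hk
  rw [coeff_extendHom] at hI
  by_cases h : ∀ k, k ∉ Set.range e → I k = 0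
  · rw [pullSeries_apply_of_forall _ h] at hI
    by_cases hk' : k ∈ Set.range e
    · obtain ⟨j, rfl⟩ := hk'
      exact hf _ hI j fun hj => hk (hinv j hj)
    · rw [h k hk']
  · exact absurd (if_neg h) hI

theorem polyMul_pullSeries (he : e.Injective) (f : LPoly p σ) (a : Series p σ) :
    polyMul (extendHom p he f) (pullSeries p e a) = pullSeries p e (polyMul f a) := by
  induction f using AddMonoidAlgebra.induction_linear with
  | zero => simp
  | add f g hf hg =>
    rw [map_add, polyMul_add, LinearMap.add_apply, hf, hg, polyMul_add, LinearMap.add_apply,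
      map_add]
  | single J c =>
    funext I
    rw [extendHom_single, polyMul_single]
    have hiff : ∀ k, k ∉ Set.range e → (I - Function.extend e J 0) k = I k := fun k hk => by
      rw [Pi.sub_apply, extend_eq_zero hk, sub_zero]
    by_cases h : ∀ k, k ∉ Set.range e → I k = 0
    · rw [pullSeries_apply_of_forall _ h, pullSeries_apply_of_forall _ fun k hk => by
        rw [hiff k hk, h k hk], polyMul_single]
      congr 2
      funext j
      simp [he.extend_apply]
    · push Not at h
      obtain ⟨k, hk, hne⟩ := h
      rw [pullSeries_apply_of_ne _ hk hne, pullSeries_apply_of_ne _ hk (by rwa [hiff k hk]),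
        mul_zero]

theorem polyMul_restrSeries (he : e.Injective) (f : LPoly p σ) (a : Series p τ) :
    polyMul f (restrSeries p e a) = restrSeries p e (polyMul (extendHom p he f) a) := by
  induction f using AddMonoidAlgebra.induction_linear with
  | zero => simp
  | add f g hf hg =>
    rw [map_add, polyMul_add, LinearMap.add_apply, hf, hg, polyMul_add, LinearMap.add_apply,
      map_add]
  | single J c =>
    funext I
    rw [extendHom_single, polyMul_single, restrSeries_apply, restrSeries_apply, polyMul_single,
      extend_sub he]

variable [DecidableEq σ] [DecidableEq τ]

theorem seriesDeriv_pullSeries (he : e.Injective) (j : σ) (a : Series p σ) :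
    seriesDeriv (e j) (pullSeries p e a) = pullSeries p e (seriesDeriv j a) := by
  funext I
  rw [seriesDeriv_apply]
  have hiff : ∀ k, k ∉ Set.range e →
      (I + (Pi.single (e j) 1 : τ → ℤ)) k = I k := fun k hk => by
    rw [Pi.add_apply, Pi.single_eq_of_ne, add_zero]
    rintro rfl
    exact hk ⟨j, rfl⟩
  by_cases h : ∀ k, k ∉ Set.range e → I k = 0
  · rw [pullSeries_apply_of_forall _ h, pullSeries_apply_of_forall _ fun k hk => by
      rw [hiff k hk, h k hk], seriesDeriv_apply]
    congr 2
    funext i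
    simp only [Function.comp_apply, Pi.add_apply]
    rcases eq_or_ne i j with rfl | hij
    · simp
    · rw [Pi.single_eq_of_ne hij, Pi.single_eq_of_ne (he.ne hij)]
  · push Not at h
    obtain ⟨k, hk, hne⟩ := h
    rw [pullSeries_apply_of_ne _ hk hne, pullSeries_apply_of_ne _ hk (by rwa [hiff k hk]), mul_zero]

theorem seriesDeriv_pullSeries_of_notMem {k : τ} (hk : k ∉ Set.range e) (a : Series p σ) :
    seriesDeriv k (pullSeries p e a) = 0 := by
  funext I
  rw [seriesDeriv_apply]
  by_cases h : I k = -1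
  · rw [h]; simp
  · rw [pullSeries_apply_of_ne _ hk, mul_zero]
    · rfl
    · simp only [Pi.add_apply, Pi.single_eq_same]
      omega

theorem seriesDeriv_restrSeries (he : e.Injective) (j : σ) (a : Series p τ) :
    seriesDeriv j (restrSeries p e a) = restrSeries p e (seriesDeriv (e j) a) := by
  funext I
  rw [seriesDeriv_apply, restrSeries_apply, restrSeries_apply, seriesDeriv_apply, extend_add he,
    extend_single he, he.extend_apply]

theorem pderiv_extendHom (he : e.Injective) (j : σ) (f : LPoly p σ) :
    LPoly.pderiv (e j) (extendHom p he f) = extendHom p he (LPoly.pderiv j f) := by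
  induction f using AddMonoidAlgebra.induction_linear with
  | zero => simp
  | add f g hf hg => rw [map_add, pderiv_add, hf, hg, pderiv_add, map_add]
  | single J c =>
    rw [extendHom_single, pderiv_single, pderiv_single, extendHom_single, extend_sub he,
      extend_single he, he.extend_apply]

theorem pderiv_extendHom_of_notMem (he : e.Injective) {k : τ} (hk : k ∉ Set.range e)
    (f : LPoly p σ) : LPoly.pderiv k (extendHom p he f) = 0 := by
  induction f using AddMonoidAlgebra.induction_linear with
  | zero => simp
  | add f g hf hg => rw [map_add, pderiv_add, hf, hg, add_zero]
  | single J c =>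
    rw [extendHom_single, pderiv_single, extend_eq_zero hk]
    simp

end PullSeries

/-! ### Perturbation of a split injection by a geometric series -/

noncomputable section Perturbation

variable {p : ℕ} [Fact p.Prime] {σ : Type}

/-- A linear projector along `B` that fixes `N`, defined on the whole ambient space. -/
theorem exists_projector {K M : Type*} [Field K] [AddCommGroup M] [Module K M]
    {N B : Submodule K M} (h : Disjoint N B) :
    ∃ ρ : M →ₗ[K] M, (∀ n ∈ N, ρ n = n) ∧ ∀ b ∈ B, ρ b = 0 := by
  obtain ⟨g, hg⟩ := LinearMap.exists_leftInverse_of_injective (B.mkQ ∘ₗ N.subtype) (by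
    rw [LinearMap.ker_eq_bot']
    intro n hn
    rw [LinearMap.comp_apply, Submodule.mkQ_apply, Submodule.Quotient.mk_eq_zero] at hn
    exact Subtype.ext (Submodule.disjoint_def.1 h n n.2 hn))
  refine ⟨N.subtype ∘ₗ g ∘ₗ B.mkQ, fun n hn => ?_, fun b hb => ?_⟩
  · exact congrArg Subtype.val (LinearMap.congr_fun hg ⟨n, hn⟩)
  · simp [(Submodule.Quotient.mk_eq_zero B).2 hb]

variable {A : Submodule ℂ_[p] (Series p σ)} {U N V e : Series p σ →ₗ[ℂ_[p]] Series p σ}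
  {Z : ℕ → Series p σ → Series p σ}

/-- Let `V` be a left inverse of `U` with `U V = 1 - e`. If the geometric series
`H = V - V N V + V N V N V - ⋯` converges on `A`, then `U + N` is injective on `A`, and `A` is the
direct sum of `e A` and of the image of `U + N`. -/
theorem exists_projector_of_perturbation
    (hc : Continuous (V ∘ₗ N : Series p σ →ₗ[ℂ_[p]] Series p σ))
    (hU : ∀ a ∈ A, U a ∈ A) (hN : ∀ a ∈ A, N a ∈ A) (hVU : ∀ a ∈ A, V (U a) = a)
    (hUV : ∀ a ∈ A, U (V a) = a - e a) (hVe : ∀ a ∈ A, V (e a) = 0)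
    (hZ0 : ∀ a, Z 0 a = V a) (hZ : ∀ i a, Z (i + 1) a = -V (N (Z i a)))
    (hsum : ∀ a ∈ A, Summable (fun i => Z i a) ∧ ∑' i, Z i a ∈ A) :
    (∀ a ∈ A, U a + N a = 0 → a = 0) ∧
    ∃ ρ : Series p σ →ₗ[ℂ_[p]] Series p σ, (∀ a ∈ A, ρ (e a) = e a) ∧
      (∀ a ∈ A, ρ (U a + N a) = 0) ∧
      ∀ b ∈ A, ∃ n ∈ A, ∃ a ∈ A, b = e n + (U a + N a) ∧ ρ b = e n := by
  have hZadd : ∀ i a b, Z i (a + b) = Z i a + Z i b := by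
    intro i
    induction i with
    | zero => intro a b; simp [hZ0]
    | succ i ih => intro a b; rw [hZ, hZ, hZ, ih, map_add, map_add, neg_add]
  have hZUN : ∀ a ∈ A, ∀ i, Z i (N a) = -Z (i + 1) (U a) := by
    intro a ha i
    induction i with
    | zero => rw [hZ, hZ0, hZ0, hVU a ha, neg_neg]
    | succ i ih => rw [hZ, ih, map_neg, map_neg, neg_neg, hZ (i + 1), neg_neg]
  have hHT : ∀ a ∈ A, ∑' i, Z i (U a + N a) = a := by
    intro a ha
    have h1 := (hsum _ (hU a ha)).1
    have h2 := (hsum _ (hN a ha)).1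
    simp only [hZadd]
    rw [h1.tsum_add h2, h1.tsum_eq_zero_add, hZ0, hVU a ha]
    simp only [hZUN a ha]
    rw [tsum_neg, add_neg_cancel_right]
  have hH : ∀ b ∈ A, ∑' i, Z i b = V (b - N (∑' i, Z i b)) := by
    intro b hb
    have h1 := (hsum b hb).1
    have h2 : V (N (∑' i, Z i b)) = ∑' i, V (N (Z i b)) :=
      h1.map_tsum (V ∘ₗ N : Series p σ →ₗ[ℂ_[p]] Series p σ) hc
    rw [map_sub, h2]
    conv_lhs => rw [h1.tsum_eq_zero_add, hZ0]
    simp only [hZ]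
    rw [tsum_neg, sub_eq_add_neg]
  have hZe : ∀ a ∈ A, ∀ i, Z i (e a) = 0 := by
    intro a ha i
    induction i with
    | zero => rw [hZ0, hVe a ha]
    | succ i ih => rw [hZ, ih, map_zero, map_zero, neg_zero]
  have hdec : ∀ b ∈ A, ∃ n ∈ A, ∃ a ∈ A, b = e n + (U a + N a) := by
    intro b hb
    have hHA := (hsum b hb).2
    have hn : b - N (∑' i, Z i b) ∈ A := A.sub_mem hb (hN _ hHA)
    refine ⟨_, hn, _, hHA, ?_⟩
    have h1 : U (∑' i, Z i b) = _ := (congrArg U (hH b hb)).trans (hUV _ hn)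
    rw [h1]
    abel
  have hdisj : ∀ n ∈ A, ∀ a ∈ A, e n = U a + N a → e n = 0 := by
    intro n hn a ha h
    have h1 := hHT a ha
    rw [← h] at h1
    simp only [hZe n hn, tsum_zero] at h1
    rw [h, ← h1]; simp
  obtain ⟨ρ, h1, h2⟩ := exists_projector (N := A.map e) (B := A.map (U + N)) (by
    rw [Submodule.disjoint_def]
    rintro _ ⟨n, hn, rfl⟩ ⟨a, ha, h⟩
    exact hdisj n hn a ha h.symm)
  have h2' : ∀ a ∈ A, ρ (U a + N a) = 0 := fun a ha => h2 _ ⟨a, ha, rfl⟩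
  refine ⟨fun a ha h => ?_, ρ, fun a ha => h1 _ ⟨a, ha, rfl⟩, h2', fun b hb => ?_⟩
  · have h3 := hHT a ha
    rw [h] at h3
    have h4 : ∀ i, Z i (0 : Series p σ) = 0 := fun i => by simpa using hZadd i 0 0
    simpa [h4] using h3.symm
  · obtain ⟨n, hn, a, ha, h⟩ := hdec b hb
    exact ⟨n, hn, a, ha, h, by rw [h, map_add, h1 _ ⟨n, hn, rfl⟩, h2' a ha, add_zero]⟩

/-- A criterion for the convergence of a series of series to an overconvergent one. -/
theorem summable_and_tsum_mem_overconv [Fintype σ] {inv : Set σ} {z : ℕ → Series p σ}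
    (hreg : ∀ i I, ¬ IsRegularExp inv I → z i I = 0) {C r : ℝ} (hC : 0 ≤ C) (hr0 : 0 < r)
    (hr1 : r < 1) (h : ∀ i I, ‖z i I‖ ≤ C * r ^ (i + expSize I)) :
    Summable z ∧ ∑' i, z i ∈ overconv p inv := by
  have hs : Summable z := Pi.summable.2 fun I => by
    refine summable_nat_of_geometric_bound (C := C) hr0 hr1 fun i => (h i I).trans ?_
    exact mul_le_mul_of_nonneg_left
      (pow_le_pow_of_le_one hr0.le hr1.le (Nat.le_add_right _ _)) hC
  refine ⟨hs, mem_overconv.2 ⟨fun I hI => ?_, C, r, hC, hr0, hr1, fun I => ?_⟩⟩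
  · rw [tsum_apply hs]
    simp [hreg _ I hI]
  · rw [tsum_apply hs]
    refine IsUltrametricDist.norm_tsum_le_of_forall_le fun i => (h i I).trans ?_
    exact mul_le_mul_of_nonneg_left
      (pow_le_pow_of_le_one hr0.le hr1.le (Nat.le_add_left _ _)) hC

end Perturbation

/-! ### Bounds for products of Laurent polynomials -/

noncomputable section CoeffBounds

variable {p : ℕ} [Fact p.Prime] {σ τ : Type}

theorem exists_coeff_mul_le (f g : LPoly p σ) (I : σ → ℤ) (h : (f * g).coeff I ≠ 0) :
    ∃ J, f.coeff J ≠ 0 ∧ g.coeff (I - J) ≠ 0 ∧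
      ‖(f * g).coeff I‖ ≤ ‖f.coeff J‖ * ‖g.coeff (I - J)‖ := by
  rw [← polyMul_coeff] at h ⊢
  exact exists_norm_polyMul_le f _ I h

theorem norm_coeff_mul_le {f g : LPoly p σ} {c d : ℝ} (hc : 0 ≤ c) (hd : 0 ≤ d)
    (hf : ∀ I, ‖f.coeff I‖ ≤ c) (hg : ∀ I, ‖g.coeff I‖ ≤ d) (I : σ → ℤ) :
    ‖(f * g).coeff I‖ ≤ c * d := by
  by_cases h : (f * g).coeff I = 0
  · rw [h, norm_zero]; positivity
  · obtain ⟨J, -, -, hle⟩ := exists_coeff_mul_le f g I h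
    exact hle.trans (mul_le_mul (hf _) (hg _) (norm_nonneg _) hc)

theorem norm_coeff_one_le [DecidableEq (σ → ℤ)] (I : σ → ℤ) : ‖(1 : LPoly p σ).coeff I‖ ≤ 1 := by
  rw [AddMonoidAlgebra.one_def, AddMonoidAlgebra.coeff_single, Finsupp.single_apply]
  split_ifs <;> simp

theorem norm_coeff_pow_le {f : LPoly p σ} {c : ℝ} (hc : 0 ≤ c) (hf : ∀ I, ‖f.coeff I‖ ≤ c)
    (k : ℕ) (I : σ → ℤ) : ‖(f ^ k).coeff I‖ ≤ c ^ k := by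
  classical
  induction k generalizing I with
  | zero => simpa using norm_coeff_one_le I
  | succ k ih => rw [pow_succ, pow_succ]; exact norm_coeff_mul_le (by positivity) hc ih hf I

theorem expSize_le_of_coeff_mul_ne_zero [Fintype σ] {f g : LPoly p σ} {M N : ℕ}
    (hf : ∀ I, f.coeff I ≠ 0 → expSize I ≤ M) (hg : ∀ I, g.coeff I ≠ 0 → expSize I ≤ N)
    (I : σ → ℤ) (h : (f * g).coeff I ≠ 0) : expSize I ≤ M + N := by
  obtain ⟨J, h1, h2, -⟩ := exists_coeff_mul_le f g I h
  have h3 := expSize_le_sub_add I J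
  have h4 := hf _ h1
  have h5 := hg _ h2
  omega

theorem expSize_le_of_coeff_pow_ne_zero [Fintype σ] {f : LPoly p σ} {M : ℕ}
    (hf : ∀ I, f.coeff I ≠ 0 → expSize I ≤ M) (k : ℕ)
    (I : σ → ℤ) (h : (f ^ k).coeff I ≠ 0) : expSize I ≤ k * M := by
  classical
  induction k generalizing I with
  | zero =>
    rw [pow_zero, AddMonoidAlgebra.one_def, AddMonoidAlgebra.coeff_single,
      Finsupp.single_apply] at h
    split_ifs at h with h0
    · rw [← h0]; simp [expSize]
    · exact absurd rfl h
  | succ k ih =>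
    rw [pow_succ] at h
    have := expSize_le_of_coeff_mul_ne_zero ih hf I h
    rw [add_mul, one_mul]
    exact this

theorem exists_expSize_le [Fintype σ] (f : LPoly p σ) :
    ∃ M : ℕ, ∀ J, f.coeff J ≠ 0 → expSize J ≤ M :=
  ⟨f.coeff.support.sup expSize, fun _ hJ => Finset.le_sup (Finsupp.mem_support_iff.2 hJ)⟩

/-- The operator that shifts exponents by `v` and multiplies the coefficients by a function of the
exponent of one coordinate. -/
def diagShift (p : ℕ) [Fact p.Prime] {τ : Type} (t : τ) (φ : ℤ → ℂ_[p]) (v : τ → ℤ) :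
    Series p τ →ₗ[ℂ_[p]] Series p τ where
  toFun a := fun I => φ (I t) * a (I - v)
  map_add' a b := by funext I; simp [mul_add]
  map_smul' c a := by funext I; simp [mul_left_comm]

theorem diagShift_apply (t : τ) (φ : ℤ → ℂ_[p]) (v : τ → ℤ) (a : Series p τ) (I : τ → ℤ) :
    diagShift p t φ v a I = φ (I t) * a (I - v) := rfl

theorem continuous_diagShift (t : τ) (φ : ℤ → ℂ_[p]) (v : τ → ℤ) :
    Continuous (diagShift p t φ v : Series p τ → Series p τ) := by
  refine continuous_pi fun I => ?_
  simp only [diagShift_apply]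
  fun_prop

/-- The diagonal shift by functions of a coordinate commutes with the multiplication by Laurent
polynomials in the other coordinates. -/
theorem polyMul_diagShift {t : τ} {f : LPoly p τ} (hf : ∀ I, f.coeff I ≠ 0 → I t = 0)
    (φ : ℤ → ℂ_[p]) (v : τ → ℤ) (a : Series p τ) :
    polyMul f (diagShift p t φ v a) = diagShift p t φ v (polyMul f a) := by
  funext I
  rw [diagShift_apply, polyMul_apply, polyMul_apply, Finsupp.sum, Finsupp.sum, Finset.mul_sum]
  refine Finset.sum_congr rfl fun J hJ => ?_
  rw [diagShift_apply, Pi.sub_apply, hf J (Finsupp.mem_support_iff.1 hJ), sub_zero, sub_right_comm]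
  ring

end CoeffBounds

/-! ### The polar part along a coordinate, and residues -/

noncomputable section Residue

variable {p : ℕ} [Fact p.Prime] {τ : Type}

/-- The part of a series with negative exponents of the coordinate `t`. -/
def polarPart (p : ℕ) [Fact p.Prime] {τ : Type} (t : τ) : Series p τ →ₗ[ℂ_[p]] Series p τ :=
  diagShift p t (fun s => if s < 0 then 1 else 0) 0

theorem polarPart_apply (t : τ) (a : Series p τ) (I : τ → ℤ) :
    polarPart p t a I = if I t < 0 then a I else 0 := by
  simp [polarPart, diagShift_apply]

theorem polarPart_polarPart (t : τ) (a : Series p τ) :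
    polarPart p t (polarPart p t a) = polarPart p t a := by
  funext I
  simp only [polarPart_apply]
  split_ifs <;> rfl

theorem polarPart_eq_zero_iff {t : τ} {a : Series p τ} :
    polarPart p t a = 0 ↔ ∀ I, I t < 0 → a I = 0 := by
  constructor
  · intro h I hI
    have := congrFun h I
    rwa [polarPart_apply, if_pos hI] at this
  · intro h
    funext I
    rw [polarPart_apply]
    split_ifs with hI
    · exact h I hI
    · rfl

theorem polarPart_polyMul {t : τ} {f : LPoly p τ} (hf : ∀ I, f.coeff I ≠ 0 → 0 ≤ I t)
    {a : Series p τ} (ha : polarPart p t a = 0) : polarPart p t (polyMul f a) = 0 := by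
  rw [polarPart_eq_zero_iff] at ha ⊢
  intro I hI
  by_contra hne
  obtain ⟨J, hJ, haJ, -⟩ := exists_norm_polyMul_le f a I hne
  exact haJ (ha _ (by have := hf J hJ; simp only [Pi.sub_apply]; omega))

variable [DecidableEq τ]

theorem polarPart_seriesDeriv {t : τ} (k : τ) {a : Series p τ} (ha : polarPart p t a = 0) :
    polarPart p t (seriesDeriv k a) = 0 := by
  rw [polarPart_eq_zero_iff] at ha ⊢
  intro I hI
  rw [seriesDeriv_apply]
  rcases eq_or_ne k t with rfl | hk
  · by_cases h1 : I k = -1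
    · rw [h1]; simp
    · rw [ha, mul_zero]
      simp only [Pi.add_apply, Pi.single_eq_same]
      omega
  · rw [ha, mul_zero]
    simpa [Pi.single_eq_of_ne hk.symm] using hI

theorem coeff_pderiv_nonneg {t : τ} (k : τ) {f : LPoly p τ} (hf : ∀ I, f.coeff I ≠ 0 → 0 ≤ I t)
    (I : τ → ℤ) (hI : (LPoly.pderiv k f).coeff I ≠ 0) : 0 ≤ I t := by
  refine pderiv_mem_algFun (inv := {t}ᶜ) k (f := f) (fun J hJ j hj => ?_) I hI t (by simp)
  obtain rfl : j = t := by simpa using hj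
  exact hf J hJ

/-- The derivatives preserve series without polar part. -/
theorem polarPart_twistedDeriv {t : τ} {f : LPoly p τ} (hf : ∀ I, f.coeff I ≠ 0 → 0 ≤ I t) (k : τ)
    (a : Series p τ) :
    polarPart p t (twistedDeriv f k (polarPart p t a)) = polarPart p t (twistedDeriv f k a) := by
  have h : polarPart p t (a - polarPart p t a) = 0 := by rw [map_sub, polarPart_polarPart, sub_self]
  have h2 : polarPart p t (twistedDeriv f k (a - polarPart p t a)) = 0 := by
    rw [twistedDeriv_apply, map_add, polarPart_seriesDeriv k h,
      polarPart_polyMul (coeff_pderiv_nonneg k hf) h, add_zero]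
  rw [map_sub, map_sub, sub_eq_zero] at h2
  exact h2.symm

variable [Fintype τ]

theorem diagShift_mem_overconv {t : τ} {φ : ℤ → ℂ_[p]} {v : τ → ℤ} {inv : Set τ}
    (hv : ∀ j, j ∉ inv → v j = 0) {K : ℝ} (hφ : ∀ s, ‖φ s‖ ≤ K * (s.natAbs + 1)) {a : Series p τ}
    (ha : a ∈ overconv p inv) : diagShift p t φ v a ∈ overconv p inv := by
  refine overconv_of_le ha (fun I hI => ?_) |K| (expSize v + 1) fun I _ => ⟨I - v, ?_, ?_⟩
  · rw [diagShift_apply, ha.1 _ fun h => hI fun j hj => ?_, mul_zero]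
    simpa [hv j hj] using h j hj
  · have := expSize_le_sub_add I v
    nlinarith
  · rw [diagShift_apply, norm_mul]
    refine mul_le_mul_of_nonneg_right ((hφ _).trans ?_) (norm_nonneg _)
    have : ((I t).natAbs : ℝ) ≤ expSize I := by exact_mod_cast natAbs_le_expSize I t
    gcongr
    exact le_abs_self K

theorem polarPart_mem_overconv {t : τ} {inv : Set τ} {a : Series p τ}
    (ha : a ∈ overconv p inv) : polarPart p t a ∈ overconv p inv := by
  refine overconv_of_le ha (fun I hI => ?_) 1 1 fun I _ => ⟨I, by omega, ?_⟩
  · rw [polarPart_apply, ha.1 _ hI, ite_self]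
  · rw [polarPart_apply, one_mul]
    split_ifs
    · exact le_mul_of_one_le_left (norm_nonneg _) (by simp)
    · rw [norm_zero]; positivity

theorem mem_overconv_of_polarPart_eq_zero {t : τ} {inv : Set τ} {a : Series p τ}
    (ha : a ∈ overconv p (insert t inv)) (h : polarPart p t a = 0) : a ∈ overconv p inv := by
  refine ⟨fun I hI => ?_, ha.2⟩
  rw [polarPart_eq_zero_iff] at h
  by_cases hIt : I t < 0
  · exact h I hIt
  · refine ha.1 I fun h' => hI fun j hj => ?_
    rcases eq_or_ne j t with rfl | hjt
    · exact not_lt.1 hIt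
    · exact h' j (by simp [hjt, hj])

theorem polarPart_eq_zero_of_mem_overconv {t : τ} {inv : Set τ} (ht : t ∉ inv) {a : Series p τ}
    (ha : a ∈ overconv p inv) : polarPart p t a = 0 :=
  polarPart_eq_zero_iff.2 fun I hI => ha.1 I fun h => absurd (h t ht) (not_le.2 hI)

/-- The polar parts along `t` of the overconvergent series. -/
def polarSeries (p : ℕ) [Fact p.Prime] {τ : Type} [Fintype τ] (inv : Set τ) (t : τ) :
    Submodule ℂ_[p] (Series p τ) :=
  overconv p inv ⊓ LinearMap.ker (polarPart p t - LinearMap.id)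

theorem mem_polarSeries {inv : Set τ} {t : τ} {a : Series p τ} :
    a ∈ polarSeries p inv t ↔ a ∈ overconv p inv ∧ polarPart p t a = a := by
  rw [polarSeries, Submodule.mem_inf, LinearMap.mem_ker, LinearMap.sub_apply, sub_eq_zero]
  rfl

theorem polarPart_mem_polarSeries {t : τ} {inv : Set τ} {a : Series p τ}
    (ha : a ∈ overconv p inv) : polarPart p t a ∈ polarSeries p inv t :=
  mem_polarSeries.2 ⟨polarPart_mem_overconv ha, polarPart_polarPart t a⟩

/-- The coefficients of the `i`-fold integration `t ^ (s - i - 1) ↦ t ^ s` of polar parts, times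
`(-ϖ) ^ i`. -/
def polarCoeff (ϖ : ℂ_[p]) (i : ℕ) (s : ℤ) : ℂ_[p] :=
  if s < 0 then (-ϖ) ^ i * ∏ q ∈ range (i + 1), ((s - q : ℤ) : ℂ_[p])⁻¹ else 0

theorem polarCoeff_zero (ϖ : ℂ_[p]) (s : ℤ) :
    polarCoeff ϖ 0 s = if s < 0 then ((s : ℤ) : ℂ_[p])⁻¹ else 0 := by
  simp [polarCoeff]

theorem polarCoeff_succ (ϖ : ℂ_[p]) (i : ℕ) (s : ℤ) :
    polarCoeff ϖ (i + 1) s = -ϖ * (polarCoeff ϖ 0 s * polarCoeff ϖ i (s - 1)) := by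
  rw [polarCoeff_zero]
  unfold polarCoeff
  by_cases hs : s < 0
  · rw [if_pos hs, if_pos hs, if_pos (by omega), Finset.prod_range_succ', pow_succ]
    have : ∀ q : ℕ, (s - ((q + 1 : ℕ) : ℤ)) = (s - 1 - q) := fun q => by push_cast; ring
    simp only [this]
    push_cast
    rw [sub_zero]
    ring
  · rw [if_neg hs, if_neg hs]; ring

theorem prod_neg_sub_eq (k i : ℕ) :
    ‖∏ q ∈ range (i + 1), ((-((k : ℤ) + 1) - q : ℤ) : ℂ_[p])‖ * ‖(k.factorial : ℂ_[p])‖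
      = ‖((k + i + 1).factorial : ℂ_[p])‖ := by
  induction i with
  | zero =>
    rw [Finset.prod_range_one, ← norm_mul, Nat.add_zero, Nat.factorial_succ, ← norm_neg]
    congr 1
    push_cast
    ring
  | succ i ih =>
    rw [Finset.prod_range_succ, norm_mul, mul_right_comm, ih, ← norm_mul,
      show k + (i + 1) + 1 = (k + i + 1) + 1 by ring, Nat.factorial_succ (k + i + 1), ← norm_neg]
    congr 1
    push_cast
    ring

/-- For `s = -(k + 1)` the coefficient is `ϖ ^ i * k! / (k + i + 1)!` up to sign, and the factorials
are comparable to powers of `ϖ`. -/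
theorem norm_polarCoeff_le {ϖ : ℂ_[p]} (hϖ : ϖ ^ (p - 1) = -(p : ℂ_[p])) (i : ℕ) (s : ℤ) :
    ‖polarCoeff ϖ i s‖ ≤ p / ‖ϖ‖ * (s.natAbs + 1) := by
  have hϖ0 : 0 < ‖ϖ‖ := norm_pos_iff.2 (pi_ne_zero hϖ)
  unfold polarCoeff
  split_ifs with hs
  · obtain ⟨k, rfl⟩ : ∃ k : ℕ, s = -((k : ℤ) + 1) := ⟨(-s - 1).toNat, by omega⟩
    have hk : (k.factorial : ℂ_[p]) ≠ 0 := by exact_mod_cast k.factorial_ne_zero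
    have hf : ((k + i + 1).factorial : ℂ_[p]) ≠ 0 := by
      exact_mod_cast (k + i + 1).factorial_ne_zero
    have h1 := norm_factorial_div_pi_pow_le hϖ k
    have h2 := norm_pi_pow_div_factorial_le hϖ (k + i + 1)
    have h3 := prod_neg_sub_eq (p := p) k i
    have hk' : 0 < ‖(k.factorial : ℂ_[p])‖ := norm_pos_iff.2 hk
    have hf' : 0 < ‖((k + i + 1).factorial : ℂ_[p])‖ := norm_pos_iff.2 hf
    rw [Finset.prod_inv_distrib, norm_mul, norm_inv, norm_pow, norm_neg]
    have h4 : ‖∏ q ∈ range (i + 1), ((-((k : ℤ) + 1) - q : ℤ) : ℂ_[p])‖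
        = ‖((k + i + 1).factorial : ℂ_[p])‖ / ‖(k.factorial : ℂ_[p])‖ := by
      rw [eq_div_iff hk'.ne', h3]
    rw [h4]
    have h5 : ‖ϖ‖ ^ i * (‖((k + i + 1).factorial : ℂ_[p])‖ / ‖(k.factorial : ℂ_[p])‖)⁻¹
        = ‖ϖ ^ (k + i + 1) / ((k + i + 1).factorial : ℂ_[p])‖ *
          ‖(k.factorial : ℂ_[p]) / ϖ ^ k‖ / ‖ϖ‖ := by
      rw [norm_div, norm_div, norm_pow, norm_pow]
      field_simp
      ring
    rw [h5]
    have h6 : ((-((k : ℤ) + 1)).natAbs : ℝ) = k + 1 := by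
      have : (-((k : ℤ) + 1)).natAbs = k + 1 := by omega
      rw [this]; push_cast; ring
    rw [h6]
    calc _ ≤ 1 * (p * (k + 1 : ℝ)) / ‖ϖ‖ := by gcongr
      _ = p / ‖ϖ‖ * (k + 1) := by ring
      _ ≤ _ := by gcongr; linarith
  · rw [norm_zero]; positivity

end Residue

noncomputable section ResidueOperator

variable {p : ℕ} [Fact p.Prime] {σ τ : Type} [Fintype σ] [Fintype τ] [DecidableEq σ]
  [DecidableEq τ] {e : σ → τ} (he : e.Injective) {t : τ} (ht : t ∉ Set.range e)
  {inv : Set σ} {P : LPoly p σ} {ϖ : ℂ_[p]}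

theorem pderiv_coordFun (j k : τ) :
    LPoly.pderiv j (coordFun p k : LPoly p τ) = if j = k then 1 else 0 := by
  rw [coordFun, pderiv_single]
  split_ifs with h
  · subst h
    simp [AddMonoidAlgebra.one_def]
  · simp [Pi.single_eq_of_ne h]

theorem coordFun_mem_algFun (k : τ) (inv : Set τ) : coordFun p k ∈ algFun p inv := by
  intro I hI j hj
  rw [coordFun, AddMonoidAlgebra.coeff_single, Finsupp.single_apply] at hI
  split_ifs at hI with h
  · rw [← h]
    rcases eq_or_ne j k with rfl | hjk
    · simp
    · rw [Pi.single_eq_of_ne hjk]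
  · exact absurd rfl hI

theorem polyMul_coordFun (k : τ) (a : Series p τ) (I : τ → ℤ) :
    polyMul (coordFun p k) a I = a (I - Pi.single k 1) := by
  rw [coordFun, polyMul_single, one_mul]

/-- The function `ϖ P t`, where `t` is one more coordinate. -/
def timesCoord (ϖ : ℂ_[p]) (t : τ) (P : LPoly p σ) : LPoly p τ :=
  ϖ • (coordFun p t * extendHom p he P)

include ht in
theorem pderiv_timesCoord_self :
    LPoly.pderiv t (timesCoord he ϖ t P) = ϖ • extendHom p he P := by
  rw [timesCoord, pderiv_smul, pderiv_mul, pderiv_coordFun, if_pos rfl, one_mul,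
    pderiv_extendHom_of_notMem he ht, mul_zero, add_zero]

include ht in
theorem pderiv_timesCoord (j : σ) :
    LPoly.pderiv (e j) (timesCoord he ϖ t P) = timesCoord he ϖ t (LPoly.pderiv j P) := by
  rw [timesCoord, pderiv_smul, pderiv_mul, pderiv_coordFun, if_neg fun h => ht ⟨j, h⟩, zero_mul,
    pderiv_extendHom he, zero_add]
  rfl

theorem timesCoord_mem_algFun {inv' : Set τ} (hinv : ∀ j, j ∈ inv → e j ∈ inv')
    (hP : P ∈ algFun p inv) : timesCoord he ϖ t P ∈ algFun p inv' :=
  Subalgebra.smul_mem _ (Subalgebra.mul_mem _ (coordFun_mem_algFun t _)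
    (extendHom_mem_algFun he hinv hP)) _

include ht in
theorem coeff_extendHom_eq_zero (I : τ → ℤ) (hI : (extendHom p he P).coeff I ≠ 0) : I t = 0 := by
  by_contra h
  rw [coeff_extendHom, pullSeries_apply_of_ne _ ht h] at hI
  exact hI rfl

theorem norm_coeff_extendHom_le {c : ℝ} (hc : 0 ≤ c) (hP : ∀ I, ‖P.coeff I‖ ≤ c) (I : τ → ℤ) :
    ‖(extendHom p he P).coeff I‖ ≤ c := by
  rw [coeff_extendHom]
  by_cases h : ∀ k, k ∉ Set.range e → I k = 0
  · rw [pullSeries_apply_of_forall _ h]; exact hP _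
  · rw [show pullSeries p e (fun J => P.coeff J) I = 0 from if_neg h, norm_zero]; exact hc

include ht in
theorem coeff_extendHom_pow_eq_zero (i : ℕ) (I : τ → ℤ)
    (hI : (extendHom p he P ^ i).coeff I ≠ 0) : I t = 0 := by
  rw [← map_pow] at hI
  exact coeff_extendHom_eq_zero he ht I hI

theorem notMem_image (ht : t ∉ Set.range e) : t ∉ e '' inv :=
  fun ⟨j, _, h⟩ => ht ⟨j, h⟩

theorem coeff_timesCoord_nonneg (ht : t ∉ Set.range e) (I : τ → ℤ)
    (hI : (timesCoord he ϖ t P).coeff I ≠ 0) : 0 ≤ I t :=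
  timesCoord_mem_algFun he (inv := Set.univ) (inv' := e '' Set.univ)
    (fun _ hj => Set.mem_image_of_mem e hj) (fun _ _ _ hj => absurd (Set.mem_univ _) hj) I hI t
    (notMem_image ht)

/-- The projection to the terms of exponent `-1` in `t`. -/
def simplePole (p : ℕ) [Fact p.Prime] {τ : Type} (t : τ) : Series p τ →ₗ[ℂ_[p]] Series p τ :=
  diagShift p t (fun s => if s = -1 then 1 else 0) 0

theorem simplePole_apply (t : τ) (a : Series p τ) (I : τ → ℤ) :
    simplePole p t a I = if I t = -1 then a I else 0 := by
  simp [simplePole, diagShift_apply]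

/-- The `i`-th term of the geometric series that inverts `∂_t + ϖ Q` on polar parts: `i + 1`
integrations in `t`, and multiplication by `(-ϖ Q) ^ i`. -/
def polarIter (ϖ : ℂ_[p]) (t : τ) (Q : LPoly p τ) (i : ℕ) : Series p τ →ₗ[ℂ_[p]] Series p τ :=
  diagShift p t (polarCoeff ϖ i) (Pi.single t ((i : ℤ) + 1)) ∘ₗ polyMul (Q ^ i)

theorem polarIter_apply (ϖ : ℂ_[p]) (t : τ) (Q : LPoly p τ) (i : ℕ) (a : Series p τ) (I : τ → ℤ) :
    polarIter ϖ t Q i a I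
      = polarCoeff ϖ i (I t) * polyMul (Q ^ i) a (I - Pi.single t ((i : ℤ) + 1)) := rfl

theorem continuous_polarPart (t : τ) :
    Continuous (polarPart p t : Series p τ → Series p τ) := continuous_diagShift _ _ _

theorem polarIter_mem_overconv (hϖ : ϖ ^ (p - 1) = -(p : ℂ_[p])) {inv' : Set τ} {Q : LPoly p τ}
    (hQ : Q ∈ algFun p (insert t inv')) (i : ℕ) {b : Series p τ}
    (hb : b ∈ overconv p (insert t inv')) : polarIter ϖ t Q i b ∈ overconv p (insert t inv') := by
  have h1 : polyMul (Q ^ i) b ∈ overconv p (insert t inv') :=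
    polyMul_mem_overconv (Subalgebra.pow_mem _ hQ i) hb
  rw [polarIter, LinearMap.comp_apply]
  refine diagShift_mem_overconv (fun j hj => ?_) (K := p / ‖ϖ‖)
    (fun s => norm_polarCoeff_le hϖ i s) h1
  have hjt : j ≠ t := by
    rintro rfl
    exact hj (Set.mem_insert _ _)
  exact Pi.single_eq_of_ne hjt _

include ht in
/-- The terms of the geometric series on polar parts decay geometrically: the integrations divide by
factorials that the powers of `ϖ` compensate, and each of them lowers the order of the pole, so that
the `i`-th term only involves coefficients of `b` of size larger than `i`. -/
theorem exists_norm_polarIter_le (hϖ : ϖ ^ (p - 1) = -(p : ℂ_[p]))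
    (hint : ∀ I, ‖P.coeff I‖ ≤ 1) {b : Series p τ} {inv' : Set τ} (hb : b ∈ overconv p inv') :
    ∃ D s : ℝ, 0 ≤ D ∧ 0 < s ∧ s < 1 ∧ ∀ i I,
      ‖polarIter ϖ t (extendHom p he P) i b I‖ ≤ D * s ^ (i + expSize I) := by
  obtain ⟨-, C, r, hC, hr0, hr1, hbd⟩ := mem_overconv.1 hb
  obtain ⟨M, hM⟩ := exists_expSize_le (extendHom p he P)
  have hϖ0 : 0 < ‖ϖ‖ := norm_pos_iff.2 (pi_ne_zero hϖ)
  obtain ⟨D, s, hD, hs0, hs1, hs⟩ := exists_geometric_bound hr0 hr1 (p / ‖ϖ‖ * C) (M + 3)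
  refine ⟨D, s, hD, hs0, hs1, fun i I => ?_⟩
  rw [polarIter_apply]
  by_cases hIt : I t < 0
  swap
  · rw [polarCoeff, if_neg hIt, zero_mul, norm_zero]; positivity
  by_cases h0 : polyMul (extendHom p he P ^ i) b (I - Pi.single t ((i : ℤ) + 1)) = 0
  · rw [h0, mul_zero, norm_zero]; positivity
  -- `J` is an exponent of `P ^ i`, so its size is at most `M * i` and it does not involve `t`.
  obtain ⟨J, hJ, hbJ, hle⟩ := exists_norm_polyMul_le _ b _ h0
  have hJ1 : ‖(extendHom p he P ^ i).coeff J‖ ≤ 1 := by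
    have := norm_coeff_pow_le zero_le_one (norm_coeff_extendHom_le he zero_le_one hint) i J
    rwa [one_pow] at this
  have hJM := expSize_le_of_coeff_pow_ne_zero hM i J hJ
  have hJt := coeff_extendHom_pow_eq_zero he ht i J hJ
  -- The exponent of `b` that contributes has a pole of order larger than `i` in `t`, so that its
  -- size `q` is larger than `i`.
  obtain ⟨q, hq⟩ : ∃ q, expSize (I - Pi.single t ((i : ℤ) + 1) - J) = q := ⟨_, rfl⟩
  have hqi : i + 1 ≤ q := by
    have := natAbs_le_expSize (I - Pi.single t ((i : ℤ) + 1) - J) t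
    simp only [Pi.sub_apply, Pi.single_eq_same, hJt] at this
    omega
  have hIq : i + expSize I ≤ (M + 3) * (q + 1) := by
    have h1 := expSize_le_sub_add (I - Pi.single t ((i : ℤ) + 1)) J
    have h2 := expSize_le_sub_add I (Pi.single t ((i : ℤ) + 1))
    rw [expSize_single] at h2
    have h3 : ((i : ℤ) + 1).natAbs = i + 1 := by omega
    have h4 : i * M ≤ q * M := Nat.mul_le_mul_right _ (by omega)
    rw [add_mul, mul_add, mul_one, mul_comm M q]
    omega
  have hN : ((I t).natAbs : ℝ) + 1 ≤ ((i + expSize I : ℕ) : ℝ) + 1 := by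
    have := natAbs_le_expSize I t
    have h2 : (I t).natAbs ≤ i + expSize I := by omega
    have h3 : ((I t).natAbs : ℝ) ≤ ((i + expSize I : ℕ) : ℝ) := by exact_mod_cast h2
    linarith
  have hb' := hbd (I - Pi.single t ((i : ℤ) + 1) - J)
  rw [hq] at hb'
  rw [norm_mul]
  have h1 : ‖polarCoeff ϖ i (I t)‖ ≤ p / ‖ϖ‖ * (((i + expSize I : ℕ) : ℝ) + 1) :=
    (norm_polarCoeff_le hϖ i _).trans (mul_le_mul_of_nonneg_left hN (by positivity))
  have h2 := hle.trans (mul_le_mul hJ1 hb' (norm_nonneg _) zero_le_one)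
  refine (mul_le_mul h1 h2 (norm_nonneg _) (by positivity)).trans
    (le_trans (le_of_eq ?_) (hs _ _ hIq))
  ring

include ht in
theorem summable_polar (hϖ : ϖ ^ (p - 1) = -(p : ℂ_[p])) (hP : P ∈ algFun p inv)
    (hint : ∀ I, ‖P.coeff I‖ ≤ 1) {b : Series p τ}
    (hb : b ∈ polarSeries p (insert t (e '' inv)) t) :
    Summable (fun i : ℕ => polarIter ϖ t (extendHom p he P) i b) ∧
    ∑' i : ℕ, polarIter ϖ t (extendHom p he P) i b ∈ polarSeries p (insert t (e '' inv)) t := by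
  have hQ : extendHom p he P ∈ algFun p (insert t (e '' inv)) :=
    extendHom_mem_algFun he (fun j hj => Set.mem_insert_of_mem _ (Set.mem_image_of_mem e hj)) hP
  have hb1 := (mem_polarSeries.1 hb).1
  obtain ⟨D, s, hD, hs0, hs1, hbd⟩ := exists_norm_polarIter_le he ht hϖ hint hb1
  have hz := summable_and_tsum_mem_overconv (z := fun i => polarIter ϖ t (extendHom p he P) i b)
    (fun i I hI => (polarIter_mem_overconv hϖ hQ i hb1).1 I hI) hD hs0 hs1 hbd
  refine ⟨hz.1, mem_polarSeries.2 ⟨hz.2, ?_⟩⟩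
  funext I
  rw [polarPart_apply]
  split_ifs with hI
  · rfl
  · rw [tsum_apply hz.1]
    simp [polarIter_apply, polarCoeff, hI]

include ht in
/-- The operators on polar parts: `∂_t + ϖ P` is injective, with the terms in `t⁻¹` as a complement
of its image. -/
theorem exists_projector_polar (hϖ : ϖ ^ (p - 1) = -(p : ℂ_[p])) (hP : P ∈ algFun p inv)
    (hint : ∀ I, ‖P.coeff I‖ ≤ 1) :
    (∀ a ∈ polarSeries p (insert t (e '' inv)) t,
      polarPart p t (twistedDeriv (timesCoord he ϖ t P) t a) = 0 → a = 0) ∧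
    ∃ ρ : Series p τ →ₗ[ℂ_[p]] Series p τ,
      (∀ a ∈ polarSeries p (insert t (e '' inv)) t, ρ (simplePole p t a) = simplePole p t a) ∧
      (∀ a ∈ polarSeries p (insert t (e '' inv)) t,
        ρ (polarPart p t (twistedDeriv (timesCoord he ϖ t P) t a)) = 0) ∧
      ∀ b ∈ polarSeries p (insert t (e '' inv)) t,
        ∃ n ∈ polarSeries p (insert t (e '' inv)) t,
        ∃ a ∈ polarSeries p (insert t (e '' inv)) t,
          b = simplePole p t n + polarPart p t (twistedDeriv (timesCoord he ϖ t P) t a) ∧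
          ρ b = simplePole p t n := by
  set A := polarSeries p (insert t (e '' inv)) t with hA
  set Q := extendHom p he P with hQ
  have hQalg : Q ∈ algFun p (insert t (e '' inv)) :=
    extendHom_mem_algFun he (fun j hj => Set.mem_insert_of_mem _ (Set.mem_image_of_mem e hj)) hP
  have hQt : ∀ i I, (Q ^ i).coeff I ≠ 0 → I t = 0 := coeff_extendHom_pow_eq_zero he ht
  have hQt' : ∀ I, Q.coeff I ≠ 0 → I t = 0 := coeff_extendHom_eq_zero he ht
  have hsplit : ∀ a, polarPart p t (twistedDeriv (timesCoord he ϖ t P) t a)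
      = (polarPart p t ∘ₗ seriesDeriv t) a + (polarPart p t ∘ₗ polyMul (ϖ • Q)) a := by
    intro a
    rw [twistedDeriv_apply, pderiv_timesCoord_self he ht, map_add]; rfl
  simp only [hsplit]
  -- Integration in `t` inverts `∂_t` on polar parts up to the terms in `t⁻¹`, and multiplication by
  -- `ϖ P` is the perturbation.
  refine exists_projector_of_perturbation (A := A) (U := polarPart p t ∘ₗ seriesDeriv t)
    (N := polarPart p t ∘ₗ polyMul (ϖ • Q))
    (V := diagShift p t (polarCoeff ϖ 0) (Pi.single t 1)) (e := simplePole p t)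
    (Z := fun i => polarIter ϖ t Q i)
    ?_ ?_ ?_ ?_ ?_ ?_ ?_ ?_ ?_
  · simp only [LinearMap.coe_comp]
    exact (continuous_diagShift _ _ _).comp ((continuous_polarPart t).comp
      (continuous_polyMul _))
  · intro a ha
    exact polarPart_mem_polarSeries (seriesDeriv_mem_overconv t (mem_polarSeries.1 ha).1)
  · intro a ha
    exact polarPart_mem_polarSeries (polyMul_mem_overconv (Subalgebra.smul_mem _ hQalg _)
      (mem_polarSeries.1 ha).1)
  · intro a ha
    funext I
    rw [diagShift_apply, LinearMap.comp_apply, polarPart_apply, seriesDeriv_apply, polarCoeff_zero,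
      sub_add_cancel]
    by_cases hI : I t < 0
    · have h0 : (I t : ℂ_[p]) ≠ 0 := by exact_mod_cast hI.ne
      rw [if_pos hI, if_pos (by simp; omega)]
      simp only [Pi.sub_apply, Pi.single_eq_same]
      push_cast
      field_simp
      ring
    · rw [if_neg hI, zero_mul, ← (mem_polarSeries.1 ha).2, polarPart_apply, if_neg hI]
  · intro a ha
    funext I
    rw [LinearMap.comp_apply, polarPart_apply, seriesDeriv_apply, diagShift_apply, polarCoeff_zero,
      Pi.sub_apply, simplePole_apply, add_sub_cancel_right]
    simp only [Pi.add_apply, Pi.single_eq_same]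
    by_cases hI : I t < 0
    · rw [if_pos hI]
      by_cases h1 : I t = -1
      · rw [if_pos h1, h1]; simp
      · have h0 : (I t : ℂ_[p]) + 1 ≠ 0 := by
          have : (I t + 1 : ℤ) ≠ 0 := by omega
          exact_mod_cast this
        rw [if_neg h1, if_pos (by omega)]
        push_cast
        field_simp
        ring
    · rw [if_neg hI, if_neg (by omega), ← (mem_polarSeries.1 ha).2, polarPart_apply, if_neg hI,
        sub_zero]
  · intro a ha
    funext I
    rw [diagShift_apply, simplePole_apply, polarCoeff_zero]
    by_cases hI : I t < 0
    · have h1 : ¬ ((I - (Pi.single t 1 : τ → ℤ)) t = -1) := by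
        simp only [Pi.sub_apply, Pi.single_eq_same]; omega
      rw [if_neg h1, mul_zero]; rfl
    · rw [if_neg hI, zero_mul]; rfl
  · intro a
    funext I
    simp [polarIter_apply, diagShift_apply]
  · intro i a
    simp only [LinearMap.comp_apply]
    rw [show polarIter ϖ t Q i a = diagShift p t (polarCoeff ϖ i) (Pi.single t ((i : ℤ) + 1))
      (polyMul (Q ^ i) a) from rfl, polyMul_smul, LinearMap.smul_apply, polyMul_diagShift hQt',
      ← polyMul_mul, ← pow_succ']
    funext I
    rw [polarIter_apply, polarCoeff_succ, Pi.neg_apply, diagShift_apply, polarPart_apply,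
      Pi.smul_apply, diagShift_apply]
    by_cases hI : I t < 0
    · rw [if_pos (by simp; omega)]
      simp only [Pi.sub_apply, Pi.single_eq_same, smul_eq_mul]
      rw [show I - Pi.single t (((i + 1 : ℕ) : ℤ) + 1)
        = I - Pi.single t 1 - Pi.single t ((i : ℤ) + 1) by
          rw [sub_sub, ← Pi.single_add]; congr 2; push_cast; ring]
      ring
    · rw [polarCoeff_zero, if_neg hI]; ring
  · exact fun b hb => summable_polar he ht hϖ hP hint hb

/-- The series `t⁻¹ a`, where `t` is one more coordinate. -/
def invCoordPull (p : ℕ) [Fact p.Prime] {σ τ : Type} [DecidableEq τ] (e : σ → τ) (t : τ) :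
    Series p σ →ₗ[ℂ_[p]] Series p τ :=
  polyMul (AddMonoidAlgebra.single (-Pi.single t 1) 1) ∘ₗ pullSeries p e

theorem invCoordPull_apply (a : Series p σ) (I : τ → ℤ) :
    invCoordPull p e t a I = pullSeries p e a (I + Pi.single t 1) := by
  rw [invCoordPull, LinearMap.comp_apply, polyMul_single, one_mul, sub_neg_eq_add]

include ht in
theorem invCoordPull_apply_of_ne (a : Series p σ) {I : τ → ℤ} (hI : I t ≠ -1) :
    invCoordPull p e t a I = 0 := by
  rw [invCoordPull_apply, pullSeries_apply_of_ne _ ht]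
  simp only [Pi.add_apply, Pi.single_eq_same]
  omega

theorem polyMul_coordFun_invCoordPull (a : Series p σ) :
    polyMul (coordFun p t) (invCoordPull p e t a) = pullSeries p e a := by
  rw [invCoordPull, LinearMap.comp_apply, ← polyMul_mul, coordFun,
    AddMonoidAlgebra.single_mul_single, add_neg_cancel, one_mul, ← AddMonoidAlgebra.one_def,
    polyMul_one]

include ht in
theorem simplePole_invCoordPull (a : Series p σ) :
    simplePole p t (invCoordPull p e t a) = invCoordPull p e t a := by
  funext I
  rw [simplePole_apply]
  split_ifs with h
  · rfl
  · rw [invCoordPull_apply_of_ne ht a h]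

include ht in
theorem polarPart_invCoordPull (a : Series p σ) :
    polarPart p t (invCoordPull p e t a) = invCoordPull p e t a := by
  funext I
  rw [polarPart_apply]
  split_ifs with h
  · rfl
  · rw [invCoordPull_apply_of_ne ht a (by omega)]

include he in
theorem invCoordPull_mem_overconv {a : Series p σ} (ha : a ∈ overconv p inv) :
    invCoordPull p e t a ∈ overconv p (insert t (e '' inv)) := by
  refine polyMul_mem_overconv (fun I hI j hj => ?_) (pullSeries_mem_overconv he
    (fun j hj => Set.mem_insert_of_mem _ (Set.mem_image_of_mem e hj)) ha)
  rw [AddMonoidAlgebra.coeff_single, Finsupp.single_apply] at hI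
  split_ifs at hI with h
  · rw [← h, Pi.neg_apply, Pi.single_eq_of_ne (by rintro rfl; exact hj (Set.mem_insert _ _)),
      neg_zero]
  · exact absurd rfl hI

/-- The coefficient of `t⁻¹`. -/
def invCoeff (p : ℕ) [Fact p.Prime] {σ τ : Type} [DecidableEq τ] (e : σ → τ) (t : τ) :
    Series p τ →ₗ[ℂ_[p]] Series p σ := restrSeries p e ∘ₗ polyMul (coordFun p t)

include he in
theorem invCoeff_mem_overconv (ht : t ∉ Set.range e) {a : Series p τ}
    (ha : a ∈ overconv p (insert t (e '' inv))) : invCoeff p e t a ∈ overconv p inv := by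
  refine restrSeries_mem_overconv he (fun j hj => ?_)
    (polyMul_mem_overconv (coordFun_mem_algFun t _) ha)
  rcases hj with rfl | ⟨i, hi, hij⟩
  · exact absurd ⟨j, rfl⟩ ht
  · rwa [← he hij]

include he in
theorem invCoeff_invCoordPull (a : Series p σ) : invCoeff p e t (invCoordPull p e t a) = a := by
  rw [invCoeff, LinearMap.comp_apply, polyMul_coordFun_invCoordPull, restrSeries_pullSeries he]

include he in
theorem simplePole_eq_invCoordPull (hcov : ∀ k, k = t ∨ k ∈ Set.range e) (ht : t ∉ Set.range e)
    (a : Series p τ) :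
    simplePole p t a = invCoordPull p e t (invCoeff p e t (simplePole p t a)) := by
  funext I
  by_cases hI : I t = -1
  · have h : ∀ k, k ∉ Set.range e → (I + (Pi.single t 1 : τ → ℤ)) k = 0 := by
      intro k hk
      obtain rfl := (hcov k).resolve_right hk
      simp [hI]
    rw [invCoordPull_apply, pullSeries_apply_of_forall _ h, invCoeff, LinearMap.comp_apply,
      restrSeries_apply, extend_comp_of_forall he h, polyMul_coordFun, add_sub_cancel_right]
  · rw [invCoordPull_apply_of_ne ht _ hI, simplePole_apply, if_neg hI]

include ht in
/-- On terms in `t⁻¹`, the polar part of `∂_j + t ϖ (∂_j P)` is `∂_j`. -/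
theorem polarPart_twistedDeriv_invCoordPull (j : σ) (a : Series p σ) :
    polarPart p t (twistedDeriv (timesCoord he ϖ t P) (e j) (invCoordPull p e t a))
      = invCoordPull p e t (seriesDeriv j a) := by
  have h1 : seriesDeriv (e j) (invCoordPull p e t a) = invCoordPull p e t (seriesDeriv j a) := by
    rw [invCoordPull, LinearMap.comp_apply, LinearMap.comp_apply, seriesDeriv_polyMul,
      seriesDeriv_pullSeries he, pderiv_single]
    have h2 : e j ≠ t := fun h => ht ⟨j, h⟩
    simp [Pi.single_eq_of_ne h2]
  have h2 : polarPart p t (polyMul (timesCoord he ϖ t (LPoly.pderiv j P)) (invCoordPull p e t a))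
      = 0 := by
    rw [timesCoord, polyMul_smul, LinearMap.smul_apply, mul_comm, polyMul_mul,
      polyMul_coordFun_invCoordPull, polyMul_pullSeries, map_smul]
    convert smul_zero ϖ
    refine polarPart_eq_zero_iff.2 fun I hI => pullSeries_apply_of_ne _ ht hI.ne
  rw [twistedDeriv_apply, pderiv_timesCoord he ht, map_add, h2, add_zero, h1,
    polarPart_invCoordPull ht]

include ht in
/-- The residue along `t` of `e ^ (ϖ P t)` times a series, as an operator. -/
theorem exists_residue (hcov : ∀ k, k = t ∨ k ∈ Set.range e)
    (hϖ : ϖ ^ (p - 1) = -(p : ℂ_[p])) (hP : P ∈ algFun p inv)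
    (hint : ∀ I, ‖P.coeff I‖ ≤ 1) :
    ∃ R : Series p τ →ₗ[ℂ_[p]] Series p σ,
      (∀ a ∈ overconv p (insert t (e '' inv)), R a ∈ overconv p inv) ∧
      (∀ a, polarPart p t a = 0 → R a = 0) ∧
      (∀ a ∈ overconv p inv, R (invCoordPull p e t a) = a) ∧
      (∀ a ∈ overconv p (insert t (e '' inv)), R (twistedDeriv (timesCoord he ϖ t P) t a) = 0) ∧
      (∀ a ∈ overconv p (insert t (e '' inv)), ∀ j,
        R (twistedDeriv (timesCoord he ϖ t P) (e j) a) = twistedDeriv 0 j (R a)) ∧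
      (∀ a ∈ overconv p (insert t (e '' inv)), R a = 0 →
        ∃ b ∈ polarSeries p (insert t (e '' inv)) t,
          polarPart p t (twistedDeriv (timesCoord he ϖ t P) t b) = polarPart p t a) := by
  obtain ⟨-, ρ, h1, h2, h3⟩ := exists_projector_polar he ht hϖ hP hint
  have hf := coeff_timesCoord_nonneg (ϖ := ϖ) (P := P) he ht
  have hfalg : timesCoord he ϖ t P ∈ algFun p (insert t (e '' inv)) :=
    timesCoord_mem_algFun he (fun j hj => Set.mem_insert_of_mem _ (Set.mem_image_of_mem e hj)) hP
  have hdec : ∀ a ∈ overconv p (insert t (e '' inv)), ∃ n ∈ overconv p inv,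
      ∃ b ∈ polarSeries p (insert t (e '' inv)) t, polarPart p t a
        = invCoordPull p e t n + polarPart p t (twistedDeriv (timesCoord he ϖ t P) t b) ∧
        ρ (polarPart p t a) = invCoordPull p e t n := by
    intro a ha
    obtain ⟨n, hn, b, hb, h4, h5⟩ := h3 _ (polarPart_mem_polarSeries ha)
    have h6 : simplePole p t n ∈ overconv p (insert t (e '' inv)) :=
      diagShift_mem_overconv (K := 1) (fun _ _ => rfl)
        (fun s => by split_ifs <;> simp; positivity) (mem_polarSeries.1 hn).1
    refine ⟨_, invCoeff_mem_overconv he ht h6, b, hb, ?_, ?_⟩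
    · rw [← simplePole_eq_invCoordPull he hcov ht]; exact h4
    · rw [← simplePole_eq_invCoordPull he hcov ht]; exact h5
  have hρ : ∀ a ∈ overconv p inv, ρ (invCoordPull p e t a) = invCoordPull p e t a := by
    intro a ha
    have := h1 _ (mem_polarSeries.2 ⟨invCoordPull_mem_overconv he ha, polarPart_invCoordPull ht a⟩)
    rwa [simplePole_invCoordPull ht] at this
  -- Project to the terms in `t⁻¹` along the image of `∂_t + ϖ P`, and take the coefficient of
  -- `t⁻¹`.
  refine ⟨invCoeff p e t ∘ₗ ρ ∘ₗ polarPart p t, ?_, ?_, ?_, ?_, ?_, ?_⟩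
  · intro a ha
    obtain ⟨n, hn, b, hb, -, h5⟩ := hdec a ha
    simp only [LinearMap.comp_apply]
    rw [h5, invCoeff_invCoordPull he]
    exact hn
  · intro a ha
    simp [ha]
  · intro a ha
    simp only [LinearMap.comp_apply]
    rw [polarPart_invCoordPull ht, hρ a ha, invCoeff_invCoordPull he]
  · intro a ha
    simp only [LinearMap.comp_apply]
    rw [← polarPart_twistedDeriv hf, h2 _ (polarPart_mem_polarSeries ha), map_zero]
  · intro a ha j
    obtain ⟨n, hn, b, hb, h4, h5⟩ := hdec a ha
    have hb1 := (mem_polarSeries.1 hb).1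
    simp only [LinearMap.comp_apply]
    rw [h5, ← polarPart_twistedDeriv hf, h4, map_add, map_add,
      polarPart_twistedDeriv_invCoordPull he ht, polarPart_twistedDeriv hf, twistedDeriv_comm,
      ← polarPart_twistedDeriv hf, map_add, h2 _ (polarPart_mem_polarSeries
        (twistedDeriv_mem_overconv hfalg _ hb1)), hρ _ (seriesDeriv_mem_overconv j hn), add_zero,
      invCoeff_invCoordPull he, invCoeff_invCoordPull he]
    simp [twistedDeriv_apply]
  · intro a ha h
    obtain ⟨n, hn, b, hb, h4, h5⟩ := hdec a ha
    simp only [LinearMap.comp_apply] at h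
    rw [h5, invCoeff_invCoordPull he] at h
    exact ⟨b, hb, by rw [h4, h, map_zero, zero_add]⟩

end ResidueOperator

/-! ### Pull-back and restriction of Koszul complexes -/

noncomputable section PullKoszul

variable {p : ℕ} [Fact p.Prime] {σ τ : Type} [Fintype σ] [LinearOrder σ] [Fintype τ]
  [LinearOrder τ] {e : σ → τ} {T : τ → Series p τ →ₗ[ℂ_[p]] Series p τ}
  {T' : σ → Series p σ →ₗ[ℂ_[p]] Series p σ}

theorem restrWith_koszulD (he : StrictMono e) {R : Series p τ →ₗ[ℂ_[p]] Series p σ}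
    {A : Submodule ℂ_[p] (Series p τ)} (hR : ∀ a ∈ A, ∀ j, R (T (e j) a) = T' j (R a)) {k : ℤ}
    {Ω : Forms p τ} (hΩ : Ω ∈ formsIn A k) :
    restrWith e R (koszulD T Ω) = koszulD T' (restrWith e R Ω) := by
  rw [koszulD_apply, koszulD_apply, map_sum]
  refine (Fintype.sum_of_injective e he.injective _ _ (fun k hk => ?_) fun j => ?_).symm
  · rw [restrWith_wedge_of_notMem hk]
  · rw [restrWith_wedge he]
    congr 1
    funext S
    exact (hR _ (hΩ _).1 j).symm

open scoped Classical in
/-- The differential of a form `pullWith e G ω`, where `G` commutes with the operators up to the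
errors `E j`. -/
theorem koszulD_pullWith_add (he : StrictMono e) {G : Series p σ →ₗ[ℂ_[p]] Series p τ}
    {E : σ → Series p σ →ₗ[ℂ_[p]] Series p τ} {A : Submodule ℂ_[p] (Series p σ)}
    (hG : ∀ a ∈ A, ∀ j, T (e j) (G a) = G (T' j a) + E j a) {k : ℤ}
    {ω : Forms p σ} (hω : ω ∈ formsIn A k) :
    koszulD T (pullWith e G ω) = pullWith e G (koszulD T' ω) +
      ∑ j, wedge p (e j) (pullWith e (E j) ω) +
      ∑ k with k ∉ Set.range e, wedge p k (coeffwise (T k) (pullWith e G ω)) := by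
  rw [koszulD_apply, koszulD_apply, map_sum, ← Finset.sum_add_distrib,
    ← Finset.sum_filter_add_sum_filter_not univ (fun k => k ∈ Set.range e)]
  congr 1
  rw [Finset.sum_filter]
  refine (Fintype.sum_of_injective e he.injective _ _ (fun k hk => if_neg hk) fun j => ?_).symm
  rw [if_pos ⟨j, rfl⟩, pullWith_wedge he, ← map_add]
  congr 1
  funext S
  simp only [LinearMap.compLeft_apply, Function.comp_apply, pullWith_apply, Pi.add_apply]
  split_ifs
  · exact (hG _ (hω _).1 j).symm
  · rw [map_zero, add_zero]

open scoped Classical in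
theorem koszulD_pullWith (he : StrictMono e) {G : Series p σ →ₗ[ℂ_[p]] Series p τ}
    {A : Submodule ℂ_[p] (Series p σ)} (hG : ∀ a ∈ A, ∀ j, T (e j) (G a) = G (T' j a)) {k : ℤ}
    {ω : Forms p σ} (hω : ω ∈ formsIn A k) :
    koszulD T (pullWith e G ω) = pullWith e G (koszulD T' ω) +
      ∑ k with k ∉ Set.range e, wedge p k (coeffwise (T k) (pullWith e G ω)) := by
  rw [koszulD_pullWith_add (T' := T') (E := fun _ => 0) he
    (fun a ha j => by rw [hG a ha j, LinearMap.zero_apply, add_zero]) hω, add_left_inj, add_eq_left]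
  exact Finset.sum_eq_zero fun j _ => by rw [pullWith_zero, map_zero]

end PullKoszul

/-! ### The residue sequence -/

noncomputable section ResidueSequence

variable {p : ℕ} [Fact p.Prime] {σ τ : Type} [Fintype σ] [LinearOrder σ] [Fintype τ]
  [LinearOrder τ] {e : σ → τ} {t : τ} {inv : Set σ} {P : LPoly p σ} {ϖ : ℂ_[p]}

theorem coeffwise_koszulD {T : τ → Series p τ →ₗ[ℂ_[p]] Series p τ}
    (N : Series p τ →ₗ[ℂ_[p]] Series p τ) (ω : Forms p τ) :
    coeffwise N (koszulD T ω) = koszulD (fun k => N ∘ₗ T k) ω := by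
  rw [koszulD_apply, koszulD_apply, map_sum]
  exact Finset.sum_congr rfl fun k _ => coeffwise_wedge _ _ _

theorem mem_formsOfDeg_of_polarPart {k : ℤ} {ω : Forms p τ} {inv' : Set τ}
    (hω : ω ∈ formsOfDeg p (insert t inv') k) (h : coeffwise (polarPart p t) ω = 0) :
    ω ∈ formsOfDeg p inv' k := fun S =>
  ⟨mem_overconv_of_polarPart_eq_zero (hω S).1 (congrFun h S), (hω S).2⟩

theorem formsOfDeg_mono {k : ℤ} {inv' inv'' : Set τ} (h : inv' ⊆ inv'') :
    formsOfDeg p inv' k ≤ formsOfDeg p inv'' k := fun _ hω S =>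
  ⟨overconv_mono h (hω S).1, (hω S).2⟩

/-- The residue of forms along `t = 0` in the complex of `e ^ (ϖ P t)`, and its section
`η ↦ t⁻¹ dt η`. The last property says that forms with a pole and without residue are regular
up to exact forms. -/
theorem exists_residue_forms (he : StrictMono e) (ht : t ∉ Set.range e)
    (hcov : ∀ k, k = t ∨ k ∈ Set.range e) (hϖ : ϖ ^ (p - 1) = -(p : ℂ_[p]))
    (hP : P ∈ algFun p inv) (hint : ∀ I, ‖P.coeff I‖ ≤ 1) :
    ∃ (Res : Forms p τ →ₗ[ℂ_[p]] Forms p σ) (S : Forms p σ →ₗ[ℂ_[p]] Forms p τ),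
      (∀ k, ∀ ω ∈ formsOfDeg p (insert t (e '' inv)) (k + 1), Res ω ∈ formsOfDeg p inv k) ∧
      (∀ k, ∀ ω ∈ formsOfDeg p (e '' inv) k, Res ω = 0) ∧
      (∀ k, ∀ ω ∈ formsOfDeg p (insert t (e '' inv)) k,
        Res (deRhamD (timesCoord he.injective ϖ t P) ω) = -deRhamD 0 (Res ω)) ∧
      (∀ k, ∀ η ∈ formsOfDeg p inv k, S η ∈ formsOfDeg p (insert t (e '' inv)) (k + 1)) ∧
      (∀ k, ∀ η ∈ formsOfDeg p inv k, Res (S η) = η) ∧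
      (∀ k, ∀ η ∈ formsOfDeg p inv k,
        deRhamD (timesCoord he.injective ϖ t P) (S η) + S (deRhamD 0 η)
          ∈ formsOfDeg p (e '' inv) (k + 2)) ∧
      (∀ k, ∀ ω ∈ formsOfDeg p (insert t (e '' inv)) k,
        deRhamD (timesCoord he.injective ϖ t P) ω ∈ formsOfDeg p (e '' inv) (k + 1) →
        Res ω = 0 →
        ∃ θ ∈ formsOfDeg p (insert t (e '' inv)) (k - 1),
          ω - deRhamD (timesCoord he.injective ϖ t P) θ ∈ formsOfDeg p (e '' inv) k) := by
  obtain ⟨R, hRmem, hRreg, hRS, hRt, hRe, hR0⟩ :=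
    exists_residue he.injective ht hcov hϖ hP hint
  have htinv : t ∉ e '' inv := notMem_image ht
  have hf : timesCoord he.injective ϖ t P ∈ algFun p (insert t (e '' inv)) :=
    timesCoord_mem_algFun he.injective (fun j hj => Or.inr ⟨j, hj, rfl⟩) hP
  set f := timesCoord he.injective ϖ t P with hfdef
  set bar := overconv p (insert t (e '' inv)) with hbar
  have hfn : ∀ I, f.coeff I ≠ 0 → 0 ≤ I t := coeff_timesCoord_nonneg he.injective ht
  have hTbar : ∀ j, ∀ a ∈ bar, twistedDeriv f j a ∈ bar := fun j a ha =>
    twistedDeriv_mem_overconv hf j ha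
  have hcoeff : ∀ (S : Finset σ) (ω : Forms p τ),
      restrWith e R (contract p t ω) S
        = wedgeSign p t (S.image e) • R (ω (insert t (S.image e))) := by
    intro S ω
    rw [restrWith_apply, contract_apply, if_neg, map_smul]
    intro h
    obtain ⟨j, -, hj⟩ := Finset.mem_image.1 h
    exact ht ⟨j, hj⟩
  set S : Forms p σ →ₗ[ℂ_[p]] Forms p τ := wedge p t ∘ₗ pullWith e (invCoordPull p e t) with hS
  have hSapply : ∀ η, S η = wedge p t (pullWith e (invCoordPull p e t) η) := fun _ => rfl
  have hSmem : ∀ k, ∀ η ∈ formsOfDeg p inv k, S η ∈ formsOfDeg p (insert t (e '' inv)) (k + 1) :=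
    fun k η hη => wedge_mem_formsIn rfl t
      (pullWith_mem_formsIn he (fun a ha => invCoordPull_mem_overconv he.injective ha) hη)
  have hDmem : ∀ k, ∀ ω ∈ formsOfDeg p (insert t (e '' inv)) k,
      deRhamD f ω ∈ formsOfDeg p (insert t (e '' inv)) (k + 1) := fun k ω hω =>
    deRhamD_mem_formsOfDeg hf rfl hω
  -- The residue of a form is `R` of its `dt` part.
  refine ⟨restrWith e R ∘ₗ contract p t, S, fun k ω hω => ?_, fun k ω hω => ?_,
    fun k ω hω => ?_, hSmem, fun k η hη => ?_, fun k η hη => ?_, fun k ω hω hD hRes => ?_⟩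
  · exact restrWith_mem_formsIn he hRmem (contract_mem_formsIn rfl t hω)
  · funext U
    rw [LinearMap.comp_apply, hcoeff, hRreg _ (polarPart_eq_zero_of_mem_overconv htinv (hω _).1),
      smul_zero]
    rfl
  · rw [LinearMap.comp_apply, LinearMap.comp_apply, deRhamD_eq_koszulD, contract_koszulD, map_sub,
      restrWith_koszulD he hRe (contract_mem_formsIn (k := k) (l := k - 1) (by ring) t hω),
      deRhamD_eq_koszulD, sub_eq_neg_self]
    funext U
    rw [restrWith_apply]
    exact hRt _ (hω _).1
  · rw [LinearMap.comp_apply, hSapply, contract_wedge_self, contract_pullWith ht, map_zero,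
      sub_zero, restrWith_pullWith he]
    funext U
    exact hRS _ (hη U).1
  · refine mem_formsOfDeg_of_polarPart (t := t) ?_ ?_
    · refine Submodule.add_mem _ ?_ ?_
      · have := hDmem _ _ (hSmem k η hη)
        rwa [add_assoc] at this
      · have := hSmem (k + 1) _ (deRhamD_mem_formsOfDeg (Subalgebra.zero_mem _) rfl hη)
        rwa [add_assoc] at this
    · rw [map_add, deRhamD_eq_koszulD, coeffwise_koszulD, hSapply, hSapply, koszulD_wedge,
        koszulD_pullWith (T' := twistedDeriv 0) he (A := overconv p inv) (fun a _ j => ?_) hη,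
        map_add, map_sum, Finset.sum_eq_zero, add_zero, coeffwise_wedge, coeffwise_pullWith,
        deRhamD_eq_koszulD]
      · rw [neg_add_eq_zero]
        rw [show polarPart p t ∘ₗ invCoordPull p e t = invCoordPull p e t from
          LinearMap.ext fun a => polarPart_invCoordPull ht a]
      · intro k hk
        obtain rfl : k = t := (hcov k).resolve_right (Finset.mem_filter.1 hk).2
        exact wedge_self _ _
      · rw [LinearMap.comp_apply, hfdef, polarPart_twistedDeriv_invCoordPull he.injective ht]
        congr 1
        rw [twistedDeriv_apply, pderiv_zero, polyMul_zero]
        simp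
  · set ω' := coeffwise (polarPart p t) ω with hω'
    -- Elimination of `t` applies to the polar part `ω'`, since `∂_t + ϖ P` is injective on polar
    -- parts and the `dt` part of `ω'` is in its image.
    set Q : τ → Series p τ →ₗ[ℂ_[p]] Series p τ := fun k => polarPart p t ∘ₗ twistedDeriv f k
      with hQ
    have hω'mem : ω' ∈ formsIn (polarSeries p (insert t (e '' inv)) t) k :=
      coeffwise_mem_formsIn (fun a ha => polarPart_mem_polarSeries ha) hω
    have hQpol : ∀ θ : Forms p τ, koszulD Q (coeffwise (polarPart p t) θ)
        = coeffwise (polarPart p t) (deRhamD f θ) := by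
      intro θ
      rw [deRhamD_eq_koszulD, coeffwise_koszulD, koszulD_apply, koszulD_apply]
      refine Finset.sum_congr rfl fun k _ => ?_
      congr 1
      funext U
      exact polarPart_twistedDeriv hfn k (θ U)
    have hQmem : ∀ j, ∀ a ∈ polarSeries p (insert t (e '' inv)) t,
        Q j a ∈ polarSeries p (insert t (e '' inv)) t := fun j a ha =>
      polarPart_mem_polarSeries (hTbar j a (mem_polarSeries.1 ha).1)
    obtain ⟨θ, hθ, hθω⟩ := exact_of_contract_mem_range (T := Q)
      (A := polarSeries p (insert t (e '' inv)) t) hQmem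
      (fun i j a ha => by
        simp only [hQ, LinearMap.comp_apply]
        rw [polarPart_twistedDeriv hfn, polarPart_twistedDeriv hfn, twistedDeriv_comm])
      (j := t) (fun a ha h => (exists_projector_polar he.injective ht hϖ hP hint).1 a ha h)
      hω'mem
      (by
        rw [hω', hQpol]
        funext U
        exact polarPart_eq_zero_of_mem_overconv htinv (hD U).1)
      (fun U => by
        rw [contract_apply]
        split_ifs with hU
        · exact ⟨0, Submodule.zero_mem _, map_zero _⟩
        · obtain ⟨U', rfl⟩ : ∃ U' : Finset σ, U'.image e = U := by
            refine ⟨univ.filter fun j => e j ∈ U, ?_⟩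
            ext k
            simp only [Finset.mem_image, Finset.mem_filter, Finset.mem_univ, true_and]
            constructor
            · rintro ⟨j, hj, rfl⟩; exact hj
            · intro hk
              obtain rfl | ⟨j, rfl⟩ := hcov k
              · exact absurd hk hU
              · exact ⟨j, hk, rfl⟩
          have h0 := congrFun hRes U'
          rw [LinearMap.comp_apply, hcoeff] at h0
          have h1 : R (ω (insert t (U'.image e))) = 0 :=
            (smul_eq_zero.1 h0).resolve_left (wedgeSign_ne_zero _ _)
          obtain ⟨b, hb, hb'⟩ := hR0 _ (hω _).1 h1
          refine ⟨wedgeSign p t (U'.image e) • b, Submodule.smul_mem _ _ hb, ?_⟩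
          rw [map_smul]
          congr 1)
    refine ⟨θ, fun U => ⟨(mem_polarSeries.1 (hθ U).1).1, (hθ U).2⟩, ?_⟩
    have hθbar : θ ∈ formsOfDeg p (insert t (e '' inv)) (k - 1) :=
      fun U => ⟨(mem_polarSeries.1 (hθ U).1).1, (hθ U).2⟩
    refine mem_formsOfDeg_of_polarPart (t := t) (Submodule.sub_mem _ hω ?_) ?_
    · have := hDmem _ _ hθbar
      rwa [sub_add_cancel] at this
    · rw [map_sub, ← hω', ← hθω, ← hQpol, sub_eq_zero]
      congr 1
      funext U
      exact (mem_polarSeries.1 (hθ U).1).2.symm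

end ResidueSequence

noncomputable section GysinSequence

variable {p : ℕ} [Fact p.Prime] {σ τ : Type} [Fintype σ] [LinearOrder σ] [Fintype τ]
  [LinearOrder τ] {e : σ → τ} {t : τ} {inv : Set σ} {P : LPoly p σ} {ϖ : ℂ_[p]}

/-- The long exact sequence of the inclusion of regular forms into the forms with poles along
`t = 0`: the cohomology of the quotient is that of the base, by taking residues. -/
theorem exists_gysin_sequence (he : StrictMono e) (ht : t ∉ Set.range e)
    (hcov : ∀ k, k = t ∨ k ∈ Set.range e) (hϖ : ϖ ^ (p - 1) = -(p : ℂ_[p]))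
    (hP : P ∈ algFun p inv) (hint : ∀ I, ‖P.coeff I‖ ≤ 1) :
    ∃ (a : ∀ i : ℤ, DeRham (e '' inv) (timesCoord he.injective ϖ t P) (i + 2) →ₗ[ℂ_[p]]
          DeRham (insert t (e '' inv)) (timesCoord he.injective ϖ t P) (i + 2))
      (b : ∀ i : ℤ, DeRham (insert t (e '' inv)) (timesCoord he.injective ϖ t P) (i + 2) →ₗ[ℂ_[p]]
          DeRham inv (0 : LPoly p σ) (i + 1))
      (δ : ∀ i : ℤ, DeRham inv (0 : LPoly p σ) i →ₗ[ℂ_[p]]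
          DeRham (e '' inv) (timesCoord he.injective ϖ t P) (i + 2)),
      (∀ i, Induces id (a i)) ∧
      ∀ i, Function.Exact (δ i) (a i) ∧ Function.Exact (a i) (b i) ∧
        Function.Exact (b i) (δ (i + 1)) := by
  obtain ⟨Res, S, hResMem, hResReg, hResD, hSmem, hResS, hDS, hQ⟩ :=
    exists_residue_forms (t := t) he ht hcov hϖ hP hint
  have hfr : timesCoord he.injective ϖ t P ∈ algFun p (e '' inv) :=
    timesCoord_mem_algFun he.injective (fun j hj => ⟨j, hj, rfl⟩) hP
  have hfb : timesCoord he.injective ϖ t P ∈ algFun p (insert t (e '' inv)) :=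
    timesCoord_mem_algFun he.injective (fun j hj => Or.inr ⟨j, hj, rfl⟩) hP
  have h0 : (0 : LPoly p σ) ∈ algFun p inv := Subalgebra.zero_mem _
  set f := timesCoord he.injective ϖ t P
  have hle : ∀ k, formsOfDeg p (e '' inv) k ≤ formsOfDeg p (insert t (e '' inv)) k :=
    fun k => formsOfDeg_mono (Set.subset_insert _ _)
  have hDSclosed : ∀ k, ∀ η ∈ formsOfDeg p inv k, deRhamD 0 η = 0 →
      deRhamD f (S η) ∈ formsOfDeg p (e '' inv) (k + 2) := fun k η hη hc => by
    simpa [hc] using hDS k η hη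
  have ha : ∀ i : ℤ, ∃ Φ : DeRham (e '' inv) f (i + 2) →ₗ[ℂ_[p]]
      DeRham (insert t (e '' inv)) f (i + 2), Induces id Φ := fun i =>
    exists_induces id (fun _ _ _ _ => rfl) (fun _ _ _ => rfl)
      (fun ω hω => ⟨hle _ hω.1, hω.2⟩) (fun θ hθ _ => ⟨θ, hle _ hθ, rfl⟩)
  have hb : ∀ i : ℤ, ∃ Φ : DeRham (insert t (e '' inv)) f (i + 2) →ₗ[ℂ_[p]]
      DeRham inv (0 : LPoly p σ) (i + 1), Induces Res Φ := fun i => by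
    refine exists_induces Res (fun _ _ _ _ => map_add _ _ _) (fun _ _ _ => map_smul _ _ _)
      (fun ω hω => ⟨hResMem _ ω (by rw [add_assoc]; exact hω.1), ?_⟩)
      (fun θ hθ _ => ⟨-Res θ, neg_mem (hResMem _ _ ?_), ?_⟩)
    · have h := hResD _ _ hω.1
      rw [show deRhamD f ω = 0 from hω.2, map_zero, eq_comm, neg_eq_zero] at h
      exact h
    · have h : i + 1 - 1 + 1 = i + 2 - 1 := by ring
      rwa [h]
    · rw [map_neg, hResD _ _ hθ]
  have hδ : ∀ i : ℤ, ∃ Φ : DeRham inv (0 : LPoly p σ) i →ₗ[ℂ_[p]]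
      DeRham (e '' inv) f (i + 2), Induces (deRhamD f ∘ₗ S) Φ := fun i => by
    refine exists_induces _ (fun _ _ _ _ => map_add _ _ _) (fun _ _ _ => map_smul _ _ _)
      (fun ω hω => ⟨hDSclosed _ _ hω.1 hω.2, ?_⟩)
      (fun θ hθ _ => ⟨deRhamD f (S θ) + S (deRhamD 0 θ), ?_, ?_⟩)
    · exact deRhamD_deRhamD f _
    · have h := hDS _ _ hθ
      rwa [show i - 1 + 2 = i + 2 - 1 by ring] at h
    · rw [map_add, deRhamD_deRhamD, zero_add]; rfl
  choose a ha using ha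
  choose b hb using hb
  choose δ hδ using hδ
  refine ⟨a, b, δ, ha, fun i => ⟨?_, ?_, ?_⟩⟩
  -- If a regular form is `D θ`, it is the image of `Res θ`: the form `θ - S (Res θ)` has no
  -- residue, so it is regular up to exact forms.
  · intro x
    obtain ⟨ω, rfl⟩ := Submodule.Quotient.mk_surjective _ x
    obtain ⟨hω, haω⟩ := ha i ω
    constructor
    · intro h
      rw [haω, mk_eq_zero_iff] at h
      obtain ⟨θ, hθ, hDθ⟩ := h
      replace hDθ : deRhamD f θ = ω := hDθ
      rw [show i + 2 - 1 = i + 1 by ring] at hθ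
      have hη : Res θ ∈ formsOfDeg p inv i := hResMem _ _ hθ
      have hηc : deRhamD 0 (Res θ) = 0 := by
        have := hResD _ _ hθ
        rwa [hDθ, hResReg _ _ ω.2.1, eq_comm, neg_eq_zero] at this
      obtain ⟨ψ, hψ, hψr⟩ := hQ (i + 1) (θ - S (Res θ)) (Submodule.sub_mem _ hθ (hSmem _ _ hη))
        (by
          rw [map_sub, hDθ, show i + 1 + 1 = i + 2 by ring]
          exact Submodule.sub_mem _ ω.2.1 (hDSclosed _ _ hη hηc))
        (by rw [map_sub, hResS _ _ hη, sub_self])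
      refine ⟨Submodule.Quotient.mk ⟨Res θ, hη, hηc⟩, ?_⟩
      obtain ⟨h1, h2⟩ := hδ i ⟨Res θ, hη, hηc⟩
      rw [h2, mk_eq_mk_iff]
      refine ⟨-(θ - S (Res θ) - deRhamD f ψ), neg_mem ?_, ?_⟩
      · rwa [show i + 2 - 1 = i + 1 by ring]
      · rw [map_neg, map_sub, map_sub, deRhamD_deRhamD, hDθ, sub_zero, neg_sub]
        rfl
    · rintro ⟨y, hy⟩
      obtain ⟨η, rfl⟩ := Submodule.Quotient.mk_surjective _ y
      obtain ⟨h1, h2⟩ := hδ i η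
      rw [← hy, h2]
      obtain ⟨h3, h4⟩ := ha i ⟨_, h1⟩
      rw [h4, mk_eq_zero_iff]
      refine ⟨S η, ?_, rfl⟩
      rw [show i + 2 - 1 = i + 1 by ring]
      exact hSmem _ _ η.2.1
  -- If `Res ω = dη`, then `ω + D (S η)` has no residue.
  · intro x
    obtain ⟨ω, rfl⟩ := Submodule.Quotient.mk_surjective _ x
    obtain ⟨hω, hbω⟩ := hb i ω
    constructor
    · intro h
      rw [hbω, mk_eq_zero_iff] at h
      obtain ⟨η, hη, hDη⟩ := h
      replace hDη : deRhamD 0 η = Res ω := hDη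
      rw [show i + 1 - 1 = i by ring] at hη
      have hω1 : (ω : Forms p τ) ∈ formsOfDeg p (insert t (e '' inv)) (i + 2) := ω.2.1
      have hSη : S η ∈ formsOfDeg p (insert t (e '' inv)) (i + 2 - 1) := by
        rw [show i + 2 - 1 = i + 1 by ring]; exact hSmem _ _ hη
      have hω' : (ω : Forms p τ) + deRhamD f (S η) ∈ formsOfDeg p (insert t (e '' inv)) (i + 2) :=
        Submodule.add_mem _ hω1 (deRhamD_mem_formsOfDeg hfb (by ring) hSη)
      have hω'c : deRhamD f ((ω : Forms p τ) + deRhamD f (S η)) = 0 := by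
        rw [map_add, deRhamD_deRhamD, show deRhamD f ω = 0 from ω.2.2, add_zero]
      obtain ⟨ψ, hψ, hψr⟩ := hQ (i + 2) _ hω' (by rw [hω'c]; exact Submodule.zero_mem _)
        (by rw [map_add, hResD _ _ hSη, hResS _ _ hη, hDη, add_neg_cancel])
      have hc : deRhamD f ((ω : Forms p τ) + deRhamD f (S η) - deRhamD f ψ) = 0 := by
        rw [map_sub, hω'c, deRhamD_deRhamD, sub_zero]
      refine ⟨Submodule.Quotient.mk ⟨_, hψr, hc⟩, ?_⟩
      obtain ⟨h1, h2⟩ := ha i ⟨_, hψr, hc⟩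
      rw [h2, mk_eq_mk_iff]
      refine ⟨S η - ψ, Submodule.sub_mem _ hSη hψ, ?_⟩
      rw [map_sub]
      simp only [id]
      abel
    · rintro ⟨y, hy⟩
      obtain ⟨η, rfl⟩ := Submodule.Quotient.mk_surjective _ y
      obtain ⟨h1, h2⟩ := ha i η
      rw [← hy, h2]
      obtain ⟨h3, h4⟩ := hb i ⟨_, h1⟩
      rw [h4, mk_eq_zero_iff]
      exact ⟨0, Submodule.zero_mem _, by rw [map_zero]; exact (hResReg _ _ η.2.1).symm⟩
  -- If `D (S η) = D ρ` with `ρ` regular, then `S η - ρ` is closed with residue `η`.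
  · intro x
    obtain ⟨η, rfl⟩ := Submodule.Quotient.mk_surjective _ x
    obtain ⟨hω, hδη⟩ := hδ (i + 1) η
    have hSη : S η ∈ formsOfDeg p (insert t (e '' inv)) (i + 2) := by
      have := hSmem _ _ η.2.1
      rwa [add_assoc] at this
    constructor
    · intro h
      rw [hδη, mk_eq_zero_iff] at h
      obtain ⟨ρ, hρ, hDρ⟩ := h
      replace hDρ : deRhamD f ρ = deRhamD f (S η) := hDρ
      rw [show i + 1 + 2 - 1 = i + 2 by ring] at hρ
      have hc : deRhamD f (S η - ρ) = 0 := by rw [map_sub, hDρ, sub_self]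
      refine ⟨Submodule.Quotient.mk ⟨S η - ρ, Submodule.sub_mem _ hSη (hle _ hρ), hc⟩, ?_⟩
      obtain ⟨h1, h2⟩ := hb i ⟨S η - ρ, Submodule.sub_mem _ hSη (hle _ hρ), hc⟩
      rw [h2]
      congr 1
      ext1
      change Res (S η - ρ) = η
      rw [map_sub, hResS _ _ η.2.1, hResReg _ _ hρ, sub_zero]
    · rintro ⟨y, hy⟩
      obtain ⟨ω, rfl⟩ := Submodule.Quotient.mk_surjective _ y
      obtain ⟨h1, h2⟩ := hb i ω
      rw [← hy, h2]
      obtain ⟨h3, h4⟩ := hδ (i + 1) ⟨_, h1⟩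
      rw [h4, mk_eq_zero_iff]
      have hη : Res ω ∈ formsOfDeg p inv (i + 1) := h1.1
      have hηc : deRhamD 0 (Res ω) = 0 := h1.2
      have hS' : S (Res ω) ∈ formsOfDeg p (insert t (e '' inv)) (i + 2) := by
        have := hSmem _ _ hη
        rwa [add_assoc] at this
      obtain ⟨ψ, hψ, hψr⟩ := hQ (i + 2) ((ω : Forms p τ) - S (Res ω))
        (Submodule.sub_mem _ ω.2.1 hS')
        (by
          rw [map_sub, show deRhamD f ω = 0 from ω.2.2, zero_sub]
          have := hDSclosed _ _ hη hηc
          rw [show i + 1 + 2 = i + 2 + 1 by ring] at this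
          exact neg_mem this)
        (by rw [map_sub, hResS _ _ hη, sub_self])
      refine ⟨-((ω : Forms p τ) - S (Res ω) - deRhamD f ψ), neg_mem ?_, ?_⟩
      · rwa [show i + 1 + 2 - 1 = i + 2 by ring]
      · rw [map_neg, map_sub, map_sub, deRhamD_deRhamD, show deRhamD f ω = 0 from ω.2.2]
        simp

end GysinSequence

/-! ### The Poincaré lemma for a product with the affine line -/

noncomputable section Poincare

variable {p : ℕ} [Fact p.Prime] {σ τ : Type} [Fintype σ] [LinearOrder σ] [Fintype τ]
  [LinearOrder τ] {e : σ → τ} {x : τ} {inv : Set σ}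

theorem twistedDeriv_zero (j : τ) : twistedDeriv (0 : LPoly p τ) j = seriesDeriv j := by
  rw [twistedDeriv, pderiv_zero, polyMul_zero, add_zero]

/-- The formal integral `∫ a dx` without constant term. The inverse of the exponent is zero in
degree zero, where `a` has no coefficient to integrate if it is regular. -/
def integral (p : ℕ) [Fact p.Prime] {τ : Type} [DecidableEq τ] (x : τ) :
    Series p τ →ₗ[ℂ_[p]] Series p τ :=
  diagShift p x (fun s => ((s : ℤ) : ℂ_[p])⁻¹) (Pi.single x 1 : τ → ℤ)

theorem integral_apply (a : Series p τ) (I : τ → ℤ) :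
    integral p x a I = ((I x : ℤ) : ℂ_[p])⁻¹ * a (I - Pi.single x 1) := rfl

theorem integral_mem_overconv {inv' : Set τ} (hx : x ∉ inv') {a : Series p τ}
    (ha : a ∈ overconv p inv') : integral p x a ∈ overconv p inv' := by
  refine mem_overconv_of_polarPart_eq_zero (t := x) ?_ ?_
  · refine diagShift_mem_overconv (K := 1) (fun j hj => ?_) (fun s => ?_)
      (overconv_mono (Set.subset_insert _ _) ha)
    · refine Pi.single_eq_of_ne ?_ _
      rintro rfl
      exact hj (Set.mem_insert _ _)
    · refine (norm_inv_intCast_le s).trans ?_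
      linarith
  · rw [polarPart_eq_zero_iff]
    intro I hI
    rw [integral_apply, polarPart_eq_zero_iff.1 (polarPart_eq_zero_of_mem_overconv hx ha), mul_zero]
    simp only [Pi.sub_apply, Pi.single_eq_same]
    omega

theorem seriesDeriv_integral_of_ne {j : τ} (hj : j ≠ x) (a : Series p τ) :
    seriesDeriv j (integral p x a) = integral p x (seriesDeriv j a) := by
  funext I
  simp only [seriesDeriv_apply, integral_apply, Pi.add_apply, Pi.sub_apply,
    Pi.single_eq_of_ne hj, Pi.single_eq_of_ne hj.symm, add_zero, sub_zero]
  rw [show I + Pi.single j 1 - Pi.single x 1 = I - Pi.single x 1 + Pi.single j 1 by abel]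
  ring

theorem seriesDeriv_integral {a : Series p τ} (ha : polarPart p x a = 0) :
    seriesDeriv x (integral p x a) = a := by
  funext I
  simp only [seriesDeriv_apply, integral_apply, Pi.add_apply, Pi.single_eq_same,
    add_sub_cancel_right]
  by_cases h : I x < 0
  · rw [polarPart_eq_zero_iff.1 ha I h, mul_zero, mul_zero]
  · rw [← mul_assoc, ← Int.cast_one (R := ℂ_[p]), ← Int.cast_add, mul_inv_cancel₀, one_mul]
    have : I x + 1 ≠ 0 := by omega
    exact_mod_cast this

theorem integral_seriesDeriv (a : Series p τ) (I : τ → ℤ) :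
    integral p x (seriesDeriv x a) I = if I x = 0 then 0 else a I := by
  simp only [integral_apply, seriesDeriv_apply, Pi.sub_apply, Pi.single_eq_same, sub_add_cancel]
  split_ifs with h
  · simp [h]
  · push_cast
    rw [sub_add_cancel, ← mul_assoc, inv_mul_cancel₀ (by exact_mod_cast h), one_mul]

theorem pullSeries_restrSeries (he : e.Injective) (hx : x ∉ Set.range e)
    (hcov : ∀ k, k = x ∨ k ∈ Set.range e) (a : Series p τ) (I : τ → ℤ) :
    pullSeries p e (restrSeries p e a) I = if I x = 0 then a I else 0 := by
  split_ifs with h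
  · have h' : ∀ k, k ∉ Set.range e → I k = 0 := fun k hk => by
      rwa [(hcov k).resolve_right hk]
    rw [pullSeries_apply_of_forall _ h', restrSeries_apply, extend_comp_of_forall he h']
  · exact pullSeries_apply_of_ne _ hx h

/-- The homotopy formula: integration of the `dx`-component along the fibres is a homotopy between
the identity and the pull-back of the restriction to `x = 0`. -/
theorem deRhamD_integral (he : StrictMono e) (hx : x ∉ Set.range e)
    (hcov : ∀ k, k = x ∨ k ∈ Set.range e) {k : ℤ} {ω : Forms p τ}
    (hω : ω ∈ formsOfDeg p (e '' inv) k) (hc : deRhamD 0 ω = 0) :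
    deRhamD 0 (coeffwise (integral p x) (contract p x ω)) =
      ω - pullWith e (pullSeries p e) (restrWith e (restrSeries p e) ω) := by
  have hx' : x ∉ e '' inv := notMem_image hx
  set E : Series p τ →ₗ[ℂ_[p]] Series p τ :=
    LinearMap.id - integral p x ∘ₗ seriesDeriv x with hE
  have hEapply : ∀ a I, E a I = if I x = 0 then a I else 0 := fun a I => by
    rw [hE, LinearMap.sub_apply, Pi.sub_apply, LinearMap.comp_apply, integral_seriesDeriv]
    split_ifs <;> simp
  have hpull : pullWith e (pullSeries p e) (restrWith e (restrSeries p e) ω)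
      = coeffwise E ω - wedge p x (coeffwise E (contract p x ω)) := by
    refine formsIn_ext_pull (e := e) (fun S => ?_) fun k hk => ?_
    · rw [pullWith_image he, restrWith_apply, Pi.sub_apply, wedge_apply, if_neg, sub_zero]
      · funext I
        rw [pullSeries_restrSeries he.injective hx hcov]
        exact (hEapply _ I).symm
      · intro h
        obtain ⟨j, -, hj⟩ := Finset.mem_image.1 h
        exact hx ⟨j, hj⟩
    · obtain rfl : k = x := (hcov k).resolve_right hk
      rw [contract_pullWith hk, map_sub, contract_wedge_self, ← coeffwise_contract,
        ← coeffwise_contract, contract_self, map_zero, map_zero, sub_zero, sub_self]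
  have hcon : koszulD (seriesDeriv (p := p)) (contract p x ω) = coeffwise (seriesDeriv x) ω := by
    have h0 : koszulD (seriesDeriv (p := p)) ω = 0 := by
      rw [deRhamD_eq_koszulD, funext (twistedDeriv_zero (p := p))] at hc
      exact hc
    have := contract_koszulD (T := seriesDeriv (p := p)) x ω
    rw [h0, map_zero, eq_comm, sub_eq_zero] at this
    exact this.symm
  have hmain : koszulD (seriesDeriv (p := p)) (coeffwise (integral p x) (contract p x ω))
      = coeffwise (integral p x) (koszulD (seriesDeriv (p := p)) (contract p x ω))
        + wedge p x (coeffwise E (contract p x ω)) := by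
    rw [koszulD_apply, koszulD_apply, map_sum, ← Finset.add_sum_erase _ _ (Finset.mem_univ x),
      ← Finset.add_sum_erase _ _ (Finset.mem_univ x), add_right_comm]
    congr 1
    · rw [coeffwise_wedge, ← map_add]
      congr 1
      funext S
      simp only [Pi.add_apply, LinearMap.compLeft_apply, Function.comp_apply]
      rw [seriesDeriv_integral, hE, LinearMap.sub_apply, LinearMap.comp_apply]
      · simp
      · rw [contract_apply]
        split_ifs
        · exact map_zero _
        · rw [map_smul, polarPart_eq_zero_of_mem_overconv hx' (hω _).1, smul_zero]
    · refine Finset.sum_congr rfl fun j hj => ?_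
      rw [coeffwise_wedge]
      congr 1
      funext S
      exact seriesDeriv_integral_of_ne (Finset.ne_of_mem_erase hj) _
  rw [hpull, deRhamD_eq_koszulD, funext (twistedDeriv_zero (p := p)), hmain, hcon]
  have : coeffwise E ω = ω - coeffwise (integral p x) (coeffwise (seriesDeriv x) ω) := by
    funext S
    rfl
  rw [this]
  abel

/-- The Poincaré lemma: pull-back along the projection that forgets the coordinate `x`, which is not
invertible, is an isomorphism on de Rham cohomology. -/
theorem nonempty_poincare_equiv (he : StrictMono e) (hx : x ∉ Set.range e)
    (hcov : ∀ k, k = x ∨ k ∈ Set.range e) (k : ℤ) :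
    Nonempty (DeRham inv (0 : LPoly p σ) k ≃ₗ[ℂ_[p]] DeRham (e '' inv) (0 : LPoly p τ) k) := by
  classical
  have hpmem : ∀ k, ∀ ω ∈ formsOfDeg p inv k,
      pullWith e (pullSeries p e) ω ∈ formsOfDeg p (e '' inv) k := fun k ω hω =>
    pullWith_mem_formsIn he
      (fun a ha => pullSeries_mem_overconv he.injective (inv := inv)
        (fun j hj => Set.mem_image_of_mem e hj) ha) hω
  have hrmem : ∀ k, ∀ ω ∈ formsOfDeg p (e '' inv) k,
      restrWith e (restrSeries p e) ω ∈ formsOfDeg p inv k := fun k ω hω =>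
    restrWith_mem_formsIn he
      (fun a ha => restrSeries_mem_overconv he.injective
        (inv := inv) (fun j hj => (he.injective.mem_set_image).1 hj) ha) hω
  have hpD : ∀ k, ∀ ω ∈ formsOfDeg p inv k, deRhamD 0 (pullWith e (pullSeries p e) ω)
      = pullWith e (pullSeries p e) (deRhamD 0 ω) := fun k ω hω => by
    simp only [deRhamD_eq_koszulD, funext (twistedDeriv_zero (p := p))]
    rw [koszulD_pullWith he (A := overconv p inv)
      (fun a _ j => seriesDeriv_pullSeries he.injective j a) hω, add_eq_left]
    refine Finset.sum_eq_zero fun k hk => ?_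
    rw [coeffwise_pullWith, show seriesDeriv k ∘ₗ pullSeries p e = 0 from LinearMap.ext fun a =>
      seriesDeriv_pullSeries_of_notMem (Finset.mem_filter.1 hk).2 a, pullWith_zero, map_zero]
  have hrD : ∀ k, ∀ ω ∈ formsOfDeg p (e '' inv) k, restrWith e (restrSeries p e) (deRhamD 0 ω)
      = deRhamD 0 (restrWith e (restrSeries p e) ω) := fun k ω hω => by
    simp only [deRhamD_eq_koszulD, funext (twistedDeriv_zero (p := p))]
    exact restrWith_koszulD he
      (fun a _ j => (seriesDeriv_restrSeries he.injective j a).symm) hω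
  obtain ⟨Φ, hΦ⟩ := exists_induces (inv := inv) (f := (0 : LPoly p σ)) (k := k)
    (inv' := e '' inv) (g := (0 : LPoly p τ)) (l := k)
    (pullWith e (pullSeries p e)) (fun _ _ _ _ => map_add _ _ _) (fun _ _ _ => map_smul _ _ _)
    (fun ω hω => ⟨hpmem _ _ hω.1, by
      change deRhamD 0 _ = 0
      rw [hpD _ _ hω.1, show deRhamD 0 ω = 0 from hω.2, map_zero]⟩)
    (fun θ hθ _ => ⟨_, hpmem _ _ hθ, hpD _ _ hθ⟩)
  refine ⟨LinearEquiv.ofBijective Φ ⟨?_, ?_⟩⟩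
  · rw [← LinearMap.ker_eq_bot, LinearMap.ker_eq_bot']
    intro y hy
    obtain ⟨ω, rfl⟩ := Submodule.Quotient.mk_surjective _ y
    obtain ⟨h1, h2⟩ := hΦ ω
    rw [h2, mk_eq_zero_iff] at hy
    obtain ⟨θ, hθ, hDθ⟩ := hy
    rw [mk_eq_zero_iff]
    refine ⟨_, hrmem _ _ hθ, ?_⟩
    rw [← hrD _ _ hθ, hDθ, restrWith_pullWith he]
    funext S
    exact restrSeries_pullSeries he.injective _
  · intro y
    obtain ⟨ω, rfl⟩ := Submodule.Quotient.mk_surjective _ y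
    have hc : deRhamD 0 (restrWith e (restrSeries p e) ω) = 0 := by
      rw [← hrD _ _ ω.2.1, show deRhamD 0 (ω : Forms p τ) = 0 from ω.2.2, map_zero]
    refine ⟨Submodule.Quotient.mk ⟨_, hrmem _ _ ω.2.1, hc⟩, ?_⟩
    obtain ⟨h1, h2⟩ := hΦ ⟨_, hrmem _ _ ω.2.1, hc⟩
    rw [h2, mk_eq_mk_iff]
    refine ⟨-coeffwise (integral p x) (contract p x ω), neg_mem ?_, ?_⟩
    · exact coeffwise_mem_formsIn (fun a ha => integral_mem_overconv (notMem_image hx) ha)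
        (contract_mem_formsIn (by ring) x ω.2.1)
    · rw [map_neg, deRhamD_integral he hx hcov ω.2.1 ω.2.2, neg_sub]

end Poincare

/-! ### The operator `∂_x + ϖ t y` -/

noncomputable section SuspensionOperator

variable {p : ℕ} [Fact p.Prime] {τ : Type} [Fintype τ] [DecidableEq τ] {t x y : τ}
  {inv : Set τ} {ϖ : ℂ_[p]}

/-- The terms of a series that are constant in the coordinate `y`. -/
def constPart (p : ℕ) [Fact p.Prime] {τ : Type} (y : τ) : Series p τ →ₗ[ℂ_[p]] Series p τ :=
  diagShift p y (fun s => if s = 0 then 1 else 0) 0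

theorem constPart_apply (y : τ) (a : Series p τ) (I : τ → ℤ) :
    constPart p y a I = if I y = 0 then a I else 0 := by
  rw [constPart, diagShift_apply, sub_zero]
  split_ifs <;> simp

theorem constPart_mem_overconv (y : τ) {a : Series p τ} (ha : a ∈ overconv p inv) :
    constPart p y a ∈ overconv p inv := by
  refine overconv_of_le ha (fun I hI => ?_) 1 1 fun I _ => ⟨I, by omega, ?_⟩
  · rw [constPart_apply, ha.1 _ hI, ite_self]
  · rw [constPart_apply, one_mul]
    split_ifs
    · exact le_mul_of_one_le_left (norm_nonneg _) (by simp)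
    · rw [norm_zero]; positivity

/-- Division by `ϖ t y` of series that are regular in `y`, dropping the terms that are constant
in `y`. -/
def suspDiv (ϖ : ℂ_[p]) (t y : τ) : Series p τ →ₗ[ℂ_[p]] Series p τ :=
  diagShift p y (fun s => if 0 ≤ s then ϖ⁻¹ else 0) (-(Pi.single t 1 + Pi.single y 1) : τ → ℤ)

theorem suspDiv_apply (a : Series p τ) (I : τ → ℤ) :
    suspDiv ϖ t y a I = (if 0 ≤ I y then ϖ⁻¹ else 0) * a (I + (Pi.single t 1 + Pi.single y 1)) := by
  rw [suspDiv, diagShift_apply, sub_neg_eq_add]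

theorem continuous_suspDiv : Continuous (suspDiv ϖ t y : Series p τ → Series p τ) := by
  rw [suspDiv]
  exact continuous_diagShift _ _ _

theorem suspDiv_mem_overconv (ht : t ∈ inv) {a : Series p τ}
    (ha : a ∈ overconv p inv) : suspDiv ϖ t y a ∈ overconv p inv := by
  refine mem_overconv_of_polarPart_eq_zero (t := y) ?_ ?_
  · refine diagShift_mem_overconv (K := ‖ϖ⁻¹‖) (fun j hj => ?_) (fun s => ?_)
      (overconv_mono (Set.subset_insert _ _) ha)
    · have h1 : j ≠ t := fun h => hj (Or.inr (h ▸ ht))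
      have h2 : j ≠ y := fun h => hj (Or.inl h)
      simp [h1, h2]
    · split_ifs
      · exact le_mul_of_one_le_right (norm_nonneg _) (by simp)
      · rw [norm_zero]; positivity
  · rw [polarPart_eq_zero_iff]
    intro I hI
    rw [suspDiv_apply, if_neg (not_le.2 hI), zero_mul]

/-- The terms of the geometric series that inverts `∂_x + ϖ t y` up to terms that are constant in
`y`. -/
def suspIter (ϖ : ℂ_[p]) (t x y : τ) (i : ℕ) (a : Series p τ) : Series p τ :=
  (fun b => -suspDiv ϖ t y (seriesDeriv x b))^[i] (suspDiv ϖ t y a)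

theorem suspIter_zero (a : Series p τ) : suspIter ϖ t x y 0 a = suspDiv ϖ t y a := rfl

theorem suspIter_succ (i : ℕ) (a : Series p τ) :
    suspIter ϖ t x y (i + 1) a = -suspDiv ϖ t y (seriesDeriv x (suspIter ϖ t x y i a)) := by
  rw [suspIter, Function.iterate_succ_apply', suspIter]

theorem suspIter_apply (htx : t ≠ x) (hxy : x ≠ y) (hty : t ≠ y) (i : ℕ) (a : Series p τ)
    (I : τ → ℤ) :
    suspIter ϖ t x y i a I = if 0 ≤ I y then (-1) ^ i * ϖ⁻¹ ^ (i + 1) *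
      ((∏ q ∈ range i, (I x + 1 + q) : ℤ) : ℂ_[p]) *
      a (I + ((i : ℤ) • Pi.single x 1 + ((i : ℤ) + 1) • (Pi.single t 1 + Pi.single y 1)))
      else 0 := by
  induction i generalizing I with
  | zero =>
    rw [suspIter_zero, suspDiv_apply]
    split_ifs <;> simp
  | succ i ih =>
    rw [suspIter_succ, Pi.neg_apply, suspDiv_apply, seriesDeriv_apply, ih]
    by_cases h : 0 ≤ I y
    · have h1 : (I + (Pi.single t 1 + Pi.single y 1) + Pi.single x 1 : τ → ℤ) y = I y + 1 := by
        simp [hty.symm, hxy.symm]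
      have h2 : (I + (Pi.single t 1 + Pi.single y 1) + Pi.single x 1 : τ → ℤ) x = I x + 1 := by
        simp [htx.symm, hxy]
      have h3 : (I + (Pi.single t 1 + Pi.single y 1) : τ → ℤ) x = I x := by
        simp [htx.symm, hxy]
      rw [h1, h2, h3, if_pos h, if_pos h, if_pos (by omega), Finset.prod_range_succ']
      have h4 : I + (Pi.single t 1 + Pi.single y 1) + Pi.single x 1 +
          ((i : ℤ) • Pi.single x 1 + ((i : ℤ) + 1) • (Pi.single t 1 + Pi.single y 1))
          = I + (((i + 1 : ℕ) : ℤ) • Pi.single x 1 +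
            (((i + 1 : ℕ) : ℤ) + 1) • (Pi.single t 1 + Pi.single y 1)) := by
        push_cast
        simp only [add_smul, one_smul]
        abel
      rw [h4]
      have h5 : ∏ q ∈ range i, (I x + 1 + 1 + (q : ℤ))
          = ∏ q ∈ range i, (I x + 1 + ((q + 1 : ℕ) : ℤ)) :=
        Finset.prod_congr rfl fun q _ => by push_cast; ring
      rw [h5]
      push_cast
      ring
    · rw [if_neg h, if_neg h, zero_mul, neg_zero]

theorem suspIter_mem_overconv (ht : t ∈ inv) {a : Series p τ}
    (ha : a ∈ overconv p inv) (i : ℕ) : suspIter ϖ t x y i a ∈ overconv p inv := by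
  induction i with
  | zero => exact suspDiv_mem_overconv ht ha
  | succ i ih =>
    rw [suspIter_succ]
    exact neg_mem (suspDiv_mem_overconv ht (seriesDeriv_mem_overconv x ih))

theorem norm_prod_range_add_le (n : ℤ) (i : ℕ) :
    ‖((∏ q ∈ range i, (n + q) : ℤ) : ℂ_[p])‖ ≤ ‖(i.factorial : ℂ_[p])‖ := by
  obtain ⟨m, hm⟩ := Nat.factorial_coe_dvd_prod i n
  rw [hm, Int.cast_mul, norm_mul, Int.cast_natCast]
  exact mul_le_of_le_one_right (norm_nonneg _) (norm_intCast_le_one m)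

/-- The terms of that geometric series decay geometrically: the derivatives produce products of `i`
consecutive integers, which are divisible by `i!` and so compensate the powers of `ϖ⁻¹`. -/
theorem exists_norm_suspIter_le (hϖ : ϖ ^ (p - 1) = -(p : ℂ_[p])) (htx : t ≠ x) (hxy : x ≠ y)
    (hty : t ≠ y) {a : Series p τ} (ha : a ∈ overconv p inv) :
    ∃ D s : ℝ, 0 ≤ D ∧ 0 < s ∧ s < 1 ∧ ∀ i I,
      ‖suspIter ϖ t x y i a I‖ ≤ D * s ^ (i + expSize I) := by
  obtain ⟨-, C, r, hC, hr0, hr1, hbd⟩ := mem_overconv.1 ha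
  have hϖ0 : 0 < ‖ϖ‖ := norm_pos_iff.2 (pi_ne_zero hϖ)
  obtain ⟨D, s, hD, hs0, hs1, hs⟩ := exists_geometric_bound hr0 hr1 (p / ‖ϖ‖ * C) 6
  refine ⟨D, s, hD, hs0, hs1, fun i I => ?_⟩
  rw [suspIter_apply htx hxy hty]
  split_ifs with hIy
  swap
  · rw [norm_zero]; positivity
  set v : τ → ℤ := (i : ℤ) • Pi.single x 1 + ((i : ℤ) + 1) • (Pi.single t 1 + Pi.single y 1) with hv
  have hvy : v y = i + 1 := by simp [hv, hxy.symm, hty.symm]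
  have hvs : expSize v ≤ 3 * i + 2 := by
    have h0 : ∀ (c : ℤ) (j : τ), expSize (c • Pi.single j 1 : τ → ℤ) = c.natAbs := fun c j => by
      rw [← Pi.single_smul, smul_eq_mul, mul_one, expSize_single]
    have h1 := expSize_add_le ((i : ℤ) • Pi.single x 1 : τ → ℤ)
      (((i : ℤ) + 1) • (Pi.single t 1 + Pi.single y 1))
    have h2 := expSize_add_le (((i : ℤ) + 1) • Pi.single t 1 : τ → ℤ)
      (((i : ℤ) + 1) • Pi.single y 1)
    rw [← smul_add, h0, h0] at h2
    rw [h0] at h1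
    rw [hv]
    omega
  -- The shift by `v` raises the exponent of `y`, which is nonnegative, by `i + 1`, and changes
  -- sizes by at most `3 * i + 2`.
  obtain ⟨q, hq⟩ : ∃ q, expSize (I + v) = q := ⟨_, rfl⟩
  have hqi : i + 1 ≤ q := by
    have := natAbs_le_expSize (I + v) y
    rw [Pi.add_apply, hvy, hq] at this
    omega
  have hIq : i + expSize I ≤ 6 * (q + 1) := by
    have h1 := expSize_sub_le (I + v) v
    rw [add_sub_cancel_right, hq] at h1
    omega
  have hb' := hbd (I + v)
  rw [hq] at hb'
  have h1 : ‖(-1) ^ i * ϖ⁻¹ ^ (i + 1) * ((∏ q ∈ range i, (I x + 1 + q) : ℤ) : ℂ_[p])‖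
      ≤ p / ‖ϖ‖ * (((i + expSize I : ℕ) : ℝ) + 1) := by
    have h2 : ‖(i.factorial : ℂ_[p])‖ / ‖ϖ‖ ^ i ≤ p * (i + 1) := by
      simpa using norm_factorial_div_pi_pow_le hϖ i
    have h3 : (i : ℝ) ≤ ((i + expSize I : ℕ) : ℝ) := by exact_mod_cast Nat.le_add_right _ _
    have h4 := norm_prod_range_add_le (p := p) (I x + 1) i
    rw [norm_mul, norm_mul, norm_pow, norm_neg, norm_one, one_pow, one_mul, norm_pow, norm_inv,
      pow_succ, inv_pow]
    calc _ ≤ (‖ϖ‖ ^ i)⁻¹ * ‖ϖ‖⁻¹ * ‖(i.factorial : ℂ_[p])‖ :=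
          mul_le_mul_of_nonneg_left h4 (by positivity)
      _ = ‖(i.factorial : ℂ_[p])‖ / ‖ϖ‖ ^ i * ‖ϖ‖⁻¹ := by rw [div_eq_mul_inv]; ring
      _ ≤ p * (i + 1) * ‖ϖ‖⁻¹ := mul_le_mul_of_nonneg_right h2 (by positivity)
      _ = p / ‖ϖ‖ * (i + 1) := by rw [div_eq_mul_inv]; ring
      _ ≤ _ := mul_le_mul_of_nonneg_left (by linarith) (by positivity)
  rw [norm_mul]
  refine (mul_le_mul h1 hb' (norm_nonneg _) (by positivity)).trans
    (le_trans (le_of_eq ?_) (hs _ _ hIq))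
  ring

theorem polyMul_coordFun_mul (j k : τ) (a : Series p τ) (I : τ → ℤ) :
    polyMul (coordFun p j * coordFun p k) a I = a (I - (Pi.single j 1 + Pi.single k 1)) := by
  rw [polyMul_mul, polyMul_coordFun, polyMul_coordFun, sub_sub]

/-- The operator `∂_x + ϖ t y`, where `t` is invertible, is injective, with the series that are
constant in `y` as a complement of its image. -/
theorem exists_projector_susp (hϖ : ϖ ^ (p - 1) = -(p : ℂ_[p])) (htx : t ≠ x) (hxy : x ≠ y)
    (hty : t ≠ y) (ht : t ∈ inv) (hy : y ∉ inv) {f : LPoly p τ}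
    (hf : LPoly.pderiv x f = ϖ • (coordFun p t * coordFun p y)) :
    (∀ a ∈ overconv p inv, twistedDeriv f x a = 0 → a = 0) ∧
    ∃ ρ : Series p τ →ₗ[ℂ_[p]] Series p τ,
      (∀ a ∈ overconv p inv, ρ (constPart p y a) = constPart p y a) ∧
      (∀ a ∈ overconv p inv, ρ (twistedDeriv f x a) = 0) ∧
      ∀ b ∈ overconv p inv, ∃ n ∈ overconv p inv, ∃ a ∈ overconv p inv,
        b = constPart p y n + twistedDeriv f x a ∧ ρ b = constPart p y n := by
  have hϖ0 := pi_ne_zero hϖ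
  set U : Series p τ →ₗ[ℂ_[p]] Series p τ := polyMul (ϖ • (coordFun p t * coordFun p y)) with hU
  have hUapply : ∀ a I, U a I = ϖ * a (I - (Pi.single t 1 + Pi.single y 1)) := fun a I => by
    rw [hU, polyMul_smul, LinearMap.smul_apply, Pi.smul_apply, polyMul_coordFun_mul, smul_eq_mul]
  have hT : ∀ a, twistedDeriv f x a = U a + seriesDeriv x a := fun a => by
    rw [twistedDeriv_apply, hf, add_comm]
  have hUmem : ∀ a ∈ overconv p inv, U a ∈ overconv p inv := fun a ha =>
    polyMul_mem_overconv (Subalgebra.smul_mem _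
      (mul_mem (coordFun_mem_algFun _ _) (coordFun_mem_algFun _ _)) _) ha
  have hyv : ∀ I : τ → ℤ, (I - (Pi.single t 1 + Pi.single y 1) : τ → ℤ) y = I y - 1 := fun I => by
    simp [hty.symm]
  have hyv' : ∀ I : τ → ℤ, (I + (Pi.single t 1 + Pi.single y 1) : τ → ℤ) y = I y + 1 := fun I => by
    simp [hty.symm]
  have hzero : ∀ a ∈ overconv p inv, ∀ I : τ → ℤ, I y < 0 → a I = 0 := fun a ha I hI =>
    polarPart_eq_zero_iff.1 (polarPart_eq_zero_of_mem_overconv hy ha) I hI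
  have hVU : ∀ a ∈ overconv p inv, suspDiv ϖ t y (U a) = a := fun a ha => by
    funext I
    rw [suspDiv_apply, hUapply, add_sub_cancel_right]
    split_ifs with h
    · rw [inv_mul_cancel_left₀ hϖ0]
    · rw [zero_mul, hzero a ha I (not_le.1 h)]
  have hUV : ∀ a ∈ overconv p inv, U (suspDiv ϖ t y a) = a - constPart p y a := fun a ha => by
    funext I
    rw [hUapply, suspDiv_apply, sub_add_cancel, hyv, Pi.sub_apply, constPart_apply]
    rcases lt_trichotomy (I y) 0 with h | h | h
    · rw [hzero a ha I h]; simp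
    · rw [if_neg (by omega), if_pos h]; simp
    · rw [if_pos (by omega), if_neg (by omega), mul_inv_cancel_left₀ hϖ0, sub_zero]
  have hVe : ∀ a ∈ overconv p inv, suspDiv ϖ t y (constPart p y a) = 0 := fun a ha => by
    funext I
    rw [suspDiv_apply, constPart_apply, hyv', Pi.zero_apply]
    split_ifs with h1 h2
    · omega
    · rw [mul_zero]
    · rw [zero_mul]
    · rw [zero_mul]
  have hsum : ∀ a ∈ overconv p inv, Summable (fun i => suspIter ϖ t x y i a) ∧
      ∑' i, suspIter ϖ t x y i a ∈ overconv p inv := fun a ha => by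
    obtain ⟨D, s, hD, hs0, hs1, hbd⟩ := exists_norm_suspIter_le hϖ htx hxy hty ha
    exact summable_and_tsum_mem_overconv (z := fun i => suspIter ϖ t x y i a)
      (fun i I hI => (suspIter_mem_overconv ht ha i).1 I hI) hD hs0 hs1 hbd
  have hcont : Continuous (suspDiv ϖ t y ∘ₗ seriesDeriv x : Series p τ →ₗ[ℂ_[p]] Series p τ) := by
    have h1 : Continuous (suspDiv ϖ t y : Series p τ → Series p τ) := continuous_suspDiv
    rw [LinearMap.coe_comp]
    exact h1.comp (continuous_seriesDeriv x)
  -- Multiplication by `ϖ t y`, inverted by `suspDiv` up to the terms that are constant in `y`, is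
  -- perturbed by `∂_x`.
  have hmain := exists_projector_of_perturbation (A := overconv p inv) (U := U)
    (N := seriesDeriv x) (V := suspDiv ϖ t y) (e := constPart p y) (Z := suspIter ϖ t x y) hcont
    hUmem (fun a ha => seriesDeriv_mem_overconv x ha) hVU hUV hVe suspIter_zero suspIter_succ hsum
  simpa only [hT] using hmain

end SuspensionOperator

/-! ### Multiplication of forms by the differential of a function -/

noncomputable section WedgeD

variable {p : ℕ} [Fact p.Prime] {τ : Type} [Fintype τ] [LinearOrder τ]

/-- Multiplication of forms by `dg` on the left. -/
def wedgeD (g : LPoly p τ) : Forms p τ →ₗ[ℂ_[p]] Forms p τ :=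
  koszulD fun k => polyMul (LPoly.pderiv k g)

theorem wedgeD_apply (g : LPoly p τ) (ω : Forms p τ) :
    wedgeD g ω = ∑ k, wedge p k (coeffwise (polyMul (LPoly.pderiv k g)) ω) := koszulD_apply ω

theorem wedgeD_wedge (g : LPoly p τ) (j : τ) (ω : Forms p τ) :
    wedgeD g (wedge p j ω) = -wedge p j (wedgeD g ω) := koszulD_wedge j ω

theorem wedgeD_wedgeD (g : LPoly p τ) (ω : Forms p τ) : wedgeD g (wedgeD g ω) = 0 :=
  koszulD_koszulD fun _ _ _ => polyMul_comm _ _ _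

theorem coeffwise_polyMul_wedgeD (g h : LPoly p τ) (ω : Forms p τ) :
    coeffwise (polyMul h) (wedgeD g ω) = wedgeD g (coeffwise (polyMul h) ω) := by
  rw [wedgeD_apply, wedgeD_apply, map_sum]
  refine Finset.sum_congr rfl fun k _ => ?_
  rw [coeffwise_wedge]
  congr 1
  funext S
  exact polyMul_comm _ _ _

theorem wedgeD_smul (c : ℂ_[p]) (g : LPoly p τ) (ω : Forms p τ) :
    wedgeD (c • g) ω = c • wedgeD g ω := by
  rw [wedgeD_apply, wedgeD_apply, Finset.smul_sum]
  refine Finset.sum_congr rfl fun k _ => ?_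
  rw [pderiv_smul, polyMul_smul, ← map_smul]
  rfl

theorem wedgeD_mul (g h : LPoly p τ) (ω : Forms p τ) :
    wedgeD (g * h) ω = coeffwise (polyMul g) (wedgeD h ω) + coeffwise (polyMul h) (wedgeD g ω) := by
  rw [coeffwise_polyMul_wedgeD, coeffwise_polyMul_wedgeD, wedgeD_apply, wedgeD_apply, wedgeD_apply,
    ← Finset.sum_add_distrib]
  refine Finset.sum_congr rfl fun k _ => ?_
  rw [← map_add]
  congr 1
  funext S
  simp only [LinearMap.compLeft_apply, Function.comp_apply, Pi.add_apply]
  rw [pderiv_mul, polyMul_add, LinearMap.add_apply, polyMul_mul, polyMul_mul,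
    polyMul_comm g, add_comm]

theorem wedgeD_coordFun (j : τ) (ω : Forms p τ) : wedgeD (coordFun p j) ω = wedge p j ω := by
  rw [wedgeD_apply, Finset.sum_eq_single j]
  · rw [pderiv_coordFun, if_pos rfl]
    congr 1
    funext S
    exact polyMul_one _
  · intro k _ hk
    rw [pderiv_coordFun, if_neg hk, polyMul_zero]
    exact map_zero _
  · simp

theorem deRhamD_add (f g : LPoly p τ) (ω : Forms p τ) :
    deRhamD (f + g) ω = deRhamD f ω + wedgeD g ω := by
  rw [deRhamD_eq_koszulD, deRhamD_eq_koszulD, koszulD_apply, koszulD_apply, wedgeD_apply,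
    ← Finset.sum_add_distrib]
  refine Finset.sum_congr rfl fun k _ => ?_
  rw [← map_add]
  congr 1
  funext S
  simp only [LinearMap.compLeft_apply, Function.comp_apply, Pi.add_apply, twistedDeriv_apply]
  rw [pderiv_add, polyMul_add, LinearMap.add_apply, add_assoc]

theorem deRhamD_polyMul (f g : LPoly p τ) (ω : Forms p τ) :
    deRhamD f (coeffwise (polyMul g) ω) = coeffwise (polyMul g) (deRhamD f ω) + wedgeD g ω := by
  rw [deRhamD_eq_koszulD, koszulD_apply, koszulD_apply, wedgeD_apply, map_sum,
    ← Finset.sum_add_distrib]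
  refine Finset.sum_congr rfl fun k _ => ?_
  rw [coeffwise_wedge, ← map_add]
  congr 1
  funext S
  simp only [LinearMap.compLeft_apply, Function.comp_apply, Pi.add_apply]
  rw [twistedDeriv_polyMul, add_comm]

theorem deRhamD_wedge (f : LPoly p τ) (j : τ) (ω : Forms p τ) :
    deRhamD f (wedge p j ω) = -wedge p j (deRhamD f ω) := koszulD_wedge j ω

theorem deRhamD_wedgeD (f g : LPoly p τ) (ω : Forms p τ) :
    deRhamD f (wedgeD g ω) = -wedgeD g (deRhamD f ω) := by
  have h := congrArg (deRhamD f) (deRhamD_polyMul f g ω)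
  rw [deRhamD_deRhamD, map_add, deRhamD_polyMul, deRhamD_deRhamD, map_zero, zero_add] at h
  exact (neg_eq_of_add_eq_zero_right h.symm).symm

theorem wedgeD_mem_formsOfDeg {inv : Set τ} {g : LPoly p τ} (hg : g ∈ algFun p inv) {k l : ℤ}
    (hl : l = k + 1) {ω : Forms p τ} (hω : ω ∈ formsOfDeg p inv k) :
    wedgeD g ω ∈ formsOfDeg p inv l :=
  koszulD_mem_formsIn (fun j _ ha => polyMul_mem_overconv (pderiv_mem_algFun j hg) ha) hl hω

end WedgeD

/-! ### The suspension `f + ϖ t x y` of a function `f` -/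

noncomputable section Suspension

variable {p : ℕ} [Fact p.Prime] {σ τ : Type} [Fintype σ] [LinearOrder σ] [Fintype τ]
  [LinearOrder τ] {e : σ → τ} {t : σ} {x y : τ} {inv : Set σ} {ϖ : ℂ_[p]} {f : LPoly p σ}

theorem deRhamD_pullSeries (he : StrictMono e) {k : ℤ} {ω : Forms p σ}
    (hω : ω ∈ formsOfDeg p inv k) :
    deRhamD (extendHom p he.injective f) (pullWith e (pullSeries p e) ω)
      = pullWith e (pullSeries p e) (deRhamD f ω) := by
  classical
  rw [deRhamD_eq_koszulD, deRhamD_eq_koszulD, koszulD_pullWith (T' := twistedDeriv f) he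
    (A := overconv p inv) (fun a _ j => ?_) hω, add_eq_left]
  · refine Finset.sum_eq_zero fun k hk => ?_
    have hk' : k ∉ Set.range e := (Finset.mem_filter.1 hk).2
    rw [coeffwise_pullWith, show twistedDeriv (extendHom p he.injective f) k ∘ₗ pullSeries p e = 0
      from LinearMap.ext fun a => ?_, pullWith_zero, map_zero]
    rw [LinearMap.comp_apply, twistedDeriv_apply, seriesDeriv_pullSeries_of_notMem hk',
      pderiv_extendHom_of_notMem he.injective hk', polyMul_zero]
    simp
  · rw [twistedDeriv_apply, seriesDeriv_pullSeries he.injective, pderiv_extendHom,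
      polyMul_pullSeries, ← map_add]
    rfl

/-- The function `f + ϖ t x y` in the coordinates of `f` together with `x` and `y`. -/
def suspendFun (he : e.Injective) (ϖ : ℂ_[p]) (t : σ) (x y : τ) (f : LPoly p σ) : LPoly p τ :=
  extendHom p he f + ϖ • (coordFun p (e t) * coordFun p x * coordFun p y)

/-- The map of forms `ω ↦ d(t x) dy ω`. -/
def suspendForm (p : ℕ) [Fact p.Prime] {σ τ : Type} [Fintype σ] [LinearOrder σ] [Fintype τ]
    [LinearOrder τ] (e : σ → τ) (t : σ) (x y : τ) : Forms p σ →ₗ[ℂ_[p]] Forms p τ :=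
  wedgeD (coordFun p (e t) * coordFun p x) ∘ₗ wedge p y ∘ₗ pullWith e (pullSeries p e)

theorem suspendForm_apply (ω : Forms p σ) : suspendForm p e t x y ω =
    wedgeD (coordFun p (e t) * coordFun p x) (wedge p y (pullWith e (pullSeries p e) ω)) := rfl

theorem deRhamD_suspendForm (he : StrictMono e) {k : ℤ} {ω : Forms p σ}
    (hω : ω ∈ formsOfDeg p inv k) :
    deRhamD (suspendFun he.injective ϖ t x y f) (suspendForm p e t x y ω)
      = suspendForm p e t x y (deRhamD f ω) := by
  rw [suspendForm_apply, suspendForm_apply, suspendFun]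
  generalize coordFun p (e t) * coordFun p x = g
  rw [deRhamD_wedgeD, deRhamD_wedge, map_neg, neg_neg,
    deRhamD_add, deRhamD_pullSeries he hω, wedgeD_smul, wedgeD_mul, wedgeD_coordFun,
    map_add, map_add, add_eq_left, map_smul, map_add, map_smul, map_add, coeffwise_wedge,
    wedge_self,
    map_zero, zero_add, wedgeD_wedge, coeffwise_polyMul_wedgeD, wedgeD_wedgeD, map_zero, neg_zero,
    smul_zero]

theorem suspendFun_mem_algFun (he : e.Injective) {inv' : Set τ} (hinv : ∀ j, j ∈ inv → e j ∈ inv')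
    (hf : f ∈ algFun p inv) : suspendFun he ϖ t x y f ∈ algFun p inv' :=
  add_mem (extendHom_mem_algFun he hinv hf) (Subalgebra.smul_mem _
    (mul_mem (mul_mem (coordFun_mem_algFun _ _) (coordFun_mem_algFun _ _))
      (coordFun_mem_algFun _ _)) _)

theorem suspendForm_mem_formsOfDeg (he : StrictMono e) {inv' : Set τ}
    (hinv : ∀ j, j ∈ inv → e j ∈ inv') {k l : ℤ} (hl : l = k + 2) {ω : Forms p σ}
    (hω : ω ∈ formsOfDeg p inv k) : suspendForm p e t x y ω ∈ formsOfDeg p inv' l :=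
  wedgeD_mem_formsOfDeg (mul_mem (coordFun_mem_algFun _ _) (coordFun_mem_algFun _ _))
    (by rw [hl]; ring : l = k + 1 + 1) (wedge_mem_formsIn rfl y (pullWith_mem_formsIn he
      (fun a ha => pullSeries_mem_overconv he.injective hinv ha) hω))

theorem pderiv_suspendFun_x (he : e.Injective) (hx : x ∉ Set.range e) (hxy : x ≠ y) :
    LPoly.pderiv x (suspendFun he ϖ t x y f) = ϖ • (coordFun p (e t) * coordFun p y) := by
  have h : x ≠ e t := fun h => hx ⟨t, h.symm⟩
  rw [suspendFun, pderiv_add, pderiv_extendHom_of_notMem he hx, zero_add, pderiv_smul, pderiv_mul,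
    pderiv_mul, pderiv_coordFun, pderiv_coordFun, pderiv_coordFun, if_neg h, if_pos rfl, if_neg hxy]
  simp

theorem pderiv_suspendFun_y (he : e.Injective) (hy : y ∉ Set.range e) (hxy : x ≠ y) :
    LPoly.pderiv y (suspendFun he ϖ t x y f) = ϖ • (coordFun p (e t) * coordFun p x) := by
  have h : y ≠ e t := fun h => hy ⟨t, h.symm⟩
  rw [suspendFun, pderiv_add, pderiv_extendHom_of_notMem he hy, zero_add, pderiv_smul, pderiv_mul,
    pderiv_mul, pderiv_coordFun, pderiv_coordFun, pderiv_coordFun, if_neg h, if_pos rfl,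
    if_neg hxy.symm]
  simp

theorem pderiv_suspendFun (he : e.Injective) (hx : x ∉ Set.range e) (hy : y ∉ Set.range e)
    (j : σ) : LPoly.pderiv (e j) (suspendFun he ϖ t x y f) = extendHom p he (LPoly.pderiv j f) +
      if j = t then ϖ • (coordFun p x * coordFun p y) else 0 := by
  have h1 : e j ≠ x := fun h => hx ⟨j, h⟩
  have h2 : e j ≠ y := fun h => hy ⟨j, h⟩
  rw [suspendFun, pderiv_add, pderiv_extendHom, pderiv_smul, pderiv_mul,
    pderiv_mul, pderiv_coordFun, pderiv_coordFun, pderiv_coordFun, if_neg h1, if_neg h2]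
  congr 1
  by_cases h : j = t
  · simp [h]
  · rw [if_neg (fun h' => h (he h')), if_neg h]
    simp

end Suspension

/-! ### The residue of forms on the suspension -/

noncomputable section SuspensionResidue

variable {p : ℕ} [Fact p.Prime] {σ τ : Type} [Fintype σ] [LinearOrder σ] [Fintype τ]
  [LinearOrder τ] {e : σ → τ} {t : σ} {x y : τ} {inv : Set σ} {ϖ : ℂ_[p]} {f : LPoly p σ}

/-- The monomial `z_t⁻¹`. -/
def coordInv (p : ℕ) [Fact p.Prime] {τ : Type} [DecidableEq τ] (t : τ) : LPoly p τ :=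
  AddMonoidAlgebra.single (-Pi.single t 1) 1

theorem polyMul_coordInv (t : τ) (a : Series p τ) (I : τ → ℤ) :
    polyMul (coordInv p t) a I = a (I + Pi.single t 1) := by
  rw [coordInv, polyMul_single, one_mul, sub_neg_eq_add]

theorem coordInv_mem_algFun {t : τ} {inv' : Set τ} (ht : t ∈ inv') :
    coordInv p t ∈ algFun p inv' := by
  intro I hI
  rw [coordInv, AddMonoidAlgebra.coeff_single, Finsupp.single_apply] at hI
  split_ifs at hI with h
  · rw [← h]
    intro j hj
    have : j ≠ t := fun h => hj (h ▸ ht)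
    simp [this]
  · exact absurd rfl hI

theorem pderiv_coordInv_of_ne {j t : τ} (h : j ≠ t) : LPoly.pderiv j (coordInv p t) = 0 := by
  rw [coordInv, pderiv_single]
  simp [h]

theorem polyMul_pderiv_coordInv (t : τ) (a : Series p τ) :
    polyMul (LPoly.pderiv t (coordInv p t)) a
      = -polyMul (coordInv p t) (polyMul (coordInv p t) a) := by
  funext I
  rw [Pi.neg_apply, polyMul_coordInv, polyMul_coordInv, coordInv, pderiv_single, polyMul_single]
  simp only [Pi.neg_apply, Pi.single_eq_same, Int.cast_neg, Int.cast_one, mul_one, neg_mul, one_mul]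
  congr 2
  abel

theorem polyMul_coordInv_coordFun (t : τ) (a : Series p τ) :
    polyMul (coordInv p t) (polyMul (coordFun p t) a) = a := by
  funext I
  rw [polyMul_coordInv, polyMul_coordFun, add_sub_cancel_right]

theorem polyMul_coordFun_coordInv (t : τ) (a : Series p τ) :
    polyMul (coordFun p t) (polyMul (coordInv p t) a) = a := by
  rw [polyMul_comm, polyMul_coordInv_coordFun]

theorem constPart_polyMul {g : LPoly p τ} (hg : ∀ I, g.coeff I ≠ 0 → I y = 0) {m : Series p τ}
    (hm : constPart p y m = m) : constPart p y (polyMul g m) = polyMul g m := by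
  conv_rhs => rw [← hm]
  rw [constPart, polyMul_diagShift hg]

theorem constPart_seriesDeriv {k : τ} (hk : k ≠ y) {m : Series p τ}
    (hm : constPart p y m = m) : constPart p y (seriesDeriv k m) = seriesDeriv k m := by
  conv_rhs => rw [← hm]
  funext I
  simp only [constPart_apply, seriesDeriv_apply, Pi.add_apply, Pi.single_eq_of_ne hk.symm, add_zero]
  split_ifs <;> simp

theorem seriesDeriv_eq_zero_of_constPart {m : Series p τ} (hm : constPart p y m = m) :
    seriesDeriv y m = 0 := by
  rw [← hm]
  funext I
  rw [seriesDeriv_apply, constPart_apply, Pi.add_apply, Pi.single_eq_same]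
  split_ifs with h
  · have : ((I y : ℤ) : ℂ_[p]) + 1 = 0 := by exact_mod_cast h
    rw [this, zero_mul]
    rfl
  · rw [mul_zero]
    rfl

theorem coeff_coordFun_eq_zero {j y : τ} (h : y ≠ j) (I : τ → ℤ)
    (hI : (coordFun p j : LPoly p τ).coeff I ≠ 0) : I y = 0 := by
  rw [coordFun, AddMonoidAlgebra.coeff_single, Finsupp.single_apply] at hI
  split_ifs at hI with h'
  · rw [← h', Pi.single_eq_of_ne h]
  · exact absurd rfl hI

theorem apply_eq_zero_of_neg {inv' : Set τ} {a : Series p τ} (ha : a ∈ overconv p inv') {j : τ}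
    (hj : j ∉ inv') {I : τ → ℤ} (hI : I j < 0) : a I = 0 :=
  ha.1 I fun h => absurd (h j hj) (not_le.2 hI)

/-- For `f` a function with `t` invertible, the operators `T_x = ∂_x + ϖ t y` and `T_y = ∂_y + ϖ t
x` of `f + ϖ t x y` form a regular sequence, and `t` times the series in the old coordinates
represent the quotient by their images. The map `R` is the projection to the quotient. -/
theorem exists_susp_residue (he : StrictMono e) (hx : x ∉ Set.range e) (hy : y ∉ Set.range e)
    (hxy : x ≠ y) (hcov : ∀ k, k = x ∨ k = y ∨ k ∈ Set.range e) (ht : t ∈ inv)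
    (hf : f ∈ algFun p inv) (hϖ : ϖ ^ (p - 1) = -(p : ℂ_[p])) :
    (∀ a ∈ overconv p (e '' inv),
      twistedDeriv (suspendFun he.injective ϖ t x y f) x a = 0 → a = 0) ∧
    (∀ a ∈ overconv p (e '' inv), ∀ b ∈ overconv p (e '' inv),
      twistedDeriv (suspendFun he.injective ϖ t x y f) y a
        = twistedDeriv (suspendFun he.injective ϖ t x y f) x b →
      ∃ c ∈ overconv p (e '' inv), twistedDeriv (suspendFun he.injective ϖ t x y f) x c = a) ∧
    ∃ R : Series p τ →ₗ[ℂ_[p]] Series p σ,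
      (∀ a ∈ overconv p (e '' inv), R a ∈ overconv p inv) ∧
      (∀ a ∈ overconv p inv, R (polyMul (coordFun p (e t)) (pullSeries p e a)) = a) ∧
      (∀ a ∈ overconv p (e '' inv),
        R (twistedDeriv (suspendFun he.injective ϖ t x y f) x a) = 0) ∧
      (∀ a ∈ overconv p (e '' inv),
        R (twistedDeriv (suspendFun he.injective ϖ t x y f) y a) = 0) ∧
      (∀ a ∈ overconv p (e '' inv), ∀ j,
        R (twistedDeriv (suspendFun he.injective ϖ t x y f) (e j) a) = twistedDeriv f j (R a)) ∧
      (∀ a ∈ overconv p (e '' inv), R a = 0 →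
        ∃ b ∈ overconv p (e '' inv), ∃ c ∈ overconv p (e '' inv),
          twistedDeriv (suspendFun he.injective ϖ t x y f) x b +
            twistedDeriv (suspendFun he.injective ϖ t x y f) y c = a) := by
  set A := overconv p (e '' inv) with hA
  have hinvI : ∀ j, j ∈ inv → e j ∈ e '' inv := fun j hj => ⟨j, hj, rfl⟩
  have hxA : x ∉ e '' inv := notMem_image hx
  have hyA : y ∉ e '' inv := notMem_image hy
  have htx : e t ≠ x := fun h => hx ⟨t, h⟩
  have hty : e t ≠ y := fun h => hy ⟨t, h⟩
  have htA : e t ∈ e '' inv := ⟨t, ht, rfl⟩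
  have hϖ0 := pi_ne_zero hϖ
  obtain ⟨hinj, ρ, hρ1, hρ2, hρ3⟩ := exists_projector_susp (inv := e '' inv) hϖ htx hxy hty htA hyA
    (f := suspendFun he.injective ϖ t x y f) (pderiv_suspendFun_x he.injective hx hxy)
  set F := suspendFun he.injective ϖ t x y f with hF
  -- the decomposition, with a representative that is constant in `y`
  have hdec : ∀ b ∈ A, ∃ m ∈ A, constPart p y m = m ∧ ∃ c ∈ A,
      b = m + twistedDeriv F x c ∧ ρ b = m := by
    intro b hb
    obtain ⟨n, hn, c, hc, h1, h2⟩ := hρ3 b hb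
    refine ⟨_, constPart_mem_overconv y hn, ?_, c, hc, h1, h2⟩
    funext I
    simp only [constPart_apply]
    split_ifs <;> rfl
  have hρm : ∀ m ∈ A, constPart p y m = m → ρ m = m := fun m hm h => by
    have := hρ1 m hm
    rwa [h] at this
  have hcomm : ∀ i j a, twistedDeriv F i (twistedDeriv F j a)
    = twistedDeriv F j (twistedDeriv F i a) := twistedDeriv_comm F
  have hTx : ∀ a, twistedDeriv F x a
      = seriesDeriv x a + ϖ • polyMul (coordFun p (e t)) (polyMul (coordFun p y) a) := fun a => by
    rw [twistedDeriv_apply, hF, pderiv_suspendFun_x he.injective hx hxy, polyMul_smul,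
      LinearMap.smul_apply, polyMul_mul]
  have hTym : ∀ m, constPart p y m = m → twistedDeriv F y m
      = ϖ • polyMul (coordFun p (e t)) (polyMul (coordFun p x) m) := fun m h => by
    rw [twistedDeriv_apply, hF, pderiv_suspendFun_y he.injective hy hxy, polyMul_smul,
      LinearMap.smul_apply, polyMul_mul, seriesDeriv_eq_zero_of_constPart h, zero_add]
  have hTj : ∀ j a, twistedDeriv F (e j) a = twistedDeriv (extendHom p he.injective f) (e j) a +
      if j = t then ϖ • polyMul (coordFun p x) (polyMul (coordFun p y) a) else 0 := fun j a => by
    rw [twistedDeriv_apply, twistedDeriv_apply, hF, pderiv_suspendFun he.injective hx hy,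
      pderiv_extendHom, polyMul_add, LinearMap.add_apply, add_assoc]
    split_ifs
    · rw [polyMul_smul, LinearMap.smul_apply, polyMul_mul]
    · rw [polyMul_zero, LinearMap.zero_apply]
  have hct : ∀ m, constPart p y m = m →
      constPart p y (polyMul (coordFun p (e t)) m) = polyMul (coordFun p (e t)) m :=
    fun m hm => constPart_polyMul (coeff_coordFun_eq_zero hty.symm) hm
  have hcx : ∀ m, constPart p y m = m →
      constPart p y (polyMul (coordFun p x) m) = polyMul (coordFun p x) m :=
    fun m hm => constPart_polyMul (coeff_coordFun_eq_zero hxy.symm) hm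
  have hci : ∀ m, constPart p y m = m →
      constPart p y (polyMul (coordInv p (e t)) m) = polyMul (coordInv p (e t)) m := fun m hm => by
    refine constPart_polyMul (fun I hI => ?_) hm
    rw [coordInv, AddMonoidAlgebra.coeff_single, Finsupp.single_apply] at hI
    split_ifs at hI with h'
    · rw [← h', Pi.neg_apply, Pi.single_eq_of_ne hty.symm, neg_zero]
    · exact absurd rfl hI
  have hcT : ∀ j m, constPart p y m = m →
      constPart p y (twistedDeriv (extendHom p he.injective f) (e j) m)
        = twistedDeriv (extendHom p he.injective f) (e j) m := fun j m hm => by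
    rw [twistedDeriv_apply, map_add, constPart_seriesDeriv (fun h => hy ⟨j, h⟩) hm,
      constPart_polyMul (fun I hI => ?_) hm]
    rw [pderiv_extendHom] at hI
    exact coeff_extendHom_eq_zero he.injective hy I hI
  have hcf : ∀ j, ∀ a ∈ A, polyMul (coordFun p j) a ∈ A := fun j a ha =>
    polyMul_mem_overconv (coordFun_mem_algFun _ _) ha
  have hcinv : ∀ a ∈ A, polyMul (coordInv p (e t)) a ∈ A := fun a ha =>
    polyMul_mem_overconv (coordInv_mem_algFun htA) ha
  have hxzero : ∀ a ∈ A, restrSeries p e (polyMul (coordFun p x) a) = 0 := fun a ha => by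
    funext I
    rw [restrSeries_apply, polyMul_coordFun]
    refine apply_eq_zero_of_neg ha hxA ?_
    rw [Pi.sub_apply, extend_eq_zero hx, Pi.single_eq_same]
    norm_num
  -- `R` reduces to a series constant in `y`, divides by `t` and puts `x = 0`.
  set R : Series p τ →ₗ[ℂ_[p]] Series p σ :=
    restrSeries p e ∘ₗ polyMul (coordInv p (e t)) ∘ₗ ρ with hRdef
  have hR : ∀ a, R a = restrSeries p e (polyMul (coordInv p (e t)) (ρ a)) := fun _ => rfl
  have hRx : ∀ a ∈ A, R (twistedDeriv F x a) = 0 := fun a ha => by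
    rw [hR, hρ2 a ha, map_zero, map_zero]
  have hRm : ∀ m ∈ A, constPart p y m = m →
      R m = restrSeries p e (polyMul (coordInv p (e t)) m) := fun m hm h => by
    rw [hR, hρm m hm h]
  have hTyA : ∀ m ∈ A, constPart p y m = m → twistedDeriv F y m ∈ A := fun m hm h => by
    rw [hTym m h]
    exact A.smul_mem _ (hcf _ _ (hcf _ _ hm))
  have hTyc : ∀ m, constPart p y m = m →
      constPart p y (twistedDeriv F y m) = twistedDeriv F y m := fun m h => by
    rw [hTym m h, map_smul, hct _ (hcx _ h)]
  have hTA : ∀ c ∈ A, ∀ j, twistedDeriv F j c ∈ A := fun c hc j =>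
    twistedDeriv_mem_overconv (suspendFun_mem_algFun he.injective hinvI hf) j hc
  refine ⟨hinj, fun a ha b hb hab => ?_, R, fun a ha => ?_, fun a ha => ?_, hRx, fun a ha => ?_,
    fun a ha j => ?_, fun a ha h0 => ?_⟩
  · obtain ⟨m, hm, hmc, c, hc, hac, -⟩ := hdec a ha
    have h1 : twistedDeriv F y m = twistedDeriv F x (b - twistedDeriv F y c) := by
      rw [map_sub, ← hab, hac, map_add, hcomm x y, add_sub_cancel_right]
    -- `T_y m = ϖ t x m` is constant in `y` and lies in the image of `T_x`, hence vanishes.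
    have h2 : twistedDeriv F y m = 0 := by
      rw [← hρm _ (hTyA m hm hmc) (hTyc m hmc), h1]
      exact hρ2 _ (A.sub_mem hb (hTA c hc y))
    rw [hTym m hmc, smul_eq_zero] at h2
    have h3 := congrArg (polyMul (coordInv p (e t))) (h2.resolve_left hϖ0)
    rw [polyMul_coordInv_coordFun, map_zero] at h3
    have h4 := congrArg (polyMul (coordInv p x)) h3
    rw [polyMul_coordInv_coordFun, map_zero] at h4
    exact ⟨c, hc, by rw [hac, h4, zero_add]⟩
  · obtain ⟨m, hm, hmc, c, hc, hac, hρa⟩ := hdec a ha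
    rw [hR, hρa]
    exact restrSeries_mem_overconv he.injective
      (fun j hj => (he.injective.mem_set_image).1 hj) (hcinv m hm)
  · have h1 : pullSeries p e a ∈ A :=
      pullSeries_mem_overconv he.injective hinvI ha
    rw [hRm _ (hcf _ _ h1), polyMul_coordInv_coordFun, restrSeries_pullSeries he.injective]
    refine hct _ ?_
    funext I
    rw [constPart_apply]
    split_ifs with h
    · rfl
    · rw [pullSeries_apply_of_ne _ hy h]
  · obtain ⟨m, hm, hmc, c, hc, hac, -⟩ := hdec a ha
    rw [hac, map_add, map_add, hcomm y x, hRx _ (hTA c hc y), add_zero,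
      hRm _ (hTyA m hm hmc) (hTyc m hmc), hTym m hmc, map_smul, polyMul_coordInv_coordFun, map_smul,
      hxzero m hm, smul_zero]
  · obtain ⟨m, hm, hmc, c, hc, hac, hρa⟩ := hdec a ha
    set T₀ := twistedDeriv (extendHom p he.injective f) (e j) with hT₀
    have hkey : R (twistedDeriv F (e j) a)
        = restrSeries p e (T₀ (polyMul (coordInv p (e t)) m)) := by
      rw [hac, map_add, map_add, hcomm (e j) x, hRx _ (hTA c hc _), add_zero, hTj]
      have hT₀m : T₀ m ∈ A := twistedDeriv_mem_overconv
        (extendHom_mem_algFun he.injective hinvI hf) _ hm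
      by_cases hj : j = t
      · subst hj
        -- `ϖ x y m` is congruent to `-∂_x (x m / t)` modulo the image of `∂_x + ϖ t y`
        set u := polyMul (coordInv p (e j)) (polyMul (coordFun p x) m) with hu
        have huA : u ∈ A := hcinv _ (hcf _ _ hm)
        have huc : constPart p y u = u := hci _ (hcx _ hmc)
        have h1 : ϖ • polyMul (coordFun p x) (polyMul (coordFun p y) m)
            = twistedDeriv F x u - seriesDeriv x u := by
          rw [hTx, add_sub_cancel_left, polyMul_comm, polyMul_comm (coordFun p (e j)),
            hu, polyMul_coordFun_coordInv]
        have h2 : seriesDeriv x u = polyMul (coordInv p (e j))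
            (m + polyMul (coordFun p x) (seriesDeriv x m)) := by
          rw [hu, seriesDeriv_polyMul, pderiv_coordInv_of_ne htx.symm, polyMul_zero,
            LinearMap.zero_apply, zero_add, seriesDeriv_polyMul, pderiv_coordFun, if_pos rfl,
            polyMul_one]
        rw [if_pos rfl, h1, ← add_sub_assoc, add_sub_right_comm, map_add, hRx u huA, add_zero,
          map_sub, hRm _ hT₀m (hcT j m hmc), hRm _ (seriesDeriv_mem_overconv x huA)
            (constPart_seriesDeriv hxy huc), h2, map_add, map_add, map_add,
          polyMul_comm (coordInv p (e j)) (coordFun p x),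
          polyMul_comm (coordInv p (e j)) (coordFun p x),
          hxzero _ (hcinv _ (hcinv _ (seriesDeriv_mem_overconv x hm))), add_zero, hT₀,
          twistedDeriv_polyMul, polyMul_pderiv_coordInv, map_add, map_neg]
        abel
      · rw [if_neg hj, add_zero, hRm _ hT₀m (hcT j m hmc), hT₀, twistedDeriv_polyMul,
          pderiv_coordInv_of_ne (fun h => hj (he.injective h)), polyMul_zero, LinearMap.zero_apply,
          zero_add]
    rw [hkey, hR, hρa, hT₀, twistedDeriv_apply, twistedDeriv_apply, map_add,
      seriesDeriv_restrSeries he.injective, polyMul_restrSeries he.injective, pderiv_extendHom]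
  · obtain ⟨m, hm, hmc, c, hc, hac, hρa⟩ := hdec a ha
    rw [hR, hρa] at h0
    -- If `m` vanishes at `x = 0`, it is divisible by `ϖ t x`, and the quotient `w` satisfies `T_y w
    -- = m`.
    set w : Series p τ := ϖ⁻¹ • polyMul (coordInv p x) (polyMul (coordInv p (e t)) m) with hw
    have hwA : w ∈ A := by
      refine A.smul_mem _ (mem_overconv_of_polarPart_eq_zero (t := x) ?_ ?_)
      · exact polyMul_mem_overconv (coordInv_mem_algFun (Set.mem_insert _ _))
          (overconv_mono (Set.subset_insert _ _) (hcinv m hm))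
      · rw [polarPart_eq_zero_iff]
        intro I hI
        rw [polyMul_coordInv]
        rcases (Int.lt_iff_add_one_le.1 hI).lt_or_eq with h | h
        · refine apply_eq_zero_of_neg (hcinv m hm) hxA ?_
          rwa [Pi.add_apply, Pi.single_eq_same]
        · by_cases hIy : I y = 0
          · have h1 := congrFun h0 ((I + Pi.single x 1) ∘ e)
            rw [restrSeries_apply, extend_comp_of_forall he.injective] at h1
            · exact h1
            · intro k hk
              rcases hcov k with rfl | rfl | hk'
              · rw [Pi.add_apply, Pi.single_eq_same, h]
              · rw [Pi.add_apply, Pi.single_eq_of_ne hxy.symm, hIy, add_zero]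
              · exact absurd hk' hk
          · rw [← hci m hmc, constPart_apply, if_neg]
            rwa [Pi.add_apply, Pi.single_eq_of_ne hxy.symm, add_zero]
    refine ⟨c, hc, w, hwA, ?_⟩
    have hwc : constPart p y w = w := by
      rw [hw, map_smul, constPart_polyMul _ (hci m hmc)]
      intro I hI
      rw [coordInv, AddMonoidAlgebra.coeff_single, Finsupp.single_apply] at hI
      split_ifs at hI with h'
      · rw [← h', Pi.neg_apply, Pi.single_eq_of_ne hxy.symm, neg_zero]
      · exact absurd rfl hI
    rw [hTym w hwc, hw, map_smul, map_smul, smul_smul, mul_inv_cancel₀ hϖ0, one_smul,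
      polyMul_coordFun_coordInv, polyMul_coordFun_coordInv, hac, add_comm]

end SuspensionResidue

noncomputable section SuspensionIso

variable {p : ℕ} [Fact p.Prime] {σ τ : Type} [Fintype σ] [LinearOrder σ] [Fintype τ]
  [LinearOrder τ] {e : σ → τ} {t : σ} {x y : τ} {inv : Set σ} {ϖ : ℂ_[p]} {f : LPoly p σ}

theorem suspendForm_eq (ω : Forms p σ) : suspendForm p e t x y ω =
    coeffwise (polyMul (coordFun p (e t))) (wedge p x (wedge p y (pullWith e (pullSeries p e) ω))) +
    coeffwise (polyMul (coordFun p x))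
      (wedge p (e t) (wedge p y (pullWith e (pullSeries p e) ω))) := by
  rw [suspendForm_apply, wedgeD_mul, wedgeD_coordFun, wedgeD_coordFun]

theorem contract_contract_suspendForm (hx : x ∉ Set.range e) (hy : y ∉ Set.range e) (hxy : x ≠ y)
    (ω : Forms p σ) : contract p y (contract p x (suspendForm p e t x y ω)) =
      coeffwise (polyMul (coordFun p (e t))) (pullWith e (pullSeries p e) ω) := by
  have htx : x ≠ e t := fun h => hx ⟨t, h.symm⟩
  have h0 : contract p x (wedge p y (pullWith e (pullSeries p e) ω)) = 0 := by
    rw [contract_wedge_of_ne hxy, contract_pullWith hx, map_zero, neg_zero]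
  rw [suspendForm_eq, map_add, ← coeffwise_contract, ← coeffwise_contract, contract_wedge_self, h0,
    contract_wedge_of_ne htx, h0, map_zero, map_zero, neg_zero, map_zero, sub_zero, add_zero,
    ← coeffwise_contract, contract_wedge_self, contract_pullWith hy, map_zero, sub_zero]

/-- If `t` is invertible, the map `ω ↦ d(t x) dy ω` is bijective on cohomology. -/
theorem suspendForm_bijective (he : StrictMono e) (hx : x ∉ Set.range e) (hy : y ∉ Set.range e)
    (hxy : x ≠ y) (hcov : ∀ k, k = x ∨ k = y ∨ k ∈ Set.range e) (ht : t ∈ inv)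
    (hf : f ∈ algFun p inv) (hϖ : ϖ ^ (p - 1) = -(p : ℂ_[p])) :
    (∀ k, ∀ ω ∈ formsOfDeg p inv k,
      (∃ θ ∈ formsOfDeg p (e '' inv) (k + 1),
        deRhamD (suspendFun he.injective ϖ t x y f) θ = suspendForm p e t x y ω) →
      ∃ θ ∈ formsOfDeg p inv (k - 1), deRhamD f θ = ω) ∧
    (∀ k, ∀ Ω ∈ formsOfDeg p (e '' inv) (k + 2),
      deRhamD (suspendFun he.injective ϖ t x y f) Ω = 0 →
      ∃ ω ∈ formsOfDeg p inv k, deRhamD f ω = 0 ∧ ∃ θ ∈ formsOfDeg p (e '' inv) (k + 1),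
        deRhamD (suspendFun he.injective ϖ t x y f) θ = Ω - suspendForm p e t x y ω) := by
  obtain ⟨hinj, hreg, R, hRmem, hRS, hRx, hRy, hRe, hR0⟩ :=
    exists_susp_residue (ϖ := ϖ) (f := f) he hx hy hxy hcov ht hf hϖ
  have hinvI : ∀ j, j ∈ inv → e j ∈ e '' inv := fun j hj => ⟨j, hj, rfl⟩
  have hF : suspendFun he.injective ϖ t x y f ∈ algFun p (e '' inv) :=
    suspendFun_mem_algFun he.injective hinvI hf
  set F := suspendFun he.injective ϖ t x y f
  -- The inverse on cohomology is `R` of the `dx dy` part.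
  set c : Forms p τ →ₗ[ℂ_[p]] Forms p σ := restrWith e R ∘ₗ contract p y ∘ₗ contract p x with hc
  have hcapply : ∀ Ω, c Ω = restrWith e R (contract p y (contract p x Ω)) := fun _ => rfl
  have hcmem : ∀ k, ∀ Ω ∈ formsOfDeg p (e '' inv) (k + 2), c Ω ∈ formsOfDeg p inv k :=
    fun k Ω hΩ => restrWith_mem_formsIn he hRmem (contract_mem_formsIn rfl y
      (contract_mem_formsIn (by ring : k + 2 = k + 1 + 1) x hΩ))
  have hcs : ∀ k, ∀ ω ∈ formsOfDeg p inv k, c (suspendForm p e t x y ω) = ω := fun k ω hω => by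
    rw [hcapply, contract_contract_suspendForm hx hy hxy, coeffwise_pullWith,
      restrWith_pullWith he]
    funext S
    exact hRS _ (hω S).1
  have hcD : ∀ k, ∀ Ω ∈ formsOfDeg p (e '' inv) k, c (deRhamD F Ω) = deRhamD f (c Ω) := by
    intro k Ω hΩ
    have h1 : ∀ j (Ω' : Forms p τ), contract p j (deRhamD F Ω')
      = coeffwise (twistedDeriv F j) Ω' - deRhamD F (contract p j Ω') := contract_koszulD
    have hx' : contract p x Ω ∈ formsIn (overconv p (e '' inv)) (k - 1) :=
      contract_mem_formsIn (by ring) x hΩ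
    have hy' : contract p y Ω ∈ formsIn (overconv p (e '' inv)) (k - 1) :=
      contract_mem_formsIn (by ring) y hΩ
    have hxy' : contract p y (contract p x Ω) ∈ formsIn (overconv p (e '' inv)) (k - 1 - 1) :=
      contract_mem_formsIn (by ring) y hx'
    have h2 : restrWith e R (contract p y (coeffwise (twistedDeriv F x) Ω)) = 0 := by
      rw [← coeffwise_contract]
      funext S
      exact hRx _ (hy' _).1
    have h3 : restrWith e R (coeffwise (twistedDeriv F y) (contract p x Ω)) = 0 := by
      funext S
      exact hRy _ (hx' _).1
    rw [hcapply, h1, map_sub, h1, map_sub, map_sub, h2, h3, zero_sub, zero_sub, neg_neg]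
    exact restrWith_koszulD he hRe hxy'
  refine ⟨fun k ω hω ⟨θ, hθ, hDθ⟩ => ⟨c θ, hcmem _ _ ?_, ?_⟩, fun k Ω hΩ hD => ?_⟩
  · have h : k - 1 + 2 = k + 1 := by ring
    rwa [h]
  · rw [← hcD _ _ hθ, hDθ, hcs k ω hω]
  · have hω := hcmem k Ω hΩ
    have hDω : deRhamD f (c Ω) = 0 := by rw [← hcD _ _ hΩ, hD, map_zero]
    refine ⟨c Ω, hω, hDω, ?_⟩
    have hsub : Ω - suspendForm p e t x y (c Ω) ∈ formsOfDeg p (e '' inv) (k + 2) :=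
      Submodule.sub_mem _ hΩ (suspendForm_mem_formsOfDeg he hinvI rfl hω)
    have hsubc : deRhamD F (Ω - suspendForm p e t x y (c Ω)) = 0 := by
      rw [map_sub, hD, deRhamD_suspendForm he hω, hDω, map_zero, sub_zero]
    have hc0 : c (Ω - suspendForm p e t x y (c Ω)) = 0 := by
      rw [map_sub, hcs k _ hω, sub_self]
    obtain ⟨θ, hθ, hDθ⟩ := exact_of_contract_contract_mem_range (T := twistedDeriv F)
      (fun j a ha => twistedDeriv_mem_overconv hF j ha) (fun i j a _ => twistedDeriv_comm F i j a)
      hxy hinj hreg hsub hsubc (fun S => by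
        by_cases hS : ∃ U : Finset σ, U.image e = S
        · obtain ⟨U, rfl⟩ := hS
          refine hR0 _ ?_ (congrFun hc0 U)
          exact ((contract_mem_formsIn rfl y
            (contract_mem_formsIn (by ring : k + 2 = k + 1 + 1) x hsub)) (U.image e)).1
        · refine ⟨0, Submodule.zero_mem _, 0, Submodule.zero_mem _, ?_⟩
          rw [map_zero, map_zero, add_zero, contract_apply]
          split_ifs with h1
          · rfl
          rw [contract_apply]
          split_ifs with h2
          · rw [smul_zero]
          exfalso
          refine hS ⟨univ.filter fun j => e j ∈ S, ?_⟩
          ext k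
          simp only [Finset.mem_image, Finset.mem_filter, Finset.mem_univ, true_and]
          constructor
          · rintro ⟨j, hj, rfl⟩; exact hj
          · intro hk
            obtain rfl | rfl | ⟨j, rfl⟩ := hcov k
            · exact absurd (Finset.mem_insert_of_mem hk) h2
            · exact absurd hk h1
            · exact ⟨j, hk, rfl⟩)
    refine ⟨θ, ?_, hDθ⟩
    have h : k + 2 - 1 = k + 1 := by ring
    rwa [h] at hθ

end SuspensionIso

/-! ### Series in the product `t x y` -/

noncomputable section DiagonalExtension

variable {p : ℕ} [Fact p.Prime] {σ τ : Type} [Fintype σ] [LinearOrder σ] [Fintype τ]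
  [LinearOrder τ] {e : σ → τ} {t : σ} {x y : τ} {inv : Set σ} {ϖ : ℂ_[p]} {f : LPoly p σ}

/-- The product of the pull-back of a series with `(t x) ^ d * ∑ k, c k * (t x y) ^ k`. -/
def diagExt (p : ℕ) [Fact p.Prime] {σ τ : Type} [DecidableEq σ] (e : σ → τ) (t : σ) (x y : τ)
    (d : ℕ) (c : ℤ → ℂ_[p]) : Series p σ →ₗ[ℂ_[p]] Series p τ where
  toFun a := fun J =>
    if J x = J y + d then c (J y) * a (J ∘ e - Pi.single t (J x)) else 0
  map_add' a b := by
    ext J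
    simp only [Pi.add_apply]
    split_ifs <;> ring
  map_smul' s a := by
    ext J
    simp only [Pi.smul_apply, smul_eq_mul, RingHom.id_apply]
    split_ifs <;> ring

theorem diagExt_apply (d : ℕ) (c : ℤ → ℂ_[p]) (a : Series p σ) (J : τ → ℤ) :
    diagExt p e t x y d c a J =
      if J x = J y + d then c (J y) * a (J ∘ e - Pi.single t (J x)) else 0 := rfl

theorem pullSeries_eq_diagExt (hx : x ∉ Set.range e) (hy : y ∉ Set.range e)
    (hcov : ∀ k, k = x ∨ k = y ∨ k ∈ Set.range e) :
    pullSeries p e = diagExt p e t x y 0 (Pi.single 0 1) := by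
  ext1 a
  funext J
  rw [diagExt_apply]
  by_cases hJy : J y = 0
  · by_cases hJx : J x = 0
    · rw [pullSeries_apply_of_forall, if_pos (by simp [hJx, hJy]), hJx, hJy, Pi.single_eq_same,
        one_mul, Pi.single_zero, sub_zero]
      intro k hk
      rcases hcov k with rfl | rfl | h
      exacts [hJx, hJy, absurd h hk]
    · rw [pullSeries_apply_of_ne a hx hJx, if_neg (by simpa [hJy] using hJx)]
  · rw [pullSeries_apply_of_ne a hy hJy, Pi.single_eq_of_ne hJy, zero_mul, ite_self]

theorem single_comp (he : e.Injective) (j : σ) (c : ℤ) :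
    (Pi.single (e j) c : τ → ℤ) ∘ e = Pi.single j c := by
  funext i
  by_cases h : i = j
  · subst h; simp
  · simp [h, he.ne h]

theorem single_comp_of_notMem {k : τ} (hk : k ∉ Set.range e) (c : ℤ) :
    (Pi.single k c : τ → ℤ) ∘ e = 0 := by
  funext i
  have : e i ≠ k := fun h => hk ⟨i, h⟩
  simp [this]

theorem polyMul_diagExt (he : e.Injective) (hx : x ∉ Set.range e) (hy : y ∉ Set.range e)
    (d : ℕ) (c : ℤ → ℂ_[p]) (g : LPoly p σ) (a : Series p σ) :
    polyMul (extendHom p he g) (diagExt p e t x y d c a)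
      = diagExt p e t x y d c (polyMul g a) := by
  induction g using AddMonoidAlgebra.induction_linear with
  | zero => simp
  | add g h hg hh =>
    rw [map_add, polyMul_add, polyMul_add, LinearMap.add_apply, LinearMap.add_apply, hg, hh,
      map_add]
  | single K s =>
    funext J
    have hKe : (Function.extend e K 0) ∘ e = K := by
      funext j
      exact he.extend_apply _ _ _
    have hsub : (J - Function.extend e K 0) ∘ e = J ∘ e - K := by
      conv_rhs => rw [← hKe]
      rfl
    rw [extendHom_single, polyMul_single, diagExt_apply, diagExt_apply, polyMul_single, hsub]
    simp only [Pi.sub_apply, extend_eq_zero hx, extend_eq_zero hy, sub_zero]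
    split_ifs
    · rw [sub_right_comm]; ring
    · rw [mul_zero]

/-- The coefficients of `(∂_s + ϖ) (s * ∑ k, c k * s ^ k)`. -/
def diagDeriv (ϖ : ℂ_[p]) (c : ℤ → ℂ_[p]) (k : ℤ) : ℂ_[p] :=
  ((k : ℂ_[p]) + 1) * c k + ϖ * c (k - 1)

theorem twistedDeriv_diagExt_x (he : e.Injective) (hx : x ∉ Set.range e) (hy : y ∉ Set.range e)
    (hxy : x ≠ y) (c : ℤ → ℂ_[p]) (a : Series p σ) :
    twistedDeriv (suspendFun he ϖ t x y f) x (diagExt p e t x y 1 c a)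
      = polyMul (coordFun p (e t)) (diagExt p e t x y 0 (diagDeriv ϖ c) a) := by
  have hxt : x ≠ e t := fun h => hx ⟨t, h.symm⟩
  have hyt : y ≠ e t := fun h => hy ⟨t, h.symm⟩
  funext J
  have h1 : (J + Pi.single x 1) ∘ e = J ∘ e := by
    rw [Pi.add_comp, single_comp_of_notMem hx, add_zero]
  have h2 : (J - (Pi.single (e t) 1 + Pi.single y 1)) ∘ e = J ∘ e - Pi.single t 1 := by
    rw [Pi.sub_comp, Pi.add_comp, single_comp_of_notMem hy, add_zero, single_comp he]
  have h3 : (J - Pi.single (e t) 1) ∘ e = J ∘ e - Pi.single t 1 := by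
    rw [Pi.sub_comp, single_comp he]
  rw [twistedDeriv_apply, pderiv_suspendFun_x he hx hxy, polyMul_smul, LinearMap.smul_apply,
    Pi.add_apply, seriesDeriv_apply, Pi.smul_apply, polyMul_coordFun_mul, polyMul_coordFun,
    diagExt_apply, diagExt_apply, diagExt_apply, h1, h2, h3]
  simp only [Pi.add_apply, Pi.sub_apply, Pi.single_eq_same, Pi.single_eq_of_ne hxy.symm,
    Pi.single_eq_of_ne hxt, Pi.single_eq_of_ne hyt, Pi.single_eq_of_ne hxy,
    sub_zero, add_zero, zero_add, Nat.cast_one, Nat.cast_zero, smul_eq_mul, diagDeriv]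
  by_cases h : J x = J y
  · rw [if_pos (by omega), if_pos (by omega), if_pos h, sub_sub, ← Pi.single_add, add_comm 1 (J x),
      ← h]
    ring
  · rw [if_neg (by omega), if_neg (by omega), if_neg h]
    ring

theorem twistedDeriv_diagExt (he : e.Injective) (hx : x ∉ Set.range e) (hy : y ∉ Set.range e)
    (hxy : x ≠ y) (c : ℤ → ℂ_[p]) (j : σ) (a : Series p σ) :
    twistedDeriv (suspendFun he ϖ t x y f) (e j) (diagExt p e t x y 1 c a)
      = diagExt p e t x y 1 c (twistedDeriv f j a) +
        (if j = t then polyMul (coordFun p x) ∘ₗ diagExt p e t x y 0 (diagDeriv ϖ c) else 0) a := by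
  have hxj : x ≠ e j := fun h => hx ⟨j, h.symm⟩
  have hyj : y ≠ e j := fun h => hy ⟨j, h.symm⟩
  rw [twistedDeriv_apply, pderiv_suspendFun he hx hy, polyMul_add, LinearMap.add_apply,
    polyMul_diagExt he hx hy, twistedDeriv_apply, map_add, ← add_assoc, add_right_comm,
    add_right_comm _ (diagExt p e t x y 1 c _) _, add_left_inj]
  funext J
  have h1 : (J + Pi.single (e j) 1) ∘ e = J ∘ e + Pi.single j 1 := by
    rw [Pi.add_comp, single_comp he]
  by_cases hj : j = t
  · subst hj
    have h2 : (J - (Pi.single x 1 + Pi.single y 1)) ∘ e = J ∘ e := by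
      rw [Pi.sub_comp, Pi.add_comp, single_comp_of_notMem hy, single_comp_of_notMem hx, add_zero,
        sub_zero]
    have h3 : (J - Pi.single x 1) ∘ e = J ∘ e := by
      rw [Pi.sub_comp, single_comp_of_notMem hx, sub_zero]
    rw [if_pos rfl, if_pos rfl, polyMul_smul, LinearMap.smul_apply, LinearMap.comp_apply,
      Pi.add_apply, Pi.add_apply, seriesDeriv_apply, Pi.smul_apply, polyMul_coordFun_mul,
      polyMul_coordFun, diagExt_apply, diagExt_apply, diagExt_apply, diagExt_apply,
      seriesDeriv_apply, h1, h2, h3]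
    simp only [Pi.add_apply, Pi.sub_apply, Pi.single_eq_same, Pi.single_eq_of_ne hxy.symm,
      Pi.single_eq_of_ne hxj, Pi.single_eq_of_ne hyj, Pi.single_eq_of_ne hxy, Function.comp_apply,
      sub_zero, add_zero, zero_add, Nat.cast_one, Nat.cast_zero, smul_eq_mul, diagDeriv]
    by_cases h : J x = J y + 1
    · have h4 : J ∘ e + Pi.single j 1 - Pi.single j (J x) = J ∘ e - Pi.single j (J x - 1) := by
        rw [sub_eq_iff_eq_add, Pi.single_sub]; abel
      have h5 : J ∘ e - Pi.single j (J x) + Pi.single j 1 = J ∘ e - Pi.single j (J x - 1) := by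
        rw [← h4]; abel
      rw [if_pos h, if_pos (by omega), if_pos h, if_pos (by omega), h4, h5, h]
      push_cast
      ring
    · rw [if_neg h, if_neg (by omega), if_neg h, if_neg (by omega)]
      ring
  · rw [if_neg hj, if_neg hj, polyMul_zero, LinearMap.zero_apply, LinearMap.zero_apply, add_zero,
      add_zero, seriesDeriv_apply, diagExt_apply, diagExt_apply, seriesDeriv_apply, h1]
    simp only [Pi.add_apply, Pi.sub_apply, Pi.single_eq_of_ne hxj, Pi.single_eq_of_ne hyj,
      Function.comp_apply, Pi.single_eq_of_ne hj, sub_zero, add_zero]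
    split_ifs
    · rw [add_sub_right_comm]; ring
    · rw [mul_zero]

/-- The differential of `dy` times the product of a form with `t x * ∑ k, c k * (t x y) ^ k`. -/
theorem deRhamD_wedge_diagExt (he : StrictMono e) (hx : x ∉ Set.range e) (hy : y ∉ Set.range e)
    (hxy : x ≠ y) (hcov : ∀ k, k = x ∨ k = y ∨ k ∈ Set.range e) (c : ℤ → ℂ_[p]) {k : ℤ}
    {ω : Forms p σ} (hω : ω ∈ formsOfDeg p inv k) :
    deRhamD (suspendFun he.injective ϖ t x y f)
        (wedge p y (pullWith e (diagExt p e t x y 1 c) ω))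
      = wedgeD (coordFun p (e t) * coordFun p x)
          (wedge p y (pullWith e (diagExt p e t x y 0 (diagDeriv ϖ c)) ω))
        - wedge p y (pullWith e (diagExt p e t x y 1 c) (deRhamD f ω)) := by
  classical
  rw [deRhamD_wedge, deRhamD_eq_koszulD, deRhamD_eq_koszulD,
    koszulD_pullWith_add (T' := twistedDeriv f) he (A := overconv p inv)
    (fun a _ j => twistedDeriv_diagExt he.injective hx hy hxy c j a) hω, map_add, map_add, map_sum,
    map_sum, Finset.sum_eq_single t, Finset.sum_eq_single x]
  · rw [if_pos rfl, coeffwise_pullWith, wedgeD_wedge, wedgeD_mul, wedgeD_coordFun, wedgeD_coordFun,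
      map_add, ← coeffwise_wedge, ← coeffwise_wedge,
      show twistedDeriv (suspendFun he.injective ϖ t x y f) x ∘ₗ diagExt p e t x y 1 c
        = polyMul (coordFun p (e t)) ∘ₗ diagExt p e t x y 0 (diagDeriv ϖ c) from
        LinearMap.ext fun a => twistedDeriv_diagExt_x he.injective hx hy hxy c a,
      ← coeffwise_pullWith, ← coeffwise_pullWith, coeffwise_wedge, coeffwise_wedge,
      coeffwise_wedge, coeffwise_wedge]
    abel
  · intro k hk hkx
    rcases hcov k with rfl | rfl | h
    · exact absurd rfl hkx
    · rw [wedge_self]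
    · simp only [Finset.mem_filter, Finset.mem_univ, true_and] at hk
      exact absurd h hk
  · intro h
    simp only [Finset.mem_filter, Finset.mem_univ, true_and, not_not] at h
    exact absurd h hx
  · intro j _ hj
    rw [if_neg hj, pullWith_zero, map_zero, map_zero]
  · simp

end DiagonalExtension

noncomputable section DiagonalBounds

variable {p : ℕ} [Fact p.Prime] {σ τ : Type} [Fintype σ] [LinearOrder σ] [Fintype τ]
  [LinearOrder τ] {e : σ → τ} {t : σ} {x y : τ} {inv : Set σ} {ϖ : ℂ_[p]} {f : LPoly p σ}

theorem expSize_le_comp_add (he : e.Injective) (hx : x ∉ Set.range e) (hy : y ∉ Set.range e)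
    (hxy : x ≠ y) (hcov : ∀ k, k = x ∨ k = y ∨ k ∈ Set.range e) (J : τ → ℤ) :
    expSize J ≤ expSize (J ∘ e) + (J x).natAbs + (J y).natAbs := by
  have h : J = Function.extend e (J ∘ e) 0 + Pi.single x (J x) + Pi.single y (J y) := by
    funext k
    rcases hcov k with rfl | rfl | ⟨j, rfl⟩
    · simp [extend_eq_zero hx, hxy]
    · simp [extend_eq_zero hy, hxy.symm]
    · have h1 : e j ≠ x := fun h => hx ⟨j, h⟩
      have h2 : e j ≠ y := fun h => hy ⟨j, h⟩
      simp [he.extend_apply, h1, h2]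
  have h1 := expSize_add_le (Function.extend e (J ∘ e) 0 + Pi.single x (J x)) (Pi.single y (J y))
  have h2 := expSize_add_le (Function.extend e (J ∘ e) 0) (Pi.single x (J x))
  rw [← h, expSize_single] at h1
  rw [expSize_extend he, expSize_single] at h2
  omega

theorem expSize_le_of_diag (he : e.Injective) (hx : x ∉ Set.range e) (hy : y ∉ Set.range e)
    (hxy : x ≠ y) (hcov : ∀ k, k = x ∨ k = y ∨ k ∈ Set.range e) {J : τ → ℤ} {d : ℕ}
    (hJy : 0 ≤ J y) (hJ : J x = J y + d) :
    expSize J ≤ expSize (J ∘ e - Pi.single t (J x)) + 3 * (J y).natAbs + 2 * d := by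
  have h1 := expSize_le_comp_add he hx hy hxy hcov J
  have h2 := expSize_le_sub_add (J ∘ e) (Pi.single t (J x))
  rw [expSize_single] at h2
  omega

theorem diagExt_apply_eq_zero (hx : x ∉ Set.range e) (hy : y ∉ Set.range e)
    (hxy : x ≠ y) (hcov : ∀ k, k = x ∨ k = y ∨ k ∈ Set.range e) {d : ℕ} {c : ℤ → ℂ_[p]}
    (hc : ∀ k < 0, c k = 0) {a : Series p σ} (ha : a ∈ overconv p inv) {J : τ → ℤ}
    (hJ : ¬ IsRegularExp (e '' inv) J) : diagExt p e t x y d c a J = 0 := by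
  rw [diagExt_apply]
  split_ifs with h
  swap
  · rfl
  by_cases hJy : J y < 0
  · rw [hc _ hJy, zero_mul]
  rw [ha.1, mul_zero]
  intro hreg
  refine hJ fun k hk => ?_
  rcases hcov k with rfl | rfl | ⟨j, rfl⟩
  · omega
  · omega
  · have h1 := hreg j fun h => hk ⟨j, h, rfl⟩
    have h2 : 0 ≤ (Pi.single t (J x) : σ → ℤ) j := by
      by_cases hjt : j = t
      · subst hjt
        rw [Pi.single_eq_same]; omega
      · rw [Pi.single_eq_of_ne hjt]
    rw [Pi.sub_apply, Function.comp_apply] at h1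
    omega

theorem diagExt_mem_overconv (he : e.Injective) (hx : x ∉ Set.range e) (hy : y ∉ Set.range e)
    (hxy : x ≠ y) (hcov : ∀ k, k = x ∨ k = y ∨ k ∈ Set.range e) {d : ℕ} {c : ℤ → ℂ_[p]}
    (hc : ∀ k < 0, c k = 0) {K s : ℝ} (hs0 : 0 < s) (hs1 : s < 1)
    (hK : ∀ k : ℤ, ‖c k‖ ≤ K * s ^ k.natAbs) {a : Series p σ} (ha : a ∈ overconv p inv) :
    diagExt p e t x y d c a ∈ overconv p (e '' inv) := by
  obtain ⟨-, C, r, hC, hr0, hr1, hbd⟩ := mem_overconv.1 ha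
  have hK0 : 0 ≤ K := by simpa using (norm_nonneg _).trans (hK 0)
  set u := max s r with hu
  have hu0 : 0 < u := lt_max_of_lt_left hs0
  have hu1 : u < 1 := max_lt hs1 hr1
  obtain ⟨D, v, hD, hv0, hv1, hv⟩ := exists_geometric_bound hu0 hu1 (K * C) (2 * d + 3)
  refine mem_overconv.2 ⟨fun J hJ => diagExt_apply_eq_zero hx hy hxy hcov hc ha hJ, D, v, hD, hv0,
    hv1, fun J => ?_⟩
  rw [diagExt_apply]
  split_ifs with h
  swap
  · rw [norm_zero]; positivity
  by_cases hJy : J y < 0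
  · rw [hc _ hJy, zero_mul, norm_zero]; positivity
  have hsz := expSize_le_of_diag (t := t) he hx hy hxy hcov (not_lt.1 hJy) h
  set I := J ∘ e - Pi.single t (J x)
  have h1 : ‖c (J y)‖ ≤ K * u ^ (J y).natAbs :=
    (hK _).trans (mul_le_mul_of_nonneg_left (pow_le_pow_left₀ hs0.le (le_max_left _ _) _) hK0)
  have h2 : ‖a I‖ ≤ C * u ^ expSize I :=
    (hbd _).trans (mul_le_mul_of_nonneg_left (pow_le_pow_left₀ hr0.le (le_max_right _ _) _) hC)
  have h3 := hv (expSize J) ((J y).natAbs + expSize I)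
    (by nlinarith [Nat.zero_le (d * ((J y).natAbs + expSize I))])
  rw [norm_mul]
  refine (mul_le_mul h1 h2 (norm_nonneg _) (by positivity)).trans (le_trans ?_ h3)
  rw [pow_add]
  have h4 : (1 : ℝ) ≤ (expSize J : ℝ) + 1 := by simp
  have h5 : 0 ≤ K * C * (u ^ (J y).natAbs * u ^ expSize I) := by positivity
  nlinarith

/-- The part with a pole along `t = 0` is overconvergent as soon as the coefficients `c` are
bounded: the pole orders of the series bound the powers of `t x y` that contribute. -/
theorem polarPart_diagExt_mem_overconv (he : e.Injective) (hx : x ∉ Set.range e)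
    (hy : y ∉ Set.range e) (hxy : x ≠ y) (hcov : ∀ k, k = x ∨ k = y ∨ k ∈ Set.range e) {d : ℕ}
    {c : ℤ → ℂ_[p]} (hc : ∀ k < 0, c k = 0) {K : ℝ}
    (hK : ∀ k : ℤ, ‖c k‖ ≤ K) {a : Series p σ} (ha : a ∈ overconv p inv) :
    polarPart p (e t) (diagExt p e t x y d c a) ∈ overconv p (e '' inv) := by
  have hK0 : 0 ≤ K := (norm_nonneg _).trans (hK 0)
  refine overconv_of_le ha (fun J hJ => ?_) K (2 * d + 4) fun J hJ => ?_
  · rw [polarPart_apply, diagExt_apply_eq_zero hx hy hxy hcov hc ha hJ, ite_self]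
  · rw [polarPart_apply, diagExt_apply] at hJ ⊢
    by_cases h1 : J (e t) < 0
    swap
    · rw [if_neg h1] at hJ
      exact absurd rfl hJ
    rw [if_pos h1] at hJ ⊢
    by_cases h2 : J x = J y + d
    swap
    · rw [if_neg h2] at hJ
      exact absurd rfl hJ
    rw [if_pos h2] at hJ ⊢
    have h3 : 0 ≤ J y := by
      by_contra h
      exact hJ (by rw [hc _ (not_le.1 h), zero_mul])
    refine ⟨J ∘ e - Pi.single t (J x), ?_, ?_⟩
    · have h4 := expSize_le_of_diag (t := t) he hx hy hxy hcov h3 h2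
      have h5 := natAbs_le_expSize (J ∘ e - Pi.single t (J x)) t
      simp only [Pi.sub_apply, Function.comp_apply, Pi.single_eq_same] at h5
      have h6 : (J y).natAbs ≤ (J (e t) - J x).natAbs := by omega
      nlinarith
    · rw [norm_mul]
      refine mul_le_mul_of_nonneg_right ((hK _).trans ?_) (norm_nonneg _)
      have h4 : (0 : ℝ) ≤ expSize J := by positivity
      nlinarith

/-- The coefficients of `(1 - exp (-ϖ s)) / (ϖ s)`, on which `diagDeriv` is the constant `1`. -/
def expCoeff (ϖ : ℂ_[p]) (k : ℤ) : ℂ_[p] :=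
  if 0 ≤ k then (-ϖ) ^ k.toNat / ((k.toNat + 1).factorial : ℂ_[p]) else 0

theorem norm_expCoeff_le (hϖ : ϖ ^ (p - 1) = -(p : ℂ_[p])) (k : ℤ) :
    ‖expCoeff ϖ k‖ ≤ ‖ϖ‖⁻¹ := by
  rw [expCoeff]
  split_ifs
  · have h := norm_pi_pow_div_factorial_le hϖ (k.toNat + 1)
    have h0 : 0 < ‖ϖ‖ := norm_pos_iff.2 (pi_ne_zero hϖ)
    rw [norm_div, norm_pow, pow_succ] at h
    rw [norm_div, norm_pow, norm_neg, ← one_div, le_div_iff₀ h0]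
    calc _ = ‖ϖ‖ ^ k.toNat * ‖ϖ‖ / ‖((k.toNat + 1).factorial : ℂ_[p])‖ := by ring
      _ ≤ 1 := h
  · rw [norm_zero]; positivity

theorem diagDeriv_expCoeff : diagDeriv ϖ (expCoeff ϖ) = Pi.single (0 : ℤ) 1 := by
  funext k
  rw [diagDeriv, expCoeff, expCoeff]
  rcases lt_trichotomy k 0 with h | rfl | h
  · rw [if_neg (by omega), if_neg (by omega), Pi.single_eq_of_ne h.ne]
    ring
  · simp
  · obtain ⟨n, rfl⟩ : ∃ n : ℕ, k = n + 1 := ⟨(k - 1).toNat, by omega⟩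
    have h1 : ((n : ℤ) + 1).toNat = n + 1 := by omega
    have h2 : ((n : ℤ) + 1 - 1).toNat = n := by omega
    rw [if_pos (by omega), if_pos (by omega), Pi.single_eq_of_ne h.ne', h1, h2,
      Nat.factorial_succ (n + 1)]
    have h3 : ((n + 1).factorial : ℂ_[p]) ≠ 0 := Nat.cast_ne_zero.2 (Nat.factorial_ne_zero _)
    have h4 : ((n + 1 + 1 : ℕ) : ℂ_[p]) ≠ 0 := Nat.cast_ne_zero.2 (Nat.succ_ne_zero _)
    push_cast at h4 ⊢
    field_simp
    ring

/-- If the differential of a form `ξ` with poles along `t = 0` is regular, then `d(t x) dy ξ` is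
regular up to exact forms. -/
theorem exists_suspendForm_sub_mem (he : StrictMono e) (hx : x ∉ Set.range e)
    (hy : y ∉ Set.range e) (hxy : x ≠ y) (hcov : ∀ k, k = x ∨ k = y ∨ k ∈ Set.range e)
    (ht : t ∉ inv) (hf : f ∈ algFun p inv)
    (hϖ : ϖ ^ (p - 1) = -(p : ℂ_[p])) {k : ℤ} {ξ : Forms p σ}
    (hξ : ξ ∈ formsOfDeg p (insert t inv) k) (hD : deRhamD f ξ ∈ formsOfDeg p inv (k + 1)) :
    ∃ η ∈ formsOfDeg p (e '' insert t inv) (k + 1),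
      suspendForm p e t x y ξ - deRhamD (suspendFun he.injective ϖ t x y f) η
        ∈ formsOfDeg p (e '' inv) (k + 2) := by
  have hxt : x ≠ e t := fun h => hx ⟨t, h.symm⟩
  have hyt : y ≠ e t := fun h => hy ⟨t, h.symm⟩
  have hinvI : ∀ j, j ∈ insert t inv → e j ∈ e '' insert t inv := fun j hj => ⟨j, hj, rfl⟩
  have hfb : f ∈ algFun p (insert t inv) := fun I hI j hj => hf I hI j fun h => hj (Or.inr h)
  have hF : suspendFun he.injective ϖ t x y f ∈ algFun p (e '' insert t inv) :=
    suspendFun_mem_algFun he.injective hinvI hfb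
  have hFt : ∀ I, (suspendFun he.injective ϖ t x y f).coeff I ≠ 0 → 0 ≤ I (e t) :=
    fun I hI => suspendFun_mem_algFun (ϖ := ϖ) (t := t) (x := x) (y := y) he.injective
      (fun j hj => Set.mem_image_of_mem e hj) hf I hI (e t)
      (fun h => ht ((he.injective.mem_set_image).1 h))
  set F := suspendFun he.injective ϖ t x y f
  -- The differential of the formal form `ζ` is `d(t x) dy ξ`, up to a term that contains `D ξ` and
  -- so has no pole. The form `ζ` need not be overconvergent, but its polar part is.
  set ζ := wedge p y (pullWith e (diagExt p e t x y 1 (expCoeff ϖ)) ξ) with hζ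
  have hDζ := deRhamD_wedge_diagExt (t := t) (ϖ := ϖ) (f := f) he hx hy hxy hcov (expCoeff ϖ) hξ
  have hneg : ∀ k < 0, expCoeff ϖ k = 0 := fun k hk => if_neg (not_le.2 hk)
  rw [diagDeriv_expCoeff, ← pullSeries_eq_diagExt hx hy hcov, ← suspendForm_apply, ← hζ] at hDζ
  have hη : coeffwise (polarPart p (e t)) ζ ∈ formsOfDeg p (e '' insert t inv) (k + 1) := by
    rw [hζ, coeffwise_wedge, coeffwise_pullWith]
    exact wedge_mem_formsIn rfl y (pullWith_mem_formsIn he (fun a ha =>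
      polarPart_diagExt_mem_overconv he.injective hx hy hxy hcov hneg (norm_expCoeff_le hϖ) ha) hξ)
  refine ⟨_, hη, mem_formsOfDeg_of_polarPart (t := e t) ?_ ?_⟩
  · rw [← Set.image_insert_eq]
    refine Submodule.sub_mem _ (suspendForm_mem_formsOfDeg he hinvI rfl hξ) ?_
    exact deRhamD_mem_formsOfDeg hF (by ring) hη
  · have h1 : coeffwise (polarPart p (e t)) (deRhamD F (coeffwise (polarPart p (e t)) ζ))
        = coeffwise (polarPart p (e t)) (deRhamD F ζ) := by
      rw [deRhamD_eq_koszulD, coeffwise_koszulD, coeffwise_koszulD, koszulD_apply, koszulD_apply]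
      refine Finset.sum_congr rfl fun k _ => ?_
      congr 1
      funext U
      exact polarPart_twistedDeriv hFt k (ζ U)
    rw [map_sub, h1, hDζ, map_sub, sub_sub_cancel, coeffwise_wedge, coeffwise_pullWith]
    have h2 : pullWith e (polarPart p (e t) ∘ₗ diagExt p e t x y 1 (expCoeff ϖ))
        (deRhamD f ξ) = 0 := by
      classical
      funext U
      rw [pullWith_apply]
      split_ifs
      swap
      · rfl
      rw [LinearMap.comp_apply]
      refine polarPart_eq_zero_iff.2 fun J hJ => ?_
      exact diagExt_apply_eq_zero hx hy hxy hcov hneg (hD _).1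
        fun h => absurd (h (e t) fun h' => ht ((he.injective.mem_set_image).1 h')) (not_le.2 hJ)
    rw [h2, map_zero]

/-- The cohomology of `e ^ F`, `F` the suspension of `f`, surjects onto that of forms with poles
along `t = 0`, and `ω ↦ d(t x) dy ω` kills the forms that are exact with poles along `t = 0`. -/
theorem suspendForm_regular (he : StrictMono e) (hx : x ∉ Set.range e)
    (hy : y ∉ Set.range e) (hxy : x ≠ y) (hcov : ∀ k, k = x ∨ k = y ∨ k ∈ Set.range e)
    (ht : t ∉ inv) (hf : f ∈ algFun p inv)
    (hϖ : ϖ ^ (p - 1) = -(p : ℂ_[p])) :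
    (∀ k, ∀ Ω ∈ formsOfDeg p (e '' insert t inv) (k + 2),
      deRhamD (suspendFun he.injective ϖ t x y f) Ω = 0 →
      ∃ θ ∈ formsOfDeg p (e '' insert t inv) (k + 1),
        Ω - deRhamD (suspendFun he.injective ϖ t x y f) θ ∈ formsOfDeg p (e '' inv) (k + 2)) ∧
    (∀ k, ∀ ω ∈ formsOfDeg p inv k,
      (∃ ξ ∈ formsOfDeg p (insert t inv) (k - 1), deRhamD f ξ = ω) →
      ∃ θ ∈ formsOfDeg p (e '' inv) (k + 1),
        deRhamD (suspendFun he.injective ϖ t x y f) θ = suspendForm p e t x y ω) := by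
  have hfb : f ∈ algFun p (insert t inv) := fun I hI j hj => hf I hI j fun h => hj (Or.inr h)
  constructor
  · intro k Ω hΩ hD
    obtain ⟨ω, hω, hDω, θ, hθ, hDθ⟩ :=
      (suspendForm_bijective (inv := insert t inv) he hx hy hxy hcov
        (Set.mem_insert _ _) hfb hϖ).2 k Ω hΩ hD
    obtain ⟨η, hη, h⟩ := exists_suspendForm_sub_mem (ϖ := ϖ) he hx hy hxy hcov ht hf hϖ hω
      (by rw [hDω]; exact Submodule.zero_mem _)
    refine ⟨θ + η, Submodule.add_mem _ hθ hη, ?_⟩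
    rw [map_add, hDθ]
    convert h using 1
    abel
  · rintro k ω hω ⟨ξ, hξ, hDξ⟩
    obtain ⟨η, hη, h⟩ := exists_suspendForm_sub_mem (ϖ := ϖ) he hx hy hxy hcov ht hf hϖ hξ
      (by rw [hDξ, sub_add_cancel]; exact hω)
    rw [show k - 1 + 2 = k + 1 by ring] at h
    refine ⟨_, h, ?_⟩
    rw [map_sub, deRhamD_deRhamD, sub_zero, deRhamD_suspendForm he hξ, hDξ]

end DiagonalBounds

/-! ### The coordinates of the suspension -/

noncomputable section Coordinates

variable {p : ℕ} [Fact p.Prime] {n m : ℕ}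

theorem strictMono_sumMap {a b : ℕ} {g : Fin a → Fin b} (hg : StrictMono g) :
    StrictMono (fun j : Fin a ⊕ₗ Fin m => (toLex (Sum.map g id (ofLex j)) : Fin b ⊕ₗ Fin m)) := by
  intro j k hjk
  rw [← toLex_ofLex j, ← toLex_ofLex k, Sum.Lex.toLex_lt_toLex] at hjk
  change toLex _ < toLex _
  rw [Sum.Lex.toLex_lt_toLex]
  cases hjk with
  | inl h => exact Sum.Lex.inl (hg h)
  | inr h => exact Sum.Lex.inr h
  | sep _ _ => exact Sum.Lex.sep _ _

theorem strictMono_coordEmb : StrictMono (coordEmb n m) :=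
  strictMono_sumMap (Fin.strictMono_castAdd 2)

theorem image_sumMap_torusCoord {a b : ℕ} (g : Fin a → Fin b) :
    (fun j : Coord a m => (toLex (Sum.map g id (ofLex j)) : Coord b m)) '' torusCoord a m
      = torusCoord b m := by
  ext k
  constructor
  · rintro ⟨j, hj, rfl⟩
    change (Sum.map g id (ofLex j)).isRight = true
    rw [Sum.isRight_map]
    exact hj
  · intro hk
    obtain ⟨k, rfl⟩ := toLex.surjective k
    rcases k with k | k
    · exact absurd hk (by simp [torusCoord])
    · exact ⟨toLex (Sum.inr k), by simp [torusCoord], rfl⟩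

theorem notMem_range_sumMap {a b : ℕ} {g : Fin a → Fin b} {k : Fin b} (hk : k ∉ Set.range g) :
    (toLex (Sum.inl k) : Coord b m) ∉
      Set.range (fun j : Coord a m => (toLex (Sum.map g id (ofLex j)) : Coord b m)) := by
  rintro ⟨j, hj⟩
  obtain ⟨j, rfl⟩ := toLex.surjective j
  rcases j with j | j
  · exact hk ⟨j, Sum.inl_injective (toLex.injective hj)⟩
  · exact absurd (toLex.injective hj) (by simp)

/-- The coordinates of `Y` and `t` among those of `Y × 𝔸²` and `t`. -/
abbrev coordEmbT (n m : ℕ) : CoordT n m → CoordT (n + 2) m := WithTop.map (coordEmb n m)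

theorem strictMono_coordEmbT : StrictMono (coordEmbT n m) := strictMono_coordEmb.withTop_map

theorem coordX_notMem_range : (coordX n m : CoordT (n + 2) m) ∉ Set.range (coordEmbT n m) := by
  rintro ⟨j, hj⟩
  induction j using WithTop.recTopCoe with
  | top => exact absurd hj (by simp)
  | coe j =>
    refine notMem_range_sumMap (m := m) (g := Fin.castAdd 2) (k := (⟨n, by omega⟩ : Fin (n + 2))) ?_
      ⟨j, WithTop.coe_injective hj⟩
    rintro ⟨i, hi⟩
    have := congrArg Fin.val hi
    simp only [Fin.val_castAdd] at this
    omega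

theorem coordY_notMem_range : (coordY n m : CoordT (n + 2) m) ∉ Set.range (coordEmbT n m) := by
  rintro ⟨j, hj⟩
  induction j using WithTop.recTopCoe with
  | top => exact absurd hj (by simp)
  | coe j =>
    refine notMem_range_sumMap (m := m) (g := Fin.castAdd 2)
      (k := (⟨n + 1, by omega⟩ : Fin (n + 2))) ?_ ⟨j, WithTop.coe_injective hj⟩
    rintro ⟨i, hi⟩
    have := congrArg Fin.val hi
    simp only [Fin.val_castAdd] at this
    omega

theorem coordX_ne_coordY : (coordX n m : CoordT (n + 2) m) ≠ coordY n m := by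
  intro h
  have h1 := Sum.inl_injective (toLex.injective (WithTop.coe_injective h))
  simp at h1

theorem eq_coordX_or_eq_coordY_or_mem_range (k : CoordT (n + 2) m) :
    k = coordX n m ∨ k = coordY n m ∨ k ∈ Set.range (coordEmbT n m) := by
  induction k using WithTop.recTopCoe with
  | top => exact Or.inr (Or.inr ⟨⊤, rfl⟩)
  | coe k =>
    obtain ⟨k, rfl⟩ := toLex.surjective k
    rcases k with ⟨k, hk⟩ | k
    · rcases lt_trichotomy k n with h | rfl | h
      · exact Or.inr (Or.inr ⟨((toLex (Sum.inl ⟨k, h⟩) : Coord n m) : CoordT n m), rfl⟩)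
      · exact Or.inl rfl
      · obtain rfl : k = n + 1 := by omega
        exact Or.inr (Or.inl rfl)
    · exact Or.inr (Or.inr ⟨((toLex (Sum.inr k) : Coord n m) : CoordT n m), rfl⟩)

theorem torusCoordT_eq_image : torusCoordT (n + 2) m = coordEmbT n m '' torusCoordT n m := by
  rw [torusCoordT, torusCoordT, ← image_sumMap_torusCoord (Fin.castAdd 2), Set.image_image,
    Set.image_image]
  rfl

theorem insert_torusCoordT_eq_image : insert ⊤ (torusCoordT (n + 2) m)
    = coordEmbT n m '' insert ⊤ (torusCoordT n m) := by
  rw [Set.image_insert_eq, ← torusCoordT_eq_image]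
  rfl

theorem top_notMem_torusCoordT : (⊤ : CoordT n m) ∉ torusCoordT n m := by
  rintro ⟨j, -, hj⟩
  exact absurd hj (by simp)

theorem extend_extend {σ τ ρ : Type} {e : σ → τ} {e' : τ → ρ} (he : e.Injective)
    (he' : e'.Injective) (f : LPoly p σ) :
    extendHom p he' (extendHom p he f) = extendHom p (he'.comp he) f := by
  induction f using AddMonoidAlgebra.induction_linear with
  | zero => simp
  | add f g hf hg => rw [map_add, map_add, map_add, hf, hg]
  | single I c =>
    rw [extendHom_single, extendHom_single, extendHom_single]
    congr 1
    funext k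
    by_cases hk : k ∈ Set.range e'
    · obtain ⟨k, rfl⟩ := hk
      rw [he'.extend_apply]
      by_cases hk' : k ∈ Set.range e
      · obtain ⟨k, rfl⟩ := hk'
        rw [he.extend_apply]
        exact ((he'.comp he).extend_apply _ _ _).symm
      · rw [extend_eq_zero hk', extend_eq_zero]
        rintro ⟨j, hj⟩
        exact hk' ⟨j, he' hj⟩
    · rw [extend_eq_zero hk, extend_eq_zero]
      rintro ⟨j, hj⟩
      exact hk ⟨e j, hj⟩

theorem extendHom_coordFun {σ τ : Type} [DecidableEq σ] [DecidableEq τ] {e : σ → τ}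
    (he : e.Injective) (j : σ) : extendHom p he (coordFun p j) = coordFun p (e j) := by
  rw [coordFun, coordFun, extendHom_single, extend_single he]

theorem smul_timesT_suspend (ϖ : ℂ_[p]) (P : LPoly p (Coord n m)) :
    ϖ • timesT (suspend P) = suspendFun (strictMono_coordEmbT (n := n) (m := m)).injective ϖ ⊤
      (coordX n m : CoordT (n + 2) m) (coordY n m : CoordT (n + 2) m) (ϖ • timesT P) := by
  have hc : (WithTop.some : Coord (n + 2) m → CoordT (n + 2) m).Injective := WithTop.coe_injective
  have hc' : (WithTop.some : Coord n m → CoordT n m).Injective := WithTop.coe_injective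
  have h1 : timesT (suspend P) = coordFun p (⊤ : CoordT (n + 2) m) * extendHom p hc
      (coordFun p (coordX n m) * coordFun p (coordY n m)
        + extendHom p strictMono_coordEmb.injective P) := rfl
  have h2 : timesT P = coordFun p (⊤ : CoordT n m) * extendHom p hc' P := rfl
  rw [h1, h2, suspendFun, map_smul, map_mul, map_add, map_mul, extendHom_coordFun,
    extendHom_coordFun, extendHom_coordFun, extend_extend, extend_extend]
  have h3 : coordEmbT n m ⊤ = ⊤ := rfl
  rw [h3, ← smul_add]
  congr 1
  rw [mul_add, mul_assoc]
  exact add_comm _ _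

theorem pullForm_eq_pullWith (ω : Forms p (CoordT n m)) :
    pullForm ω = pullWith (coordEmbT n m) (pullSeries p (coordEmbT n m)) ω := by
  classical
  funext S I
  rw [pullForm, pullWith_apply]
  by_cases h1 : ∀ k ∈ S, k ∈ Set.range (coordEmbT n m)
  · rw [if_pos h1]
    by_cases h2 : ∀ k, k ∉ Set.range (coordEmbT n m) → I k = 0
    · rw [pullSeries_apply_of_forall _ h2, if_pos]
      · congr!
      · exact fun j hj => ⟨fun h => hj (h1 j h), h2 j hj⟩
    · push Not at h2
      obtain ⟨k, hk, hk'⟩ := h2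
      rw [pullSeries_apply_of_ne _ hk hk', if_neg]
      exact fun h => hk' (h k hk).2
  · rw [if_neg h1, if_neg]
    · rfl
    · push Not at h1
      obtain ⟨k, hk, hk'⟩ := h1
      exact fun h => (h k hk').1 hk

theorem alphaForm_eq_suspendForm (ω : Forms p (CoordT n m)) :
    alphaForm ω = suspendForm p (coordEmbT n m) ⊤ (coordX n m : CoordT (n + 2) m)
      (coordY n m : CoordT (n + 2) m) ω := by
  rw [suspendForm_eq, alphaForm, pullForm_eq_pullWith]
  rfl

theorem suspend_mem_algFun {P : LPoly p (Coord n m)} (hP : P ∈ algFun p (torusCoord n m)) :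
    suspend P ∈ algFun p (torusCoord (n + 2) m) := by
  refine add_mem (mul_mem (coordFun_mem_algFun _ _) (coordFun_mem_algFun _ _)) ?_
  refine extendHom_mem_algFun (inv := torusCoord n m) strictMono_coordEmb.injective
    (fun j hj => ?_) hP
  rw [← image_sumMap_torusCoord (Fin.castAdd 2)]
  exact ⟨j, hj, rfl⟩

theorem norm_coeff_suspend_le {P : LPoly p (Coord n m)} (hP : ∀ I, ‖P.coeff I‖ ≤ 1) (I) :
    ‖(suspend P).coeff I‖ ≤ 1 := by
  have h1 : ‖(coordFun p (coordX n m) * coordFun p (coordY n m) :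
      LPoly p (Coord (n + 2) m)).coeff I‖ ≤ 1 := by
    rw [coordFun, coordFun, AddMonoidAlgebra.single_mul_single, AddMonoidAlgebra.coeff_single,
      Finsupp.single_apply]
    split_ifs <;> simp
  have h2 := norm_coeff_extendHom_le (strictMono_coordEmb (n := n) (m := m)).injective
    (zero_le_one) hP I
  rw [suspend, AddMonoidAlgebra.coeff_add, Finsupp.add_apply]
  exact (IsUltrametricDist.norm_add_le_max _ _).trans (max_le h1 h2)

theorem nonempty_poincare_equiv_HY (i : ℤ) : Nonempty (HY p n m i ≃ₗ[ℂ_[p]] HY p (n + 1) m i) := by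
  have h := nonempty_poincare_equiv (p := p) (inv := torusCoord n m)
    (e := fun j : Coord n m => (toLex (Sum.map Fin.castSucc id (ofLex j)) : Coord (n + 1) m))
    (x := toLex (Sum.inl (Fin.last n))) (strictMono_sumMap Fin.strictMono_castSucc)
    (notMem_range_sumMap (by
      rintro ⟨j, hj⟩
      exact absurd hj (Fin.castSucc_lt_last j).ne)) (fun k => ?_) i
  · rwa [image_sumMap_torusCoord] at h
  · obtain ⟨k, rfl⟩ := toLex.surjective k
    rcases k with k | k
    · rcases Fin.eq_castSucc_or_eq_last k with ⟨k, rfl⟩ | rfl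
      · exact Or.inr ⟨toLex (Sum.inl k), rfl⟩
      · exact Or.inl rfl
    · exact Or.inr ⟨toLex (Sum.inr k), rfl⟩

end Coordinates

/-! ### The cohomology of the suspension -/

noncomputable section SuspensionCohomology

variable {p : ℕ} [Fact p.Prime] {n m : ℕ} {ϖ : ℂ_[p]} {P : LPoly p (Coord n m)}

/-- A short exact sequence splits compatibly with a map `α` to its middle term, if no nonzero
value of `α` lies in the kernel of `q`. -/
theorem exists_equiv_prod {K E G M N : Type*} [Field K] [AddCommGroup E] [Module K E]
    [AddCommGroup G] [Module K G] [AddCommGroup M] [Module K M] [AddCommGroup N] [Module K N]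
    {δ : E →ₗ[K] M} {q : M →ₗ[K] G} {α : N →ₗ[K] M} (hδ : Function.Injective δ)
    (hex : Function.Exact δ q) (hq : Function.Surjective q) (hα : ∀ x, q (α x) = 0 → α x = 0) :
    ∃ Ψ : M ≃ₗ[K] E × G, ∀ x, Ψ (α x) = (0, q (α x)) := by
  obtain ⟨g, hg⟩ := LinearMap.exists_leftInverse_of_injective ((LinearMap.range α).mkQ ∘ₗ δ) (by
    rw [LinearMap.ker_eq_bot']
    intro u hu
    rw [LinearMap.comp_apply, Submodule.mkQ_apply, Submodule.Quotient.mk_eq_zero] at hu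
    obtain ⟨x, hx⟩ := hu
    have h1 : q (α x) = 0 := by rw [hx]; exact hex.apply_apply_eq_zero u
    apply hδ
    rw [← hx, hα x h1, map_zero])
  set r : M →ₗ[K] E := g ∘ₗ (LinearMap.range α).mkQ
  have hrδ : ∀ u, r (δ u) = u := fun u => LinearMap.congr_fun hg u
  have hrα : ∀ x, r (α x) = 0 := fun x => by
    have : (LinearMap.range α).mkQ (α x) = 0 := by
      rw [Submodule.mkQ_apply, Submodule.Quotient.mk_eq_zero]
      exact ⟨x, rfl⟩
    rw [LinearMap.comp_apply, this, map_zero]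
  refine ⟨LinearEquiv.ofBijective (r.prod q) ⟨?_, ?_⟩, fun x => ?_⟩
  · rw [← LinearMap.ker_eq_bot, LinearMap.ker_eq_bot']
    intro z hz
    replace hz : r z = 0 ∧ q z = 0 := Prod.mk_eq_zero.1 hz
    obtain ⟨u, rfl⟩ := (hex z).1 hz.2
    rw [← hrδ u, hz.1, map_zero]
  · rintro ⟨u, v⟩
    obtain ⟨z, rfl⟩ := hq v
    refine ⟨z + δ (u - r z), ?_⟩
    change (r _, q _) = _
    rw [map_add, hrδ, map_add, hex.apply_apply_eq_zero,
      add_sub_cancel, add_zero]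
  · change (r (α x), q (α x)) = _
    rw [hrα]

theorem exists_gysin_sequence_HX (hϖ : ϖ ^ (p - 1) = -(p : ℂ_[p]))
    (hP : P ∈ algFun p (torusCoord n m)) (hint : ∀ I, ‖P.coeff I‖ ≤ 1) :
    ∃ (a : ∀ i : ℤ, HX ϖ P i →ₗ[ℂ_[p]] HXbar ϖ P i)
      (b : ∀ i : ℤ, HXbar ϖ P i →ₗ[ℂ_[p]] HY p n m (i + 1))
      (δ : ∀ i : ℤ, HY p n m i →ₗ[ℂ_[p]] HX ϖ P i),
      (∀ i, Induces id (a i)) ∧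
      ∀ i, Function.Exact (δ i) (a i) ∧ Function.Exact (a i) (b i) ∧
        Function.Exact (b i) (δ (i + 1)) :=
  exists_gysin_sequence (e := (WithTop.some : Coord n m → CoordT n m)) WithTop.coe_strictMono
    (t := ⊤) (by rintro ⟨j, hj⟩; exact absurd hj (by simp))
    (fun k => by
      induction k using WithTop.recTopCoe with
      | top => exact Or.inl rfl
      | coe k => exact Or.inr ⟨k, rfl⟩) hϖ hP hint

theorem smul_timesT_mem_algFun (ϖ : ℂ_[p]) (hP : P ∈ algFun p (torusCoord n m)) :
    ϖ • timesT P ∈ algFun p (torusCoordT n m) :=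
  timesCoord_mem_algFun (e := (WithTop.some : Coord n m → CoordT n m)) WithTop.coe_injective
    (fun j hj => ⟨j, hj, rfl⟩) hP

theorem alphaForm_mem_closedForms {k l : ℤ} (hl : l = k + 2)
    {ω : Forms p (CoordT n m)} (hω : ω ∈ closedForms (torusCoordT n m) (ϖ • timesT P) k) :
    alphaForm ω ∈ closedForms (torusCoordT (n + 2) m) (ϖ • timesT (suspend P)) l := by
  rw [alphaForm_eq_suspendForm]
  refine ⟨suspendForm_mem_formsOfDeg (inv := torusCoordT n m) strictMono_coordEmbT
    (fun j hj => ?_) hl hω.1, ?_⟩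
  · rw [torusCoordT_eq_image]
    exact ⟨j, hj, rfl⟩
  · change deRhamD _ _ = 0
    rw [smul_timesT_suspend, deRhamD_suspendForm strictMono_coordEmbT hω.1,
      show deRhamD (ϖ • timesT P) ω = 0 from hω.2, map_zero]

set_option maxHeartbeats 1000000 in
/-- The cohomology of the suspension: its residue sequence breaks up into short exact sequences, in
which the cohomology with `t` invertible is that of `P`. -/
theorem exists_suspension_iso (hϖ : ϖ ^ (p - 1) = -(p : ℂ_[p]))
    (hP : P ∈ algFun p (torusCoord n m)) (hint : ∀ I, ‖P.coeff I‖ ≤ 1) (i : ℤ)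
    (a : HX ϖ P (i - 2) →ₗ[ℂ_[p]] HXbar ϖ P (i - 2)) (ha : Induces id a) :
    ∃ (α : HX ϖ P (i - 2) →ₗ[ℂ_[p]] HX ϖ (suspend P) i)
      (Ψ : HX ϖ (suspend P) i ≃ₗ[ℂ_[p]] HY p n m i × HXbar ϖ P (i - 2)),
      Induces alphaForm α ∧ ∀ x, Ψ (α x) = (0, a x) := by
  have hmono := strictMono_coordEmbT (n := n) (m := m)
  have hf := smul_timesT_mem_algFun ϖ hP
  have hfb : ϖ • timesT P ∈ algFun p (insert ⊤ (torusCoordT n m)) :=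
    fun I hI j hj => hf I hI j fun h => hj (Or.inr h)
  have hFeq := smul_timesT_suspend ϖ P
  have hdeg : i + 2 = i - 2 + 2 + 2 := by ring
  obtain ⟨hinj, hsurj⟩ := suspendForm_bijective (ϖ := ϖ) (f := ϖ • timesT P) (t := ⊤)
    (inv := insert ⊤ (torusCoordT n m)) hmono coordX_notMem_range
    coordY_notMem_range coordX_ne_coordY eq_coordX_or_eq_coordY_or_mem_range (Set.mem_insert _ _)
    hfb hϖ
  obtain ⟨hreg, hker⟩ := suspendForm_regular (ϖ := ϖ) (f := ϖ • timesT P) (t := ⊤)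
    (inv := torusCoordT n m) hmono coordX_notMem_range
    coordY_notMem_range coordX_ne_coordY eq_coordX_or_eq_coordY_or_mem_range top_notMem_torusCoordT
    hf hϖ
  rw [← insert_torusCoordT_eq_image, ← hFeq] at hreg hinj hsurj
  rw [← torusCoordT_eq_image, ← hFeq] at hker
  rw [← torusCoordT_eq_image] at hreg
  simp only [← alphaForm_eq_suspendForm] at hinj hsurj hker
  have hadd : ∀ ω η : Forms p (CoordT n m), alphaForm (ω + η) = alphaForm ω + alphaForm η :=
    fun ω η => by simp only [alphaForm_eq_suspendForm, map_add]
  have hsmul : ∀ (c : ℂ_[p]) (ω : Forms p (CoordT n m)), alphaForm (c • ω) = c • alphaForm ω :=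
    fun c ω => by simp only [alphaForm_eq_suspendForm, map_smul]
  have hD : ∀ (inv : Set (CoordT n m)) (k : ℤ), ∀ ω ∈ formsOfDeg p inv k,
      deRhamD (ϖ • timesT (suspend P)) (alphaForm ω) = alphaForm (deRhamD (ϖ • timesT P) ω) :=
    fun inv k ω hω => by
      rw [hFeq, alphaForm_eq_suspendForm, alphaForm_eq_suspendForm, deRhamD_suspendForm hmono hω]
  have hmem : ∀ k l, l = k + 2 → ∀ ω ∈ formsOfDeg p (torusCoordT n m) k,
      alphaForm ω ∈ formsOfDeg p (torusCoordT (n + 2) m) l := fun k l hl ω hω => by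
    rw [alphaForm_eq_suspendForm, torusCoordT_eq_image]
    exact suspendForm_mem_formsOfDeg hmono (fun j hj => Set.mem_image_of_mem _ hj) hl hω
  have hmemb : ∀ k l, l = k + 2 → ∀ ω ∈ formsOfDeg p (insert ⊤ (torusCoordT n m)) k,
      alphaForm ω ∈ formsOfDeg p (insert ⊤ (torusCoordT (n + 2) m)) l := fun k l hl ω hω => by
    rw [alphaForm_eq_suspendForm, insert_torusCoordT_eq_image]
    exact suspendForm_mem_formsOfDeg hmono (fun j hj => Set.mem_image_of_mem _ hj) hl hω
  obtain ⟨α, hα⟩ := exists_induces (inv := torusCoordT n m) (f := ϖ • timesT P) (k := i - 2 + 2)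
    (inv' := torusCoordT (n + 2) m) (g := ϖ • timesT (suspend P)) (l := i + 2)
    alphaForm (fun ω _ η _ => hadd ω η) (fun c ω _ => hsmul c ω)
    (fun ω hω => alphaForm_mem_closedForms hdeg hω)
    (fun θ hθ _ => ⟨_, hmem _ _ (by ring) θ hθ, hD _ _ θ hθ⟩)
  obtain ⟨β, hβ⟩ := exists_induces (inv := insert ⊤ (torusCoordT n m)) (f := ϖ • timesT P)
    (k := i - 2 + 2)
    (inv' := insert ⊤ (torusCoordT (n + 2) m)) (g := ϖ • timesT (suspend P)) (l := i + 2)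
    alphaForm (fun ω _ η _ => hadd ω η) (fun c ω _ => hsmul c ω)
    (fun ω hω => ⟨hmemb _ _ hdeg ω hω.1, by
      change deRhamD _ _ = 0
      rw [hD _ _ ω hω.1, show deRhamD (ϖ • timesT P) ω = 0 from hω.2, ← zero_smul ℂ_[p] ω, hsmul,
        zero_smul]⟩)
    (fun θ hθ _ => ⟨_, hmemb _ _ (by ring) θ hθ, hD _ _ θ hθ⟩)
  -- With `t` invertible, `alphaForm` is bijective on cohomology.
  have hβinj : Function.Injective β := by
    rw [← LinearMap.ker_eq_bot, LinearMap.ker_eq_bot']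
    intro z hz
    obtain ⟨ω, rfl⟩ := Submodule.Quotient.mk_surjective _ z
    obtain ⟨h1, h2⟩ := hβ ω
    rw [h2, mk_eq_zero_iff] at hz
    rw [mk_eq_zero_iff]
    refine hinj _ _ ω.2.1 ?_
    rwa [show i + 2 - 1 = i - 2 + 2 + 1 by ring] at hz
  have hβsurj : Function.Surjective β := by
    intro z
    obtain ⟨Ω, rfl⟩ := Submodule.Quotient.mk_surjective _ z
    obtain ⟨ω, hω, hDω, θ, hθ, hDθ⟩ := hsurj (i - 2 + 2) Ω (by rw [← hdeg]; exact Ω.2.1) Ω.2.2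
    refine ⟨Submodule.Quotient.mk ⟨ω, hω, hDω⟩, ?_⟩
    obtain ⟨h1, h2⟩ := hβ ⟨ω, hω, hDω⟩
    rw [h2, eq_comm, mk_eq_mk_iff]
    refine ⟨θ, ?_, hDθ⟩
    rwa [show i + 2 - 1 = i - 2 + 2 + 1 by ring]
  obtain ⟨a', b', δ', ha', hex⟩ := exists_gysin_sequence_HX (ϖ := ϖ) hϖ (suspend_mem_algFun hP)
    (norm_coeff_suspend_le hint)
  -- Every class with `t` invertible has a regular representative, so the connecting maps of the
  -- residue sequence of the suspension are injective.
  have ha'surj : ∀ j, Function.Surjective (a' j) := by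
    intro j z
    obtain ⟨Ω, rfl⟩ := Submodule.Quotient.mk_surjective _ z
    obtain ⟨θ, hθ, h⟩ := hreg j Ω Ω.2.1 Ω.2.2
    have hc : deRhamD (ϖ • timesT (suspend P)) ((Ω : Forms p (CoordT (n + 2) m)) -
        deRhamD (ϖ • timesT (suspend P)) θ) = 0 := by
      rw [map_sub, deRhamD_deRhamD, sub_zero]
      exact Ω.2.2
    refine ⟨Submodule.Quotient.mk ⟨_, h, hc⟩, ?_⟩
    obtain ⟨h1, h2⟩ := ha' j ⟨_, h, hc⟩
    rw [h2, eq_comm, mk_eq_mk_iff]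
    refine ⟨θ, ?_, ?_⟩
    · rwa [show j + 2 - 1 = j + 1 by ring]
    · exact (sub_sub_cancel _ _).symm
  have hδinj : Function.Injective (δ' i) := by
    obtain ⟨j, rfl⟩ : ∃ j, i = j + 1 := ⟨i - 1, by ring⟩
    rw [← LinearMap.ker_eq_bot, LinearMap.ker_eq_bot']
    intro u hu
    obtain ⟨z, rfl⟩ := ((hex j).2.2 u).1 hu
    obtain ⟨w, rfl⟩ := ha'surj j z
    exact (hex j).2.1.apply_apply_eq_zero w
  obtain ⟨E₁⟩ := nonempty_poincare_equiv_HY (p := p) (n := n) (m := m) i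
  obtain ⟨E₂⟩ := nonempty_poincare_equiv_HY (p := p) (n := n + 1) (m := m) i
  set B := LinearEquiv.ofBijective β ⟨hβinj, hβsurj⟩ with hB
  set q : HX ϖ (suspend P) i →ₗ[ℂ_[p]] HXbar ϖ P (i - 2) := B.symm.toLinearMap ∘ₗ a' i with hq
  have hqα : ∀ x, q (α x) = a x := by
    intro x
    obtain ⟨ω, rfl⟩ := Submodule.Quotient.mk_surjective _ x
    obtain ⟨h1, h2⟩ := hα ω
    obtain ⟨h3, h4⟩ := ha ω
    obtain ⟨h5, h6⟩ := ha' i ⟨_, h1⟩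
    obtain ⟨h7, h8⟩ := hβ ⟨_, h3⟩
    rw [h2, h4, hq, LinearMap.comp_apply, h6, LinearEquiv.coe_coe, LinearEquiv.symm_apply_eq]
    exact h8.symm
  obtain ⟨Ψ, hΨ⟩ := exists_equiv_prod (δ := δ' i ∘ₗ (E₁.trans E₂).toLinearMap) (q := q) (α := α)
    (hδinj.comp (E₁.trans E₂).injective)
    (fun z => by
      have h1 : q z = 0 ↔ a' i z = 0 := by
        rw [hq, LinearMap.comp_apply, LinearEquiv.coe_coe, LinearEquiv.map_eq_zero_iff]
      rw [h1, (hex i).1 z]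
      constructor
      · rintro ⟨u, rfl⟩
        exact ⟨(E₁.trans E₂).symm u, by simp⟩
      · rintro ⟨u, rfl⟩
        exact ⟨_, rfl⟩)
    (B.symm.surjective.comp (ha'surj i))
    (fun x hx => by
      rw [hqα] at hx
      obtain ⟨ω, rfl⟩ := Submodule.Quotient.mk_surjective _ x
      obtain ⟨h1, h2⟩ := hα ω
      obtain ⟨h3, h4⟩ := ha ω
      rw [h4, mk_eq_zero_iff] at hx
      rw [h2, mk_eq_zero_iff]
      have := hker _ _ ω.2.1 hx
      rwa [show i + 2 - 1 = i - 2 + 2 + 1 by ring])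
  exact ⟨α, Ψ, hα, fun x => by rw [hΨ, hqα]⟩

end SuspensionCohomology

/-! ### Exponentials of power series and the Artin–Hasse exponential -/

noncomputable section ArtinHasse

namespace PowerSeries

variable {K : Type*} [Field K] [CharZero K]

/-- A first-order linear differential equation has at most one solution with a given constant
term. -/
theorem eq_of_derivative_eq_mul {g V W : PowerSeries K} (hV : derivative K V = g * V)
    (hW : derivative K W = g * W) (h0 : constantCoeff V = constantCoeff W) : V = W := by
  ext d
  induction d using Nat.strong_induction_on with
  | _ d ih =>
    rcases d with - | d
    · simpa using h0
    · have h1 := congrArg (coeff d) hV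
      have h2 := congrArg (coeff d) hW
      rw [coeff_derivative, coeff_mul] at h1 h2
      have h3 : ((d : K) + 1) ≠ 0 := by exact_mod_cast Nat.succ_ne_zero d
      refine mul_right_cancel₀ h3 (h1.trans (Eq.trans ?_ h2.symm))
      refine Finset.sum_congr rfl fun x hx => ?_
      rw [HasAntidiagonal.mem_antidiagonal] at hx
      rw [ih x.2 (by omega)]

/-- The exponential of a power series without constant term. -/
def pexp (G : PowerSeries K) : PowerSeries K := (exp K).subst G

variable {G H : PowerSeries K}

theorem coeff_pexp (hG : constantCoeff G = 0) (d : ℕ) :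
    coeff d (pexp G) = ∑ᶠ k : ℕ, ((k.factorial : K))⁻¹ * coeff d (G ^ k) := by
  rw [pexp, coeff_subst' (HasSubst.of_constantCoeff_zero' hG)]
  refine finsum_congr fun k => ?_
  simp [coeff_exp]

theorem constantCoeff_pexp (hG : constantCoeff G = 0) : constantCoeff (pexp G) = 1 := by
  rw [← coeff_zero_eq_constantCoeff_apply, coeff_pexp hG, finsum_eq_single _ 0]
  · simp
  · intro k hk
    simp [hG, hk]

theorem derivative_pexp (hG : constantCoeff G = 0) :
    derivative K (pexp G) = derivative K G * pexp G := by
  rw [pexp, derivative_subst (HasSubst.of_constantCoeff_zero' hG), derivative_exp, mul_comm]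

theorem pexp_zero : pexp (0 : PowerSeries K) = 1 := by
  refine eq_of_derivative_eq_mul (g := 0) ?_ ?_ ?_
  · rw [derivative_pexp (by simp)]; simp
  · simp
  · rw [constantCoeff_pexp (by simp)]; simp

theorem pexp_add (hG : constantCoeff G = 0) (hH : constantCoeff H = 0) :
    pexp (G + H) = pexp G * pexp H := by
  have h : constantCoeff (G + H) = 0 := by simp [hG, hH]
  refine eq_of_derivative_eq_mul (derivative_pexp h) ?_ ?_
  · rw [Derivation.leibniz, derivative_pexp hG, derivative_pexp hH, map_add, smul_eq_mul,
      smul_eq_mul]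
    ring
  · simp [constantCoeff_pexp, hG, hH, h]

theorem pexp_nsmul (hG : constantCoeff G = 0) (k : ℕ) : pexp (k • G) = pexp G ^ k := by
  induction k with
  | zero => simp [pexp_zero]
  | succ k ih => rw [succ_nsmul, pexp_add (by simp [hG]) hG, ih, pow_succ]

theorem pexp_expand {q : ℕ} (hq : q ≠ 0) (hG : constantCoeff G = 0) :
    pexp (expand q hq G) = expand q hq (pexp G) := by
  rw [pexp, pexp, expand_apply, expand_apply, subst_comp_subst_apply
    (HasSubst.of_constantCoeff_zero' hG) (HasSubst.X_pow hq)]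

theorem pexp_rescale (c : K) (hG : constantCoeff G = 0) :
    pexp (rescale c G) = rescale c (pexp G) := by
  rw [pexp, pexp, rescale_eq_subst, rescale_eq_subst, subst_comp_subst_apply
    (HasSubst.of_constantCoeff_zero' hG) (HasSubst.smul_X' c)]

theorem pexp_smul_X (c : K) (k : ℕ) :
    coeff k (pexp (c • (X : PowerSeries K))) = c ^ k * ((k.factorial : K))⁻¹ := by
  rw [pexp, ← rescale_eq_subst, coeff_rescale, coeff_exp]
  simp

theorem pexp_map {L : Type*} [Field L] [CharZero L] (φ : K →+* L) (hG : constantCoeff G = 0) :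
    pexp (map φ G) = map φ (pexp G) := by
  ext d
  have hG' : constantCoeff (map φ G) = 0 := by
    rw [← coeff_zero_eq_constantCoeff_apply, coeff_map, coeff_zero_eq_constantCoeff_apply, hG,
      map_zero]
  rw [coeff_map, coeff_pexp hG, coeff_pexp hG', map_finsum]
  · refine finsum_congr fun k => ?_
    rw [map_mul, map_inv₀, map_natCast, ← coeff_map, map_pow (PowerSeries.map φ)]
  · have h := coeff_subst_finite' (HasSubst.of_constantCoeff_zero' hG) (exp K) d
    refine h.subset fun k hk => ?_
    simpa [coeff_exp] using hk

open scoped Classical in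
/-- The logarithm `∑ X ^ (p ^ i) / p ^ i` of the Artin–Hasse exponential. -/
def artinHasseLog (K : Type*) [Field K] (p : ℕ) : PowerSeries K :=
  mk fun N => if ∃ i, N = p ^ i then (N : K)⁻¹ else 0

theorem constantCoeff_artinHasseLog (p : ℕ) : constantCoeff (artinHasseLog K p) = 0 := by
  rw [← coeff_zero_eq_constantCoeff_apply, artinHasseLog, coeff_mk]
  simp

theorem nsmul_artinHasseLog (p : ℕ) [hp : Fact p.Prime] :
    p • artinHasseLog K p
      = expand p hp.out.ne_zero (artinHasseLog K p) + (p : K) • (X : PowerSeries K) := by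
  ext N
  have hp0 := hp.out.ne_zero
  have hp0' : (p : K) ≠ 0 := by exact_mod_cast hp0
  rw [map_nsmul, map_add, coeff_smul, coeff_X, nsmul_eq_mul, smul_eq_mul]
  by_cases hN : p ∣ N
  · obtain ⟨M, rfl⟩ := hN
    have h1 : p * M ≠ 1 := fun h => hp.out.one_lt.ne' (Nat.eq_one_of_mul_eq_one_right h)
    rw [coeff_expand_mul, if_neg h1, mul_zero, add_zero, artinHasseLog, coeff_mk, coeff_mk]
    have h2 : (∃ i, p * M = p ^ i) ↔ ∃ i, M = p ^ i := by
      constructor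
      · rintro ⟨i, hi⟩
        rcases i with - | i
        · exact absurd hi h1
        · exact ⟨i, Nat.eq_of_mul_eq_mul_left hp.out.pos (hi.trans (pow_succ' _ _))⟩
      · rintro ⟨i, rfl⟩
        exact ⟨i + 1, (pow_succ' _ _).symm⟩
    by_cases h3 : ∃ i, M = p ^ i
    · rw [if_pos (h2.2 h3), if_pos h3, Nat.cast_mul, mul_inv, ← mul_assoc, mul_inv_cancel₀ hp0',
        one_mul]
    · rw [if_neg fun h => h3 (h2.1 h), if_neg h3, mul_zero]
  · rw [coeff_expand_of_not_dvd _ _ _ hN, zero_add, artinHasseLog, coeff_mk]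
    by_cases h1 : N = 1
    · subst h1
      rw [if_pos ⟨0, (pow_zero p).symm⟩, if_pos rfl, Nat.cast_one, inv_one]
    · rw [if_neg, if_neg h1]
      rintro ⟨i, rfl⟩
      rcases i with - | i
      · exact h1 (pow_zero p)
      · exact hN (dvd_pow_self _ (Nat.succ_ne_zero i))

/-- The relation between the Artin–Hasse exponential and its Frobenius twist. -/
theorem artinHasse_pow (p : ℕ) [hp : Fact p.Prime] :
    pexp (artinHasseLog K p) ^ p = expand p hp.out.ne_zero (pexp (artinHasseLog K p)) *
      pexp ((p : K) • (X : PowerSeries K)) := by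
  have h0 := constantCoeff_artinHasseLog (K := K) p
  have h1 : constantCoeff (expand p hp.out.ne_zero (artinHasseLog K p)) = 0 := by
    rw [constantCoeff_expand, h0]
  rw [← pexp_nsmul h0, nsmul_artinHasseLog, pexp_add h1 (by simp), pexp_expand _ h0]

end PowerSeries

open PowerSeries

variable (p : ℕ) [hp : Fact p.Prime]

/-- Over `ℤ_p`, raising to the power `p` agrees with substituting `X ^ p` up to multiples
of `p`. -/
theorem exists_pow_eq_expand_add (A : Polynomial ℤ_[p]) :
    ∃ B : Polynomial ℤ_[p], A ^ p = Polynomial.expand ℤ_[p] p A + Polynomial.C (p : ℤ_[p]) * B := by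
  have h : Polynomial.C (p : ℤ_[p]) ∣ A ^ p - Polynomial.expand ℤ_[p] p A := by
    rw [Polynomial.C_dvd_iff_dvd_coeff]
    intro d
    rw [← Ideal.mem_span_singleton, ← PadicInt.maximalIdeal_eq_span_p, ← PadicInt.ker_toZMod,
      RingHom.mem_ker, ← Polynomial.coeff_map, Polynomial.map_sub, Polynomial.map_pow,
      Polynomial.map_expand, ZMod.expand_card, sub_self, Polynomial.coeff_zero]
  obtain ⟨B, hB⟩ := h
  exact ⟨B, by rw [← hB]; ring⟩

/-- `p ^ k / k!` is divisible by `p` for `k ≥ 1`. -/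
theorem norm_pow_div_factorial_le {k : ℕ} (hk : k ≠ 0) :
    ‖((p : ℚ_[p]) ^ k * ((k.factorial : ℚ_[p]))⁻¹)‖ ≤ ‖(p : ℚ_[p])‖ := by
  have hp1 := hp.out.one_lt
  have hp0 : (1 : ℝ) < p := by exact_mod_cast hp1
  have hv : padicValNat p k.factorial ≤ k - 1 := by
    have h1 := sub_one_mul_padicValNat_factorial (p := p) k
    have h2 : 1 ≤ (p.digits k).sum := by
      by_contra hcon
      have h3 : (p.digits k).sum = 0 := by omega
      rw [List.sum_eq_zero_iff] at h3
      have h4 := Nat.ofDigits_digits p k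
      have h5 : ∀ l : List ℕ, (∀ x ∈ l, x = 0) → Nat.ofDigits p l = 0 := by
        intro l
        induction l with
        | nil => simp
        | cons a l ih =>
          intro h
          rw [Nat.ofDigits_cons, h a (by simp), ih fun x hx => h x (by simp [hx])]
          simp
      exact hk (h4.symm.trans (h5 _ h3))
    have h6 : padicValNat p k.factorial ≤ (p - 1) * padicValNat p k.factorial :=
      Nat.le_mul_of_pos_left _ (by omega)
    omega
  have h0 : (k.factorial : ℚ_[p]) ≠ 0 := by exact_mod_cast k.factorial_ne_zero
  rw [norm_mul, norm_pow, norm_inv, Padic.norm_eq_zpow_neg_valuation h0, Padic.valuation_natCast,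
    Padic.norm_p, zpow_neg, zpow_natCast, inv_inv, inv_pow]
  rw [← div_eq_inv_mul, div_le_iff₀ (by positivity), ← div_eq_inv_mul,
    le_div_iff₀ (by positivity), ← pow_succ]
  exact pow_le_pow_right₀ hp0.le (by omega)

/-- Dwork's lemma for the Artin–Hasse exponential: its coefficients are `p`-adic integers. -/
theorem norm_coeff_artinHasse_le (n : ℕ) :
    ‖coeff n (pexp (artinHasseLog ℚ_[p] p))‖ ≤ 1 := by
  set W := pexp (artinHasseLog ℚ_[p] p) with hW
  have hp0 := hp.out.ne_zero
  induction n using Nat.strong_induction_on with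
  | _ n ih =>
    rcases Nat.eq_zero_or_pos n with rfl | hn
    · rw [coeff_zero_eq_constantCoeff_apply, hW,
        constantCoeff_pexp (constantCoeff_artinHasseLog p)]
      simp
    -- The truncation of `W` below degree `n`, as an integral polynomial.
    let c : Fin n → ℤ_[p] := fun i => ⟨coeff i W, ih i i.2⟩
    have hc : ∀ i, (c i : ℚ_[p]) = coeff i W := fun _ => rfl
    set A : Polynomial ℤ_[p] := ∑ i : Fin n, Polynomial.monomial (i : ℕ) (c i) with hA
    have hAc : ∀ i (hi : i < n), ((A.coeff i : ℤ_[p]) : ℚ_[p]) = coeff i W := by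
      intro i hi
      rw [hA, Polynomial.finsetSum_coeff, Finset.sum_eq_single ⟨i, hi⟩]
      · rw [Polynomial.coeff_monomial, if_pos rfl, hc]
      · intro b _ hb
        rw [Polynomial.coeff_monomial, if_neg]
        exact fun h => hb (Fin.ext h)
      · simp
    have hAn : A.coeff n = 0 := by
      rw [hA, Polynomial.finsetSum_coeff]
      exact Finset.sum_eq_zero fun b _ => by rw [Polynomial.coeff_monomial, if_neg b.2.ne]
    set A' : PowerSeries ℚ_[p] := ((A.map PadicInt.Coe.ringHom : Polynomial ℚ_[p]) :
      PowerSeries ℚ_[p]) with hA'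
    have hA'c : ∀ i < n, coeff i A' = coeff i W := by
      intro i hi
      rw [hA', Polynomial.coeff_coe, Polynomial.coeff_map, ← hAc i hi]
      rfl
    have hA'n : coeff n A' = 0 := by
      rw [hA', Polynomial.coeff_coe, Polynomial.coeff_map, hAn, map_zero]
    obtain ⟨R, hR⟩ : (X : PowerSeries ℚ_[p]) ^ n ∣ W - A' := by
      rw [X_pow_dvd_iff]
      intro m hm
      rw [map_sub, hA'c m hm, sub_self]
    have hR0 : coeff n W = constantCoeff R := by
      have h := congrArg (coeff n) hR
      rw [map_sub, hA'n, sub_zero] at h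
      rw [h]
      simpa using coeff_X_pow_mul R n 0
    have hA0 : constantCoeff A' = 1 := by
      rw [← coeff_zero_eq_constantCoeff_apply, hA'c 0 hn, coeff_zero_eq_constantCoeff_apply, hW,
        constantCoeff_pexp (constantCoeff_artinHasseLog p)]
    -- The coefficient of degree `n` enters `W ^ p` linearly.
    have hpow : ∀ k : ℕ, ∃ S : PowerSeries ℚ_[p], W ^ k = A' ^ k + X ^ n * S ∧
        constantCoeff S = k * constantCoeff R := by
      intro k
      induction k with
      | zero => exact ⟨0, by simp, by simp⟩
      | succ k ihk =>
        obtain ⟨S, h1, h2⟩ := ihk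
        refine ⟨A' ^ k * R + S * W, ?_, ?_⟩
        · have h3 : W = A' + X ^ n * R := by rw [← hR]; ring
          have h4 : W ^ (k + 1) = (A' ^ k + X ^ n * S) * W := by rw [pow_succ, h1]
          have h5 : A' ^ k * W = A' ^ k * (A' + X ^ n * R) := by rw [← h3]
          rw [h4, add_mul, h5, pow_succ]
          ring
        · have hW0 : constantCoeff W = 1 := by
            rw [hW, constantCoeff_pexp (constantCoeff_artinHasseLog p)]
          simp only [map_add, map_mul, map_pow, hA0, h2, hW0]
          push_cast
          ring
    obtain ⟨S, hS1, hS2⟩ := hpow p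
    obtain ⟨B, hB⟩ := exists_pow_eq_expand_add p A
    have hpn : (0 : ℝ) < ‖(p : ℚ_[p])‖ := norm_pos_iff.2 (by exact_mod_cast hp0)
    have hint : ∀ i ≤ n, ‖coeff i (expand p hp0 W)‖ ≤ 1 := by
      intro i hi
      rw [coeff_expand]
      split_ifs with h
      · obtain ⟨j, rfl⟩ := h
        rw [Nat.mul_div_cancel_left _ hp.out.pos]
        rcases Nat.eq_zero_or_pos j with rfl | hj
        · exact ih 0 hn
        · exact ih j (by nlinarith [hp.out.two_le])
      · simp
    have h1 : ‖coeff n (W ^ p) - coeff n (expand p hp0 W)‖ ≤ ‖(p : ℚ_[p])‖ := by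
      have h2 : W ^ p - expand p hp0 W =
          expand p hp0 W * (pexp ((p : ℚ_[p]) • (X : PowerSeries ℚ_[p])) - 1) := by
        rw [hW, artinHasse_pow]; ring
      rw [← map_sub, h2, coeff_mul]
      refine IsUltrametricDist.norm_sum_le_of_forall_le_of_nonneg (norm_nonneg _) fun x hx => ?_
      rw [HasAntidiagonal.mem_antidiagonal] at hx
      have h3 : ‖coeff x.2 (pexp ((p : ℚ_[p]) • (X : PowerSeries ℚ_[p])) - 1)‖ ≤ ‖(p : ℚ_[p])‖ := by
        rw [map_sub, pexp_smul_X, coeff_one]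
        split_ifs with h
        · rw [h]; simp
        · rw [sub_zero]
          exact norm_pow_div_factorial_le p h
      rw [norm_mul]
      calc _ ≤ 1 * ‖(p : ℚ_[p])‖ :=
            mul_le_mul (hint _ (by omega)) h3 (norm_nonneg _) zero_le_one
        _ = _ := one_mul _
    have h4 : ‖coeff n (A' ^ p) - coeff n (expand p hp0 W)‖ ≤ ‖(p : ℚ_[p])‖ := by
      have h5 : coeff n (A' ^ p) = coeff n (expand p hp0 W) +
          (p : ℚ_[p]) * ((B.coeff n : ℤ_[p]) : ℚ_[p]) := by
        rw [hA', ← Polynomial.coe_pow, Polynomial.coeff_coe, ← Polynomial.map_pow, hB,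
          Polynomial.coeff_map, Polynomial.coeff_add, Polynomial.coeff_C_mul, coeff_expand,
          Polynomial.coeff_expand hp.out.pos, map_add, map_mul, map_natCast]
        congr 1
        split_ifs with h
        · obtain ⟨j, rfl⟩ := h
          rw [Nat.mul_div_cancel_left _ hp.out.pos]
          exact hAc j (by nlinarith [hp.out.two_le])
        · simp
      rw [h5, add_sub_cancel_left, norm_mul]
      exact mul_le_of_le_one_right (norm_nonneg _) (PadicInt.norm_le_one _)
    have h6 : coeff n (W ^ p) = coeff n (A' ^ p) + p * coeff n W := by
      rw [hS1, map_add, hR0, ← hS2]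
      congr 1
      simpa using coeff_X_pow_mul S n 0
    have h7 : ‖(p : ℚ_[p]) * coeff n W‖ ≤ ‖(p : ℚ_[p])‖ := by
      have h8 : (p : ℚ_[p]) * coeff n W = (coeff n (W ^ p) - coeff n (expand p hp0 W)) -
          (coeff n (A' ^ p) - coeff n (expand p hp0 W)) := by rw [h6]; ring
      rw [h8, sub_eq_add_neg]
      exact (IsUltrametricDist.norm_add_le_max _ _).trans (max_le h1 (by rwa [norm_neg]))
    rw [norm_mul] at h7
    exact le_of_mul_le_mul_left (by rwa [mul_one]) hpn

end ArtinHasse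

/-! ### Overconvergence of Dwork's splitting function -/

noncomputable section SplittingFunction

open PowerSeries

variable {p : ℕ} [hp : Fact p.Prime]

theorem map_artinHasseLog {K L : Type*} [Field K] [CharZero K] [Field L] [CharZero L]
    (φ : K →+* L) (p : ℕ) : map φ (artinHasseLog K p) = artinHasseLog L p := by
  ext N
  rw [coeff_map, artinHasseLog, artinHasseLog, coeff_mk, coeff_mk]
  split_ifs
  · rw [map_inv₀, map_natCast]
  · rw [map_zero]

theorem norm_coeff_artinHasse_padicComplex_le (n : ℕ) :
    ‖coeff n (pexp (artinHasseLog ℂ_[p] p))‖ ≤ 1 := by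
  rw [← map_artinHasseLog (algebraMap ℚ_[p] ℂ_[p]), pexp_map _ (constantCoeff_artinHasseLog p),
    coeff_map]
  exact (PadicComplex.norm_extends' p _).trans_le (norm_coeff_artinHasse_le p n)

/-- Products of power series with coefficients of size at most `r ^ n`. -/
theorem norm_coeff_mul_le_pow {r : ℝ} (hr : 0 ≤ r) {G H : PowerSeries ℂ_[p]}
    (hG : ∀ n, ‖coeff n G‖ ≤ r ^ n) (hH : ∀ n, ‖coeff n H‖ ≤ r ^ n) (n : ℕ) :
    ‖coeff n (G * H)‖ ≤ r ^ n := by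
  rw [coeff_mul]
  refine IsUltrametricDist.norm_sum_le_of_forall_le_of_nonneg (by positivity) fun x hx => ?_
  rw [HasAntidiagonal.mem_antidiagonal] at hx
  rw [norm_mul, ← hx, pow_add]
  exact mul_le_mul (hG _) (hH _) (norm_nonneg _) (by positivity)

theorem norm_coeff_pow_le_pow {r : ℝ} (hr : 0 ≤ r) {H : PowerSeries ℂ_[p]}
    (hH : ∀ n, ‖coeff n H‖ ≤ r ^ n) (k n : ℕ) : ‖coeff n (H ^ k)‖ ≤ r ^ n := by
  induction k generalizing n with
  | zero =>
    rw [pow_zero, coeff_one]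
    split_ifs with h
    · simp [h]
    · simpa using pow_nonneg hr n
  | succ k ih =>
    rw [pow_succ]
    exact norm_coeff_mul_le_pow hr ih hH n

variable {ϖ : ℂ_[p]}

theorem norm_coeff_pexp_le (hϖ : ϖ ^ (p - 1) = -(p : ℂ_[p])) {r : ℝ} (hr : 0 ≤ r)
    {H : PowerSeries ℂ_[p]} (hH : ∀ n, ‖coeff n H‖ ≤ r ^ n) (h0 : constantCoeff H = 0) (n : ℕ) :
    ‖coeff n (pexp (ϖ • H))‖ ≤ r ^ n := by
  have h1 : constantCoeff (ϖ • H) = 0 := by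
    rw [← coeff_zero_eq_constantCoeff_apply, coeff_smul, coeff_zero_eq_constantCoeff_apply, h0,
      smul_zero]
  rw [coeff_pexp h1]
  refine finsum_induction (fun x : ℂ_[p] => ‖x‖ ≤ r ^ n) ?_ ?_ ?_
  · simpa using pow_nonneg hr n
  · intro x y hx hy
    exact (IsUltrametricDist.norm_add_le_max x y).trans (max_le hx hy)
  · intro k
    rw [smul_pow, coeff_smul, smul_eq_mul, ← mul_assoc, ← div_eq_inv_mul, norm_mul]
    calc _ ≤ 1 * r ^ n := mul_le_mul (norm_pi_pow_div_factorial_le hϖ k)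
          (norm_coeff_pow_le_pow hr hH k n) (norm_nonneg _) zero_le_one
      _ = r ^ n := one_mul _

theorem pow_sub_two_le (hp2 : p ≠ 2) {i : ℕ} (hi : 2 ≤ i) :
    p ^ (i - 2) + i * (p - 1) + 1 ≤ p ^ i := by
  have h2 := hp.out.two_le
  obtain ⟨q, rfl⟩ : ∃ q, p = q + 3 := ⟨p - 3, by omega⟩
  obtain ⟨k, rfl⟩ : ∃ k, i = k + 2 := ⟨i - 2, by omega⟩
  rw [show q + 3 - 1 = q + 2 by omega, show k + 2 - 2 = k by omega]
  clear hi
  induction k with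
  | zero =>
    have h : (q + 3) ^ (0 + 2) = q * q + 6 * q + 9 := by ring
    rw [h, pow_zero]
    nlinarith
  | succ k ih =>
    have h3 : (q + 3) ^ (k + 1 + 2) = (q + 3) * (q + 3) ^ (k + 2) := by ring
    have h4 : (q + 3) ^ (k + 1) = (q + 3) * (q + 3) ^ k := by ring
    rw [h3, h4]
    refine le_trans ?_ (Nat.mul_le_mul_left (q + 3) ih)
    have h5 : k + 3 ≤ (q + 3) * (k + 2) := by nlinarith [Nat.zero_le (q * k)]
    have h6 := Nat.mul_le_mul_right (q + 2) h5
    calc _ ≤ (q + 3) * (q + 3) ^ k + (q + 3) * (k + 2) * (q + 2) + (q + 3) := by linarith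
      _ = _ := by ring

variable (ϖ) in
/-- The coefficients of Dwork's splitting function `exp (ϖ (s ^ p - s))`. -/
def dworkCoeff (k : ℤ) : ℂ_[p] :=
  if 0 ≤ k then coeff k.toNat (pexp (ϖ • (X ^ p - X : PowerSeries ℂ_[p]))) else 0

theorem constantCoeff_X_pow_sub_X : constantCoeff (X ^ p - X : PowerSeries ℂ_[p]) = 0 := by
  simp [hp.out.ne_zero]

theorem constantCoeff_smul_X_pow_sub_X :
    constantCoeff (ϖ • (X ^ p - X) : PowerSeries ℂ_[p]) = 0 := by
  rw [← coeff_zero_eq_constantCoeff_apply, coeff_smul, coeff_zero_eq_constantCoeff_apply,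
    constantCoeff_X_pow_sub_X, smul_zero]

theorem dworkCoeff_of_neg {k : ℤ} (hk : k < 0) : dworkCoeff ϖ k = 0 := if_neg (not_le.2 hk)

theorem dworkCoeff_natCast (k : ℕ) :
    dworkCoeff ϖ (k : ℤ) = coeff k (pexp (ϖ • (X ^ p - X : PowerSeries ℂ_[p]))) := by
  rw [dworkCoeff, if_pos (Int.natCast_nonneg k), Int.toNat_natCast]

theorem dworkCoeff_zero : dworkCoeff ϖ 0 = 1 := by
  have h := dworkCoeff_natCast (ϖ := ϖ) 0
  rw [coeff_zero_eq_constantCoeff_apply, constantCoeff_pexp constantCoeff_smul_X_pow_sub_X] at h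
  exact_mod_cast h

/-- The differential equation of the splitting function. -/
theorem mul_dworkCoeff (k : ℤ) :
    (k : ℂ_[p]) * dworkCoeff ϖ k
      = ϖ * (p * dworkCoeff ϖ (k - p) - dworkCoeff ϖ (k - 1)) := by
  have hp1 := hp.out.one_lt
  rcases lt_trichotomy k 0 with hk | rfl | hk
  · rw [dworkCoeff_of_neg hk, dworkCoeff_of_neg (by omega), dworkCoeff_of_neg (by omega)]
    ring
  · rw [dworkCoeff_of_neg (k := 0 - (p : ℤ)) (by omega),
      dworkCoeff_of_neg (k := 0 - 1) (by omega)]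
    simp
  obtain ⟨d, rfl⟩ : ∃ d : ℕ, k = d + 1 := ⟨(k - 1).toNat, by omega⟩
  have h := congrArg (coeff d)
    (derivative_pexp (constantCoeff_smul_X_pow_sub_X (p := p) (ϖ := ϖ)))
  have h1 : derivative ℂ_[p] (ϖ • (X ^ p - X : PowerSeries ℂ_[p]))
      = ϖ • ((p : ℂ_[p]) • X ^ (p - 1) - 1) := by
    rw [Derivation.map_smul, map_sub, derivative_pow, derivative_X, mul_one]
    congr 2
    rw [smul_eq_C_mul, map_natCast]
  rw [coeff_derivative, h1, smul_mul_assoc, sub_mul, one_mul, smul_mul_assoc, coeff_smul, map_sub,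
    coeff_smul, coeff_X_pow_mul', smul_eq_mul, smul_eq_mul] at h
  have h2 : dworkCoeff ϖ ((d : ℤ) + 1) = coeff (d + 1) (pexp (ϖ • (X ^ p - X))) := by
    rw [← dworkCoeff_natCast]; push_cast; rfl
  rw [h2, mul_comm]
  push_cast
  rw [h, add_sub_cancel_right, dworkCoeff_natCast]
  congr 3
  split_ifs with hd
  · rw [← dworkCoeff_natCast]
    congr 1
    omega
  · rw [dworkCoeff_of_neg (by omega)]

/-- Dwork's splitting function converges on a disc of radius larger than `1`: up to a factor with
small exponents it is the Artin–Hasse exponential of `-ϖ s`. -/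
theorem exists_norm_dworkCoeff_le (hp2 : p ≠ 2) (hϖ : ϖ ^ (p - 1) = -(p : ℂ_[p])) :
    ∃ r : ℝ, 0 < r ∧ r < 1 ∧ ∀ k : ℤ, ‖dworkCoeff ϖ k‖ ≤ r ^ k.natAbs := by
  have hp1 := hp.out.one_lt
  have hϖ0 := pi_ne_zero hϖ
  have hϖn : 0 < ‖ϖ‖ := norm_pos_iff.2 hϖ0
  have hϖ1 := norm_pi_lt_one hϖ
  have hp0 : (p : ℂ_[p]) ≠ 0 := by exact_mod_cast hp.out.ne_zero
  -- The radius is dictated by the first term of the remainder `H` below, which has degree `p ^ 2`.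
  set r : ℝ := ‖ϖ‖ ^ (((p ^ 2 : ℕ) : ℝ)⁻¹) with hr
  have hr0 : 0 < r := Real.rpow_pos_of_pos hϖn _
  have hr1 : r < 1 := Real.rpow_lt_one hϖn.le hϖ1 (by positivity)
  have hrp : r ^ (p ^ 2) = ‖ϖ‖ := Real.rpow_inv_natCast_pow hϖn.le (by positivity)
  have hϖr : ‖ϖ‖ ≤ r := by
    rw [← hrp]
    exact pow_le_of_le_one hr0.le hr1.le (by positivity)
  -- Here `ϖ (X ^ p - X) = L + ϖ H`. The terms of degree `1` and `p` of `H` cancel, because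
  -- `ϖ ^ (p - 1) = -p` and `p` is odd.
  set L := rescale (-ϖ) (artinHasseLog ℂ_[p] p) with hL
  have hL0 : constantCoeff L = 0 := by
    rw [← coeff_zero_eq_constantCoeff_apply, hL, coeff_rescale, coeff_zero_eq_constantCoeff_apply,
      constantCoeff_artinHasseLog, mul_zero]
  set H : PowerSeries ℂ_[p] := X ^ p - X - ϖ⁻¹ • L with hH
  have hH0 : constantCoeff H = 0 := by
    rw [hH, map_sub, constantCoeff_X_pow_sub_X, ← coeff_zero_eq_constantCoeff_apply, coeff_smul,
      coeff_zero_eq_constantCoeff_apply, hL0, smul_zero, sub_zero]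
  have hsum : ϖ • (X ^ p - X : PowerSeries ℂ_[p]) = L + ϖ • H := by
    rw [hH, smul_sub ϖ (X ^ p - X), smul_inv_smul₀ hϖ0]
    ring
  have hϖp : ϖ ^ p = -(p : ℂ_[p]) * ϖ := by
    rw [← hϖ, ← pow_succ]; congr 1; omega
  have hodd : (-1 : ℂ_[p]) ^ p = -1 := (hp.out.odd_of_ne_two hp2).neg_one_pow
  have hHn : ∀ n, ‖coeff n H‖ ≤ r ^ n := by
    intro n
    rw [hH, map_sub, map_sub, coeff_smul, hL, coeff_rescale, coeff_X_pow, coeff_X, artinHasseLog,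
      coeff_mk, smul_eq_mul]
    by_cases h : ∃ i, n = p ^ i
    · rw [if_pos h]
      obtain ⟨i, rfl⟩ := h
      rcases Nat.lt_or_ge i 2 with hi | hi
      · have hz : ∀ x : ℂ_[p], x = 0 → ‖x‖ ≤ r ^ p ^ i := by
          rintro x rfl; rw [norm_zero]; positivity
        apply hz
        interval_cases i
        · rw [pow_zero, if_neg hp1.ne, if_pos rfl]
          field_simp
          simp
        · rw [pow_one, if_pos rfl, if_neg hp1.ne', neg_pow, hodd, hϖp]
          field_simp
          simp
      · have h1 : p ^ i ≠ p := by
          intro h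
          have := Nat.pow_right_injective hp1 (h.trans (pow_one p).symm)
          omega
        have h2 : p ^ i ≠ 1 := (Nat.one_lt_pow (by omega) hp1).ne'
        rw [if_neg h1, if_neg h2, sub_zero, zero_sub, norm_neg, norm_mul, norm_mul, norm_inv,
          norm_inv, norm_pow, norm_neg, Nat.cast_pow, norm_pow]
        have h3 : ‖(p : ℂ_[p])‖ = ‖ϖ‖ ^ (p - 1) := by rw [← norm_pow, hϖ, norm_neg]
        have h4 := pow_sub_two_le hp2 hi
        obtain ⟨e, he⟩ := Nat.exists_eq_add_of_le h4
        rw [h3, ← pow_mul, mul_comm (p - 1) i]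
        have h5 : ‖ϖ‖ ^ p ^ i = ‖ϖ‖ * ‖ϖ‖ ^ (i * (p - 1)) * ‖ϖ‖ ^ (p ^ (i - 2) + e) := by
          rw [he, ← pow_succ', ← pow_add]
          congr 1
          omega
        rw [h5]
        have h6 : ‖ϖ‖⁻¹ * (‖ϖ‖ * ‖ϖ‖ ^ (i * (p - 1)) * ‖ϖ‖ ^ (p ^ (i - 2) + e) *
            (‖ϖ‖ ^ (i * (p - 1)))⁻¹) = ‖ϖ‖ ^ (p ^ (i - 2) + e) := by
          field_simp
        rw [h6]
        have h7 : r ^ p ^ i = ‖ϖ‖ ^ p ^ (i - 2) := by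
          rw [← hrp, ← pow_mul, ← pow_add]
          congr 2
          omega
        rw [h7]
        exact pow_le_pow_of_le_one hϖn.le hϖ1.le (Nat.le_add_right _ _)
    · have h1 : n ≠ p := fun h1 => h ⟨1, by rw [h1, pow_one]⟩
      have h2 : n ≠ 1 := fun h2 => h ⟨0, by rw [h2, pow_zero]⟩
      rw [if_neg h1, if_neg h2, if_neg h]
      simpa using pow_nonneg hr0.le n
  have hLn : ∀ n, ‖coeff n (pexp L)‖ ≤ r ^ n := by
    intro n
    rw [hL, pexp_rescale _ (constantCoeff_artinHasseLog p), coeff_rescale, norm_mul, norm_pow,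
      norm_neg]
    calc _ ≤ r ^ n * 1 := mul_le_mul (pow_le_pow_left₀ hϖn.le hϖr n)
          (norm_coeff_artinHasse_padicComplex_le n) (norm_nonneg _) (by positivity)
      _ = r ^ n := mul_one _
  refine ⟨r, hr0, hr1, fun k => ?_⟩
  rcases lt_or_ge k 0 with hk | hk
  · rw [dworkCoeff_of_neg hk, norm_zero]
    positivity
  · obtain ⟨d, rfl⟩ := Int.eq_ofNat_of_zero_le hk
    have h1 : constantCoeff (ϖ • H) = 0 := by
      rw [← coeff_zero_eq_constantCoeff_apply, coeff_smul, coeff_zero_eq_constantCoeff_apply, hH0,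
        smul_zero]
    rw [dworkCoeff_natCast, hsum, pexp_add hL0 h1, Int.natAbs_natCast]
    exact norm_coeff_mul_le_pow hr0.le hLn (norm_coeff_pexp_le hϖ hr0.le hHn hH0) d

end SplittingFunction

/-! ### Products of overconvergent series -/

noncomputable section SeriesMul

variable {p : ℕ} [Fact p.Prime] {σ : Type}

theorem seriesMul_comm (a b : Series p σ) : seriesMul a b = seriesMul b a := by
  funext I
  rw [seriesMul, seriesMul, ← (Equiv.subLeft I).tsum_eq]
  refine tsum_congr fun J => ?_
  rw [Equiv.subLeft_apply, sub_sub_cancel, mul_comm]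

variable [Fintype σ] {inv : Set σ} {a b c : Series p σ}

theorem exists_common_bound (ha : a ∈ overconv p inv) (hb : b ∈ overconv p inv) :
    ∃ C r : ℝ, 0 ≤ C ∧ 0 < r ∧ r < 1 ∧ (∀ I, ‖a I‖ ≤ C * r ^ expSize I) ∧
      ∀ I, ‖b I‖ ≤ C * r ^ expSize I := by
  obtain ⟨-, C, r, hC, hr0, hr1, h⟩ := mem_overconv.1 ha
  obtain ⟨-, D, s, hD, hs0, hs1, h'⟩ := mem_overconv.1 hb
  refine ⟨max C D, max r s, le_max_of_le_left hC, lt_max_of_lt_left hr0, max_lt hr1 hs1,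
    fun I => (h I).trans ?_, fun I => (h' I).trans ?_⟩
  · exact mul_le_mul (le_max_left _ _) (pow_le_pow_left₀ hr0.le (le_max_left _ _) _)
      (by positivity) (le_max_of_le_left hC)
  · exact mul_le_mul (le_max_right _ _) (pow_le_pow_left₀ hs0.le (le_max_right _ _) _)
      (by positivity) (le_max_of_le_left hC)

theorem summable_seriesMul (ha : a ∈ overconv p inv) (hb : b ∈ overconv p inv) (I : σ → ℤ) :
    Summable fun J => a J * b (I - J) := by
  obtain ⟨C, r, hC, hr0, hr1, h, h'⟩ := exists_common_bound ha hb
  refine summable_of_geometric_bound (C := C * C) hr0 hr1 fun J => ?_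
  rw [norm_mul]
  calc _ ≤ C * r ^ expSize J * (C * 1) := mul_le_mul (h J)
        ((h' _).trans (mul_le_mul_of_nonneg_left (pow_le_one₀ hr0.le hr1.le) hC))
        (norm_nonneg _) (by positivity)
    _ = _ := by ring

theorem seriesMul_mem_overconv (ha : a ∈ overconv p inv) (hb : b ∈ overconv p inv) :
    seriesMul a b ∈ overconv p inv := by
  refine mem_overconv.2 ⟨fun I hI => ?_, ?_⟩
  · rw [seriesMul]
    refine (tsum_congr fun J => ?_).trans tsum_zero
    by_cases hJ : IsRegularExp inv J
    · rw [hb.1 (I - J), mul_zero]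
      intro h
      refine hI fun j hj => ?_
      have h1 := hJ j hj
      have h2 := h j hj
      rw [Pi.sub_apply] at h2
      omega
    · rw [ha.1 J hJ, zero_mul]
  · obtain ⟨C, r, hC, hr0, hr1, h, h'⟩ := exists_common_bound ha hb
    refine ⟨C * C, r, by positivity, hr0, hr1, fun I => ?_⟩
    refine IsUltrametricDist.norm_tsum_le_of_forall_le_of_nonneg (by positivity) fun J => ?_
    rw [norm_mul]
    calc _ ≤ C * r ^ expSize J * (C * r ^ expSize (I - J)) :=
          mul_le_mul (h J) (h' _) (norm_nonneg _) (by positivity)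
      _ = C * C * r ^ (expSize (I - J) + expSize J) := by rw [pow_add]; ring
      _ ≤ _ := by
        gcongr ?_ * ?_
        exact pow_le_pow_of_le_one hr0.le hr1.le (expSize_le_sub_add I J)

theorem seriesMul_add (ha : a ∈ overconv p inv) (hb : b ∈ overconv p inv)
    (hc : c ∈ overconv p inv) : seriesMul a (b + c) = seriesMul a b + seriesMul a c := by
  funext I
  rw [Pi.add_apply, seriesMul, seriesMul, seriesMul,
    ← (summable_seriesMul ha hb I).tsum_add (summable_seriesMul ha hc I)]
  simp only [Pi.add_apply, mul_add]

omit [Fintype σ] in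
theorem seriesMul_smul (k : ℂ_[p]) (a b : Series p σ) :
    seriesMul a (k • b) = k • seriesMul a b := by
  funext I
  rw [Pi.smul_apply, seriesMul, seriesMul, smul_eq_mul, ← tsum_mul_left]
  refine tsum_congr fun J => ?_
  rw [Pi.smul_apply, smul_eq_mul]
  ring

omit [Fintype σ] in
@[simp] theorem seriesMul_zero (a : Series p σ) : seriesMul a 0 = 0 := by
  funext I
  simp [seriesMul]

theorem mem_algFun_univ (f : LPoly p σ) : f ∈ algFun p (Set.univ : Set σ) :=
  fun _ _ j hj => absurd (Set.mem_univ j) hj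

theorem mem_overconv_univ (ha : a ∈ overconv p inv) : a ∈ overconv p (Set.univ : Set σ) :=
  overconv_mono (Set.subset_univ _) ha

theorem seriesMul_polyMul (ha : a ∈ overconv p inv) (f : LPoly p σ) (hb : b ∈ overconv p inv) :
    seriesMul a (polyMul f b) = polyMul f (seriesMul a b) := by
  have ha' := mem_overconv_univ ha
  have hb' := mem_overconv_univ hb
  induction f using AddMonoidAlgebra.induction_linear with
  | zero => simp
  | add f g hf hg =>
    rw [polyMul_add, LinearMap.add_apply, LinearMap.add_apply, seriesMul_add ha'
      (polyMul_mem_overconv (mem_algFun_univ f) hb') (polyMul_mem_overconv (mem_algFun_univ g) hb'),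
      hf, hg]
  | single K k =>
    funext I
    rw [polyMul_single, seriesMul, seriesMul, ← tsum_mul_left]
    refine tsum_congr fun J => ?_
    rw [polyMul_single, sub_right_comm]
    ring

theorem polyMul_seriesMul (ha : a ∈ overconv p inv) (f : LPoly p σ) (hb : b ∈ overconv p inv) :
    seriesMul (polyMul f a) b = polyMul f (seriesMul a b) := by
  rw [seriesMul_comm, seriesMul_polyMul hb f ha, seriesMul_comm]

theorem seriesDeriv_seriesMul [DecidableEq σ] (j : σ) (ha : a ∈ overconv p inv)
    (hb : b ∈ overconv p inv) :
    seriesDeriv j (seriesMul a b) =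
      seriesMul (seriesDeriv j a) b + seriesMul a (seriesDeriv j b) := by
  funext I
  rw [seriesDeriv_apply, Pi.add_apply]
  have h1 : seriesMul (seriesDeriv j a) b I
      = ∑' J, (J j : ℂ_[p]) * (a J * b (I + Pi.single j 1 - J)) := by
    rw [seriesMul, ← (Equiv.subRight (Pi.single j 1 : σ → ℤ)).tsum_eq]
    refine tsum_congr fun J => ?_
    rw [Equiv.subRight_apply, seriesDeriv_apply, sub_add_cancel, Pi.sub_apply, Pi.single_eq_same,
      show I - (J - Pi.single j 1) = I + Pi.single j 1 - J by abel]
    push_cast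
    ring
  have hs := summable_seriesMul (seriesDeriv_mem_overconv j ha) hb I
  have h2 : Summable fun J => (J j : ℂ_[p]) * (a J * b (I + Pi.single j 1 - J)) := by
    rw [← (Equiv.addRight (Pi.single j 1 : σ → ℤ)).summable_iff]
    refine hs.congr fun J => ?_
    rw [Function.comp_apply, Equiv.coe_addRight, seriesDeriv_apply, add_sub_add_right_eq_sub]
    simp only [Pi.add_apply, Pi.single_eq_same]
    push_cast
    ring
  rw [h1, seriesMul, seriesMul, ← h2.tsum_add
    (summable_seriesMul ha (seriesDeriv_mem_overconv j hb) I), ← tsum_mul_left]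
  refine tsum_congr fun J => ?_
  rw [seriesDeriv_apply, show I - J + Pi.single j 1 = I + Pi.single j 1 - J by abel, Pi.sub_apply]
  push_cast
  ring

/-- Multiplication by a solution `a` of `∂_j a = (∂_j g) a` intertwines the `D`-module structures
twisted by `f` and by `g + f`. -/
theorem twistedDeriv_seriesMul [DecidableEq σ] (j : σ) {f g : LPoly p σ}
    (ha : a ∈ overconv p inv) (hb : b ∈ overconv p inv)
    (h : seriesDeriv j a = polyMul (LPoly.pderiv j g) a) :
    twistedDeriv f j (seriesMul a b) = seriesMul a (twistedDeriv (f + g) j b) := by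
  rw [twistedDeriv_apply, twistedDeriv_apply, seriesDeriv_seriesMul j ha hb, h,
    seriesMul_add (mem_overconv_univ ha) (seriesDeriv_mem_overconv j (mem_overconv_univ hb))
      (polyMul_mem_overconv (mem_algFun_univ _) (mem_overconv_univ hb)),
    seriesMul_polyMul ha _ hb, polyMul_seriesMul ha _ hb, pderiv_add, polyMul_add,
    LinearMap.add_apply]
  abel

end SeriesMul

/-! ### Power series in a function divisible by a coordinate -/

noncomputable section PowSeries

variable {p : ℕ} [Fact p.Prime] {σ : Type}

/-- The series `∑ μ_k H ^ k`; it is used for `H` divisible by one of the coordinates, and then every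
coefficient is a finite sum. -/
def powSeries (μ : ℕ → ℂ_[p]) (H : LPoly p σ) : Series p σ :=
  fun I => ∑' k : ℕ, μ k * (H ^ k).coeff I

theorem expSeries_eq_powSeries (G : LPoly p σ) :
    expSeries G = powSeries (fun k => ((k.factorial : ℂ_[p]))⁻¹) G := rfl

theorem powSeries_smul (μ : ℕ → ℂ_[p]) (c : ℂ_[p]) (H : LPoly p σ) :
    powSeries μ (c • H) = powSeries (fun k => μ k * c ^ k) H := by
  funext I
  refine tsum_congr fun k => ?_
  rw [smul_pow, AddMonoidAlgebra.coeff_smul, Finsupp.smul_apply, smul_eq_mul, mul_assoc]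

variable {t : σ} {H : LPoly p σ} (hH : ∀ I, H.coeff I ≠ 0 → 1 ≤ I t)

include hH in
theorem le_of_coeff_pow_ne_zero (k : ℕ) (I : σ → ℤ) (h : (H ^ k).coeff I ≠ 0) : (k : ℤ) ≤ I t := by
  induction k generalizing I with
  | zero =>
    have h0 : I = 0 := by
      by_contra hne
      apply h
      rw [pow_zero, AddMonoidAlgebra.one_def, AddMonoidAlgebra.coeff_single]
      exact Finsupp.single_eq_of_ne hne
    simp [h0]
  | succ k ih =>
    rw [pow_succ] at h
    obtain ⟨J, h1, h2, -⟩ := exists_coeff_mul_le (H ^ k) H I h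
    have h3 := ih J h1
    have h4 := hH _ h2
    rw [Pi.sub_apply] at h4
    push_cast
    omega

include hH in
theorem powSeries_eq_sum (μ : ℕ → ℂ_[p]) {I : σ → ℤ} {N : ℕ} (hN : I t < N) :
    powSeries μ H I = ∑ k ∈ range N, μ k * (H ^ k).coeff I := by
  refine tsum_eq_sum fun k hk => ?_
  have h0 : (H ^ k).coeff I = 0 := by
    by_contra h
    have := le_of_coeff_pow_ne_zero hH k I h
    rw [mem_range] at hk
    omega
  rw [h0, mul_zero]

include hH in
theorem powSeries_of_nonpos (μ : ℕ → ℂ_[p]) {I : σ → ℤ} (hI : I t ≤ 0) :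
    powSeries μ H I = μ 0 * (1 : LPoly p σ).coeff I := by
  rw [powSeries_eq_sum hH μ (N := 1) (by push_cast; omega), sum_range_one, pow_zero]

include hH in
theorem polyMul_powSeries (μ : ℕ → ℂ_[p]) {g : LPoly p σ} (hg : ∀ J, g.coeff J ≠ 0 → 0 ≤ J t)
    {I : σ → ℤ} {N : ℕ} (hN : I t < N) :
    polyMul g (powSeries μ H) I = ∑ k ∈ range N, μ k * (g * H ^ k).coeff I := by
  have h1 : ∀ k, (g * H ^ k).coeff I = g.coeff.sum fun J c => c * (H ^ k).coeff (I - J) := by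
    intro k
    rw [← polyMul_coeff, polyMul_apply]
  simp only [h1, Finsupp.sum]
  rw [polyMul_apply, Finsupp.sum]
  simp only [mul_sum]
  rw [sum_comm]
  refine sum_congr rfl fun J hJ => ?_
  have h2 := hg J (Finsupp.mem_support_iff.1 hJ)
  rw [powSeries_eq_sum hH μ (N := N) (by rw [Pi.sub_apply]; omega), mul_sum]
  refine sum_congr rfl fun k _ => ?_
  ring

include hH in
theorem polyMul_self_powSeries (μ : ℕ → ℂ_[p]) :
    polyMul H (powSeries μ H) = powSeries (fun k => if k = 0 then 0 else μ (k - 1)) H := by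
  funext I
  obtain ⟨N, hN⟩ : ∃ N : ℕ, I t < N := ⟨(I t).toNat + 1, by omega⟩
  rw [polyMul_powSeries hH μ (fun J hJ => by have := hH J hJ; omega) hN,
    powSeries_eq_sum hH _ (N := N + 1) (by push_cast; omega), sum_range_succ', if_pos rfl, zero_mul,
    add_zero]
  refine sum_congr rfl fun k _ => ?_
  rw [if_neg (Nat.succ_ne_zero k), Nat.add_sub_cancel, pow_succ']

include hH in
theorem polyMul_pow_powSeries (μ : ℕ → ℂ_[p]) (q : ℕ) :
    polyMul (H ^ q) (powSeries μ H) = powSeries (fun k => if k < q then 0 else μ (k - q)) H := by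
  induction q with
  | zero => simp
  | succ q ih =>
    rw [pow_succ', polyMul_mul, ih, polyMul_self_powSeries hH]
    congr 1
    funext k
    rcases k with - | k
    · simp
    · simp

include hH in
theorem seriesDeriv_powSeries [DecidableEq σ] (μ : ℕ → ℂ_[p]) (j : σ) :
    seriesDeriv j (powSeries μ H) =
      polyMul (LPoly.pderiv j H) (powSeries (fun k => ((k : ℂ_[p]) + 1) * μ (k + 1)) H) := by
  funext I
  obtain ⟨N, hN, hN'⟩ : ∃ N : ℕ, I t < N ∧ (I + Pi.single j 1 : σ → ℤ) t < N + 1 := by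
    refine ⟨(I t).toNat + 1, by omega, ?_⟩
    rw [Pi.add_apply]
    have h1 : (Pi.single j 1 : σ → ℤ) t ≤ 1 := by
      rw [Pi.single_apply]; split_ifs <;> simp
    push_cast
    omega
  have hg : ∀ J, (LPoly.pderiv j H).coeff J ≠ 0 → 0 ≤ J t :=
    coeff_pderiv_nonneg j fun J hJ => by have := hH J hJ; omega
  rw [polyMul_powSeries hH _ hg hN, seriesDeriv_apply,
    powSeries_eq_sum hH μ (N := N + 1) (by exact_mod_cast hN'), mul_sum]
  have h1 : ∀ k, ((I j : ℂ_[p]) + 1) * (μ k * (H ^ k).coeff (I + Pi.single j 1))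
      = μ k * (LPoly.pderiv j (H ^ k)).coeff I := by
    intro k
    rw [coeff_pderiv]; ring
  simp only [h1]
  rw [sum_range_succ']
  have h2 : LPoly.pderiv j (H ^ 0) = 0 := by
    rw [pow_zero, AddMonoidAlgebra.one_def, pderiv_single]; simp
  rw [h2, AddMonoidAlgebra.coeff_zero, Finsupp.zero_apply, mul_zero, add_zero]
  refine sum_congr rfl fun k _ => ?_
  rw [pderiv_pow, AddMonoidAlgebra.coeff_smul, Finsupp.smul_apply, smul_eq_mul, mul_comm (H ^ k)]
  ring

include hH in
theorem seriesDeriv_expSeries [DecidableEq σ] (j : σ) :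
    seriesDeriv j (expSeries H) = polyMul (LPoly.pderiv j H) (expSeries H) := by
  rw [expSeries_eq_powSeries, seriesDeriv_powSeries hH]
  congr 2
  funext k
  have h : ((k : ℂ_[p]) + 1) ≠ 0 := by exact_mod_cast Nat.succ_ne_zero k
  rw [Nat.factorial_succ, Nat.cast_mul, mul_inv]
  push_cast
  rw [← mul_assoc, mul_inv_cancel₀ h, one_mul]

/-- A linear differential equation in the direction of the coordinate `t` determines a series
by its coefficients with nonpositive exponent of `t`. -/
theorem eq_zero_of_seriesDeriv_eq [DecidableEq σ] {h : LPoly p σ}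
    (hh : ∀ J, h.coeff J ≠ 0 → 0 ≤ J t) {Y : Series p σ} (hY : seriesDeriv t Y = polyMul h Y)
    (h0 : ∀ I, I t ≤ 0 → Y I = 0) : Y = 0 := by
  have key : ∀ d : ℕ, ∀ I : σ → ℤ, I t ≤ (d : ℤ) → Y I = 0 := by
    intro d
    induction d with
    | zero => exact fun I hI => h0 I (by exact_mod_cast hI)
    | succ d ih =>
      intro I hI
      rcases le_or_gt (I t) (d : ℤ) with hd | hd
      · exact ih I hd
      have h1 := congrFun hY (I - Pi.single t 1)
      have h2 : polyMul h Y (I - Pi.single t 1) = 0 := by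
        rw [polyMul_apply]
        refine Finset.sum_eq_zero fun J hJ => ?_
        have h3 := hh J (Finsupp.mem_support_iff.1 hJ)
        dsimp only
        rw [ih, mul_zero]
        rw [Pi.sub_apply, Pi.sub_apply, Pi.single_eq_same]
        push_cast at hI
        omega
      rw [h2, seriesDeriv_apply, sub_add_cancel, Pi.sub_apply, Pi.single_eq_same] at h1
      push_cast at h1
      rw [sub_add_cancel] at h1
      refine (mul_eq_zero.1 h1).resolve_left ?_
      have : I t ≠ 0 := by omega
      exact_mod_cast this
  exact funext fun I => key (I t).toNat I (by omega)

/-- Two solutions of a linear differential equation in the direction of `t` agree if their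
coefficients with nonpositive exponent of `t` do. -/
theorem eq_of_seriesDeriv_eq [DecidableEq σ] {h : LPoly p σ}
    (hh : ∀ J, h.coeff J ≠ 0 → 0 ≤ J t) {Y Z : Series p σ} (hY : seriesDeriv t Y = polyMul h Y)
    (hZ : seriesDeriv t Z = polyMul h Z) (h0 : ∀ I, I t ≤ 0 → Y I = Z I) : Y = Z := by
  refine sub_eq_zero.1 (eq_zero_of_seriesDeriv_eq hh ?_ fun I hI => ?_)
  · rw [map_sub, map_sub, hY, hZ]
  · rw [Pi.sub_apply, h0 I hI, sub_self]

/-- The product of two series whose coefficients with nonpositive exponent of `t` are those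
of `1` has the same property. -/
theorem seriesMul_of_nonpos [DecidableEq σ] {a b : Series p σ}
    (ha : ∀ I, I t ≤ 0 → a I = (1 : LPoly p σ).coeff I)
    (hb : ∀ I, I t ≤ 0 → b I = (1 : LPoly p σ).coeff I) {I : σ → ℤ} (hI : I t ≤ 0) :
    seriesMul a b I = (1 : LPoly p σ).coeff I := by
  have h1 : ∀ I : σ → ℤ, I ≠ 0 → (1 : LPoly p σ).coeff I = 0 := by
    intro I h
    rw [AddMonoidAlgebra.one_def, AddMonoidAlgebra.coeff_single, Finsupp.single_eq_of_ne h]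
  rw [seriesMul, tsum_eq_single 0]
  · rw [ha 0 (by simp), sub_zero, hb I hI, AddMonoidAlgebra.one_def, AddMonoidAlgebra.coeff_single,
      Finsupp.single_eq_same, one_mul]
  · intro J hJ
    rcases le_or_gt (J t) 0 with h | h
    · rw [ha J h, h1 J hJ, zero_mul]
    · rw [hb (I - J) (by rw [Pi.sub_apply]; omega), h1, mul_zero]
      intro h'
      have := congrFun h' t
      rw [Pi.sub_apply, Pi.zero_apply] at this
      omega

omit hH in
theorem powSeries_mem_overconv [Fintype σ] {inv : Set σ} (hHa : H ∈ algFun p inv)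
    {μ : ℕ → ℂ_[p]} {ρ C s : ℝ} (hρ : 0 ≤ ρ) (hHρ : ∀ I, ‖H.coeff I‖ ≤ ρ) (hs0 : 0 < s)
    (hs1 : s < 1) (hμ : ∀ k, ‖μ k‖ * ρ ^ k ≤ C * s ^ k) : powSeries μ H ∈ overconv p inv := by
  classical
  obtain ⟨M, hM⟩ := exists_expSize_le H
  obtain ⟨D, u, hD, hu0, hu1, hbd⟩ := exists_geometric_bound hs0 hs1 |C| M
  refine mem_overconv.2 ⟨fun I hI => ?_, D, u, hD, hu0, hu1, fun I => ?_⟩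
  · refine (tsum_congr fun k => ?_).trans tsum_zero
    by_contra hne
    exact hI (Subalgebra.pow_mem _ hHa k I (right_ne_zero_of_mul hne))
  · refine IsUltrametricDist.norm_tsum_le_of_forall_le_of_nonneg (by positivity) fun k => ?_
    rcases eq_or_ne ((H ^ k).coeff I) 0 with h0 | h0
    · rw [h0, mul_zero, norm_zero]
      positivity
    have h1 := expSize_le_of_coeff_pow_ne_zero hM k I h0
    have h2 := norm_coeff_pow_le hρ hHρ k I
    calc ‖μ k * (H ^ k).coeff I‖ ≤ ‖μ k‖ * ρ ^ k := by
          rw [norm_mul]; gcongr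
      _ ≤ C * s ^ k := hμ k
      _ ≤ |C| * (expSize I + 1) * s ^ k := by
          gcongr
          calc C ≤ |C| := le_abs_self C
            _ ≤ |C| * (expSize I + 1) := le_mul_of_one_le_right (abs_nonneg _) (by simp)
      _ ≤ _ := hbd _ _ (by nlinarith)

end PowSeries

/-! ### Substituting `p`-th powers of the coordinates -/

noncomputable section PowP

variable {p : ℕ} [hp : Fact p.Prime] {σ : Type}

theorem seriesPowP_mul (a : Series p σ) (K : σ → ℤ) :
    seriesPowP a ((p : ℤ) • K) = a K := by
  have hp0 : (p : ℤ) ≠ 0 := by exact_mod_cast hp.out.ne_zero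
  rw [seriesPowP, if_pos fun j => ⟨K j, rfl⟩]
  congr 1
  funext j
  exact Int.mul_ediv_cancel_left _ hp0

theorem seriesPowP_of_ne (a : Series p σ) {I : σ → ℤ} (h : ∀ K, I ≠ (p : ℤ) • K) :
    seriesPowP a I = 0 := by
  rw [seriesPowP, if_neg]
  intro h'
  choose K hK using h'
  exact h K (funext hK)

theorem seriesPowP_add (a b : Series p σ) : seriesPowP (a + b) = seriesPowP a + seriesPowP b := by
  funext I
  by_cases h : ∃ K, I = (p : ℤ) • K
  · obtain ⟨K, rfl⟩ := h
    simp only [Pi.add_apply, seriesPowP_mul]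
  · push Not at h
    simp only [Pi.add_apply, seriesPowP_of_ne _ h, add_zero]

theorem seriesPowP_smul (c : ℂ_[p]) (a : Series p σ) : seriesPowP (c • a) = c • seriesPowP a := by
  funext I
  by_cases h : ∃ K, I = (p : ℤ) • K
  · obtain ⟨K, rfl⟩ := h
    simp only [Pi.smul_apply, seriesPowP_mul]
  · push Not at h
    simp only [Pi.smul_apply, seriesPowP_of_ne _ h, smul_zero]

@[simp] theorem seriesPowP_zero : seriesPowP (0 : Series p σ) = 0 := by
  have := seriesPowP_smul (0 : ℂ_[p]) (0 : Series p σ)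
  rwa [zero_smul, zero_smul] at this

/-- The substitution of `p`-th powers of the coordinates in Laurent polynomials, as a homomorphism
of algebras. -/
def powPHom (p : ℕ) [Fact p.Prime] {σ : Type} : LPoly p σ →ₐ[ℂ_[p]] LPoly p σ :=
  AddMonoidAlgebra.mapDomainAlgHom ℂ_[p] ℂ_[p]
    { toFun := fun (I : σ → ℤ) j => (p : ℤ) * I j
      map_zero' := by funext j; simp
      map_add' := fun I J => by funext j; simp [mul_add] }

theorem powPHom_apply (f : LPoly p σ) : powPHom p f = f.powP := rfl

@[simp] theorem powPHom_single (I : σ → ℤ) (c : ℂ_[p]) :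
    powPHom p (AddMonoidAlgebra.single I c) = AddMonoidAlgebra.single ((p : ℤ) • I) c := by
  rw [powPHom_apply, LPoly.powP, AddMonoidAlgebra.mapDomain_single]
  rfl

theorem smul_int_injective {I J : σ → ℤ} (h : (p : ℤ) • I = (p : ℤ) • J) : I = J := by
  have hp0 : (p : ℤ) ≠ 0 := by exact_mod_cast hp.out.ne_zero
  funext j
  exact mul_left_cancel₀ hp0 (congrFun h j)

theorem coeff_powPHom (f : LPoly p σ) (I : σ → ℤ) :
    (powPHom p f).coeff I = seriesPowP (fun J => f.coeff J) I := by
  classical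
  induction f using AddMonoidAlgebra.induction_linear with
  | zero =>
    rw [map_zero]
    exact (congrFun seriesPowP_zero I).symm
  | add f g hf hg =>
    rw [map_add, AddMonoidAlgebra.coeff_add, Finsupp.add_apply, hf, hg]
    exact (congrFun (seriesPowP_add _ _) I).symm
  | single J c =>
    rw [powPHom_single, AddMonoidAlgebra.coeff_single, Finsupp.single_apply]
    by_cases h : ∃ K, I = (p : ℤ) • K
    · obtain ⟨K, rfl⟩ := h
      rw [seriesPowP_mul, AddMonoidAlgebra.coeff_single, Finsupp.single_apply]
      exact if_congr ⟨smul_int_injective, fun h => by rw [h]⟩ rfl rfl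
    · push Not at h
      rw [seriesPowP_of_ne _ h, if_neg fun h' => h J h'.symm]

theorem powPHom_mem_algFun {inv : Set σ} {f : LPoly p σ} (hf : f ∈ algFun p inv) :
    powPHom p f ∈ algFun p inv := by
  intro I hI j hj
  rw [coeff_powPHom] at hI
  by_cases h : ∃ K, I = (p : ℤ) • K
  · obtain ⟨K, rfl⟩ := h
    rw [seriesPowP_mul] at hI
    exact mul_nonneg (Int.natCast_nonneg p) (hf K hI j hj)
  · push Not at h
    exact absurd (seriesPowP_of_ne _ h) hI

theorem polyMul_powPHom (f : LPoly p σ) (a : Series p σ) :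
    polyMul (powPHom p f) (seriesPowP a) = seriesPowP (polyMul f a) := by
  induction f using AddMonoidAlgebra.induction_linear with
  | zero => simp
  | add f g hf hg =>
    rw [map_add, polyMul_add, LinearMap.add_apply, hf, hg, polyMul_add, LinearMap.add_apply,
      seriesPowP_add]
  | single J c =>
    funext I
    rw [powPHom_single, polyMul_single]
    by_cases h : ∃ K, I = (p : ℤ) • K
    · obtain ⟨K, rfl⟩ := h
      rw [seriesPowP_mul, ← smul_sub, seriesPowP_mul, polyMul_single]
    · push Not at h
      rw [seriesPowP_of_ne _ h, seriesPowP_of_ne, mul_zero]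
      intro K hK
      refine h (K + J) ?_
      rw [smul_add, ← hK, sub_add_cancel]

theorem seriesPowP_mem_overconv [Fintype σ] {inv : Set σ} {a : Series p σ}
    (ha : a ∈ overconv p inv) : seriesPowP a ∈ overconv p inv := by
  refine overconv_of_le ha (fun I hI => ?_) 1 p fun I hI => ?_
  · by_cases h : ∃ K, I = (p : ℤ) • K
    · obtain ⟨K, rfl⟩ := h
      rw [seriesPowP_mul]
      exact ha.1 K fun hK => hI fun j hj => mul_nonneg (Int.natCast_nonneg p) (hK j hj)
    · push Not at h
      exact seriesPowP_of_ne _ h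
  · by_cases h : ∃ K, I = (p : ℤ) • K
    · obtain ⟨K, rfl⟩ := h
      refine ⟨K, ?_, ?_⟩
      · have h1 : expSize ((p : ℤ) • K) = p * expSize K := by
          rw [expSize, expSize, mul_sum]
          refine sum_congr rfl fun j _ => ?_
          rw [Pi.smul_apply, smul_eq_mul, Int.natAbs_mul, Int.natAbs_natCast]
        rw [h1]
        exact Nat.mul_le_mul_left _ (Nat.le_succ _)
      · rw [seriesPowP_mul, one_mul]
        exact le_mul_of_one_le_left (norm_nonneg _) (by simp)
    · push Not at h
      exact absurd (seriesPowP_of_ne _ h) hI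

variable [DecidableEq σ]

theorem coordFun_pow (j : σ) (k : ℕ) :
    (coordFun p j : LPoly p σ) ^ k = AddMonoidAlgebra.single (Pi.single j (k : ℤ)) 1 := by
  induction k with
  | zero => simp [AddMonoidAlgebra.one_def]
  | succ k ih =>
    rw [pow_succ, ih, coordFun, AddMonoidAlgebra.single_mul_single, ← Pi.single_add, one_mul]
    norm_cast

theorem powPHom_coordFun (j : σ) : powPHom p (coordFun p j) = (coordFun p j : LPoly p σ) ^ p := by
  rw [coordFun_pow, coordFun, powPHom_single]
  congr 1
  funext i
  rw [Pi.smul_apply, smul_eq_mul, Pi.single_apply, Pi.single_apply]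
  split_ifs <;> simp

theorem pderiv_powPHom (j : σ) (f : LPoly p σ) :
    LPoly.pderiv j (powPHom p f)
      = (p : ℂ_[p]) • (coordFun p j ^ (p - 1) * powPHom p (LPoly.pderiv j f)) := by
  induction f using AddMonoidAlgebra.induction_linear with
  | zero => simp
  | add f g hf hg => rw [map_add, pderiv_add, hf, hg, pderiv_add, map_add, mul_add, smul_add]
  | single J c =>
    have h1 : ((p - 1 : ℕ) : ℤ) = (p : ℤ) - 1 := Nat.cast_pred hp.out.pos
    rw [powPHom_single, pderiv_single, pderiv_single, powPHom_single, coordFun_pow,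
      AddMonoidAlgebra.single_mul_single, AddMonoidAlgebra.smul_single, smul_eq_mul, one_mul]
    congr 1
    · funext i
      simp only [Pi.sub_apply, Pi.add_apply, Pi.smul_apply, smul_eq_mul, Pi.single_apply, h1]
      split_ifs <;> ring
    · rw [Pi.smul_apply, smul_eq_mul]
      push_cast
      ring

theorem seriesDeriv_seriesPowP (j : σ) (a : Series p σ) :
    seriesDeriv j (seriesPowP a)
      = (p : ℂ_[p]) • polyMul (coordFun p j ^ (p - 1)) (seriesPowP (seriesDeriv j a)) := by
  funext I
  have h1 : ((p - 1 : ℕ) : ℤ) = (p : ℤ) - 1 := Nat.cast_pred hp.out.pos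
  have h2 : ∀ K : σ → ℤ, (p : ℤ) • K - Pi.single j 1 - Pi.single j ((p - 1 : ℕ) : ℤ)
      = (p : ℤ) • (K - Pi.single j 1) := by
    intro K
    funext i
    simp only [Pi.sub_apply, Pi.smul_apply, smul_eq_mul, Pi.single_apply, h1]
    split_ifs <;> ring
  rw [seriesDeriv_apply, Pi.smul_apply, coordFun_pow, polyMul_single, one_mul, smul_eq_mul]
  by_cases h : ∃ K, I + Pi.single j 1 = (p : ℤ) • K
  · obtain ⟨K, hK⟩ := h
    obtain rfl : I = (p : ℤ) • K - Pi.single j 1 := eq_sub_of_add_eq hK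
    rw [sub_add_cancel, seriesPowP_mul, h2, seriesPowP_mul, seriesDeriv_apply, sub_add_cancel]
    simp only [Pi.sub_apply, Pi.smul_apply, smul_eq_mul, Pi.single_eq_same]
    push_cast
    ring
  · push Not at h
    rw [seriesPowP_of_ne _ h, seriesPowP_of_ne, mul_zero, mul_zero]
    intro K hK
    refine h (K + Pi.single j 1) ?_
    have h3 := h2 (K + Pi.single j 1)
    rw [add_sub_cancel_right, ← hK] at h3
    have h4 := sub_left_injective h3
    rw [← h4, sub_add_cancel]

/-- The derivatives twisted by `f(z ^ p)` and by `f` correspond under `z ↦ z ^ p`. -/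
theorem twistedDeriv_seriesPowP (j : σ) (f : LPoly p σ) (a : Series p σ) :
    twistedDeriv (powPHom p f) j (seriesPowP a)
      = (p : ℂ_[p]) • polyMul (coordFun p j ^ (p - 1)) (seriesPowP (twistedDeriv f j a)) := by
  rw [twistedDeriv_apply, twistedDeriv_apply, seriesDeriv_seriesPowP, pderiv_powPHom,
    polyMul_smul, LinearMap.smul_apply, polyMul_mul, polyMul_powPHom, seriesPowP_add, map_add,
    smul_add]

end PowP

/-! ### Overconvergence of Dwork's exponential -/

noncomputable section DworkExponential

variable {p : ℕ} [hp : Fact p.Prime] {σ : Type}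

/-- Laurent polynomials with coefficients of absolute value at most `1`. -/
def integralLPoly (p : ℕ) [Fact p.Prime] (σ : Type) : Subring (LPoly p σ) where
  carrier := {f | ∀ I, ‖f.coeff I‖ ≤ 1}
  mul_mem' hf hg I := by simpa using norm_coeff_mul_le zero_le_one zero_le_one hf hg I
  one_mem' I := by classical exact norm_coeff_one_le I
  add_mem' hf hg I := by
    rw [AddMonoidAlgebra.coeff_add, Finsupp.add_apply]
    exact (IsUltrametricDist.norm_add_le_max _ _).trans (max_le (hf I) (hg I))
  zero_mem' I := by simp
  neg_mem' hf I := by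
    rw [AddMonoidAlgebra.coeff_neg, Finsupp.neg_apply, norm_neg]
    exact hf I

theorem norm_coeff_add_lt {f g : LPoly p σ} {c : ℝ} (hf : ∀ I, ‖f.coeff I‖ < c)
    (hg : ∀ I, ‖g.coeff I‖ < c) (I : σ → ℤ) : ‖(f + g).coeff I‖ < c := by
  rw [AddMonoidAlgebra.coeff_add, Finsupp.add_apply]
  exact (IsUltrametricDist.norm_add_le_max _ _).trans_lt (max_lt (hf I) (hg I))

theorem norm_natCast_prime_lt_one : ‖(p : ℂ_[p])‖ < 1 := by
  rw [norm_natCast_padicComplex, Padic.norm_p]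
  exact inv_lt_one_of_one_lt₀ (by exact_mod_cast hp.out.one_lt)

/-- A Laurent polynomial whose coefficients reduce to elements of `𝔽_p` satisfies
`f (z ^ p) ≡ f (z) ^ p` modulo the maximal ideal. -/
theorem norm_coeff_powPHom_sub_pow_lt {f : LPoly p σ} (hf : ∀ I, ‖f.coeff I‖ ≤ 1)
    (hF : ∀ I, ‖f.coeff I ^ p - f.coeff I‖ < 1) (I : σ → ℤ) :
    ‖(powPHom p f - f ^ p).coeff I‖ < 1 := by
  classical
  have key : ∀ s : Finset (σ → ℤ), ∃ x : LPoly p σ,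
      x = ∑ J ∈ s, AddMonoidAlgebra.single J (f.coeff J) ∧ x ∈ integralLPoly p σ ∧
        ∀ I, ‖(powPHom p x - x ^ p).coeff I‖ < 1 := by
    intro s
    induction s using Finset.induction_on with
    | empty => exact ⟨0, by simp, Subring.zero_mem _, fun I => by simp [hp.out.ne_zero]⟩
    | insert J s hJ ih =>
      obtain ⟨x, hx, hxi, hxI⟩ := ih
      have hsi : AddMonoidAlgebra.single J (f.coeff J) ∈ integralLPoly p σ := by
        intro K
        rw [AddMonoidAlgebra.coeff_single, Finsupp.single_apply]
        split_ifs
        · exact hf J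
        · simp
      refine ⟨AddMonoidAlgebra.single J (f.coeff J) + x, by rw [sum_insert hJ, hx],
        Subring.add_mem _ hsi hxi, ?_⟩
      obtain ⟨r, hr⟩ := exists_add_pow_prime_eq hp.out
        (⟨_, hsi⟩ : integralLPoly p σ) ⟨x, hxi⟩
      have hr' := congrArg (fun y : integralLPoly p σ => (y : LPoly p σ)) hr
      simp only [Subring.coe_add, Subring.coe_mul, Subring.coe_pow, Subring.coe_natCast] at hr'
      set u : LPoly p σ := AddMonoidAlgebra.single J (f.coeff J) with hu
      have h1 : powPHom p (u + x) - (u + x) ^ p = (powPHom p u - u ^ p) +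
          ((powPHom p x - x ^ p) + (-(p : ℂ_[p])) • (u * x * (r : LPoly p σ))) := by
        rw [hr', map_add, neg_smul, Nat.cast_smul_eq_nsmul, nsmul_eq_mul]
        ring
      rw [h1]
      refine norm_coeff_add_lt (fun K => ?_) (norm_coeff_add_lt hxI fun K => ?_)
      · rw [hu, powPHom_single, AddMonoidAlgebra.single_pow, natCast_zsmul,
        AddMonoidAlgebra.coeff_sub,
          Finsupp.sub_apply, AddMonoidAlgebra.coeff_single, AddMonoidAlgebra.coeff_single,
          Finsupp.single_apply, Finsupp.single_apply]
        split_ifs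
        · rw [norm_sub_rev]
          exact hF J
        · simp
      · rw [AddMonoidAlgebra.coeff_smul, Finsupp.smul_apply, smul_eq_mul, norm_mul, norm_neg]
        have h2 := Subring.mul_mem _ (Subring.mul_mem _ hsi hxi) r.2 K
        calc _ ≤ ‖(p : ℂ_[p])‖ * 1 := mul_le_mul_of_nonneg_left h2 (norm_nonneg _)
          _ < 1 := by rw [mul_one]; exact norm_natCast_prime_lt_one
  obtain ⟨x, hx, -, hxI⟩ := key f.coeff.support
  have hfx : x = f := by
    rw [hx]
    exact f.sum_coeff_single
  rw [← hfx]
  exact hxI I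

theorem exists_norm_coeff_le_of_lt_one {f : LPoly p σ} (hf : ∀ I, ‖f.coeff I‖ < 1) :
    ∃ ρ : ℝ, 0 < ρ ∧ ρ < 1 ∧ ∀ I, ‖f.coeff I‖ ≤ ρ := by
  classical
  have key : ∀ s : Finset (σ → ℤ), ∃ ρ : ℝ, 0 < ρ ∧ ρ < 1 ∧ ∀ I ∈ s, ‖f.coeff I‖ ≤ ρ := by
    intro s
    induction s using Finset.induction_on with
    | empty => exact ⟨1 / 2, by norm_num, by norm_num, by simp⟩
    | insert J s hJ ih =>
      obtain ⟨ρ, h0, h1, h⟩ := ih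
      refine ⟨max ρ ‖f.coeff J‖, lt_max_of_lt_left h0, max_lt h1 (hf J), fun I hI => ?_⟩
      rcases mem_insert.1 hI with rfl | hI
      · exact le_max_right _ _
      · exact (h I hI).trans (le_max_left _ _)
  obtain ⟨ρ, h0, h1, h⟩ := key f.coeff.support
  refine ⟨ρ, h0, h1, fun I => ?_⟩
  by_cases hI : f.coeff I = 0
  · rw [hI, norm_zero]; exact h0.le
  · exact h I (Finsupp.mem_support_iff.2 hI)

variable {t : σ} {Q : LPoly p σ} (hQ : ∀ I, Q.coeff I ≠ 0 → 1 ≤ I t) {ϖ : ℂ_[p]}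

include hQ in
theorem le_of_coeff_powPHom_ne_zero (I : σ → ℤ) (hI : (powPHom p Q).coeff I ≠ 0) : 1 ≤ I t := by
  rw [coeff_powPHom] at hI
  by_cases h : ∃ K, I = (p : ℤ) • K
  · obtain ⟨K, rfl⟩ := h
    rw [seriesPowP_mul] at hI
    have h1 := hQ K hI
    have h2 : (1 : ℤ) ≤ p := by exact_mod_cast hp.out.one_le
    rw [Pi.smul_apply, smul_eq_mul]
    nlinarith
  · push Not at h
    exact absurd (seriesPowP_of_ne _ h) hI

omit hp hQ in
theorem le_of_coeff_sub_ne_zero [Fact p.Prime] {f g : LPoly p σ} (hf : ∀ I, f.coeff I ≠ 0 → 1 ≤ I t)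
    (hg : ∀ I, g.coeff I ≠ 0 → 1 ≤ I t) (I : σ → ℤ) (hI : (f - g).coeff I ≠ 0) : 1 ≤ I t := by
  by_cases h : f.coeff I = 0
  · refine hg I fun h' => hI ?_
    rw [AddMonoidAlgebra.coeff_sub, Finsupp.sub_apply, h, h', sub_zero]
  · exact hf I h

omit hp hQ in
theorem le_of_coeff_smul_ne_zero [Fact p.Prime] {f : LPoly p σ} (hf : ∀ I, f.coeff I ≠ 0 → 1 ≤ I t)
    (c : ℂ_[p]) (I : σ → ℤ) (hI : (c • f).coeff I ≠ 0) : 1 ≤ I t := by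
  refine hf I fun h => hI ?_
  rw [AddMonoidAlgebra.coeff_smul, Finsupp.smul_apply, h, smul_zero]

variable (ϖ) in
/-- The composite of `Q` with Dwork's splitting function. -/
def splitSeries (Q : LPoly p σ) : Series p σ := powSeries (fun k => dworkCoeff ϖ k) Q

include hQ in
/-- The differential equation of `exp (ϖ (Q ^ p - Q))`. -/
theorem seriesDeriv_splitSeries [DecidableEq σ] (j : σ) :
    seriesDeriv j (splitSeries ϖ Q)
      = polyMul (LPoly.pderiv j (ϖ • (Q ^ p - Q))) (splitSeries ϖ Q) := by
  have hp1 : p - 1 + 1 = p := Nat.sub_add_cancel hp.out.one_le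
  have h1 : LPoly.pderiv j (ϖ • (Q ^ p - Q))
      = LPoly.pderiv j Q * (ϖ • ((p : ℂ_[p]) • Q ^ (p - 1) - 1)) := by
    have h := pderiv_pow j Q (p - 1)
    have h2 : ((p - 1 : ℕ) : ℂ_[p]) + 1 = p := by
      rw [← Nat.cast_succ, Nat.succ_eq_add_one, hp1]
    rw [hp1, h2] at h
    rw [pderiv_smul, pderiv_sub, h, mul_smul_comm, mul_sub, mul_one, mul_smul_comm,
      mul_comm (LPoly.pderiv j Q)]
  rw [h1, polyMul_mul, polyMul_smul, polyMul_sub, polyMul_smul, splitSeries,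
    seriesDeriv_powSeries hQ]
  congr 1
  rw [LinearMap.smul_apply, LinearMap.sub_apply, LinearMap.smul_apply, polyMul_one,
    polyMul_pow_powSeries hQ]
  funext I
  obtain ⟨N, hN⟩ : ∃ N : ℕ, I t < N := ⟨(I t).toNat + 1, by omega⟩
  simp only [Pi.smul_apply, Pi.sub_apply, smul_eq_mul]
  rw [powSeries_eq_sum hQ _ hN, powSeries_eq_sum hQ _ hN, powSeries_eq_sum hQ _ hN, mul_sum,
    ← sum_sub_distrib, mul_sum]
  refine sum_congr rfl fun k _ => ?_
  have h3 := mul_dworkCoeff (ϖ := ϖ) (p := p) ((k : ℤ) + 1)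
  have h4 : (if k < p - 1 then (0 : ℂ_[p]) else dworkCoeff ϖ ((k - (p - 1) : ℕ) : ℤ))
      = dworkCoeff ϖ ((k : ℤ) + 1 - p) := by
    have := hp.out.one_le
    split_ifs with h
    · rw [dworkCoeff_of_neg (by omega)]
    · congr 1
      omega
  rw [add_sub_cancel_right] at h3
  push_cast at h3 ⊢
  rw [h3, h4]
  ring

include hQ in
/-- Dwork's exponential splits into an exponential with small exponent and a composite with the
splitting function. -/
theorem expSeries_eq_seriesMul [Fintype σ] [DecidableEq σ] {inv : Set σ}
    (h1 : expSeries (ϖ • (powPHom p Q - Q ^ p)) ∈ overconv p inv)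
    (h2 : splitSeries ϖ Q ∈ overconv p inv) :
    expSeries (ϖ • (powPHom p Q - Q))
      = seriesMul (expSeries (ϖ • (powPHom p Q - Q ^ p))) (splitSeries ϖ Q) := by
  have hφ := le_of_coeff_powPHom_ne_zero hQ
  have hQp : ∀ I, (Q ^ p).coeff I ≠ 0 → 1 ≤ I t := fun I hI => by
    have := le_of_coeff_pow_ne_zero hQ p I hI
    have := hp.out.one_le
    omega
  have hG := le_of_coeff_smul_ne_zero (le_of_coeff_sub_ne_zero hφ hQ) ϖ
  have hA := le_of_coeff_smul_ne_zero (le_of_coeff_sub_ne_zero hφ hQp) ϖ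
  refine eq_of_seriesDeriv_eq (t := t) (h := LPoly.pderiv t (ϖ • (powPHom p Q - Q)))
    (coeff_pderiv_nonneg t fun J hJ => zero_le_one.trans (hG J hJ)) (seriesDeriv_expSeries hG t) ?_
    fun I hI => ?_
  · rw [seriesDeriv_seriesMul t h1 h2, seriesDeriv_expSeries hA, seriesDeriv_splitSeries hQ,
      polyMul_seriesMul h1 _ h2, seriesMul_polyMul h1 _ h2, ← LinearMap.add_apply, ← polyMul_add,
      ← pderiv_add, ← smul_add, sub_add_sub_cancel]
  · rw [seriesMul_of_nonpos (t := t) (fun J hJ => ?_) (fun J hJ => ?_) hI, expSeries_eq_powSeries,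
      powSeries_of_nonpos hG _ hI]
    · simp
    · rw [expSeries_eq_powSeries, powSeries_of_nonpos hA _ hJ]
      simp
    · rw [splitSeries, powSeries_of_nonpos hQ _ hJ, Nat.cast_zero, dworkCoeff_zero, one_mul]

include hQ in
theorem expSeries_powPHom_sub_mem_overconv [Fintype σ] {inv : Set σ} (hp2 : p ≠ 2)
    (hϖ : ϖ ^ (p - 1) = -(p : ℂ_[p])) (hQa : Q ∈ algFun p inv) (hQ1 : ∀ I, ‖Q.coeff I‖ ≤ 1)
    (hQF : ∀ I, ‖Q.coeff I ^ p - Q.coeff I‖ < 1) :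
    expSeries (ϖ • (powPHom p Q - Q)) ∈ overconv p inv := by
  classical
  have hKa : powPHom p Q - Q ^ p ∈ algFun p inv :=
    Subalgebra.sub_mem _ (powPHom_mem_algFun hQa) (Subalgebra.pow_mem _ hQa p)
  obtain ⟨ρ, hρ0, hρ1, hρ⟩ := exists_norm_coeff_le_of_lt_one (norm_coeff_powPHom_sub_pow_lt hQ1 hQF)
  have hA : expSeries (ϖ • (powPHom p Q - Q ^ p)) ∈ overconv p inv := by
    rw [expSeries_eq_powSeries, powSeries_smul]
    refine powSeries_mem_overconv hKa hρ0.le hρ hρ0 hρ1 (C := 1) fun k => ?_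
    have h := norm_pi_pow_div_factorial_le hϖ k
    rw [div_eq_inv_mul] at h
    exact mul_le_mul_of_nonneg_right h (by positivity)
  obtain ⟨r, hr0, hr1, hr⟩ := exists_norm_dworkCoeff_le hp2 hϖ
  have hB : splitSeries ϖ Q ∈ overconv p inv := by
    refine powSeries_mem_overconv hQa zero_le_one hQ1 hr0 hr1 (C := 1) fun k => ?_
    rw [one_pow, mul_one, one_mul]
    simpa using hr k
  rw [expSeries_eq_seriesMul hQ hA hB]
  exact seriesMul_mem_overconv hA hB

end DworkExponential

/-! ### Frobenius on forms -/

noncomputable section FrobeniusForms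

variable {p : ℕ} [hp : Fact p.Prime] {σ : Type}

/-- The map of forms `g dz_S ↦ F g(z ^ p) d(z ^ p)_S`. -/
def frobForms [DecidableEq σ] (F : Series p σ) (ω : Forms p σ) : Forms p σ :=
  fun S => (p : ℂ_[p]) ^ S.card •
    seriesMul F (polyMul (∏ j ∈ S, coordFun p j ^ (p - 1)) (seriesPowP (ω S)))

variable [Fintype σ] [LinearOrder σ] {inv : Set σ} {F : Series p σ} {f g : LPoly p σ}
  {ω η : Forms p σ}

theorem polyMul_seriesPowP_mem (g : LPoly p σ) {a : Series p σ} (ha : a ∈ overconv p inv) :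
    polyMul g (seriesPowP a) ∈ overconv p (Set.univ : Set σ) :=
  polyMul_mem_overconv (mem_algFun_univ _) (mem_overconv_univ (seriesPowP_mem_overconv ha))

theorem frobForms_add (hF : F ∈ overconv p inv) (hω : ∀ S, ω S ∈ overconv p inv)
    (hη : ∀ S, η S ∈ overconv p inv) : frobForms F (ω + η) = frobForms F ω + frobForms F η := by
  funext S
  rw [Pi.add_apply, frobForms, frobForms, frobForms, Pi.add_apply, seriesPowP_add, map_add,
    seriesMul_add (mem_overconv_univ hF) (polyMul_seriesPowP_mem _ (hω S))
      (polyMul_seriesPowP_mem _ (hη S)), smul_add]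

theorem frobForms_smul (F : Series p σ) (c : ℂ_[p]) (ω : Forms p σ) :
    frobForms F (c • ω) = c • frobForms F ω := by
  funext S
  rw [Pi.smul_apply, frobForms, frobForms, Pi.smul_apply, seriesPowP_smul, map_smul, seriesMul_smul,
    smul_comm]

theorem frobForms_zero (F : Series p σ) : frobForms F (0 : Forms p σ) = 0 := by
  have h := frobForms_smul F 0 (0 : Forms p σ)
  rwa [zero_smul, zero_smul] at h

theorem frobForms_sum (hF : F ∈ overconv p inv) {ι : Type} (s : Finset ι) (Ω : ι → Forms p σ)
    (hΩ : ∀ i S, Ω i S ∈ overconv p inv) :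
    frobForms F (∑ i ∈ s, Ω i) = ∑ i ∈ s, frobForms F (Ω i) := by
  classical
  induction s using Finset.induction_on with
  | empty => rw [sum_empty, sum_empty, frobForms_zero]
  | insert i s hi ih =>
    rw [sum_insert hi, sum_insert hi, frobForms_add hF (hΩ i) (fun S => ?_), ih]
    rw [Finset.sum_apply]
    exact Submodule.sum_mem _ fun i _ => hΩ i S

theorem wedge_mem_overconv (hω : ∀ S, ω S ∈ overconv p inv) (j : σ) (S : Finset σ) :
    wedge p j ω S ∈ overconv p inv := by
  rw [wedge_apply]
  split_ifs
  · exact Submodule.smul_mem _ _ (hω _)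
  · exact Submodule.zero_mem _

theorem frobForms_mem_formsOfDeg (hF : F ∈ overconv p inv) {k : ℤ}
    (hω : ω ∈ formsOfDeg p inv k) : frobForms F ω ∈ formsOfDeg p inv k := by
  intro S
  refine ⟨Submodule.smul_mem _ _ (seriesMul_mem_overconv hF (polyMul_mem_overconv ?_
    (seriesPowP_mem_overconv (hω S).1))), fun h => ?_⟩
  · exact Subalgebra.prod_mem _ fun j _ => Subalgebra.pow_mem _ (coordFun_mem_algFun j inv) _
  · rw [frobForms, (hω S).2 h, seriesPowP_zero, map_zero, seriesMul_zero, smul_zero]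

theorem frobForms_polyMul (hF : F ∈ overconv p inv) (hω : ∀ S, ω S ∈ overconv p inv)
    (g : LPoly p σ) : frobForms F (coeffwise (polyMul g) ω)
      = coeffwise (polyMul (powPHom p g)) (frobForms F ω) := by
  funext S
  rw [LinearMap.compLeft_apply, Function.comp_apply, frobForms, frobForms,
    LinearMap.compLeft_apply, Function.comp_apply, map_smul, ← polyMul_powPHom, polyMul_comm,
    seriesMul_polyMul (mem_overconv_univ hF) _ (polyMul_seriesPowP_mem _ (hω S))]

/-- Frobenius and multiplication by `dz_j`. -/
theorem frobForms_wedge (hF : F ∈ overconv p inv) (hω : ∀ S, ω S ∈ overconv p inv) (j : σ) :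
    frobForms F (wedge p j ω)
      = (p : ℂ_[p]) • wedge p j (coeffwise (polyMul (coordFun p j ^ (p - 1))) (frobForms F ω)) := by
  funext S
  rw [Pi.smul_apply, frobForms, wedge_apply, wedge_apply]
  split_ifs with hj
  · rw [LinearMap.compLeft_apply, Function.comp_apply, frobForms, seriesPowP_smul, map_smul,
      seriesMul_smul, map_smul, ← mul_prod_erase S _ hj, polyMul_mul,
      seriesMul_polyMul (mem_overconv_univ hF) _ (polyMul_seriesPowP_mem _ (hω _)),
      ← card_erase_add_one hj, pow_succ', mul_smul, smul_comm (wedgeSign p j S)]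
  · rw [seriesPowP_zero, map_zero, seriesMul_zero, smul_zero, smul_zero]

theorem wedge_congr {j : σ} (h : ∀ S, j ∉ S → ω S = η S) : wedge p j ω = wedge p j η := by
  funext S
  rw [wedge_apply, wedge_apply, h _ (notMem_erase j S)]

theorem pderiv_prod_coordFun_pow {j : σ} {S : Finset σ} (hj : j ∉ S) (k : ℕ) :
    LPoly.pderiv j (∏ i ∈ S, (coordFun p i : LPoly p σ) ^ k) = 0 := by
  induction S using Finset.induction_on with
  | empty => rw [prod_empty, AddMonoidAlgebra.one_def, pderiv_single]; simp
  | insert i S hi ih =>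
    rw [mem_insert, not_or] at hj
    rw [prod_insert hi, pderiv_mul, ih hj.2, mul_zero, add_zero, coordFun_pow, pderiv_single,
      Pi.single_eq_of_ne hj.1]
    simp

/-- Frobenius is a map of complexes, if `F` is a solution of `dF = dg F` with
`g = f(z ^ p) - f(z)`. -/
theorem deRhamD_frobForms (hF : F ∈ overconv p inv)
    (hder : ∀ j, seriesDeriv j F = polyMul (LPoly.pderiv j g) F) (hg : f + g = powPHom p f)
    (hω : ∀ S, ω S ∈ overconv p inv) :
    deRhamD f (frobForms F ω) = frobForms F (deRhamD f ω) := by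
  have hF' := mem_overconv_univ hF
  have hT : ∀ j S, coeffwise (twistedDeriv f j) ω S ∈ overconv p (Set.univ : Set σ) := fun j S =>
    twistedDeriv_mem_overconv (mem_algFun_univ f) j (mem_overconv_univ (hω S))
  rw [deRhamD_eq_koszulD, koszulD_apply, koszulD_apply, frobForms_sum hF' _ _
    fun j S => wedge_mem_overconv (hT j) j S]
  refine sum_congr rfl fun j _ => ?_
  rw [frobForms_wedge hF' (hT j), ← map_smul]
  refine wedge_congr fun S hj => ?_
  have hm := polyMul_seriesPowP_mem (∏ i ∈ S, coordFun p i ^ (p - 1)) (hω S)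
  have hT' : twistedDeriv f j (ω S) ∈ overconv p (Set.univ : Set σ) := hT j S
  have h1 := twistedDeriv_seriesMul j (f := f) hF' hm (hder j)
  rw [Pi.smul_apply, LinearMap.compLeft_apply, Function.comp_apply, LinearMap.compLeft_apply,
    Function.comp_apply, frobForms, frobForms, LinearMap.compLeft_apply, Function.comp_apply,
    map_smul, h1, hg, twistedDeriv_polyMul, pderiv_prod_coordFun_pow hj, polyMul_zero,
    LinearMap.zero_apply, zero_add, twistedDeriv_seriesPowP, map_smul, seriesMul_smul, map_smul,
    polyMul_comm, seriesMul_polyMul hF' _ (polyMul_seriesPowP_mem _ hT'), smul_comm]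

theorem frobForms_wedgeD (hF : F ∈ overconv p inv) (hω : ∀ S, ω S ∈ overconv p inv)
    (h : LPoly p σ) : frobForms F (wedgeD h ω) = wedgeD (powPHom p h) (frobForms F ω) := by
  have hF' := mem_overconv_univ hF
  have hω' := fun S => mem_overconv_univ (hω S)
  have hT : ∀ j S, coeffwise (polyMul (LPoly.pderiv j h)) ω S ∈ overconv p (Set.univ : Set σ) :=
    fun j S => polyMul_mem_overconv (mem_algFun_univ _) (hω' S)
  rw [wedgeD_apply, wedgeD_apply, frobForms_sum hF' _ _ fun j S => wedge_mem_overconv (hT j) j S]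
  refine sum_congr rfl fun j _ => ?_
  rw [frobForms_wedge hF' (hT j), frobForms_polyMul hF' hω', ← map_smul]
  congr 1
  funext S
  simp only [Pi.smul_apply, LinearMap.compLeft_apply, Function.comp_apply]
  rw [pderiv_powPHom, polyMul_smul, LinearMap.smul_apply, polyMul_mul]

theorem frobForms_mem_closedForms (hF : F ∈ overconv p inv)
    (hder : ∀ j, seriesDeriv j F = polyMul (LPoly.pderiv j g) F) (hg : f + g = powPHom p f) {k : ℤ}
    (hω : ω ∈ closedForms inv f k) : frobForms F ω ∈ closedForms inv f k := by
  refine ⟨frobForms_mem_formsOfDeg hF hω.1, ?_⟩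
  change deRhamD f (frobForms F ω) = 0
  rw [deRhamD_frobForms hF hder hg fun S => (hω.1 S).1, show deRhamD f ω = 0 from hω.2,
    frobForms_zero]

theorem exists_induces_frobForms (hF : F ∈ overconv p inv)
    (hder : ∀ j, seriesDeriv j F = polyMul (LPoly.pderiv j g) F) (hg : f + g = powPHom p f)
    (k : ℤ) : ∃ Φ : DeRham inv f k →ₗ[ℂ_[p]] DeRham inv f k, Induces (frobForms F) Φ := by
  refine exists_induces _ (fun ω hω η hη => frobForms_add hF (fun S => (hω S).1) fun S => (hη S).1)
    (fun c ω _ => frobForms_smul F c ω) (fun ω hω => frobForms_mem_closedForms hF hder hg hω)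
    fun θ hθ _ => ⟨frobForms F θ, frobForms_mem_formsOfDeg hF hθ, ?_⟩
  exact deRhamD_frobForms hF hder hg fun S => (hθ S).1

end FrobeniusForms

/-! ### Frobenius and suspension -/

noncomputable section FrobeniusSuspension

variable {p : ℕ} [hp : Fact p.Prime] {σ τ : Type} [Fintype σ] [LinearOrder σ] [Fintype τ]
  [LinearOrder τ] {e : σ → τ} {t : σ} {x y : τ} {inv : Set σ} {ϖ : ℂ_[p]} {Q : LPoly p σ}

theorem seriesPowP_pullSeries (he : e.Injective) (a : Series p σ) :
    seriesPowP (pullSeries p e a) = pullSeries p e (seriesPowP a) := by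
  have hp0 : (p : ℤ) ≠ 0 := by exact_mod_cast hp.out.ne_zero
  funext I
  by_cases h : ∀ k, k ∉ Set.range e → I k = 0
  · rw [pullSeries_apply_of_forall _ h]
    by_cases hI : ∃ K, I = (p : ℤ) • K
    · obtain ⟨K, rfl⟩ := hI
      rw [seriesPowP_mul, pullSeries_apply_of_forall, ← seriesPowP_mul a]
      · rfl
      · intro k hk
        exact (mul_eq_zero.1 (h k hk)).resolve_left hp0
    · push Not at hI
      rw [seriesPowP_of_ne _ hI, seriesPowP_of_ne]
      intro K hK
      refine hI (Function.extend e K 0) ?_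
      funext k
      by_cases hk : k ∈ Set.range e
      · obtain ⟨j, rfl⟩ := hk
        rw [Pi.smul_apply, he.extend_apply]
        exact congrFun hK j
      · rw [h k hk, Pi.smul_apply, extend_eq_zero hk, smul_zero]
  · push Not at h
    obtain ⟨k, hk, hne⟩ := h
    rw [pullSeries_apply_of_ne _ hk hne]
    by_cases hI : ∃ K, I = (p : ℤ) • K
    · obtain ⟨K, rfl⟩ := hI
      rw [seriesPowP_mul, pullSeries_apply_of_ne _ hk]
      rintro h0
      exact hne (by rw [Pi.smul_apply, h0, smul_zero])
    · push Not at hI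
      rw [seriesPowP_of_ne _ hI]

theorem powPHom_extendHom (he : e.Injective) (f : LPoly p σ) :
    powPHom p (extendHom p he f) = extendHom p he (powPHom p f) := by
  induction f using AddMonoidAlgebra.induction_linear with
  | zero => simp
  | add f g hf hg => simp only [map_add, hf, hg]
  | single J c =>
    rw [extendHom_single, powPHom_single, powPHom_single, extendHom_single]
    congr 1
    funext k
    by_cases hk : k ∈ Set.range e
    · obtain ⟨j, rfl⟩ := hk
      rw [Pi.smul_apply, he.extend_apply, he.extend_apply, Pi.smul_apply]
    · rw [Pi.smul_apply, extend_eq_zero hk, extend_eq_zero hk, smul_zero]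

theorem extendHom_coordFun_pow (he : e.Injective) (j : σ) (k : ℕ) :
    extendHom p he (coordFun p j ^ k) = coordFun p (e j) ^ k := by
  rw [coordFun_pow, coordFun_pow, extendHom_single, extend_single he]

theorem diagExt_sub_smul (d : ℕ) (s s' : ℂ_[p]) (c c' : ℤ → ℂ_[p]) :
    diagExt p e t x y d (fun k => s * c k - s' * c' k)
      = s • diagExt p e t x y d c - s' • diagExt p e t x y d c' := by
  ext1 a
  funext J
  simp only [LinearMap.sub_apply, LinearMap.smul_apply, Pi.sub_apply, Pi.smul_apply, smul_eq_mul,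
    diagExt_apply]
  split_ifs <;> ring

/-- Multiplication by `t x y` shifts the coefficients of a series in `t x y`. -/
theorem polyMul_prod_diagExt (he : e.Injective) (hx : x ∉ Set.range e) (hy : y ∉ Set.range e)
    (hxy : x ≠ y) (c : ℤ → ℂ_[p]) (a : Series p σ) :
    polyMul (coordFun p (e t) * coordFun p x * coordFun p y) (diagExt p e t x y 0 c a)
      = diagExt p e t x y 0 (fun k => c (k - 1)) a := by
  have hxt : x ≠ e t := fun h => hx ⟨t, h.symm⟩
  have hyt : y ≠ e t := fun h => hy ⟨t, h.symm⟩
  funext J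
  have h2 : (J - Pi.single (e t) 1 - (Pi.single x 1 + Pi.single y 1)) ∘ e
      = J ∘ e - Pi.single t 1 := by
    rw [Pi.sub_comp, Pi.sub_comp, Pi.add_comp, single_comp_of_notMem hy, single_comp_of_notMem hx,
      add_zero, sub_zero, single_comp he]
  rw [mul_assoc, polyMul_mul, polyMul_coordFun, polyMul_coordFun_mul, diagExt_apply, diagExt_apply,
    h2]
  simp only [Pi.add_apply, Pi.sub_apply, Pi.single_eq_same, Pi.single_eq_of_ne hxy.symm,
    Pi.single_eq_of_ne hxt, Pi.single_eq_of_ne hyt, Pi.single_eq_of_ne hxy,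
    sub_zero, add_zero, zero_add, Nat.cast_zero]
  by_cases h : J x = J y
  · rw [if_pos (by omega), if_pos h, sub_sub, ← Pi.single_add, add_sub_cancel]
  · rw [if_neg (by omega), if_neg h]

theorem polyMul_prod_pow_diagExt (he : e.Injective) (hx : x ∉ Set.range e) (hy : y ∉ Set.range e)
    (hxy : x ≠ y) (c : ℤ → ℂ_[p]) (a : Series p σ) (q : ℕ) :
    polyMul ((coordFun p (e t) * coordFun p x * coordFun p y) ^ q) (diagExt p e t x y 0 c a)
      = diagExt p e t x y 0 (fun k => c (k - q)) a := by
  induction q with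
  | zero => simp
  | succ q ih =>
    rw [pow_succ', polyMul_mul, ih, polyMul_prod_diagExt he hx hy hxy]
    congr 2
    funext k
    push_cast
    congr 1
    ring

theorem seriesDeriv_diagExt (he : e.Injective) (hx : x ∉ Set.range e) (hy : y ∉ Set.range e)
    (hxy : x ≠ y) (c : ℤ → ℂ_[p]) (a : Series p σ) :
    seriesDeriv (e t) (diagExt p e t x y 0 c a) = diagExt p e t x y 0 c (seriesDeriv t a) +
      polyMul (coordFun p x * coordFun p y)
        (diagExt p e t x y 0 (fun k => ((k : ℂ_[p]) + 1) * c (k + 1)) a) := by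
  have hxt : x ≠ e t := fun h => hx ⟨t, h.symm⟩
  have hyt : y ≠ e t := fun h => hy ⟨t, h.symm⟩
  funext J
  have h1 : (J + Pi.single (e t) 1) ∘ e = J ∘ e + Pi.single t 1 := by
    rw [Pi.add_comp, single_comp he]
  have h2 : (J - (Pi.single x 1 + Pi.single y 1)) ∘ e = J ∘ e := by
    rw [Pi.sub_comp, Pi.add_comp, single_comp_of_notMem hy, single_comp_of_notMem hx, add_zero,
      sub_zero]
  rw [seriesDeriv_apply, Pi.add_apply, polyMul_coordFun_mul, diagExt_apply, diagExt_apply,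
    diagExt_apply, seriesDeriv_apply, h1, h2]
  simp only [Pi.add_apply, Pi.sub_apply, Pi.single_eq_same, Pi.single_eq_of_ne hxy.symm,
    Pi.single_eq_of_ne hxt, Pi.single_eq_of_ne hyt, Pi.single_eq_of_ne hxy, Function.comp_apply,
    add_zero, zero_add, Nat.cast_zero]
  by_cases h : J x = J y
  · have h4 : J ∘ e + Pi.single t 1 - Pi.single t (J x) = J ∘ e - Pi.single t (J x - 1) := by
      rw [sub_eq_iff_eq_add, Pi.single_sub]; abel
    have h5 : J ∘ e - Pi.single t (J x) + Pi.single t 1 = J ∘ e - Pi.single t (J x - 1) := by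
      rw [← h4]; abel
    rw [if_pos h, if_pos h, if_pos (by omega), h4, h5, h, sub_add_cancel]
    push_cast
    ring
  · rw [if_neg h, if_neg h, if_neg (by omega)]
    ring

/-- A product with a pull-back can be formed before applying `diagExt`: the terms that contribute
have the exponents of `x` and `y` of the first factor, and `ψ` enumerates them. -/
theorem seriesMul_diagExt_pullSeries (he : e.Injective) (hx : x ∉ Set.range e)
    (hy : y ∉ Set.range e) (hxy : x ≠ y) (hcov : ∀ k, k = x ∨ k = y ∨ k ∈ Set.range e)
    (c : ℤ → ℂ_[p]) (a b : Series p σ) :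
    seriesMul (diagExt p e t x y 0 c a) (pullSeries p e b)
      = diagExt p e t x y 0 c (seriesMul a b) := by
  have hxr : ∀ j, e j ≠ x := fun j h => hx ⟨j, h⟩
  have hyr : ∀ j, e j ≠ y := fun j h => hy ⟨j, h⟩
  funext J
  rw [seriesMul, diagExt_apply]
  have hzero : ∀ K : τ → ℤ, K x ≠ J x ∨ K y ≠ J y →
      diagExt p e t x y 0 c a K * pullSeries p e b (J - K) = 0 := by
    rintro K (h | h)
    · rw [pullSeries_apply_of_ne _ hx (by rw [Pi.sub_apply]; omega), mul_zero]
    · rw [pullSeries_apply_of_ne _ hy (by rw [Pi.sub_apply]; omega), mul_zero]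
  by_cases hJ : J x = J y
  · rw [if_pos (by simpa using hJ), seriesMul, ← tsum_mul_left]
    let ψ : (σ → ℤ) → (τ → ℤ) := fun L =>
      Function.extend e (L + Pi.single t (J x)) 0 + Pi.single x (J x) + Pi.single y (J y)
    have hψe : ∀ L, ψ L ∘ e = L + Pi.single t (J x) := by
      intro L
      funext j
      simp only [ψ, Function.comp_apply, Pi.add_apply, he.extend_apply,
        Pi.single_eq_of_ne (hxr j), Pi.single_eq_of_ne (hyr j), add_zero]
    have hψx : ∀ L, ψ L x = J x := by
      intro L
      simp only [ψ, Pi.add_apply, extend_eq_zero hx, Pi.single_eq_same, Pi.single_eq_of_ne hxy,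
        zero_add, add_zero]
    have hψy : ∀ L, ψ L y = J y := by
      intro L
      simp only [ψ, Pi.add_apply, extend_eq_zero hy, Pi.single_eq_same,
        Pi.single_eq_of_ne hxy.symm, zero_add, add_zero]
    have hψinj : Function.Injective ψ := by
      intro L L' h
      have h1 := hψe L
      rw [h, hψe L'] at h1
      exact (add_right_cancel h1).symm
    have hsupp : Function.support (fun K => diagExt p e t x y 0 c a K * pullSeries p e b (J - K))
        ⊆ Set.range ψ := by
      intro K hK
      have hKx : K x = J x := by
        by_contra h
        exact hK (hzero K (Or.inl h))
      have hKy : K y = J y := by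
        by_contra h
        exact hK (hzero K (Or.inr h))
      refine ⟨K ∘ e - Pi.single t (J x), ?_⟩
      funext k
      rcases hcov k with rfl | rfl | ⟨j, rfl⟩
      · rw [hψx, hKx]
      · rw [hψy, hKy]
      · have h := congrFun (hψe (K ∘ e - Pi.single t (J x))) j
        rw [sub_add_cancel] at h
        exact h
    rw [← hψinj.tsum_eq hsupp]
    refine tsum_congr fun L => ?_
    have h1 : (J - ψ L) ∘ e = J ∘ e - Pi.single t (J x) - L := by
      rw [Pi.sub_comp, hψe, sub_sub, add_comm L]
    rw [diagExt_apply, hψx, hψy, hψe, if_pos (by simpa using hJ), add_sub_cancel_right,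
      pullSeries_apply_of_forall, h1, mul_assoc]
    intro k hk
    rcases hcov k with rfl | rfl | h
    · rw [Pi.sub_apply, hψx, sub_self]
    · rw [Pi.sub_apply, hψy, sub_self]
    · exact absurd h hk
  · rw [if_neg (by simpa using hJ)]
    refine (tsum_congr fun K => ?_).trans tsum_zero
    by_cases h : K x = J x ∧ K y = J y
    · rw [diagExt_apply, if_neg, zero_mul]
      rw [h.1, h.2]
      simpa using hJ
    · exact hzero K (by tauto)

/-- Frobenius of a pull-back, for the multiplier `F * ∑ k, c k * (t x y) ^ k`. -/
theorem frobForms_pullWith (he : StrictMono e) (hx : x ∉ Set.range e) (hy : y ∉ Set.range e)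
    (hxy : x ≠ y) (hcov : ∀ k, k = x ∨ k = y ∨ k ∈ Set.range e) (c : ℤ → ℂ_[p])
    (F : Series p σ) (ω : Forms p σ) :
    frobForms (diagExt p e t x y 0 c F) (pullWith e (pullSeries p e) ω)
      = pullWith e (diagExt p e t x y 0 c) (frobForms F ω) := by
  funext S
  induction S using forall_finset_of_image (e := e) with
  | h1 S =>
    have h1 : ∏ j ∈ S.image e, (coordFun p j : LPoly p τ) ^ (p - 1)
        = extendHom p he.injective (∏ j ∈ S, coordFun p j ^ (p - 1)) := by
      rw [prod_image fun i _ j _ h => he.injective h, map_prod]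
      exact prod_congr rfl fun j _ => (extendHom_coordFun_pow he.injective j _).symm
    rw [frobForms, pullWith_image he, pullWith_image he, frobForms, map_smul,
      card_image_of_injective _ he.injective, seriesPowP_pullSeries he.injective, h1,
      polyMul_pullSeries, seriesMul_diagExt_pullSeries he.injective hx hy hxy hcov]
  | h2 S k hk hk' =>
    rw [frobForms, pullWith_of_notMem_range _ hk hk', pullWith_of_notMem_range _ hk hk',
      seriesPowP_zero, map_zero, seriesMul_zero, smul_zero]

end FrobeniusSuspension

noncomputable section SuspensionExponential

variable {p : ℕ} [hp : Fact p.Prime] {σ τ : Type} [Fintype σ] [LinearOrder σ] [Fintype τ]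
  [LinearOrder τ] {e : σ → τ} {t : σ} {x y : τ} {inv : Set σ} {ϖ : ℂ_[p]} {Q : LPoly p σ}

/-- The exponential attached to `Q + t x y` is the one attached to `Q` times Dwork's splitting
function of `t x y`. -/
theorem expSeries_suspend (he : e.Injective) (hx : x ∉ Set.range e) (hy : y ∉ Set.range e)
    (hxy : x ≠ y) (hcov : ∀ k, k = x ∨ k = y ∨ k ∈ Set.range e)
    (hQ : ∀ I, Q.coeff I ≠ 0 → 1 ≤ I t) {Q' : LPoly p τ}
    (hQ' : Q' = extendHom p he Q + coordFun p (e t) * coordFun p x * coordFun p y)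
    (hQ't : ∀ I, Q'.coeff I ≠ 0 → 1 ≤ I (e t)) :
    expSeries (ϖ • (powPHom p Q' - Q'))
      = diagExt p e t x y 0 (dworkCoeff ϖ) (expSeries (ϖ • (powPHom p Q - Q))) := by
  have hG := le_of_coeff_smul_ne_zero
    (le_of_coeff_sub_ne_zero (le_of_coeff_powPHom_ne_zero hQ) hQ) ϖ
  have hG' := le_of_coeff_smul_ne_zero
    (le_of_coeff_sub_ne_zero (le_of_coeff_powPHom_ne_zero hQ't) hQ't) ϖ
  have hxt : e t ≠ x := fun h => hx ⟨t, h⟩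
  have hyt : e t ≠ y := fun h => hy ⟨t, h⟩
  have hp1 : p - 1 + 1 = p := Nat.sub_add_cancel hp.out.one_le
  set F := expSeries (ϖ • (powPHom p Q - Q)) with hF
  set s : LPoly p τ := coordFun p (e t) * coordFun p x * coordFun p y with hs
  have hGs : ϖ • (powPHom p Q' - Q')
      = extendHom p he (ϖ • (powPHom p Q - Q)) + ϖ • (s ^ p - s) := by
    rw [hQ', map_add, powPHom_extendHom, map_smul, map_sub, ← smul_add, hs]
    simp only [map_mul, powPHom_coordFun, mul_pow]
    congr 1
    ring
  have hds : LPoly.pderiv (e t) s = coordFun p x * coordFun p y := by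
    rw [hs, pderiv_mul, pderiv_mul, pderiv_coordFun, pderiv_coordFun, pderiv_coordFun, if_pos rfl,
      if_neg hxt, if_neg hyt]
    simp
  have hdG : LPoly.pderiv (e t) (ϖ • (powPHom p Q' - Q'))
      = extendHom p he (LPoly.pderiv t (ϖ • (powPHom p Q - Q))) +
        coordFun p x * coordFun p y * (ϖ • ((p : ℂ_[p]) • s ^ (p - 1) - 1)) := by
    have h := pderiv_pow (e t) s (p - 1)
    have h2 : ((p - 1 : ℕ) : ℂ_[p]) + 1 = p := by
      rw [← Nat.cast_succ, Nat.succ_eq_add_one, hp1]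
    rw [hp1, h2] at h
    rw [hGs, pderiv_add, pderiv_extendHom, pderiv_smul (e t) ϖ, pderiv_sub, h, hds, mul_smul_comm,
      mul_sub, mul_one, mul_smul_comm, mul_comm (coordFun p x * coordFun p y)]
  -- Both sides satisfy the same differential equation in `t`, and they agree where the exponent of
  -- `t` is not positive.
  refine eq_of_seriesDeriv_eq (t := e t) (h := LPoly.pderiv (e t) (ϖ • (powPHom p Q' - Q')))
    (coeff_pderiv_nonneg _ fun J hJ => zero_le_one.trans (hG' J hJ))
    (seriesDeriv_expSeries hG' _) ?_ fun I hI => ?_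
  · rw [seriesDeriv_diagExt he hx hy hxy, hF, seriesDeriv_expSeries hG, ← hF, hdG, polyMul_add,
      LinearMap.add_apply, polyMul_diagExt he hx hy,
      polyMul_mul (coordFun p x * coordFun p y) (ϖ • ((p : ℂ_[p]) • s ^ (p - 1) - 1)), polyMul_smul,
      LinearMap.smul_apply, polyMul_sub, polyMul_smul, LinearMap.sub_apply, LinearMap.smul_apply,
      polyMul_one, polyMul_prod_pow_diagExt he hx hy hxy]
    congr 2
    have h1 : (fun k : ℤ => ((k : ℂ_[p]) + 1) * dworkCoeff ϖ (k + 1))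
        = fun k => ϖ * p * dworkCoeff ϖ (k - ((p - 1 : ℕ) : ℤ)) - ϖ * dworkCoeff ϖ k := by
      funext k
      have h2 := mul_dworkCoeff (ϖ := ϖ) (k + 1)
      rw [add_sub_cancel_right] at h2
      push_cast at h2
      rw [h2, Nat.cast_pred hp.out.pos, show k + 1 - (p : ℤ) = k - ((p : ℤ) - 1) by ring]
      ring
    rw [h1, diagExt_sub_smul (c := fun k => dworkCoeff ϖ (k - ((p - 1 : ℕ) : ℤ)))
      (c' := dworkCoeff ϖ), LinearMap.sub_apply, LinearMap.smul_apply, LinearMap.smul_apply,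
      smul_sub, smul_smul]
  · rw [expSeries_eq_powSeries, powSeries_of_nonpos hG' _ hI, Nat.factorial_zero, Nat.cast_one,
      inv_one, one_mul, diagExt_apply]
    have hone : ∀ {ρ : Type} (I : ρ → ℤ), I ≠ 0 → (1 : LPoly p ρ).coeff I = 0 := by
      intro ρ I h
      rw [AddMonoidAlgebra.one_def, AddMonoidAlgebra.coeff_single, Finsupp.single_eq_of_ne h]
    have hone' : ∀ {ρ : Type}, (1 : LPoly p ρ).coeff 0 = 1 := by
      intro ρ
      rw [AddMonoidAlgebra.one_def, AddMonoidAlgebra.coeff_single, Finsupp.single_eq_same]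
    have hF0 : ∀ L : σ → ℤ, L t ≤ 0 → F L = (1 : LPoly p σ).coeff L := by
      intro L hL
      rw [hF, expSeries_eq_powSeries, powSeries_of_nonpos hG _ hL, Nat.factorial_zero, Nat.cast_one,
        inv_one, one_mul]
    by_cases hI0 : I = 0
    · subst hI0
      have h0 : (0 : τ → ℤ) ∘ e - Pi.single t 0 = (0 : σ → ℤ) := by
        rw [Pi.single_zero, sub_zero]; rfl
      rw [if_pos (by simp), Pi.zero_apply, Pi.zero_apply, h0, hF0 0 le_rfl, hone', hone',
        dworkCoeff_zero, one_mul]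
    · rw [hone I hI0]
      split_ifs with hIxy
      swap
      · rfl
      rcases lt_or_ge (I y) 0 with hy0 | hy0
      · rw [dworkCoeff_of_neg hy0, zero_mul]
      rw [Nat.cast_zero, add_zero] at hIxy
      have h1 : (I ∘ e - Pi.single t (I x) : σ → ℤ) t = I (e t) - I x := by
        rw [Pi.sub_apply, Pi.single_eq_same]; rfl
      rw [hF0 _ (by rw [h1]; omega), hone, mul_zero]
      intro h2
      have h3 := congrFun h2 t
      rw [h1, Pi.zero_apply] at h3
      have hx0 : I x = 0 := by omega
      rw [hx0, Pi.single_zero, sub_zero] at h2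
      refine hI0 (funext fun k => ?_)
      rcases hcov k with rfl | rfl | ⟨j, rfl⟩
      · exact hx0
      · rw [← hIxy, hx0]; rfl
      · exact congrFun h2 j

variable {F : Series p σ} {f : LPoly p σ}

theorem wedgeD_pow (g : LPoly p τ) (k : ℕ) (ω : Forms p τ) :
    wedgeD (g ^ (k + 1)) ω = ((k : ℂ_[p]) + 1) • coeffwise (polyMul (g ^ k)) (wedgeD g ω) := by
  rw [coeffwise_polyMul_wedgeD, wedgeD_apply, wedgeD_apply, smul_sum]
  refine sum_congr rfl fun j _ => ?_
  rw [← map_smul]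
  congr 1
  funext S
  simp only [Pi.smul_apply, LinearMap.compLeft_apply, Function.comp_apply]
  rw [pderiv_pow, polyMul_smul, LinearMap.smul_apply, polyMul_mul, polyMul_comm]

theorem pullWith_sub_smul (s s' : ℂ_[p]) (G G' : Series p σ →ₗ[ℂ_[p]] Series p τ)
    (ω : Forms p σ) :
    pullWith e (s • G - s' • G') ω = s • pullWith e G ω - s' • pullWith e G' ω := by
  funext S
  simp only [pullWith_apply, Pi.sub_apply, Pi.smul_apply]
  split_ifs <;> simp

/-- Frobenius of `d(t x) dy ω`, computed from
`d((t x) ^ p) d(y ^ p) = p ^ 2 (t x y) ^ (p - 1) d(t x) dy`. -/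
theorem frobForms_suspendForm (he : StrictMono e) (hx : x ∉ Set.range e) (hy : y ∉ Set.range e)
    (hxy : x ≠ y) (hcov : ∀ k, k = x ∨ k = y ∨ k ∈ Set.range e) {c : ℤ → ℂ_[p]}
    (hF' : diagExt p e t x y 0 c F ∈ overconv p (e '' inv)) {ω : Forms p σ} {k : ℤ}
    (hω : ω ∈ formsOfDeg p inv k) :
    frobForms (diagExt p e t x y 0 c F) (suspendForm p e t x y ω)
      = (p : ℂ_[p]) ^ 2 • wedgeD (coordFun p (e t) * coordFun p x) (wedge p y
        (pullWith e (diagExt p e t x y 0 fun k => c (k - (p - 1 : ℕ))) (frobForms F ω))) := by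
  have hp1 : p - 1 + 1 = p := Nat.sub_add_cancel hp.out.one_le
  have hpull : pullWith e (pullSeries p e) ω ∈ formsOfDeg p (e '' inv) k :=
    pullWith_mem_formsIn he (fun a ha => pullSeries_mem_overconv he.injective
      (fun j hj => Set.mem_image_of_mem e hj) ha) hω
  set g : LPoly p τ := coordFun p (e t) * coordFun p x with hg
  have h1 : powPHom p g = g ^ (p - 1 + 1) := by
    rw [hp1, hg, map_mul, powPHom_coordFun, powPHom_coordFun, mul_pow]
  have h2 : ((p - 1 : ℕ) : ℂ_[p]) + 1 = p := by
    rw [← Nat.cast_succ, Nat.succ_eq_add_one, hp1]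
  rw [suspendForm_apply, frobForms_wedgeD hF' (wedge_mem_overconv (fun S => (hpull S).1) y), h1,
    wedgeD_pow, h2, frobForms_wedge hF' fun S => (hpull S).1, frobForms_pullWith he hx hy hxy hcov,
    map_smul, map_smul, smul_smul, ← pow_two, coeffwise_polyMul_wedgeD, coeffwise_wedge,
    coeffwise_pullWith, coeffwise_pullWith]
  congr 5
  ext1 a
  rw [LinearMap.comp_apply, LinearMap.comp_apply, ← polyMul_mul, ← mul_pow, hg,
    polyMul_prod_pow_diagExt he.injective hx hy hxy]

/-- The coefficients of `p / ϖ * (λ(s) - 1) / s`, where `λ(s) = exp (ϖ (s ^ p - s))` is the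
splitting function. -/
def primCoeff (ϖ : ℂ_[p]) (k : ℤ) : ℂ_[p] :=
  if 0 ≤ k then p / ϖ * dworkCoeff ϖ (k + 1) else 0

/-- The primitive that compares the two Frobenius maps: `∂_s + ϖ` sends `p / ϖ * (λ(s) - 1)` to
`p ^ 2 s ^ (p - 1) λ(s) - p`. -/
theorem diagDeriv_primCoeff (hϖ : ϖ ^ (p - 1) = -(p : ℂ_[p])) (k : ℤ) :
    diagDeriv ϖ (primCoeff ϖ) k
      = (p : ℂ_[p]) ^ 2 * dworkCoeff ϖ (k - (p - 1 : ℕ))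
        - p * (Pi.single (0 : ℤ) 1 : ℤ → ℂ_[p]) k := by
  have h0 := pi_ne_zero hϖ
  have hp1 := hp.out.one_lt
  have h1 := mul_dworkCoeff (ϖ := ϖ) (k + 1)
  rw [add_sub_cancel_right] at h1
  push_cast at h1
  rw [diagDeriv, primCoeff, primCoeff, Nat.cast_pred hp.out.pos,
    show k - ((p : ℤ) - 1) = k + 1 - p by ring]
  rcases lt_trichotomy k 0 with h | rfl | h
  · rw [if_neg (by omega), if_neg (by omega), Pi.single_eq_of_ne h.ne, dworkCoeff_of_neg (by omega)]
    ring
  · rw [if_pos le_rfl, if_neg (by omega), Pi.single_eq_same]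
    rw [dworkCoeff_of_neg (k := 0 + 1 - (p : ℤ)) (by omega), dworkCoeff_zero] at h1
    rw [dworkCoeff_of_neg (k := 0 + 1 - (p : ℤ)) (by omega), mul_left_comm, h1]
    field_simp
    ring
  · rw [if_pos h.le, if_pos (by omega), Pi.single_eq_of_ne h.ne', sub_add_cancel, mul_left_comm,
      h1]
    field_simp
    ring

/-- Frobenius commutes with `ω ↦ d(t x) dy ω` up to the factor `p` and an exact form, the
differential of `dy` times the product of `x t * ∑ k, primCoeff ϖ k * (t x y) ^ k` with the
Frobenius of `ω`. -/
theorem exists_frobForms_suspendForm_sub (he : StrictMono e) (hx : x ∉ Set.range e)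
    (hy : y ∉ Set.range e) (hxy : x ≠ y) (hcov : ∀ k, k = x ∨ k = y ∨ k ∈ Set.range e)
    (hp2 : p ≠ 2) (hϖ : ϖ ^ (p - 1) = -(p : ℂ_[p])) (hF : F ∈ overconv p inv) {k : ℤ}
    {ω : Forms p σ} (hω : ω ∈ formsOfDeg p inv k) (hD : deRhamD f (frobForms F ω) = 0) :
    ∃ θ ∈ formsOfDeg p (e '' inv) (k + 1),
      deRhamD (suspendFun he.injective ϖ t x y f) θ
        = frobForms (diagExt p e t x y 0 (dworkCoeff ϖ) F) (suspendForm p e t x y ω)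
          - (p : ℂ_[p]) • suspendForm p e t x y (frobForms F ω) := by
  obtain ⟨r, hr0, hr1, hr⟩ := exists_norm_dworkCoeff_le hp2 hϖ
  have hF' : diagExt p e t x y 0 (dworkCoeff ϖ) F ∈ overconv p (e '' inv) :=
    diagExt_mem_overconv he.injective hx hy hxy hcov (fun k hk => dworkCoeff_of_neg hk) hr0 hr1
      (K := 1) (fun k => by rw [one_mul]; exact hr k) hF
  have hFω := frobForms_mem_formsOfDeg hF hω
  refine ⟨wedge p y (pullWith e (diagExt p e t x y 1 (primCoeff ϖ)) (frobForms F ω)),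
    wedge_mem_formsIn rfl y (pullWith_mem_formsIn he (fun a ha => ?_) hFω), ?_⟩
  · refine diagExt_mem_overconv (c := primCoeff ϖ) he.injective hx hy hxy hcov
      (fun k hk => if_neg (not_le.2 hk)) hr0 hr1 (K := ‖(p : ℂ_[p]) / ϖ‖) (fun k => ?_) ha
    rw [primCoeff]
    split_ifs with hk
    · rw [norm_mul]
      refine mul_le_mul_of_nonneg_left ((hr _).trans ?_) (norm_nonneg _)
      exact pow_le_pow_of_le_one hr0.le hr1.le (by omega)
    · rw [norm_zero]
      positivity
  · have h1 : diagDeriv ϖ (primCoeff ϖ) = fun k => (p : ℂ_[p]) ^ 2 *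
        (fun k : ℤ => dworkCoeff ϖ (k - (p - 1 : ℕ))) k - p * (Pi.single (0 : ℤ) 1 : ℤ → ℂ_[p]) k :=
      funext (diagDeriv_primCoeff hϖ)
    rw [deRhamD_wedge_diagExt (t := t) he hx hy hxy hcov _ hFω, hD, map_zero, map_zero, sub_zero,
      h1, diagExt_sub_smul, pullWith_sub_smul, map_sub, map_sub, map_smul, map_smul, map_smul,
      map_smul, frobForms_suspendForm he hx hy hxy hcov hF' hω, suspendForm_apply,
      pullSeries_eq_diagExt (t := t) hx hy hcov]

end SuspensionExponential

/-! ### Frobenius on the cohomology of a hypersurface -/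

noncomputable section HypersurfaceFrobenius

variable {p : ℕ} [hp : Fact p.Prime] {n m : ℕ} {ϖ : ℂ_[p]} {P : LPoly p (Coord n m)}

theorem coeff_timesT_eq_zero_or (P : LPoly p (Coord n m)) (I : CoordT n m → ℤ) :
    (timesT P).coeff I = 0 ∨ I ⊤ = 1 ∧ ∃ J, (timesT P).coeff I = P.coeff J := by
  have hc : (WithTop.some : Coord n m → CoordT n m).Injective := WithTop.coe_injective
  have h1 : (timesT P).coeff I
      = (extendHom p hc P).coeff (I - (Pi.single ⊤ 1 : CoordT n m → ℤ)) := by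
    rw [show timesT P = coordFun p ⊤ * extendHom p hc P from rfl, ← polyMul_coeff,
      polyMul_coordFun]
  rw [h1, coeff_extendHom]
  by_cases h : ∀ k, k ∉ Set.range (WithTop.some : Coord n m → CoordT n m) →
      (I - (Pi.single ⊤ 1 : CoordT n m → ℤ)) k = 0
  · refine Or.inr ⟨?_, _, pullSeries_apply_of_forall _ h⟩
    have h2 := h ⊤ (by rintro ⟨j, hj⟩; exact absurd hj (by simp))
    rw [Pi.sub_apply, Pi.single_eq_same] at h2
    omega
  · exact Or.inl (if_neg h)

theorem one_le_of_coeff_timesT_ne_zero (I : CoordT n m → ℤ) (hI : (timesT P).coeff I ≠ 0) :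
    1 ≤ I ⊤ :=
  ((coeff_timesT_eq_zero_or P I).resolve_left hI).1.ge

theorem timesT_mem_algFun (hP : P ∈ algFun p (torusCoord n m)) :
    timesT P ∈ algFun p (torusCoordT n m) := by
  simpa only [one_smul] using smul_timesT_mem_algFun 1 hP

theorem timesT_suspend (P : LPoly p (Coord n m)) :
    timesT (suspend P) = extendHom p (strictMono_coordEmbT (n := n) (m := m)).injective (timesT P)
      + coordFun p (coordEmbT n m ⊤) * coordFun p (coordX n m : CoordT (n + 2) m)
        * coordFun p (coordY n m : CoordT (n + 2) m) := by
  have h := smul_timesT_suspend 1 P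
  rwa [suspendFun, one_smul, one_smul, one_smul] at h

theorem dworkSeries_eq (ϖ : ℂ_[p]) (P : LPoly p (Coord n m)) :
    dworkSeries ϖ P = expSeries (ϖ • (powPHom p (timesT P) - timesT P)) := rfl

theorem dworkFrob_eq_frobForms (ϖ : ℂ_[p]) (P : LPoly p (Coord n m)) :
    dworkFrob ϖ P = frobForms (dworkSeries ϖ P) := rfl

theorem dworkSeries_mem_overconv (hp2 : p ≠ 2) (hϖ : ϖ ^ (p - 1) = -(p : ℂ_[p]))
    (hP : P ∈ algFun p (torusCoord n m)) (hint : ∀ I, ‖P.coeff I‖ ≤ 1)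
    (hfrob : ∀ I, ‖P.coeff I ^ p - P.coeff I‖ < 1) :
    dworkSeries ϖ P ∈ overconv p (torusCoordT n m) := by
  rw [dworkSeries_eq]
  refine expSeries_powPHom_sub_mem_overconv (t := ⊤) one_le_of_coeff_timesT_ne_zero hp2 hϖ
    (timesT_mem_algFun hP) (fun I => ?_) fun I => ?_
  · rcases coeff_timesT_eq_zero_or P I with h | ⟨-, J, h⟩
    · rw [h, norm_zero]
      exact zero_le_one
    · rw [h]
      exact hint J
  · rcases coeff_timesT_eq_zero_or P I with h | ⟨-, J, h⟩
    · rw [h, zero_pow hp.out.ne_zero, sub_zero, norm_zero]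
      exact zero_lt_one
    · rw [h]
      exact hfrob J

theorem dworkSeries_suspend (ϖ : ℂ_[p]) (P : LPoly p (Coord n m)) :
    dworkSeries ϖ (suspend P) = diagExt p (coordEmbT n m) ⊤ (coordX n m : CoordT (n + 2) m)
      (coordY n m : CoordT (n + 2) m) 0 (dworkCoeff ϖ) (dworkSeries ϖ P) := by
  rw [dworkSeries_eq, dworkSeries_eq]
  exact expSeries_suspend strictMono_coordEmbT.injective coordX_notMem_range coordY_notMem_range
    coordX_ne_coordY eq_coordX_or_eq_coordY_or_mem_range one_le_of_coeff_timesT_ne_zero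
    (timesT_suspend P) one_le_of_coeff_timesT_ne_zero

theorem dworkSeries_suspend_mem_overconv (hp2 : p ≠ 2) (hϖ : ϖ ^ (p - 1) = -(p : ℂ_[p]))
    (hF : dworkSeries ϖ P ∈ overconv p (torusCoordT n m)) :
    dworkSeries ϖ (suspend P) ∈ overconv p (torusCoordT (n + 2) m) := by
  obtain ⟨r, hr0, hr1, hr⟩ := exists_norm_dworkCoeff_le hp2 hϖ
  rw [dworkSeries_suspend, torusCoordT_eq_image]
  exact diagExt_mem_overconv strictMono_coordEmbT.injective coordX_notMem_range coordY_notMem_range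
    coordX_ne_coordY eq_coordX_or_eq_coordY_or_mem_range (fun k hk => dworkCoeff_of_neg hk) hr0 hr1
    (K := 1) (fun k => by rw [one_mul]; exact hr k) hF

theorem seriesDeriv_dworkSeries (ϖ : ℂ_[p]) (P : LPoly p (Coord n m)) (j : CoordT n m) :
    seriesDeriv j (dworkSeries ϖ P)
      = polyMul (LPoly.pderiv j (ϖ • (powPHom p (timesT P) - timesT P))) (dworkSeries ϖ P) :=
  have h : ∀ I : CoordT n m → ℤ, (timesT P).coeff I ≠ 0 → 1 ≤ I ⊤ := one_le_of_coeff_timesT_ne_zero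
  seriesDeriv_expSeries (t := ⊤)
    (le_of_coeff_smul_ne_zero (le_of_coeff_sub_ne_zero (le_of_coeff_powPHom_ne_zero h) h) ϖ) j

theorem smul_timesT_add (ϖ : ℂ_[p]) (P : LPoly p (Coord n m)) :
    ϖ • timesT P + ϖ • (powPHom p (timesT P) - timesT P) = powPHom p (ϖ • timesT P) := by
  rw [← smul_add, add_sub_cancel, map_smul]

theorem exists_induces_dworkFrob (hF : dworkSeries ϖ P ∈ overconv p (torusCoordT n m)) (i : ℤ) :
    ∃ Φ : HX ϖ P i →ₗ[ℂ_[p]] HX ϖ P i, Induces (dworkFrob ϖ P) Φ :=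
  exists_induces_frobForms hF (seriesDeriv_dworkSeries ϖ P) (smul_timesT_add ϖ P) (i + 2)

theorem dworkFrob_mem_closedForms (hF : dworkSeries ϖ P ∈ overconv p (torusCoordT n m)) {k : ℤ}
    {ω : Forms p (CoordT n m)} (hω : ω ∈ closedForms (torusCoordT n m) (ϖ • timesT P) k) :
    dworkFrob ϖ P ω ∈ closedForms (torusCoordT n m) (ϖ • timesT P) k :=
  frobForms_mem_closedForms hF (seriesDeriv_dworkSeries ϖ P) (smul_timesT_add ϖ P) hω

/-- Dwork's Frobenius commutes with the suspension map up to the factor `p`. -/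
theorem apply_dworkFrob_suspend (hp2 : p ≠ 2) (hϖ : ϖ ^ (p - 1) = -(p : ℂ_[p]))
    (hF : dworkSeries ϖ P ∈ overconv p (torusCoordT n m))
    {i : ℤ} {α : HX ϖ P (i - 2) →ₗ[ℂ_[p]] HX ϖ (suspend P) i} (hα : Induces alphaForm α)
    {Φ : HX ϖ P (i - 2) →ₗ[ℂ_[p]] HX ϖ P (i - 2)} (hΦ : Induces (dworkFrob ϖ P) Φ)
    {Φ' : HX ϖ (suspend P) i →ₗ[ℂ_[p]] HX ϖ (suspend P) i}
    (hΦ' : Induces (dworkFrob ϖ (suspend P)) Φ') (z : HX ϖ P (i - 2)) :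
    Φ' (α z) = (p : ℂ_[p]) • α (Φ z) := by
  obtain ⟨ω, rfl⟩ := Submodule.Quotient.mk_surjective _ z
  have hFω := dworkFrob_mem_closedForms hF ω.2
  obtain ⟨θ, hθ, hDθ⟩ := exists_frobForms_suspendForm_sub (f := ϖ • timesT P) strictMono_coordEmbT
    coordX_notMem_range coordY_notMem_range coordX_ne_coordY eq_coordX_or_eq_coordY_or_mem_range
    hp2 hϖ hF ω.2.1 hFω.2
  replace hDθ : deRhamD (ϖ • timesT (suspend P)) θ = dworkFrob ϖ (suspend P) (alphaForm ω)
      - (p : ℂ_[p]) • alphaForm (dworkFrob ϖ P ω) := by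
    rw [dworkFrob_eq_frobForms, dworkFrob_eq_frobForms, dworkSeries_suspend,
      alphaForm_eq_suspendForm, alphaForm_eq_suspendForm, smul_timesT_suspend]
    exact hDθ
  rw [← torusCoordT_eq_image] at hθ
  obtain ⟨h1, h2⟩ := hα ω
  obtain ⟨h3, h4⟩ := hΦ ω
  obtain ⟨h5, h6⟩ := hα ⟨_, h3⟩
  obtain ⟨h7, h8⟩ := hΦ' ⟨_, h1⟩
  rw [h2, h4, h6, h8, ← Submodule.Quotient.mk_smul, mk_eq_mk_iff]
  refine ⟨θ, ?_, hDθ⟩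
  rwa [show i + 2 - 1 = i - 2 + 2 + 1 by ring]

end HypersurfaceFrobenius

theorem mainTheorem4 (p : ℕ) [Fact p.Prime] (hp : p ≠ 2)
    (ϖ : ℂ_[p]) (hϖ : ϖ ^ (p - 1) = -(p : ℂ_[p])) (n m : ℕ)
    (P : algFun p (torusCoord n m)) (hP : P ≠ 0)
    (hsmooth : Algebra.Smooth ℂ_[p] (algFun p (torusCoord n m) ⧸ Ideal.span {P}))
    (hint : ∀ I, ‖(P : LPoly p (Coord n m)).coeff I‖ ≤ 1) :
    ∃ (α : ∀ i : ℤ, HX ϖ (P : LPoly p (Coord n m)) (i - 2) →ₗ[ℂ_[p]]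
          HX ϖ (suspend (P : LPoly p (Coord n m))) i)
      (a : ∀ i : ℤ, HX ϖ (P : LPoly p (Coord n m)) i →ₗ[ℂ_[p]]
          HXbar ϖ (P : LPoly p (Coord n m)) i)
      (b : ∀ i : ℤ, HXbar ϖ (P : LPoly p (Coord n m)) i →ₗ[ℂ_[p]] HY p n m (i + 1))
      (δ : ∀ i : ℤ, HY p n m i →ₗ[ℂ_[p]] HX ϖ (P : LPoly p (Coord n m)) i)
      (Ψ : ∀ i : ℤ, HX ϖ (suspend (P : LPoly p (Coord n m))) i ≃ₗ[ℂ_[p]]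
          HY p n m i × HXbar ϖ (P : LPoly p (Coord n m)) (i - 2)),
      (∀ i, Induces alphaForm (α i)) ∧
      (∀ i, Induces id (a i)) ∧
      (∀ i, Function.Exact (δ i) (a i) ∧ Function.Exact (a i) (b i) ∧
        Function.Exact (b i) (δ (i + 1))) ∧
      (∀ i x, Ψ i (α i x) = (0, a (i - 2) x)) ∧
      ((∀ I, ‖(P : LPoly p (Coord n m)).coeff I ^ p - (P : LPoly p (Coord n m)).coeff I‖ < 1) →
        dworkSeries ϖ (P : LPoly p (Coord n m)) ∈ overconv p (torusCoordT n m) ∧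
        dworkSeries ϖ (suspend (P : LPoly p (Coord n m))) ∈ overconv p (torusCoordT (n + 2) m) ∧
        ∃ (FrX : ∀ i : ℤ, HX ϖ (P : LPoly p (Coord n m)) i →ₗ[ℂ_[p]]
              HX ϖ (P : LPoly p (Coord n m)) i)
          (FrX' : ∀ i : ℤ, HX ϖ (suspend (P : LPoly p (Coord n m))) i →ₗ[ℂ_[p]]
              HX ϖ (suspend (P : LPoly p (Coord n m))) i),
          (∀ i, IsFrobenius (FrX i)) ∧ (∀ i, IsFrobenius (FrX' i)) ∧
          ∀ i x, FrX' i (α i x) = (p : ℂ_[p]) • α i (FrX (i - 2) x)) := by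
  obtain ⟨a, b, δ, ha, hex⟩ := exists_gysin_sequence_HX hϖ P.2 hint
  choose α Ψ hα hΨ using fun i => exists_suspension_iso hϖ P.2 hint i (a (i - 2)) (ha (i - 2))
  refine ⟨α, a, b, δ, Ψ, hα, ha, hex, hΨ, fun hfrob => ?_⟩
  have hF := dworkSeries_mem_overconv hp hϖ P.2 hint hfrob
  have hF' := dworkSeries_suspend_mem_overconv hp hϖ hF
  have hp0 : (p : ℂ_[p]) ≠ 0 := Nat.cast_ne_zero.2 (Fact.out : p.Prime).ne_zero
  choose Φ hΦ using exists_induces_dworkFrob hF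
  choose Φ' hΦ' using exists_induces_dworkFrob hF'
  refine ⟨hF, hF', fun i => (p : ℂ_[p])⁻¹ • Φ i, fun i => (p : ℂ_[p])⁻¹ • Φ' i, fun i => ?_,
    fun i => ?_, fun i z => ?_⟩
  · rw [IsFrobenius, smul_inv_smul₀ hp0]
    exact hΦ i
  · rw [IsFrobenius, smul_inv_smul₀ hp0]
    exact hΦ' i
  · rw [LinearMap.smul_apply, LinearMap.smul_apply, map_smul,
      apply_dworkFrob_suspend hp hϖ hF (hα i) (hΦ (i - 2)) (hΦ' i), smul_comm]
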